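/- Let $k\ge 2$ be an integer and $\rho>0$. There is a constant $C>0$ depending only on $k$ and $\rho$ such that the following holds. Setting. Let $\Omega\subset\mathbb R^2$ be a bounded polygonal open set with $\operatorname{int}\overline\Omega=\Omega$ (for instance a polygonal Lipschitz domain), and let $\mathcal T_h$ be a finite conforming mesh of $\overline\Omega$ into closed convex polygons with interior angles smaller than $\pi$: two different elements are disjoint, or meet in a common vertex, or meet in a common edge. Assume that each $K\in\mathcal T_h$ has a conforming triangulation into triangles $\tau$ such that each $\tau$ contains a disc of radius $\rho\,\mathrm{diam}(\tau)$, $\mathrm{diam}(\tau)\ge\rho\,\mathrm{diam}(K)$, and each edge of $K$ is a side of one of the triangles. For $K\in\mathcal T_h$ the local lifting space is $$\widetilde V_k(K)=\{v\in H^2(K):\ \Delta^2v\in\mathbb P_{k-2}(K),\ v|_e\in\mathbb P_k(e),\ \Delta v|_e\in\mathbb P_{k-2}(e)\ \text{for every edge } e\subset\partial K\},$$ where the boundary values of $\Delta v\in L^2(K)$ are understood through Green's formula: $\Delta v|_e=g_e$ for all $e$ means $(\Delta v,\Delta w)_K=(\Delta^2v,w)_K+\sum_e(g_e,\partial_{\boldsymbol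 n}w)_e$ for all $w\in H^2(K)\cap H^1_0(K)$. Its degrees of freedom are the values at the vertices of $K$, the moments of $v$ and of $\partial_{\boldsymbol n}v$ against $\mathbb P_{k-2}(e)$ on each edge $e$, and the moments of $v$ against $\mathbb P_{k-2}(K)$. Let $\boldsymbol V_h$ be the space of vector fields on $\Omega$ whose two components lie in $\widetilde V_k(K)$ for every $K$ and have vertex and edge degrees of freedom that are continuous through the interior vertices and interior edges (endpoints included), and let $\boldsymbol V_h^0\subset\boldsymbol V_h$ be the subspace on which the degrees of freedom at the vertices and edges on $\partial\Omega$ vanish. Let $\Pi^0_r$ denote the $L^2(K)$-orthogonal projection onto polynomials of degree at most $r$ (componentwise for vectors), taken on each element. Statement. Let $\boldsymbol u\in (H^2(\Omega))^2$. There is a unique interpolant $I_h\boldsymbol u\in\boldsymbol V_h$, i.e. a unique element of $\boldsymbol V_h$ that has the same degrees of freedom as $\boldsymbol u$ on every element, and there is $\boldsymbol u_{\mathcal I}\in\boldsymbol V_h$ such that for every $K\in\mathcal T_h$: 1. $\Pi^0_{k-1}\operatorname{div}\boldsymbol u_{\mathcal I}=\Pi^0_{k-1}\operatorname{div}\boldsymbol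 u$ and $\Pi^0_{k-2}\nabla\operatorname{div}\boldsymbol u_{\mathcal I}=\Pi^0_{k-2}\nabla\operatorname{div}\boldsymbol u$ on $K$; 2. $|\boldsymbol u-\boldsymbol u_{\mathcal I}|_{\ell,K}\le C\,|\boldsymbol u-I_h\boldsymbol u|_{\ell,K}$ for $\ell=1,2$. If moreover $\boldsymbol u\in (H^2_0(\Omega))^2$, then $I_h\boldsymbol u$ and $\boldsymbol u_{\mathcal I}$ belong to $\boldsymbol V_h^0$. -/

import Mathlib

open MeasureTheory Filter Topology
open scoped ContDiff

noncomputable section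

namespace StrainGradientVEM

abbrev Plane := EuclideanSpace ℝ (Fin 2)

/-! ## Sobolev spaces of order one and two, through weak derivatives -/

/-- Classical partial derivative in the `i`-th coordinate direction. -/
def pderiv (i : Fin 2) (f : Plane → ℝ) (x : Plane) : ℝ :=
  fderiv ℝ f x (EuclideanSpace.single i 1)

/-- Smooth functions with compact support inside `U`. -/
def IsTestFunction (U : Set Plane) (φ : Plane → ℝ) : Prop :=
  ContDiff ℝ ∞ φ ∧ HasCompactSupport φ ∧ tsupport φ ⊆ U

/-- `g` is the weak partial derivative `∂ᵢ f` on the open set `U`. -/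
def IsWeakPartial (U : Set Plane) (i : Fin 2) (f g : Plane → ℝ) : Prop :=
  LocallyIntegrableOn f U ∧ LocallyIntegrableOn g U ∧
    ∀ φ, IsTestFunction U φ → ∫ x in U, f x * pderiv i φ x = -∫ x in U, g x * φ x

open Classical in
/-- The weak partial derivative `∂ᵢ f` on `U` (unique almost everywhere on `U` when it exists). -/
def weakPartial (U : Set Plane) (i : Fin 2) (f : Plane → ℝ) : Plane → ℝ :=
  if h : ∃ g, IsWeakPartial U i f g then h.choose else 0

/-- `f ∈ H¹(U)`. -/
def MemH1 (U : Set Plane) (f : Plane → ℝ) : Prop :=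
  MemLp f 2 (volume.restrict U) ∧
    ∀ i, ∃ g, MemLp g 2 (volume.restrict U) ∧ IsWeakPartial U i f g

/-- `f ∈ H²(U)`. -/
def MemH2 (U : Set Plane) (f : Plane → ℝ) : Prop :=
  MemH1 U f ∧ ∀ i, MemH1 U (weakPartial U i f)

/-- `f ∈ H²₀(U)`: the closure of the test functions in `H²(U)`. -/
def MemH20 (U : Set Plane) (f : Plane → ℝ) : Prop :=
  MemH2 U f ∧ ∃ φ : ℕ → Plane → ℝ, (∀ m, IsTestFunction U (φ m)) ∧
    Tendsto (fun m => eLpNorm (φ m - f) 2 (volume.restrict U)) atTop (𝓝 0) ∧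
    (∀ i, Tendsto (fun m => eLpNorm (pderiv i (φ m) - weakPartial U i f) 2 (volume.restrict U))
      atTop (𝓝 0)) ∧
    ∀ i j, Tendsto (fun m => eLpNorm (pderiv j (pderiv i (φ m)) -
      weakPartial U j (weakPartial U i f)) 2 (volume.restrict U)) atTop (𝓝 0)

/-- The weak Laplacian of an `H²` function. -/
def weakLaplacian (U : Set Plane) (f : Plane → ℝ) (x : Plane) : ℝ :=
  ∑ i, weakPartial U i (weakPartial U i f) x

/-- The weak divergence of a vector field, given by its two components. -/
def weakDiv (U : Set Plane) (u : Fin 2 → Plane → ℝ) (x : Plane) : ℝ :=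
  ∑ i, weakPartial U i (u i) x

/-- The seminorm `|u|_{1,U}` of a vector field. -/
def seminormH1 (U : Set Plane) (u : Fin 2 → Plane → ℝ) : ℝ :=
  √(∑ c, ∑ i, ∫ x in U, weakPartial U i (u c) x ^ 2)

/-- The seminorm `|u|_{2,U}` of a vector field. -/
def seminormH2 (U : Set Plane) (u : Fin 2 → Plane → ℝ) : ℝ :=
  √(∑ c, ∑ i, ∑ j, ∫ x in U, weakPartial U j (weakPartial U i (u c)) x ^ 2)

/-! ## Polynomials -/

/-- Value of a bivariate polynomial at a point. -/
def polyEval (p : MvPolynomial (Fin 2) ℝ) (x : Plane) : ℝ :=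
  MvPolynomial.eval (fun i => x i) p

/-- `q` is the `L²(U)`-orthogonal projection of `g` onto the polynomials of degree at most `r`. -/
def IsL2Proj (U : Set Plane) (r : ℕ) (g : Plane → ℝ) (q : MvPolynomial (Fin 2) ℝ) : Prop :=
  q.totalDegree ≤ r ∧ ∀ p : MvPolynomial (Fin 2) ℝ, p.totalDegree ≤ r →
    ∫ x in U, polyEval q x * polyEval p x = ∫ x in U, g x * polyEval p x

open Classical in
/-- The `L²` projection `Π⁰_r g` on `U`. -/
def l2Proj (U : Set Plane) (r : ℕ) (g : Plane → ℝ) : MvPolynomial (Fin 2) ℝ :=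
  if h : ∃ q, IsL2Proj U r g q then h.choose else 0

/-! ## Convex polygons -/

/-- The oriented area of the parallelogram spanned by two vectors. -/
def cross (a b : Plane) : ℝ := a 0 * b 1 - a 1 * b 0

/-- A convex polygon with `extra + 3` vertices, listed counterclockwise. The condition says that
every vertex off an edge lies strictly to the left of that edge (so all interior angles are
smaller than `π`). Addition in `Fin (extra + 3)` is cyclic. -/
structure ConvexPolygon where
  extra : ℕ
  vert : Fin (extra + 3) → Plane
  left : ∀ i j, j ≠ i → j ≠ i + 1 → 0 < cross (vert (i + 1) - vert i) (vert j - vert i)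

namespace ConvexPolygon

variable (K : ConvexPolygon)

/-- The closed polygon. -/
def carrier : Set Plane := convexHull ℝ (Set.range K.vert)

/-- The open polygon. -/
def inner : Set Plane := interior K.carrier

/-- The `i`-th closed edge. -/
def edge (i : Fin (K.extra + 3)) : Set Plane := segment ℝ (K.vert i) (K.vert (i + 1))

/-- The length of the `i`-th edge. -/
def edgeLength (i : Fin (K.extra + 3)) : ℝ := dist (K.vert i) (K.vert (i + 1))

/-- The arc length measure on the `i`-th edge. -/
def edgeMeasure (i : Fin (K.extra + 3)) : Measure Plane :=
  ENNReal.ofReal (K.edgeLength i) •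
    Measure.map (fun t : ℝ => AffineMap.lineMap (K.vert i) (K.vert (i + 1)) t)
      (volume.restrict (Set.Icc 0 1))

/-- The outward unit normal on the `i`-th edge. -/
def normal (i : Fin (K.extra + 3)) : Plane :=
  (K.edgeLength i)⁻¹ •
    !₂[K.vert (i + 1) 1 - K.vert i 1, -(K.vert (i + 1) 0 - K.vert i 0)]

/-- The diameter `h_K`. -/
def diam : ℝ := Metric.diam K.carrier

/-- The area `|K|`. -/
def area : ℝ := volume.real K.carrier

end ConvexPolygon

/-! ## Traces -/

open Classical in
/-- The continuous representative on the closed polygon of a function given almost everywhere.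
It exists for `H²` functions and carries their vertex values and edge traces. -/
def contRep (K : ConvexPolygon) (f : Plane → ℝ) : Plane → ℝ :=
  if h : ∃ g : Plane → ℝ, ContinuousOn g K.carrier ∧ f =ᵐ[volume.restrict K.inner] g
  then h.choose else 0

/-- `T` is the trace on the `i`-th edge of the `H¹` function `g`: the `L²`-limit on the edge of
smooth functions that converge to `g` in `H¹`. -/
def IsTrace (K : ConvexPolygon) (i : Fin (K.extra + 3)) (g T : Plane → ℝ) : Prop :=
  MemLp T 2 (K.edgeMeasure i) ∧ ∃ φ : ℕ → Plane → ℝ, (∀ m, ContDiff ℝ ∞ (φ m)) ∧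
    Tendsto (fun m => eLpNorm (φ m - g) 2 (volume.restrict K.inner)) atTop (𝓝 0) ∧
    (∀ j, Tendsto (fun m => eLpNorm (pderiv j (φ m) - weakPartial K.inner j g) 2
      (volume.restrict K.inner)) atTop (𝓝 0)) ∧
    Tendsto (fun m => eLpNorm (φ m - T) 2 (K.edgeMeasure i)) atTop (𝓝 0)

open Classical in
/-- The trace on the `i`-th edge of an `H¹` function. -/
def trace (K : ConvexPolygon) (i : Fin (K.extra + 3)) (g : Plane → ℝ) : Plane → ℝ :=
  if h : ∃ T, IsTrace K i g T then h.choose else 0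

/-- The outward normal derivative on the `i`-th edge of an `H²` function on `K`. -/
def normalDeriv (K : ConvexPolygon) (i : Fin (K.extra + 3)) (f : Plane → ℝ) (x : Plane) : ℝ :=
  ∑ j, K.normal i j * trace K i (weakPartial K.inner j f) x

/-! ## The local virtual element space and its degrees of freedom -/

/-- `Δ² v = f` in the sense of distributions on `K`. -/
def IsBilaplacian (K : ConvexPolygon) (v : Plane → ℝ) (f : MvPolynomial (Fin 2) ℝ) : Prop :=
  ∀ φ, IsTestFunction K.inner φ →
    ∫ x in K.inner, weakLaplacian K.inner v x * weakLaplacian K.inner φ x =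
      ∫ x in K.inner, polyEval f x * φ x

/-- `Δv = g e` on every edge `e` of `K`, for `v ∈ H²(K)` with `Δ² v = f`. Since `Δv` is only square
integrable, its boundary values are understood through Green's formula
`(Δv, Δw)_K = (Δ² v, w)_K + (Δv, ∂ₙ w)_{∂K}` for all `w ∈ H²(K) ∩ H¹₀(K)`. -/
def HasLaplacianTrace (K : ConvexPolygon) (v : Plane → ℝ) (f : MvPolynomial (Fin 2) ℝ)
    (g : Fin (K.extra + 3) → MvPolynomial (Fin 2) ℝ) : Prop :=
  ∀ w : Plane → ℝ, MemH2 K.inner w → ContinuousOn w K.carrier →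
    (∀ x ∈ frontier K.carrier, w x = 0) →
    ∫ x in K.inner, weakLaplacian K.inner v x * weakLaplacian K.inner w x =
      (∫ x in K.inner, polyEval f x * w x) +
        ∑ i, ∫ x, polyEval (g i) x * normalDeriv K i w x ∂(K.edgeMeasure i)

/-- The lifting space of order `k` on `K`: all `v ∈ H²(K)` with `Δ² v ∈ P_{k-2}(K)`,
`v|_e ∈ P_k(e)` and `Δv|_e ∈ P_{k-2}(e)` for every edge `e`. -/
def MemLocalSpace (k : ℕ) (K : ConvexPolygon) (v : Plane → ℝ) : Prop :=
  MemH2 K.inner v ∧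
  (∀ i, ∃ p : MvPolynomial (Fin 2) ℝ, p.totalDegree ≤ k ∧
    ∀ x ∈ K.edge i, contRep K v x = polyEval p x) ∧
  ∃ f : MvPolynomial (Fin 2) ℝ, f.totalDegree ≤ k - 2 ∧ IsBilaplacian K v f ∧
    ∃ g : Fin (K.extra + 3) → MvPolynomial (Fin 2) ℝ, (∀ i, (g i).totalDegree ≤ k - 2) ∧
      HasLaplacianTrace K v f g

/-- The value at the `i`-th vertex. -/
def dofVertex (K : ConvexPolygon) (i : Fin (K.extra + 3)) (v : Plane → ℝ) : ℝ :=
  contRep K v (K.vert i)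

/-- The moment of `v` on the `i`-th edge against `m`. -/
def dofEdge (K : ConvexPolygon) (i : Fin (K.extra + 3)) (m : MvPolynomial (Fin 2) ℝ)
    (v : Plane → ℝ) : ℝ :=
  (K.edgeLength i)⁻¹ * ∫ x, polyEval m x * contRep K v x ∂(K.edgeMeasure i)

/-- The moment of the outward normal derivative of `v` on the `i`-th edge against `m`. -/
def dofNormal (K : ConvexPolygon) (i : Fin (K.extra + 3)) (m : MvPolynomial (Fin 2) ℝ)
    (v : Plane → ℝ) : ℝ :=
  ∫ x, polyEval m x * normalDeriv K i v x ∂(K.edgeMeasure i)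

/-- The moment of `v` on `K` against `m`. -/
def dofInner (K : ConvexPolygon) (m : MvPolynomial (Fin 2) ℝ) (v : Plane → ℝ) : ℝ :=
  K.area⁻¹ * ∫ x in K.inner, polyEval m x * v x

/-! ## Meshes -/

/-- `T` is a conforming partition of `S` into closed convex polygons: two different elements are
disjoint, or meet in a common vertex, or meet in a common edge. -/
def IsPartition (S : Set Plane) (T : Finset ConvexPolygon) : Prop :=
  (⋃ K ∈ T, K.carrier) = S ∧
  ∀ K ∈ T, ∀ L ∈ T, K ≠ L →
    K.carrier ∩ L.carrier = ∅ ∨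
    (∃ i j, K.vert i = L.vert j ∧ K.carrier ∩ L.carrier = {K.vert i}) ∨
    ∃ i j, K.edge i = L.edge j ∧ K.carrier ∩ L.carrier = K.edge i

/-- `T` is a conforming polygonal mesh of the bounded polygonal open set `Ω`. The middle condition
excludes slits and holds for every Lipschitz domain. -/
def IsMesh (Ω : Set Plane) (T : Finset ConvexPolygon) : Prop :=
  IsOpen Ω ∧ interior (closure Ω) = Ω ∧ IsPartition (closure Ω) T

/-- `K` has a virtual triangulation whose triangles are shape regular with sizes proportional to
`h_K` (hence quasi-uniform), both with the constant `ρ`, and every edge of `K` is a side of one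
of these triangles. -/
def HasVirtualTriangulation (ρ : ℝ) (K : ConvexPolygon) : Prop :=
  ∃ TK : Finset ConvexPolygon,
    (∀ τ ∈ TK, τ.extra = 0) ∧ IsPartition K.carrier TK ∧
    (∀ τ ∈ TK, ∃ c : Plane, Metric.closedBall c (ρ * τ.diam) ⊆ τ.carrier) ∧
    (∀ τ ∈ TK, ρ * K.diam ≤ τ.diam) ∧
    ∀ i, ∃ τ ∈ TK, ∃ j, τ.edge j = K.edge i

/-! ## The global virtual element spaces and the interpolation -/

/-- The global lifting space without boundary conditions (one component): elementwise in the
local space, with degrees of freedom continuous through interior vertices and edges. On an edge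
shared by two elements the outward normals are opposite, hence the sign in the last clause. -/
def MemGlobalSpace (k : ℕ) (Ω : Set Plane) (T : Finset ConvexPolygon) (v : Plane → ℝ) : Prop :=
  (∀ K ∈ T, MemLocalSpace k K v) ∧
  (∀ K ∈ T, ∀ L ∈ T, ∀ p q, K.vert p = L.vert q →
    (K.vert p ∈ Ω ∨ ∃ i j, K.edge i = L.edge j ∧ K.vert p ∈ K.edge i) →
      dofVertex K p v = dofVertex L q v) ∧
  ∀ K ∈ T, ∀ L ∈ T, K ≠ L → ∀ i j, K.edge i = L.edge j →
    ∀ m : MvPolynomial (Fin 2) ℝ, m.totalDegree ≤ k - 2 →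
      dofEdge K i m v = dofEdge L j m v ∧ dofNormal K i m v = -dofNormal L j m v

/-- The global lifting space with vanishing boundary degrees of freedom (one component). -/
def MemGlobalSpaceZero (k : ℕ) (Ω : Set Plane) (T : Finset ConvexPolygon) (v : Plane → ℝ) :
    Prop :=
  MemGlobalSpace k Ω T v ∧
  (∀ K ∈ T, ∀ p, K.vert p ∈ frontier Ω → dofVertex K p v = 0) ∧
  ∀ K ∈ T, ∀ i, K.edge i ⊆ frontier Ω →
    ∀ m : MvPolynomial (Fin 2) ℝ, m.totalDegree ≤ k - 2 →
      dofEdge K i m v = 0 ∧ dofNormal K i m v = 0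

/-- `v` and `w` have the same degrees of freedom of the lifting space on every element. -/
def SameDofs (k : ℕ) (T : Finset ConvexPolygon) (v w : Plane → ℝ) : Prop :=
  ∀ K ∈ T, (∀ i, dofVertex K i v = dofVertex K i w) ∧
    ∀ m : MvPolynomial (Fin 2) ℝ, m.totalDegree ≤ k - 2 →
      (∀ i, dofEdge K i m v = dofEdge K i m w) ∧
      (∀ i, dofNormal K i m v = dofNormal K i m w) ∧
      dofInner K m v = dofInner K m w

/-- `Iu` is the interpolation `I_h u` of the vector field `u` in the lifting space. -/
def IsInterpolation (k : ℕ) (Ω : Set Plane) (T : Finset ConvexPolygon)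
    (u Iu : Fin 2 → Plane → ℝ) : Prop :=
  ∀ c, MemGlobalSpace k Ω T (Iu c) ∧ SameDofs k T (Iu c) (u c)

end StrainGradientVEM

end

open StrainGradientVEM

namespace StrainGradientVEM

/-! ## Convergence in `L²` -/

/-! Everything is local. On one element `K` of diameter `h` put `e = u - Iu`. Its vertex values, its
edge moments and its moments against polynomials of degree `k - 2` on `K` vanish. The field `uI` is
the local interpolant of `u + W`, where `W` is a smooth field with compact support in `K`. The
boundary degrees of freedom are then those of `u`, so the local fields can be glued, and only the
moments on `K` change.

Choice of `W`. Since `z = Iu - uI` vanishes on `∂K` and has the moments of `-W`, integration by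
parts gives `(div z, q) = (W, ∇q)` for `q` of degree at most `k - 1`; the degree of `∇q` is exactly
that of the prescribed moments. So `W` must satisfy `(W, ∇q) = -(div e, q)`. This is solvable
because `div e` has mean zero, each `∂_c e_c` having mean zero by the edge degrees of freedom.
`exists_moment_field` gives a `W` with `‖ΔW‖ ≤ M R⁻¹ ‖div e‖`, by scaling from a fixed disc; shape
regularity supplies a disc of radius `R = ρ² h` in `K`. For the moments of `∇ div`, integrate by
parts once more: the edge terms involve moments of the full gradient of `u - uI`, whose normal part
is a degree of freedom and whose tangential part reduces to vertex values and edge moments.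

Stability. Membership in the local space says that `(Δv, Δw)` vanishes for every `w` in `H² ∩ H¹₀`
without interior and normal moments (`MemLocalSpace.integral_laplacian_eq_zero`). As `z + W` is such
a `w`, it follows that `‖Δz‖ ≤ ‖ΔW‖`. On a polygon `|z|₁ ≤ 2h ‖Δz‖` by Friedrichs and `|z|₂ = ‖Δz‖`
by the Miranda-Talenti identity. With `h / R = ρ⁻²` this bounds `|z|₁` by `|e|₁`, and, after the
Poincaré inequality for the mean-free `∂_c e_c`, also `|z|₂` by `|e|₂`.

Local interpolant (`exists_localInterpolant`). Lift the boundary values smoothly, correct the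
remaining moments by an element of `H² ∩ H¹₀`, then subtract the part of the Laplacian that is
`L²`-orthogonally projected to the Laplacians of moment-free functions. For the result `v`, the
functional `w ↦ (Δv, Δw)` vanishes on the common kernel of finitely many moments, hence is a
combination of them, and its coefficients are the polynomials `Δ²v` and `Δv|_e`. Uniqueness is the
same orthogonality tested with the difference. The projection needs completeness of `H² ∩ H¹₀` for
`‖Δ·‖`, again a consequence of Miranda-Talenti.

Miranda-Talenti without any density theorem. With a weight vanishing on all edges but one, the
Jacobian of the gradient integrates to zero up to terms with the derivative of the weight, since the
tangential derivative vanishes on the remaining edge (`integral_jacWeight_edge`). Summing over the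
edges gives weights that vanish at the vertices only. Let these weights tend to one; the error is
dominated because `∇w` divided by the distance to a vertex is square integrable, which is a Hardy
inequality (`hardy`).

Gluing. Neighbouring elements see the same degrees of freedom of `u` because `u` is in `H²` across
their common edge; for `u` in `H²₀` the boundary ones vanish as limits of those of test functions.
-/

/-- Convergence in `L²(μ)` of a sequence of functions. -/
def L2Lim (μ : Measure Plane) (φ : ℕ → Plane → ℝ) (f : Plane → ℝ) : Prop :=
  Tendsto (fun m => eLpNorm (φ m - f) 2 μ) atTop (𝓝 0)

section L2Lim
variable {μ ν : Measure Plane} {φ ψ : ℕ → Plane → ℝ} {f g : Plane → ℝ}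

theorem L2Lim.congr (h : L2Lim μ φ f) (hφ : ∀ m, φ m =ᵐ[μ] ψ m) (hf : f =ᵐ[μ] g) :
    L2Lim μ ψ g := by
  refine Tendsto.congr (fun m => ?_) h
  exact eLpNorm_congr_ae ((hφ m).sub hf)

theorem L2Lim.mono (h : L2Lim μ φ f) (hνμ : ν ≤ μ) : L2Lim ν φ f :=
  tendsto_of_tendsto_of_tendsto_of_le_of_le tendsto_const_nhds h (fun _ => zero_le)
    (fun _ => eLpNorm_mono_measure _ hνμ)

theorem L2Lim.const (μ : Measure Plane) (f : Plane → ℝ) : L2Lim μ (fun _ => f) f := by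
  simp [L2Lim]

theorem L2Lim.add (h : L2Lim μ φ f) (h' : L2Lim μ ψ g)
    (hφ : ∀ m, AEStronglyMeasurable (φ m) μ) (hψ : ∀ m, AEStronglyMeasurable (ψ m) μ)
    (hf : AEStronglyMeasurable f μ) (hg : AEStronglyMeasurable g μ) :
    L2Lim μ (fun m => φ m + ψ m) (f + g) := by
  have := Tendsto.add h h'
  rw [add_zero] at this
  refine tendsto_of_tendsto_of_tendsto_of_le_of_le tendsto_const_nhds this (fun _ => zero_le)
    (fun m => ?_)
  have e : φ m + ψ m - (f + g) = (φ m - f) + (ψ m - g) := by abel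
  show eLpNorm (φ m + ψ m - (f + g)) 2 μ ≤ _
  rw [e]
  exact eLpNorm_add_le ((hφ m).sub hf) ((hψ m).sub hg) (by norm_num)

theorem L2Lim.const_smul (h : L2Lim μ φ f) (c : ℝ) :
    L2Lim μ (fun m => c • φ m) (c • f) := by
  have := ENNReal.Tendsto.const_mul (a := ‖c‖ₑ) h (Or.inr (by simp))
  rw [mul_zero] at this
  refine Tendsto.congr (fun m => ?_) this
  rw [← smul_sub, eLpNorm_const_smul]

theorem L2Lim.bdd_mul (h : L2Lim μ φ f) {a : Plane → ℝ} {C : ℝ} (hC : ∀ᵐ x ∂μ, |a x| ≤ C) :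
    L2Lim μ (fun m => a * φ m) (a * f) := by
  have := ENNReal.Tendsto.const_mul (a := ENNReal.ofReal C) h (Or.inr (by simp))
  rw [mul_zero] at this
  refine tendsto_of_tendsto_of_tendsto_of_le_of_le tendsto_const_nhds this (fun _ => zero_le)
    (fun m => ?_)
  refine eLpNorm_le_mul_eLpNorm_of_ae_le_mul ?_ 2
  filter_upwards [hC] with x hx
  simp only [Pi.sub_apply, Pi.mul_apply, Real.norm_eq_abs]
  rw [← mul_sub, abs_mul]
  exact mul_le_mul_of_nonneg_right hx (abs_nonneg _)

theorem L2Lim.toReal (h : L2Lim μ φ f) :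
    Tendsto (fun m => (eLpNorm (φ m - f) 2 μ).toReal) atTop (𝓝 0) := by
  have := (ENNReal.continuousAt_toReal (by simp : (0:ENNReal) ≠ ⊤)).tendsto.comp h
  rwa [ENNReal.toReal_zero] at this

theorem abs_integral_mul_le_eLpNorm (hf : MemLp f 2 μ) (hg : MemLp g 2 μ) :
    |∫ x, f x * g x ∂μ| ≤ (eLpNorm f 2 μ).toReal * (eLpNorm g 2 μ).toReal := by
  have h1 : |∫ x, f x * g x ∂μ| ≤ ∫ x, ‖f x‖ * ‖g x‖ ∂μ := by
    refine (abs_integral_le_integral_abs).trans (le_of_eq ?_)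
    simp [abs_mul]
  refine h1.trans ((integral_mul_norm_le_Lp_mul_Lq (p := 2) (q := 2)
    ⟨by norm_num, by norm_num, by norm_num⟩ (by simpa using hf) (by simpa using hg)).trans
    (le_of_eq ?_))
  rw [hf.eLpNorm_eq_integral_rpow_norm (by norm_num) (by norm_num),
    hg.eLpNorm_eq_integral_rpow_norm (by norm_num) (by norm_num), ENNReal.toReal_ofReal,
    ENNReal.toReal_ofReal]
  · norm_num
  · positivity
  · positivity

theorem toReal_eLpNorm_sq (hf : MemLp f 2 μ) :
    (eLpNorm f 2 μ).toReal ^ 2 = ∫ x, f x ^ 2 ∂μ := by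
  rw [hf.eLpNorm_eq_integral_rpow_norm (by norm_num) (by norm_num), ENNReal.toReal_ofReal
    (by positivity)]
  have : 0 ≤ ∫ a, ‖f a‖ ^ (2:ENNReal).toReal ∂μ := by positivity
  rw [← Real.rpow_natCast, ← Real.rpow_mul this]
  simp

theorem _root_.MeasureTheory.MemLp.integrable_mul' (hf : MemLp f 2 μ) (hg : MemLp g 2 μ) :
    Integrable (fun x => f x * g x) μ := hf.integrable_mul hg

/-- Both factors may vary. This is what carries each Green formula from smooth approximations to
Sobolev functions, in the interior and on the edges. -/
theorem L2Lim.integral_mul (h : L2Lim μ φ f) (h' : L2Lim μ ψ g)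
    (hφ : ∀ m, MemLp (φ m) 2 μ) (hψ : ∀ m, MemLp (ψ m) 2 μ) (hf : MemLp f 2 μ) (hg : MemLp g 2 μ) :
    Tendsto (fun m => ∫ x, φ m x * ψ m x ∂μ) atTop (𝓝 (∫ x, f x * g x ∂μ)) := by
  rw [tendsto_iff_dist_tendsto_zero]
  have hA := h.toReal
  have hB := h'.toReal
  have key : ∀ m, dist (∫ x, φ m x * ψ m x ∂μ) (∫ x, f x * g x ∂μ) ≤
      (eLpNorm (φ m - f) 2 μ).toReal * (eLpNorm (ψ m - g) 2 μ).toReal +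
      (eLpNorm (φ m - f) 2 μ).toReal * (eLpNorm g 2 μ).toReal +
      (eLpNorm f 2 μ).toReal * (eLpNorm (ψ m - g) 2 μ).toReal := by
    intro m
    have m1 := (hφ m).sub hf
    have m2 := (hψ m).sub hg
    have e : (∫ x, φ m x * ψ m x ∂μ) - (∫ x, f x * g x ∂μ) =
        (∫ x, (φ m - f) x * (ψ m - g) x ∂μ) + (∫ x, (φ m - f) x * g x ∂μ) +
          ∫ x, f x * (ψ m - g) x ∂μ := by
      rw [← integral_sub ((hφ m).integrable_mul' (hψ m)) (hf.integrable_mul' hg),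
        ← integral_add (m1.integrable_mul' m2) (m1.integrable_mul' hg),
        ← integral_add (f := fun x => (φ m - f) x * (ψ m - g) x + (φ m - f) x * g x)
          ((m1.integrable_mul' m2).add (m1.integrable_mul' hg)) (hf.integrable_mul' m2)]
      congr 1
      ext x
      simp only [Pi.sub_apply]
      ring
    rw [Real.dist_eq, e]
    refine (abs_add_three _ _ _).trans ?_
    gcongr <;> apply abs_integral_mul_le_eLpNorm <;> assumption
  refine squeeze_zero (fun _ => dist_nonneg) key ?_
  simpa using ((hA.mul hB).add (hA.mul_const _)).add (hB.const_mul (eLpNorm f 2 μ).toReal)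

theorem L2Lim.integral_mul_const (h : L2Lim μ φ f) (hφ : ∀ m, MemLp (φ m) 2 μ)
    (hf : MemLp f 2 μ) (hg : MemLp g 2 μ) :
    Tendsto (fun m => ∫ x, φ m x * g x ∂μ) atTop (𝓝 (∫ x, f x * g x ∂μ)) :=
  h.integral_mul (L2Lim.const μ g) hφ (fun _ => hg) hf hg

theorem L2Lim.unique (h : L2Lim μ φ f) (h' : L2Lim μ φ g) (hφ : ∀ m, AEStronglyMeasurable (φ m) μ)
    (hf : AEStronglyMeasurable f μ) (hg : AEStronglyMeasurable g μ) : f =ᵐ[μ] g := by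
  have h1 := (h.const_smul (-1)).add h' (fun m => (hφ m).const_smul _) hφ (hf.const_smul _) hg
  have h2 : eLpNorm (f - g) 2 μ = 0 := by
    have : L2Lim μ (fun m => (0 : Plane → ℝ)) ((-1 : ℝ) • f + g) := by
      refine h1.congr (fun m => ?_) (by rfl)
      filter_upwards with x
      simp
    have h3 := tendsto_nhds_unique this tendsto_const_nhds
    rw [h3]
    congr 1
    ext x
    simp
    ring
  have := (eLpNorm_eq_zero_iff (hf.sub hg) (by norm_num)).1 h2
  filter_upwards [this] with x hx
  simpa [sub_eq_zero] using hx

end L2Lim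

/-! ## Test functions and classical derivatives -/

variable {U V : Set Plane} {i j : Fin 2} {f f' g g' φ ψ : Plane → ℝ}

theorem pderiv_contDiff (hφ : ContDiff ℝ ∞ φ) (i : Fin 2) : ContDiff ℝ ∞ (pderiv i φ) :=
  (hφ.fderiv_right (m := ∞) (by simp)).clm_apply contDiff_const

theorem pderiv_mul (hφ : Differentiable ℝ φ) (hψ : Differentiable ℝ ψ) (i : Fin 2) (x : Plane) :
    pderiv i (φ * ψ) x = φ x * pderiv i ψ x + pderiv i φ x * ψ x := by
  unfold pderiv
  rw [fderiv_mul (hφ x) (hψ x)]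
  simp [mul_comm]

theorem pderiv_add (hφ : Differentiable ℝ φ) (hψ : Differentiable ℝ ψ) (i : Fin 2) (x : Plane) :
    pderiv i (φ + ψ) x = pderiv i φ x + pderiv i ψ x := by
  unfold pderiv
  rw [fderiv_add (hφ x) (hψ x)]
  simp

theorem pderiv_sub (hφ : Differentiable ℝ φ) (hψ : Differentiable ℝ ψ) (i : Fin 2) (x : Plane) :
    pderiv i (φ - ψ) x = pderiv i φ x - pderiv i ψ x := by
  unfold pderiv
  rw [fderiv_sub (hφ x) (hψ x)]
  simp

theorem pderiv_const_smul (hφ : Differentiable ℝ φ) (c : ℝ) (i : Fin 2) (x : Plane) :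
    pderiv i (c • φ) x = c * pderiv i φ x := by
  unfold pderiv
  rw [fderiv_const_smul (hφ x)]
  simp

theorem pderiv_congr_of_eventuallyEq {x : Plane} (h : φ =ᶠ[𝓝 x] ψ) (i : Fin 2) :
    pderiv i φ x = pderiv i ψ x := by
  unfold pderiv
  rw [h.fderiv_eq]

theorem pderiv_comm (hφ : ContDiff ℝ ∞ φ) (i j : Fin 2) (x : Plane) :
    pderiv i (pderiv j φ) x = pderiv j (pderiv i φ) x := by
  have hd : DifferentiableAt ℝ (fderiv ℝ φ) x :=
    ((hφ.fderiv_right (m := ∞) (by simp)).differentiable (by simp)) x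
  have key : ∀ a b : Fin 2, pderiv a (pderiv b φ) x =
      fderiv ℝ (fderiv ℝ φ) x (EuclideanSpace.single a 1) (EuclideanSpace.single b 1) := by
    intro a b
    unfold pderiv
    rw [fderiv_clm_apply hd (by fun_prop)]
    simp
  have hs : IsSymmSndFDerivAt ℝ φ x :=
    (hφ.contDiffAt).isSymmSndFDerivAt (by
      rw [minSmoothness_of_isRCLikeNormedField]
      exact WithTop.coe_le_coe.2 (le_top : (2 : ℕ∞) ≤ ⊤))
  rw [key, key]
  exact hs _ _

theorem fderiv_eq_sum_pderiv (φ : Plane → ℝ) (x v : Plane) :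
    fderiv ℝ φ x v = ∑ i, v i * pderiv i φ x := by
  have hv : v = ∑ i, v i • EuclideanSpace.single i (1:ℝ) := by
    ext k
    fin_cases k <;> simp [Fin.sum_univ_two]
  conv_lhs => rw [hv]
  simp [pderiv]

theorem tsupport_pderiv_subset (φ : Plane → ℝ) (i : Fin 2) :
    tsupport (pderiv i φ) ⊆ tsupport φ := by
  refine closure_minimal ?_ isClosed_closure
  intro x hx
  by_contra hn
  apply hx
  have : φ =ᶠ[𝓝 x] fun _ => 0 := notMem_tsupport_iff_eventuallyEq.mp hn
  unfold pderiv
  rw [this.fderiv_eq]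
  simp

theorem IsTestFunction.pderiv (h : IsTestFunction U φ) (i : Fin 2) :
    IsTestFunction U (pderiv i φ) :=
  ⟨pderiv_contDiff h.1 i, h.2.1.mono' ((subset_tsupport _).trans (tsupport_pderiv_subset φ i)),
    (tsupport_pderiv_subset φ i).trans h.2.2⟩

theorem IsTestFunction.mul (h : IsTestFunction U φ) (hψ : ContDiff ℝ ∞ ψ) :
    IsTestFunction U (ψ * φ) :=
  ⟨hψ.mul h.1, h.2.1.mul_left, (tsupport_mul_subset_right).trans h.2.2⟩

theorem IsTestFunction.mono (h : IsTestFunction U φ) (hUV : U ⊆ V) : IsTestFunction V φ :=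
  ⟨h.1, h.2.1, h.2.2.trans hUV⟩

theorem IsTestFunction.eq_zero (h : IsTestFunction U φ) {x : Plane} (hx : x ∉ U) : φ x = 0 := by
  by_contra hn
  exact hx (h.2.2 (subset_tsupport _ hn))

theorem integrable_mul_test (hf : LocallyIntegrableOn f U) (hφ : Continuous φ)
    (hc : HasCompactSupport φ) (hs : tsupport φ ⊆ U) :
    IntegrableOn (fun x => f x * φ x) U := by
  have h1 : IntegrableOn f (tsupport φ) := hf.integrableOn_compact_subset hs hc
  have h2 : IntegrableOn (fun x => f x * φ x) (tsupport φ) :=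
    h1.mul_continuousOn hφ.continuousOn hc
  have h3 : Integrable (fun x => f x * φ x) :=
    (integrableOn_iff_integrable_of_support_subset (fun x hx => subset_tsupport _ (by
      intro h0
      apply hx
      simp [h0]))).1 h2
  exact h3.integrableOn

theorem IsTestFunction.integrable_mul (h : IsTestFunction U φ) (hf : LocallyIntegrableOn f U) :
    IntegrableOn (fun x => f x * φ x) U :=
  integrable_mul_test hf h.1.continuous h.2.1 h.2.2

/-! ## Weak derivatives -/

theorem IsWeakPartial.ae_eq (hU : IsOpen U) (h : IsWeakPartial U i f g)
    (h' : IsWeakPartial U i f g') : g =ᵐ[volume.restrict U] g' := by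
  have h0 := hU.ae_eq_zero_of_integral_contDiff_smul_eq_zero (μ := volume) (h.2.1.sub h'.2.1) (by
    intro φ h1 h2 h3
    have ht : IsTestFunction U φ := ⟨h1, h2, h3⟩
    have e : ∫ x, φ x • (g - g') x = ∫ x in U, φ x • (g - g') x := by
      refine (setIntegral_eq_integral_of_forall_compl_eq_zero fun x hx => ?_).symm
      rw [ht.eq_zero hx, zero_smul]
    rw [e]
    have e2 : ∀ x, φ x • (g - g') x = g x * φ x - g' x * φ x := by
      intro x; simp; ring
    simp_rw [e2]
    rw [integral_sub (ht.integrable_mul h.2.1) (ht.integrable_mul h'.2.1)]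
    have := h.2.2 φ ht
    have := h'.2.2 φ ht
    linarith)
  rw [EventuallyEq, ae_restrict_iff' hU.measurableSet]
  filter_upwards [h0] with x hx hxU
  simpa [sub_eq_zero] using hx hxU

theorem weakPartial_spec (h : IsWeakPartial U i f g) : IsWeakPartial U i f (weakPartial U i f) := by
  have hex : ∃ g, IsWeakPartial U i f g := ⟨g, h⟩
  unfold weakPartial
  rw [dif_pos hex]
  exact hex.choose_spec

theorem IsWeakPartial.weakPartial_ae (hU : IsOpen U) (h : IsWeakPartial U i f g) :
    weakPartial U i f =ᵐ[volume.restrict U] g :=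
  (weakPartial_spec h).ae_eq hU h

theorem locallyIntegrableOn_congr (h : LocallyIntegrableOn f U)
    (e : f =ᵐ[volume.restrict U] g) : LocallyIntegrableOn g U := by
  intro x hx
  obtain ⟨s, hs, hi⟩ := h x hx
  refine ⟨s ∩ U, inter_mem hs self_mem_nhdsWithin, (hi.mono_set Set.inter_subset_left).congr ?_⟩
  exact ae_restrict_of_ae_restrict_of_subset Set.inter_subset_right e

theorem _root_.MeasureTheory.MemLp.locallyIntegrableOn (h : MemLp f 2 (volume.restrict U)) :
    LocallyIntegrableOn f U :=
  locallyIntegrableOn_of_locallyIntegrable_restrict (h.locallyIntegrable (by norm_num))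

theorem IsWeakPartial.congr (h : IsWeakPartial U i f g)
    (hf : f =ᵐ[volume.restrict U] f') (hg : g =ᵐ[volume.restrict U] g') :
    IsWeakPartial U i f' g' := by
  refine ⟨locallyIntegrableOn_congr h.1 hf, locallyIntegrableOn_congr h.2.1 hg,
    fun φ hφ => ?_⟩
  have e1 : ∫ x in U, f' x * pderiv i φ x = ∫ x in U, f x * pderiv i φ x :=
    integral_congr_ae (by filter_upwards [hf] with x hx; rw [hx])
  have e2 : ∫ x in U, g' x * φ x = ∫ x in U, g x * φ x :=
    integral_congr_ae (by filter_upwards [hg] with x hx; rw [hx])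
  rw [e1, e2, h.2.2 φ hφ]

/-- An equality of functions, not merely almost everywhere: the chosen derivative depends only on
the predicate it is chosen from, and that predicate does not see null sets. Hence inner weak
derivatives can be rewritten inside outer ones and inside traces. -/
theorem weakPartial_congr (hf : f =ᵐ[volume.restrict U] f') (i : Fin 2) :
    weakPartial U i f = weakPartial U i f' := by
  have : IsWeakPartial U i f = IsWeakPartial U i f' := by
    ext g
    exact ⟨fun h => h.congr hf (ae_eq_refl _), fun h => h.congr hf.symm (ae_eq_refl _)⟩
  unfold weakPartial
  rw [this]

theorem IsWeakPartial.add (h : IsWeakPartial U i f g) (h' : IsWeakPartial U i f' g') :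
    IsWeakPartial U i (f + f') (g + g') := by
  refine ⟨h.1.add h'.1, h.2.1.add h'.2.1, fun φ hφ => ?_⟩
  simp only [Pi.add_apply, add_mul]
  rw [integral_add ((hφ.pderiv i).integrable_mul h.1) ((hφ.pderiv i).integrable_mul h'.1),
    integral_add (hφ.integrable_mul h.2.1) (hφ.integrable_mul h'.2.1), h.2.2 φ hφ, h'.2.2 φ hφ]
  ring

theorem IsWeakPartial.const_smul (h : IsWeakPartial U i f g) (c : ℝ) :
    IsWeakPartial U i (c • f) (c • g) := by
  refine ⟨h.1.smul c, h.2.1.smul c, fun φ hφ => ?_⟩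
  simp only [Pi.smul_apply, smul_eq_mul, mul_assoc]
  rw [integral_const_mul, integral_const_mul, h.2.2 φ hφ]
  ring

theorem IsWeakPartial.mono (h : IsWeakPartial U i f g) (hVU : V ⊆ U) :
    IsWeakPartial V i f g := by
  refine ⟨h.1.mono_set hVU, h.2.1.mono_set hVU, fun φ hφ => ?_⟩
  have := h.2.2 φ (hφ.mono hVU)
  have e : ∀ (q ψ : Plane → ℝ), IsTestFunction V ψ →
      ∫ x in V, q x * ψ x = ∫ x in U, q x * ψ x := by
    intro q ψ hψ
    rw [setIntegral_eq_integral_of_forall_compl_eq_zero fun x hx => ?_,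
      setIntegral_eq_integral_of_forall_compl_eq_zero fun x hx => ?_]
    · rw [(hψ.mono hVU).eq_zero hx, mul_zero]
    · rw [hψ.eq_zero hx, mul_zero]
  rw [e _ _ (hφ.pderiv i), e _ _ hφ, this]

theorem integral_mul_pderiv_eq_neg (hφ : ContDiff ℝ ∞ φ) (hψ : ContDiff ℝ ∞ ψ)
    (hc : HasCompactSupport ψ) (i : Fin 2) :
    ∫ x, φ x * pderiv i ψ x = -∫ x, pderiv i φ x * ψ x := by
  have ht : IsTestFunction Set.univ ψ := ⟨hψ, hc, Set.subset_univ _⟩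
  refine integral_mul_fderiv_eq_neg_fderiv_mul_of_integrable ?_ ?_ ?_
    (fun x _ => hφ.differentiable (by simp) x) (fun x _ => hψ.differentiable (by simp) x)
  · exact ((pderiv_contDiff hφ i).continuous.mul hψ.continuous).integrable_of_hasCompactSupport
      hc.mul_left
  · exact (hφ.continuous.mul (pderiv_contDiff hψ i).continuous).integrable_of_hasCompactSupport
      (ht.pderiv i).2.1.mul_left
  · exact (hφ.continuous.mul hψ.continuous).integrable_of_hasCompactSupport hc.mul_left

theorem isWeakPartial_of_contDiff (hφ : ContDiff ℝ ∞ φ) (U : Set Plane) (i : Fin 2) :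
    IsWeakPartial U i φ (pderiv i φ) := by
  refine ⟨hφ.continuous.locallyIntegrable.locallyIntegrableOn U,
    (pderiv_contDiff hφ i).continuous.locallyIntegrable.locallyIntegrableOn U, fun ψ hψ => ?_⟩
  rw [setIntegral_eq_integral_of_forall_compl_eq_zero fun x hx => ?_,
      setIntegral_eq_integral_of_forall_compl_eq_zero fun x hx => ?_]
  · exact integral_mul_pderiv_eq_neg hφ hψ.1 hψ.2.1 i
  · rw [hψ.eq_zero hx, mul_zero]
  · rw [(hψ.pderiv i).eq_zero hx, mul_zero]

theorem IsWeakPartial.smooth_mul (hU : IsOpen U) (hφ : ContDiff ℝ ∞ φ) (h : IsWeakPartial U i f g) :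
    IsWeakPartial U i (φ * f) (φ * g + pderiv i φ * f) := by
  have hc := hφ.continuous
  have hc' := (pderiv_contDiff hφ i).continuous
  have l : ∀ {a q : Plane → ℝ}, Continuous a → LocallyIntegrableOn q U →
      LocallyIntegrableOn (a * q) U := fun ha hq => hq.continuousOn_mul ha.continuousOn
        hU.isLocallyClosed
  refine ⟨l hc h.1, (l hc h.2.1).add (l hc' h.1), fun ψ hψ => ?_⟩
  have h1 := h.2.2 _ (hψ.mul hφ)
  have e1 : ∀ x, f x * pderiv i (φ * ψ) x = (φ * f) x * pderiv i ψ x + f x * (pderiv i φ * ψ) x := by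
    intro x
    rw [pderiv_mul (hφ.differentiable (by simp)) (hψ.1.differentiable (by simp))]
    simp; ring
  have e2 : ∀ x, (φ * g + pderiv i φ * f) x * ψ x = g x * (φ * ψ) x + f x * (pderiv i φ * ψ) x := by
    intro x; simp; ring
  have i3 : IntegrableOn (fun x => f x * (pderiv i φ * ψ) x) U :=
    (hψ.mul (pderiv_contDiff hφ i)).integrable_mul h.1
  simp only [e1] at h1
  rw [integral_add ((hψ.pderiv i).integrable_mul (l hc h.1)) i3] at h1
  simp only [e2]
  rw [integral_add ((hψ.mul hφ).integrable_mul h.2.1) i3]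
  linarith

/-! ## The spaces `H¹` and `H²` -/

theorem MemH1.isWeakPartial (h : MemH1 U f) (i : Fin 2) :
    IsWeakPartial U i f (weakPartial U i f) := by
  obtain ⟨g, _, hg⟩ := h.2 i
  exact weakPartial_spec hg

theorem MemH1.memLp_weakPartial (hU : IsOpen U) (h : MemH1 U f) (i : Fin 2) :
    MemLp (weakPartial U i f) 2 (volume.restrict U) := by
  obtain ⟨g, hg, hg'⟩ := h.2 i
  exact (memLp_congr_ae (hg'.weakPartial_ae hU)).2 hg

theorem MemH1.congr (hU : IsOpen U) (h : MemH1 U f) (e : f =ᵐ[volume.restrict U] f') :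
    MemH1 U f' :=
  ⟨(memLp_congr_ae e).1 h.1, fun i => ⟨_, h.memLp_weakPartial hU i,
    (h.isWeakPartial i).congr e (ae_eq_refl _)⟩⟩

theorem MemH2.congr (hU : IsOpen U) (h : MemH2 U f) (e : f =ᵐ[volume.restrict U] f') :
    MemH2 U f' :=
  ⟨h.1.congr hU e, fun i => by rw [← weakPartial_congr e]; exact h.2 i⟩

theorem MemH1.add (hU : IsOpen U) (h : MemH1 U f) (h' : MemH1 U g) : MemH1 U (f + g) :=
  ⟨h.1.add h'.1, fun i => ⟨_, (h.memLp_weakPartial hU i).add (h'.memLp_weakPartial hU i),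
    (h.isWeakPartial i).add (h'.isWeakPartial i)⟩⟩

theorem MemH1.const_smul (hU : IsOpen U) (h : MemH1 U f) (c : ℝ) : MemH1 U (c • f) :=
  ⟨h.1.const_smul c, fun i => ⟨_, (h.memLp_weakPartial hU i).const_smul c,
    (h.isWeakPartial i).const_smul c⟩⟩

theorem weakPartial_add (hU : IsOpen U) (h : MemH1 U f) (h' : MemH1 U g) (i : Fin 2) :
    weakPartial U i (f + g) =ᵐ[volume.restrict U] weakPartial U i f + weakPartial U i g :=
  ((h.isWeakPartial i).add (h'.isWeakPartial i)).weakPartial_ae hU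

theorem weakPartial_const_smul (hU : IsOpen U) (h : MemH1 U f) (c : ℝ) (i : Fin 2) :
    weakPartial U i (c • f) =ᵐ[volume.restrict U] c • weakPartial U i f :=
  ((h.isWeakPartial i).const_smul c).weakPartial_ae hU

theorem MemH1.sub (hU : IsOpen U) (h : MemH1 U f) (h' : MemH1 U g) : MemH1 U (f - g) := by
  simpa [sub_eq_add_neg] using h.add hU (h'.const_smul hU (-1))

theorem weakPartial_sub (hU : IsOpen U) (h : MemH1 U f) (h' : MemH1 U g) (i : Fin 2) :
    weakPartial U i (f - g) =ᵐ[volume.restrict U] weakPartial U i f - weakPartial U i g := by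
  have := (h.isWeakPartial i).add ((h'.isWeakPartial i).const_smul (-1))
  simp only [neg_smul, one_smul, ← sub_eq_add_neg] at this
  exact this.weakPartial_ae hU

theorem MemH2.add (hU : IsOpen U) (h : MemH2 U f) (h' : MemH2 U g) : MemH2 U (f + g) :=
  ⟨h.1.add hU h'.1, fun i => ((h.2 i).add hU (h'.2 i)).congr hU (weakPartial_add hU h.1 h'.1 i).symm⟩

theorem MemH2.const_smul (hU : IsOpen U) (h : MemH2 U f) (c : ℝ) : MemH2 U (c • f) :=
  ⟨h.1.const_smul hU c, fun i => ((h.2 i).const_smul hU c).congr hU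
    (weakPartial_const_smul hU h.1 c i).symm⟩

theorem MemH2.sub (hU : IsOpen U) (h : MemH2 U f) (h' : MemH2 U g) : MemH2 U (f - g) := by
  simpa [sub_eq_add_neg] using h.add hU (h'.const_smul hU (-1))

theorem weakPartial2_add (hU : IsOpen U) (h : MemH2 U f) (h' : MemH2 U g) (i j : Fin 2) :
    weakPartial U j (weakPartial U i (f + g)) =ᵐ[volume.restrict U]
      weakPartial U j (weakPartial U i f) + weakPartial U j (weakPartial U i g) := by
  rw [weakPartial_congr (weakPartial_add hU h.1 h'.1 i) j]
  exact weakPartial_add hU (h.2 i) (h'.2 i) j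

theorem weakPartial2_const_smul (hU : IsOpen U) (h : MemH2 U f) (c : ℝ) (i j : Fin 2) :
    weakPartial U j (weakPartial U i (c • f)) =ᵐ[volume.restrict U]
      c • weakPartial U j (weakPartial U i f) := by
  rw [weakPartial_congr (weakPartial_const_smul hU h.1 c i) j]
  exact weakPartial_const_smul hU (h.2 i) c j

theorem weakPartial2_sub (hU : IsOpen U) (h : MemH2 U f) (h' : MemH2 U g) (i j : Fin 2) :
    weakPartial U j (weakPartial U i (f - g)) =ᵐ[volume.restrict U]
      weakPartial U j (weakPartial U i f) - weakPartial U j (weakPartial U i g) := by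
  rw [weakPartial_congr (weakPartial_sub hU h.1 h'.1 i) j]
  exact weakPartial_sub hU (h.2 i) (h'.2 i) j

theorem weakLaplacian_congr (e : f =ᵐ[volume.restrict U] f') :
    weakLaplacian U f = weakLaplacian U f' := by
  unfold weakLaplacian
  simp only [weakPartial_congr e]

theorem weakLaplacian_add (hU : IsOpen U) (h : MemH2 U f) (h' : MemH2 U g) :
    weakLaplacian U (f + g) =ᵐ[volume.restrict U] weakLaplacian U f + weakLaplacian U g := by
  filter_upwards [weakPartial2_add hU h h' 0 0, weakPartial2_add hU h h' 1 1] with x h0 h1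
  simp only [weakLaplacian, Fin.sum_univ_two, h0, h1, Pi.add_apply]
  ring

theorem weakLaplacian_const_smul (hU : IsOpen U) (h : MemH2 U f) (c : ℝ) :
    weakLaplacian U (c • f) =ᵐ[volume.restrict U] c • weakLaplacian U f := by
  filter_upwards [weakPartial2_const_smul hU h c 0 0, weakPartial2_const_smul hU h c 1 1]
    with x h0 h1
  simp only [weakLaplacian, Fin.sum_univ_two, h0, h1, Pi.smul_apply, smul_eq_mul]
  ring

theorem weakLaplacian_sub (hU : IsOpen U) (h : MemH2 U f) (h' : MemH2 U g) :
    weakLaplacian U (f - g) =ᵐ[volume.restrict U] weakLaplacian U f - weakLaplacian U g := by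
  filter_upwards [weakPartial2_sub hU h h' 0 0, weakPartial2_sub hU h h' 1 1] with x h0 h1
  simp only [weakLaplacian, Fin.sum_univ_two, h0, h1, Pi.sub_apply]
  ring

theorem MemH2.memLp_weakLaplacian (hU : IsOpen U) (h : MemH2 U f) :
    MemLp (weakLaplacian U f) 2 (volume.restrict U) := by
  have := ((h.2 0).memLp_weakPartial hU 0).add ((h.2 1).memLp_weakPartial hU 1)
  refine this.congr_norm (this.1.congr ?_) ?_ <;>
  · filter_upwards with x
    simp [weakLaplacian, Fin.sum_univ_two]

theorem memLp_of_continuous (hb : Bornology.IsBounded U) (hf : Continuous f) :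
    MemLp f 2 (volume.restrict U) := by
  have hK : IsCompact (closure U) := hb.isCompact_closure
  have : MemLp f 2 (volume.restrict (closure U)) := by
    obtain ⟨C, hC⟩ := (hK.image hf).isBounded.exists_norm_le
    have : IsFiniteMeasure (volume.restrict (closure U)) :=
      isFiniteMeasure_restrict.2 hK.measure_lt_top.ne
    refine MemLp.of_bound hf.aestronglyMeasurable C ?_
    filter_upwards [ae_restrict_mem isClosed_closure.measurableSet] with x hx
    exact hC _ ⟨x, hx, rfl⟩
  exact this.mono_measure (Measure.restrict_mono subset_closure le_rfl)

theorem weakPartial_of_contDiff (hU : IsOpen U) (hφ : ContDiff ℝ ∞ φ) (i : Fin 2) :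
    weakPartial U i φ =ᵐ[volume.restrict U] pderiv i φ :=
  (isWeakPartial_of_contDiff hφ U i).weakPartial_ae hU

theorem weakPartial2_of_contDiff (hU : IsOpen U) (hφ : ContDiff ℝ ∞ φ) (i j : Fin 2) :
    weakPartial U j (weakPartial U i φ) =ᵐ[volume.restrict U] pderiv j (pderiv i φ) := by
  rw [weakPartial_congr (weakPartial_of_contDiff hU hφ i) j]
  exact weakPartial_of_contDiff hU (pderiv_contDiff hφ i) j

theorem memH1_of_contDiff (hb : Bornology.IsBounded U) (hφ : ContDiff ℝ ∞ φ) :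
    MemH1 U φ :=
  ⟨memLp_of_continuous hb hφ.continuous, fun i =>
    ⟨_, memLp_of_continuous hb (pderiv_contDiff hφ i).continuous, isWeakPartial_of_contDiff hφ U i⟩⟩

theorem memH2_of_contDiff (hU : IsOpen U) (hb : Bornology.IsBounded U) (hφ : ContDiff ℝ ∞ φ) :
    MemH2 U φ :=
  ⟨memH1_of_contDiff hb hφ, fun i => (memH1_of_contDiff hb (pderiv_contDiff hφ i)).congr hU
    (weakPartial_of_contDiff hU hφ i).symm⟩

theorem weakPartial_restrict (hV : IsOpen V) (hVU : V ⊆ U)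
    (h : IsWeakPartial U i f g) :
    weakPartial V i f =ᵐ[volume.restrict V] weakPartial U i f :=
  ((weakPartial_spec h).mono hVU).weakPartial_ae hV

theorem MemH1.mono (hU : IsOpen U) (h : MemH1 U f) (hVU : V ⊆ U) : MemH1 V f :=
  ⟨h.1.mono_measure (Measure.restrict_mono hVU le_rfl), fun i => ⟨_, (h.memLp_weakPartial hU
    i).mono_measure (Measure.restrict_mono hVU le_rfl), (h.isWeakPartial i).mono hVU⟩⟩

theorem MemH2.mono (hU : IsOpen U) (hV : IsOpen V) (h : MemH2 U f) (hVU : V ⊆ U) : MemH2 V f :=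
  ⟨h.1.mono hU hVU, fun i => ((h.2 i).mono hU hVU).congr hV
    (weakPartial_restrict hV hVU (h.1.isWeakPartial i)).symm⟩

theorem weakPartial2_restrict (hV : IsOpen V) (hVU : V ⊆ U)
    (h : MemH2 U f) (i j : Fin 2) :
    weakPartial V j (weakPartial V i f) =ᵐ[volume.restrict V]
      weakPartial U j (weakPartial U i f) := by
  rw [weakPartial_congr (weakPartial_restrict hV hVU (h.1.isWeakPartial i)) j]
  exact weakPartial_restrict hV hVU ((h.2 i).isWeakPartial j)

theorem memLp_continuous_mul (hb : Bornology.IsBounded U) (hφ : Continuous φ)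
    (hf : MemLp f 2 (volume.restrict U)) (hU : MeasurableSet U) :
    MemLp (φ * f) 2 (volume.restrict U) := by
  obtain ⟨C, hC⟩ := (hb.isCompact_closure.image hφ).isBounded.exists_norm_le
  refine hf.of_le_mul (c := C) (hφ.aestronglyMeasurable.mul hf.1) ?_
  filter_upwards [ae_restrict_mem hU] with x hx
  rw [Pi.mul_apply, norm_mul]
  exact mul_le_mul_of_nonneg_right (hC _ ⟨x, subset_closure hx, rfl⟩) (norm_nonneg _)

theorem MemH1.smooth_mul (hU : IsOpen U) (hb : Bornology.IsBounded U) (hφ : ContDiff ℝ ∞ φ)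
    (h : MemH1 U f) : MemH1 U (φ * f) :=
  ⟨memLp_continuous_mul hb hφ.continuous h.1 hU.measurableSet, fun i => ⟨_,
    (memLp_continuous_mul hb hφ.continuous (h.memLp_weakPartial hU i) hU.measurableSet).add
      (memLp_continuous_mul hb (pderiv_contDiff hφ i).continuous h.1 hU.measurableSet),
      (h.isWeakPartial i).smooth_mul hU hφ⟩⟩

theorem weakPartial_smooth_mul (hU : IsOpen U) (hφ : ContDiff ℝ ∞ φ) (h : MemH1 U f) (i : Fin 2) :
    weakPartial U i (φ * f) =ᵐ[volume.restrict U] φ * weakPartial U i f + pderiv i φ * f :=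
  ((h.isWeakPartial i).smooth_mul hU hφ).weakPartial_ae hU

/-- Both derivatives are moved to the test function, where they commute. -/
theorem weakPartial_comm (hU : IsOpen U) (h : MemH2 U f) (i j : Fin 2) :
    weakPartial U j (weakPartial U i f) =ᵐ[volume.restrict U]
      weakPartial U i (weakPartial U j f) := by
  have h1 := (h.2 i).isWeakPartial j
  have h2 := (h.2 j).isWeakPartial i
  refine IsWeakPartial.ae_eq hU (h1) ⟨h1.1, h2.2.1, fun φ hφ => ?_⟩
  have a1 := (h.1.isWeakPartial i).2.2 _ (hφ.pderiv j)
  have a2 := (h.1.isWeakPartial j).2.2 _ (hφ.pderiv i)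
  have a3 := h2.2.2 φ hφ
  simp only [pderiv_comm hφ.1 i j] at a1
  linarith

theorem isWeakPartial_of_L2Lim {φ ψ : ℕ → Plane → ℝ} (hφ : ∀ m, MemLp (φ m) 2 (volume.restrict U))
    (hψ : ∀ m, MemLp (ψ m) 2 (volume.restrict U)) (h : ∀ m, IsWeakPartial U i (φ m) (ψ m))
    (hf : MemLp f 2 (volume.restrict U)) (hg : MemLp g 2 (volume.restrict U))
    (lf : L2Lim (volume.restrict U) φ f) (lg : L2Lim (volume.restrict U) ψ g) :
    IsWeakPartial U i f g := by
  refine ⟨hf.locallyIntegrableOn, hg.locallyIntegrableOn, fun θ hθ => ?_⟩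
  have m1 : MemLp θ 2 (volume.restrict U) :=
    (hθ.1.continuous.memLp_of_hasCompactSupport hθ.2.1).mono_measure Measure.restrict_le_self
  have m2 : MemLp (pderiv i θ) 2 (volume.restrict U) :=
    ((hθ.pderiv i).1.continuous.memLp_of_hasCompactSupport (hθ.pderiv i).2.1).mono_measure
      Measure.restrict_le_self
  have t1 := lf.integral_mul_const hφ hf m2
  have t2 := (lg.integral_mul_const hψ hg m1).neg
  refine tendsto_nhds_unique t1 (t2.congr fun m => ?_)
  exact ((h m).2.2 θ hθ).symm

end StrainGradientVEM

/-! ### Smooth approximation of Sobolev functions on bounded convex open sets -/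

namespace StrainGradientVEM

open ContinuousLinearMap in
/-- Average of `F` over a small ball around the contraction of `x` towards `c`. -/
noncomputable def smoothing (κ : ContDiffBump (0 : Plane)) (ε : ℝ) (c : Plane) (F : Plane → ℝ) (x : Plane) : ℝ :=
  (MeasureTheory.convolution (κ.normed volume) F (lsmul ℝ ℝ) volume) ((1 - ε) • x + ε • c)

section
variable (κ : ContDiffBump (0 : Plane)) {F G : Plane → ℝ} {ε : ℝ} {c : Plane}

/-- Jensen's inequality for the probability density `κ.normed`, obtained from Cauchy-Schwarz by
splitting the kernel into two square roots. -/
theorem enorm_sq_convolution_le (hF : AEStronglyMeasurable F volume) (x : Plane) :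
    ‖MeasureTheory.convolution (κ.normed volume) F (ContinuousLinearMap.lsmul ℝ ℝ) volume x‖ₑ ^ (2:ℝ)
      ≤ ∫⁻ t, ‖κ.normed volume t‖ₑ * ‖F (x - t)‖ₑ ^ (2:ℝ) := by
  set k : Plane → ENNReal := fun t => ‖κ.normed volume t‖ₑ with hk
  have kcont : Continuous (κ.normed volume : Plane → ℝ) := κ.continuous_normed
  have km : Measurable k := kcont.measurable.enorm
  have hk1 : ∫⁻ t, k t = 1 := by
    have h1 := ofReal_integral_eq_lintegral_ofReal (μ := volume) (κ.integrable_normed)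
      (ae_of_all _ κ.nonneg_normed)
    rw [κ.integral_normed] at h1
    rw [← ENNReal.ofReal_one, h1]
    refine lintegral_congr fun t => ?_
    rw [hk]
    simp only
    rw [Real.enorm_eq_ofReal (κ.nonneg_normed t)]
  have hFm : AEStronglyMeasurable (fun t => F (x - t)) volume :=
    hF.comp_measurePreserving (Measure.measurePreserving_sub_left volume x)
  have h0 : ‖MeasureTheory.convolution (κ.normed volume) F (ContinuousLinearMap.lsmul ℝ ℝ) volume x‖ₑ
      ≤ ∫⁻ t, (k t) ^ (1/2:ℝ) * ((k t) ^ (1/2:ℝ) * ‖F (x - t)‖ₑ) := by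
    refine (enorm_integral_le_lintegral_enorm _).trans (le_of_eq (lintegral_congr fun t => ?_))
    simp only [ContinuousLinearMap.lsmul_apply, smul_eq_mul, enorm_mul, ← mul_assoc]
    congr 1
    rw [← ENNReal.rpow_add_of_nonneg _ _ (by norm_num) (by norm_num)]
    norm_num
    rfl
  have h1 := ENNReal.lintegral_mul_le_Lp_mul_Lq volume (p := 2) (q := 2) ⟨by norm_num, by norm_num, by norm_num⟩
    (f := fun t => (k t) ^ (1/2:ℝ)) (g := fun t => (k t) ^ (1/2:ℝ) * ‖F (x - t)‖ₑ)
    (km.pow_const _).aemeasurable ((km.pow_const _).aemeasurable.mul hFm.enorm)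
  have h2 := h0.trans h1
  have e1 : ∀ t, ((k t) ^ (1/2:ℝ)) ^ (2:ℝ) = k t := by
    intro t
    rw [← ENNReal.rpow_mul]
    norm_num
  simp only [ENNReal.mul_rpow_of_nonneg _ _ (by norm_num : (0:ℝ) ≤ 2), e1, hk1] at h2
  rw [ENNReal.one_rpow, one_mul] at h2
  calc _ ≤ ((∫⁻ t, k t * ‖F (x - t)‖ₑ ^ (2:ℝ)) ^ (1/2:ℝ)) ^ (2:ℝ) :=
        ENNReal.rpow_le_rpow h2 (by norm_num)
    _ = _ := by
      rw [← ENNReal.rpow_mul]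
      norm_num
      rfl

theorem eLpNorm_convolution_le (hF : MemLp F 2 volume) :
    eLpNorm (MeasureTheory.convolution (κ.normed volume) F (ContinuousLinearMap.lsmul ℝ ℝ) volume) 2 volume
      ≤ eLpNorm F 2 volume := by
  rw [← ENNReal.rpow_le_rpow_iff (z := 2) (by norm_num)]
  have e : ∀ f : Plane → ℝ, eLpNorm f 2 volume ^ (2:ℝ) = ∫⁻ x, ‖f x‖ₑ ^ (2:ℝ) := fun f => by
    simpa using eLpNorm_nnreal_pow_eq_lintegral (μ := volume) (f := f) (p := 2) (by norm_num)
  rw [e, e]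
  -- A strongly measurable representative makes the integrand jointly measurable, as Tonelli
  -- requires.
  obtain ⟨F', hF'm, hF'⟩ := hF.1
  have ec : MeasureTheory.convolution (κ.normed volume) F (ContinuousLinearMap.lsmul ℝ ℝ) volume =
      MeasureTheory.convolution (κ.normed volume) F' (ContinuousLinearMap.lsmul ℝ ℝ) volume := by
    ext x
    refine integral_congr_ae ?_
    have := (Measure.measurePreserving_sub_left volume x).quasiMeasurePreserving.ae_eq_comp hF'
    filter_upwards [this] with t ht
    simp only [Function.comp] at ht
    rw [ht]
  have e3 : ∫⁻ x, ‖F x‖ₑ ^ (2:ℝ) = ∫⁻ x, ‖F' x‖ₑ ^ (2:ℝ) :=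
    lintegral_congr_ae (by filter_upwards [hF'] with x hx; rw [hx])
  rw [ec, e3]
  refine (lintegral_mono fun x => enorm_sq_convolution_le κ hF'm.aestronglyMeasurable x).trans ?_
  have kcont : Continuous (κ.normed volume : Plane → ℝ) := κ.continuous_normed
  rw [lintegral_lintegral_swap]
  · have : ∀ t, ∫⁻ x, ‖κ.normed volume t‖ₑ * ‖F' (x - t)‖ₑ ^ (2:ℝ) =
        ‖κ.normed volume t‖ₑ * ∫⁻ x, ‖F' x‖ₑ ^ (2:ℝ) := by
      intro t
      rw [lintegral_const_mul' _ _ (by simp)]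
      congr 1
      exact lintegral_sub_right_eq_self (fun x => ‖F' x‖ₑ ^ (2:ℝ)) t
    simp only [this]
    have hk1 : ∫⁻ t, ‖κ.normed volume t‖ₑ = 1 := by
      have h1 := ofReal_integral_eq_lintegral_ofReal (μ := volume) (κ.integrable_normed)
        (ae_of_all _ κ.nonneg_normed)
      rw [κ.integral_normed] at h1
      rw [← ENNReal.ofReal_one, h1]
      refine lintegral_congr fun t => ?_
      rw [Real.enorm_eq_ofReal (κ.nonneg_normed t)]
    rw [lintegral_mul_const _ kcont.measurable.enorm, hk1, one_mul]
  · refine AEMeasurable.mul ?_ ?_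
    · exact (kcont.measurable.enorm.comp measurable_snd).aemeasurable
    · have hm := hF'm.measurable
      exact ((hm.comp (measurable_fst.sub measurable_snd)).enorm.pow_const _).aemeasurable

/-- The Jacobian is `(1 - ε)⁻² ≤ 4`. What matters is that the bound is the same for all `ε ≤ 1/2`
and all centres. -/
theorem map_contraction_le (hε : ε ≤ 1/2) (c : Plane) :
    Measure.map (fun x : Plane => (1 - ε) • x + ε • c) volume ≤ (4 : ENNReal) • volume := by
  have h1 : (fun x : Plane => (1 - ε) • x + ε • c) = (fun x => x + ε • c) ∘ (fun x => (1 - ε) • x) := rfl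
  rw [h1, ← Measure.map_map (by fun_prop) (by fun_prop), Measure.map_addHaar_smul _ (by linarith),
    Measure.map_smul, (measurePreserving_add_right volume (ε • c)).map_eq]
  gcongr
  rw [finrank_euclideanSpace, Fintype.card_fin, abs_inv, abs_of_nonneg (sq_nonneg _)]
  have : ((1 - ε) ^ 2)⁻¹ ≤ 4 := by
    rw [inv_le_comm₀ (by nlinarith) (by norm_num)]
    nlinarith
  simpa using ENNReal.ofReal_le_ofReal this

theorem contDiff_convolution (hF : LocallyIntegrable F volume) :
    ContDiff ℝ ∞ (MeasureTheory.convolution (κ.normed volume) F (ContinuousLinearMap.lsmul ℝ ℝ) volume) :=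
  κ.hasCompactSupport_normed.contDiff_convolution_left _ κ.contDiff_normed hF

theorem contDiff_smoothing (hF : LocallyIntegrable F volume) :
    ContDiff ℝ ∞ (smoothing κ ε c F) :=
  (contDiff_convolution κ hF).comp (by fun_prop)

theorem eLpNorm_smoothing_le (hε : ε ≤ 1/2) (hF : MemLp F 2 volume) :
    eLpNorm (smoothing κ ε c F) 2 volume ≤ 4 * eLpNorm F 2 volume := by
  have hcont := (contDiff_convolution κ (hF.locallyIntegrable (by norm_num))).continuous
  have h1 : eLpNorm (smoothing κ ε c F) 2 volume = eLpNorm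
      (MeasureTheory.convolution (κ.normed volume) F (ContinuousLinearMap.lsmul ℝ ℝ) volume) 2
      (Measure.map (fun x : Plane => (1 - ε) • x + ε • c) volume) :=
    (eLpNorm_map_measure hcont.aestronglyMeasurable (by fun_prop)).symm
  rw [h1]
  refine (eLpNorm_mono_measure _ (map_contraction_le hε c)).trans ?_
  rw [eLpNorm_smul_measure_of_ne_top (by norm_num)]
  rw [smul_eq_mul]
  gcongr
  · calc (4:ENNReal) ^ (1 / (2:ENNReal)).toReal ≤ 4 ^ (1:ℝ) := by
          refine ENNReal.rpow_le_rpow_of_exponent_le (by norm_num) ?_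
          simp; norm_num
      _ = 4 := by simp
  · exact eLpNorm_convolution_le κ hF

theorem smoothing_sub (hF : LocallyIntegrable F volume) (hG : LocallyIntegrable G volume) :
    smoothing κ ε c (F - G) = smoothing κ ε c F - smoothing κ ε c G := by
  ext x
  have h1 := (κ.hasCompactSupport_normed (μ := volume)).convolutionExists_left (ContinuousLinearMap.lsmul ℝ ℝ)
    κ.continuous_normed hF ((1 - ε) • x + ε • c)
  have h2 := (κ.hasCompactSupport_normed (μ := volume)).convolutionExists_left (ContinuousLinearMap.lsmul ℝ ℝ)
    κ.continuous_normed hG ((1 - ε) • x + ε • c)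
  simp only [smoothing, Pi.sub_apply, convolution]
  rw [← integral_sub h1 h2]
  simp [mul_sub]

/-- The smoothing of a continuous function with compact support is uniformly close to it on
bounded sets. -/
theorem dist_smoothing_lt (hG : Continuous G) (hGc : HasCompactSupport G) {U : Set Plane} (hU : Bornology.IsBounded U)
    {η : ℝ} (hη : 0 < η) (c : Plane) :
    ∃ δ > 0, ∀ (κ : ContDiffBump (0 : Plane)) (ε : ℝ), 0 ≤ ε → ε < δ → κ.rOut < δ → ∀ x ∈ U,
      dist (smoothing κ ε c G x) (G x) ≤ η := by
  obtain ⟨δ, hδ, h⟩ := Metric.uniformContinuous_iff.1 (hGc.uniformContinuous_of_continuous hG)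
    (η / 2) (by positivity)
  obtain ⟨R, hR⟩ := hU.exists_norm_le
  set M := max R 0 + ‖c‖ + 1
  have hM : 0 < M := by positivity
  refine ⟨min (δ / 2) (δ / (2 * M)), by positivity, fun κ ε h0 h1 h2 x hx => ?_⟩
  have hd : dist ((1 - ε) • x + ε • c) x < δ / 2 := by
    have : (1 - ε) • x + ε • c - x = ε • (c - x) := by module
    rw [dist_eq_norm, this, norm_smul, Real.norm_of_nonneg h0]
    have h3 : ‖c - x‖ ≤ M := by
      have := norm_sub_le c x
      have := hR x hx
      have := le_max_left R 0
      linarith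
    calc ε * ‖c - x‖ ≤ ε * M := by gcongr
      _ < (δ / (2 * M)) * M := by
        gcongr
        exact h1.trans_le (min_le_right _ _)
      _ = δ / 2 := by field_simp
  set z := (1 - ε) • x + ε • c
  have h4 : dist (smoothing κ ε c G x) (G z) ≤ η / 2 := by
    refine ContDiffBump.dist_normed_convolution_le hG.aestronglyMeasurable (fun y hy => ?_)
    refine (h ?_).le
    have : dist y z < κ.rOut := hy
    have := h2.trans_le (min_le_left _ _)
    linarith
  have h5 : dist (G z) (G x) < η / 2 := h (by linarith)
  have := dist_triangle (smoothing κ ε c G x) (G z) (G x)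
  linarith

end

theorem tendsto_eLpNorm_smoothing {U : Set Plane} (hUm : MeasurableSet U) (hU : Bornology.IsBounded U) {F : Plane → ℝ}
    (hF : MemLp F 2 volume) (κ : ℕ → ContDiffBump (0 : Plane)) (ε : ℕ → ℝ) (c : Plane)
    (h0 : ∀ m, 0 ≤ ε m) (h1 : ∀ m, ε m ≤ 1/2) (hε : Tendsto ε atTop (𝓝 0))
    (hκ : Tendsto (fun m => (κ m).rOut) atTop (𝓝 0)) :
    L2Lim (volume.restrict U) (fun m => smoothing (κ m) (ε m) c F) F := by
  rw [L2Lim, ENNReal.tendsto_atTop_zero]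
  intro η hη
  by_cases htop : η = ⊤
  · exact ⟨0, fun _ _ => by simp [htop]⟩
  have : IsFiniteMeasure (volume.restrict U) :=
    isFiniteMeasure_restrict.2 (hU.measure_lt_top).ne
  -- Density of continuous compactly supported `G`. The smoothing is bounded on `L²` with constant
  -- `4`, so the budget is `4 · η/10` for smoothing `F - G`, `η/2` for `G` itself and `η/10` for `G
  -- - F`.
  obtain ⟨G, hGc, hFG, hG, hGm⟩ := hF.exists_hasCompactSupport_eLpNorm_sub_le (by norm_num) (ε := η / 10)
    (by simp [hη.ne'])
  set A := (volume.restrict U) Set.univ ^ (1 / (2:ENNReal).toReal) with hA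
  have hAt : A ≠ ⊤ := by
    refine ENNReal.rpow_ne_top_of_nonneg (by positivity) (measure_ne_top _ _)
  obtain ⟨θ, hθ, hθA⟩ : ∃ θ : ℝ, 0 < θ ∧ A * ENNReal.ofReal θ ≤ η / 2 := by
    have hb : (η / 2) / (A + 1) ≠ 0 := by
      refine (ENNReal.div_pos ?_ (by simp [hAt])).ne'
      simp [hη.ne']
    have hb' : (η / 2) / (A + 1) ≠ ⊤ := by
      refine ENNReal.div_ne_top (ENNReal.div_ne_top htop (by norm_num)) (by simp)
    refine ⟨((η / 2) / (A + 1)).toReal, ENNReal.toReal_pos hb hb', ?_⟩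
    rw [ENNReal.ofReal_toReal hb']
    calc A * ((η / 2) / (A + 1)) ≤ (A + 1) * ((η / 2) / (A + 1)) := by gcongr; exact le_self_add
      _ ≤ η / 2 := ENNReal.mul_div_le
  obtain ⟨δ, hδ, hclose⟩ := dist_smoothing_lt hG hGc hU hθ c
  obtain ⟨N, hN⟩ := eventually_atTop.1 ((hε.eventually_lt_const hδ).and (hκ.eventually_lt_const hδ))
  refine ⟨N, fun m hm => ?_⟩
  have lF := hF.locallyIntegrable (by norm_num : (1:ENNReal) ≤ 2)
  have lG := hGm.locallyIntegrable (by norm_num : (1:ENNReal) ≤ 2)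
  have e : smoothing (κ m) (ε m) c F - F = smoothing (κ m) (ε m) c (F - G) +
      ((smoothing (κ m) (ε m) c G - G) + (G - F)) := by
    rw [smoothing_sub _ lF lG]; abel
  have m1 : AEStronglyMeasurable (smoothing (κ m) (ε m) c (F - G)) (volume.restrict U) :=
    (contDiff_smoothing _ (lF.sub lG)).continuous.aestronglyMeasurable
  have m2 : AEStronglyMeasurable (smoothing (κ m) (ε m) c G - G) (volume.restrict U) :=
    ((contDiff_smoothing _ lG).continuous.sub hG).aestronglyMeasurable
  have m3 : AEStronglyMeasurable (G - F) (volume.restrict U) :=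
    hG.aestronglyMeasurable.sub hF.1.restrict
  rw [e]
  have b1 : eLpNorm (smoothing (κ m) (ε m) c (F - G)) 2 (volume.restrict U) ≤ 4 * (η / 10) :=
    (eLpNorm_mono_measure _ Measure.restrict_le_self).trans
      ((eLpNorm_smoothing_le _ (h1 m) (hF.sub hGm)).trans (by gcongr))
  have b2 : eLpNorm (smoothing (κ m) (ε m) c G - G) 2 (volume.restrict U) ≤ η / 2 := by
    refine (eLpNorm_le_of_ae_bound (C := θ) ?_).trans (by simpa [hA] using hθA)
    filter_upwards [ae_restrict_mem hUm] with x hx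
    have := hclose (κ m) (ε m) (h0 m) (hN m hm).1 (hN m hm).2 x hx
    simpa [Real.dist_eq] using this
  have b3 : eLpNorm (G - F) 2 (volume.restrict U) ≤ η / 10 := by
    refine (eLpNorm_mono_measure _ Measure.restrict_le_self).trans ?_
    rwa [← eLpNorm_neg, neg_sub]
  calc _ ≤ 4 * (η / 10) + (η / 2 + η / 10) :=
        (eLpNorm_add_le m1 (m2.add m3) (by norm_num)).trans
          (add_le_add b1 ((eLpNorm_add_le m2 m3 (by norm_num)).trans (add_le_add b2 b3)))
    _ = η := by
      lift η to NNReal using htop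
      have e10 : (10:ENNReal) = ((10:NNReal):ENNReal) := by norm_num
      have e2 : (2:ENNReal) = ((2:NNReal):ENNReal) := by norm_num
      have e4 : (4:ENNReal) = ((4:NNReal):ENNReal) := by norm_num
      rw [e10, e2, e4, ← ENNReal.coe_div (by norm_num), ← ENNReal.coe_div (by norm_num)]
      norm_cast
      ext
      push_cast
      ring

theorem isTestFunction_bump_sub {U : Set Plane} (κ : ContDiffBump (0 : Plane)) (x0 : Plane)
    (hin : ∀ t ∈ Metric.closedBall (0:Plane) κ.rOut, x0 - t ∈ U) :
    IsTestFunction U (fun y => κ.normed volume (x0 - y)) := by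
  refine ⟨κ.contDiff_normed.comp (contDiff_const.sub contDiff_id), ?_, fun y hy => ?_⟩
  · exact κ.hasCompactSupport_normed.comp_homeomorph (Homeomorph.subLeft x0)
  · have hs : tsupport (fun y => κ.normed volume (x0 - y)) ⊆
        (fun y => x0 - y) ⁻¹' Metric.closedBall (0:Plane) κ.rOut := by
      refine closure_minimal (fun y hy => ?_) (Metric.isClosed_closedBall.preimage (by fun_prop))
      have h1 : x0 - y ∈ Function.support (κ.normed (volume : Measure Plane)) :=
        Function.mem_support.2 (Function.mem_support.1 hy)
      have h2 : x0 - y ∈ Metric.ball (0:Plane) κ.rOut :=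
        (κ.support_normed_eq (μ := volume)).subset h1
      have h3 : x0 - y ∈ Metric.closedBall (0:Plane) κ.rOut := Metric.ball_subset_closedBall h2
      exact Set.mem_preimage.2 h3
    have h4 : x0 - y ∈ Metric.closedBall (0:Plane) κ.rOut := Set.mem_preimage.1 (hs hy)
    have h5 := hin _ h4
    rwa [sub_sub_cancel] at h5

theorem pderiv_comp_sub {k : Plane → ℝ} (kd : Differentiable ℝ k) (x0 y : Plane) (i : Fin 2) :
    pderiv i (fun y => k (x0 - y)) y = -pderiv i k (x0 - y) := by
  unfold pderiv
  have h1 : HasFDerivAt (fun y : Plane => x0 - y) (-ContinuousLinearMap.id ℝ Plane) y := by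
    simpa using (hasFDerivAt_id y).const_sub x0
  have h2 := ((kd (x0 - y)).hasFDerivAt.comp y h1).fderiv
  have h3 : (fun y => k (x0 - y)) = k ∘ (fun y : Plane => x0 - y) := rfl
  rw [h3, h2]
  simp

/-- The extension of `f` by zero has no weak derivative across `∂U`, so plain mollification fails
near the boundary. Contracting towards `c` by `ε` leaves room: by convexity the ball of radius `ε r`
around `(1 - ε) x + ε c` lies in `U`, hence the translated kernel is a test function on `U` and the
definition of the weak derivative applies. The factor `1 - ε` is the chain rule for the contraction.
-/
theorem pderiv_smoothing {U : Set Plane} (hU : IsOpen U) (hUc : Convex ℝ U) {c : Plane} {ε r : ℝ}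
    (hε : 0 < ε) (hε1 : ε < 1) (hr : Metric.closedBall c r ⊆ U) (κ : ContDiffBump (0 : Plane))
    (hκ : κ.rOut = ε * r) {f g : Plane → ℝ} {i : Fin 2} (h : IsWeakPartial U i f g)
    (hf : MemLp f 2 (volume.restrict U)) {x : Plane} (hx : x ∈ U) :
    pderiv i (smoothing κ ε c (U.indicator f)) x = (1 - ε) * smoothing κ ε c (U.indicator g) x := by
  set F := U.indicator f
  have hF : MemLp F 2 volume := (memLp_indicator_iff_restrict hU.measurableSet).2 hf
  have lF := hF.locallyIntegrable (by norm_num : (1:ENNReal) ≤ 2)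
  set k : Plane → ℝ := κ.normed volume with hk
  have kd : ContDiff ℝ ∞ k := κ.contDiff_normed
  have kc : HasCompactSupport k := κ.hasCompactSupport_normed
  set x0 := (1 - ε) • x + ε • c with hx0
  have hin : ∀ t ∈ Metric.closedBall (0:Plane) (ε * r), x0 - t ∈ U := by
    intro t ht
    have e : x0 - t = (1 - ε) • x + ε • (c - ε⁻¹ • t) := by
      rw [smul_sub, smul_smul, mul_inv_cancel₀ hε.ne', one_smul, hx0]; abel
    rw [e]
    refine hUc hx (hr ?_) (by linarith) hε.le (by ring)
    rw [mem_closedBall_zero_iff] at ht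
    rw [Metric.mem_closedBall, dist_eq_norm]
    have : c - ε⁻¹ • t - c = -(ε⁻¹ • t) := by abel
    rw [this, norm_neg, norm_smul, Real.norm_of_nonneg (by positivity)]
    rw [inv_mul_le_iff₀ hε]
    exact ht
  have hd := kc.hasFDerivAt_convolution_left (ContinuousLinearMap.lsmul ℝ ℝ)
    (μ := volume) (kd.of_le (by simp)) lF x0
  have hA : HasFDerivAt (fun x : Plane => (1 - ε) • x + ε • c) ((1 - ε) • ContinuousLinearMap.id ℝ Plane) x :=
    ((hasFDerivAt_id x).const_smul (1 - ε)).add_const _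
  have hcomp := (hd.comp x hA).fderiv
  have hex := ((kc.fderiv ℝ).convolutionExists_left
    ((ContinuousLinearMap.lsmul ℝ ℝ : ℝ →L[ℝ] ℝ →L[ℝ] ℝ).precompL Plane) (μ := volume)
    (kd.continuous_fderiv (by simp)) lF x0)
  have e1 : pderiv i (smoothing κ ε c F) x = (1 - ε) * ∫ t, pderiv i k t * F (x0 - t) := by
    unfold pderiv
    have : smoothing κ ε c F = (convolution k F (ContinuousLinearMap.lsmul ℝ ℝ) volume) ∘
      (fun x : Plane => (1 - ε) • x + ε • c) := rfl
    rw [this, hcomp]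
    simp only [ContinuousLinearMap.comp_apply, smul_apply,
      ContinuousLinearMap.id_apply, map_smul, smul_eq_mul]
    congr 1
    rw [convolution, ContinuousLinearMap.integral_apply hex]
    simp [ContinuousLinearMap.precompL_apply]
  rw [e1]
  congr 1
  set ψ : Plane → ℝ := fun y => k (x0 - y)
  have hψ : IsTestFunction U ψ := isTestFunction_bump_sub κ x0 (by rwa [hκ])
  have hψd : ∀ y, pderiv i ψ y = -pderiv i k (x0 - y) := fun y =>
    pderiv_comp_sub (kd.differentiable (by simp)) x0 y i
  have hw := h.2.2 ψ hψ
  have e2 : ∫ t, pderiv i k t * F (x0 - t) = ∫ y in U, f y * pderiv i k (x0 - y) := by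
    rw [← integral_sub_left_eq_self _ volume x0, ← integral_indicator hU.measurableSet]
    refine integral_congr_ae (ae_of_all _ fun y => ?_)
    by_cases hy : y ∈ U <;> simp [F, hy, mul_comm]
  have e3 : smoothing κ ε c (U.indicator g) x = ∫ y in U, g y * ψ y := by
    simp only [smoothing, convolution]
    rw [← integral_sub_left_eq_self _ volume x0, ← integral_indicator hU.measurableSet]
    refine integral_congr_ae (ae_of_all _ fun y => ?_)
    by_cases hy : y ∈ U <;> simp [hy, mul_comm, ψ, hk, hx0]
  rw [e2, e3]
  simp only [hψd, mul_neg, integral_neg] at hw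
  linarith

/-- Approximation of an `H¹` function and its derivatives by smooth functions. -/
def Approx1 (U : Set Plane) (f : Plane → ℝ) (φ : ℕ → Plane → ℝ) : Prop :=
  (∀ m, ContDiff ℝ ∞ (φ m)) ∧ L2Lim (volume.restrict U) φ f ∧
    ∀ j, L2Lim (volume.restrict U) (fun m => pderiv j (φ m)) (weakPartial U j f)

/-- Approximation of an `H²` function and its derivatives by smooth functions. -/
def Approx2 (U : Set Plane) (f : Plane → ℝ) (φ : ℕ → Plane → ℝ) : Prop :=
  Approx1 U f φ ∧ ∀ i, Approx1 U (weakPartial U i f) (fun m => pderiv i (φ m))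

/-- One sequence of operators serves all functions and commutes with differentiation up to a factor
tending to one. It can therefore be iterated, and second derivatives need no separate construction.
-/
theorem exists_smoothing_family {U : Set Plane} (hU : IsOpen U) (hUc : Convex ℝ U)
    (hUb : Bornology.IsBounded U) (hne : U.Nonempty) :
    ∃ S : ℕ → (Plane → ℝ) → Plane → ℝ, ∃ a : ℕ → ℝ, Tendsto a atTop (𝓝 1) ∧ (∀ m, |a m| ≤ 1) ∧
      (∀ f, MemLp f 2 (volume.restrict U) → (∀ m, ContDiff ℝ ∞ (S m f)) ∧
        L2Lim (volume.restrict U) (fun m => S m f) f) ∧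
      ∀ f g i, MemLp f 2 (volume.restrict U) → IsWeakPartial U i f g → ∀ m, ∀ x ∈ U,
        pderiv i (S m f) x = a m * S m g x := by
  obtain ⟨c, hc⟩ := hne
  obtain ⟨r, hr, hrU⟩ := Metric.nhds_basis_closedBall.mem_iff.1 (hU.mem_nhds hc)
  set ε : ℕ → ℝ := fun m => 1 / ((m:ℝ) + 2) with hε
  have ε0 : ∀ m, 0 < ε m := fun m => by positivity
  have ε1 : ∀ m, ε m ≤ 1/2 := fun m => by
    simp only [hε]
    gcongr
    have : (0:ℝ) ≤ m := by positivity
    linarith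
  have εl : Tendsto ε atTop (𝓝 0) := by
    have := (tendsto_one_div_add_atTop_nhds_zero_nat (𝕜 := ℝ)).comp (tendsto_add_atTop_nat 1)
    refine this.congr fun m => ?_
    simp only [Function.comp, hε]
    push_cast
    ring
  set κ : ℕ → ContDiffBump (0 : Plane) := fun m => ⟨ε m * r / 2, ε m * r, by have := ε0 m; positivity, by
    have := ε0 m
    have : 0 < ε m * r := by positivity
    linarith⟩ with hκ
  have κl : Tendsto (fun m => (κ m).rOut) atTop (𝓝 0) := by simpa [hκ] using εl.mul_const r
  refine ⟨fun m f => smoothing (κ m) (ε m) c (U.indicator f), fun m => 1 - ε m,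
    by simpa using εl.const_sub 1, fun m => ?_, fun f hf => ?_, fun f g i hf hfg m x hx => ?_⟩
  · rw [abs_of_nonneg (by linarith [ε1 m])]; linarith [ε0 m]
  · have hF : MemLp (U.indicator f) 2 volume := (memLp_indicator_iff_restrict hU.measurableSet).2 hf
    refine ⟨fun m => contDiff_smoothing _ (hF.locallyIntegrable (by norm_num)), ?_⟩
    refine (tendsto_eLpNorm_smoothing hU.measurableSet hUb hF κ ε c (fun m => (ε0 m).le) ε1 εl κl).congr
      (fun _ => ae_eq_refl _) ?_
    filter_upwards [ae_restrict_mem hU.measurableSet] with x hx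
    simp [hx]
  · exact pderiv_smoothing hU hUc (ε0 m) (by linarith [ε1 m]) hrU (κ m) rfl hfg hf hx

theorem L2Lim.smul_seq {μ : Measure Plane} {φ : ℕ → Plane → ℝ} {f : Plane → ℝ} {a : ℕ → ℝ}
    (h : L2Lim μ φ f) (ha : Tendsto a atTop (𝓝 1)) (ha1 : ∀ m, |a m| ≤ 1)
    (hφ : ∀ m, AEStronglyMeasurable (φ m) μ) (hf : MemLp f 2 μ) : L2Lim μ (fun m => a m • φ m) f := by
  have t1 : Tendsto (fun m => ‖a m - 1‖ₑ * eLpNorm f 2 μ) atTop (𝓝 0) := by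
    have : Tendsto (fun m => ‖a m - 1‖ₑ) atTop (𝓝 0) := by
      have h2 : Tendsto (fun m => a m - 1) atTop (𝓝 0) := by simpa using ha.sub_const 1
      simpa using h2.enorm
    simpa using ENNReal.Tendsto.mul_const this (Or.inr hf.2.ne)
  have := t1.add h
  rw [add_zero] at this
  refine tendsto_of_tendsto_of_tendsto_of_le_of_le tendsto_const_nhds this (fun _ => zero_le)
    (fun m => ?_)
  have e : a m • φ m - f = (a m - 1) • f + a m • (φ m - f) := by module
  show eLpNorm (a m • φ m - f) 2 μ ≤ _
  rw [e]
  refine (eLpNorm_add_le (hf.1.const_smul _) (((hφ m).sub hf.1).const_smul _) (by norm_num)).trans ?_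
  rw [eLpNorm_const_smul, eLpNorm_const_smul]
  refine add_le_add le_rfl ?_
  have : ‖a m‖ₑ ≤ 1 := by
    rw [← ofReal_norm, Real.norm_eq_abs, ← ENNReal.ofReal_one]
    exact ENNReal.ofReal_le_ofReal (ha1 m)
  exact (mul_le_mul_left this _).trans_eq (one_mul _)

theorem exists_approx {U : Set Plane} (hU : IsOpen U) (hUc : Convex ℝ U)
    (hUb : Bornology.IsBounded U) (hne : U.Nonempty) {f : Plane → ℝ} :
    (MemH1 U f → ∃ φ, Approx1 U f φ) ∧ (MemH2 U f → ∃ φ, Approx2 U f φ) := by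
  obtain ⟨S, a, ha, ha1, hS, hd⟩ := exists_smoothing_family hU hUc hUb hne
  have gen1 : ∀ f, MemH1 U f → Approx1 U f (fun m => S m f) := by
    intro f h
    refine ⟨(hS f h.1).1, (hS f h.1).2, fun j => ?_⟩
    have hw := h.memLp_weakPartial hU j
    refine ((hS _ hw).2.smul_seq ha ha1 (fun m => ((hS _ hw).1 m).continuous.aestronglyMeasurable)
      hw).congr (fun m => ?_) (ae_eq_refl _)
    filter_upwards [ae_restrict_mem hU.measurableSet] with x hx
    rw [hd f _ j h.1 (h.isWeakPartial j) m x hx]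
    simp
  refine ⟨fun h => ⟨_, gen1 f h⟩, fun h => ⟨fun m => S m f, gen1 f h.1, fun i => ?_⟩⟩
  obtain ⟨g1, g2, g3⟩ := gen1 _ (h.2 i)
  refine ⟨fun m => pderiv_contDiff ((hS f h.1.1).1 m) i, (gen1 f h.1).2.2 i, fun j => ?_⟩
  refine (g3 j |>.smul_seq ha ha1 (fun m => (pderiv_contDiff (g1 m) j).continuous.aestronglyMeasurable)
    ((h.2 i).memLp_weakPartial hU j)).congr (fun m => ?_) (ae_eq_refl _)
  filter_upwards [ae_restrict_mem hU.measurableSet] with x hx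
  -- The commutation holds on the open set `U`, so it may be differentiated once more.
  have : pderiv i (S m f) =ᶠ[𝓝 x] a m • S m (weakPartial U i f) := by
    filter_upwards [hU.mem_nhds hx] with y hy
    rw [hd f _ i h.1.1 (h.1.isWeakPartial i) m y hy]
    simp
  rw [pderiv_congr_of_eventuallyEq this, pderiv_const_smul ((g1 m).differentiable (by simp))]
  simp

end StrainGradientVEM

namespace StrainGradientVEM

/-! ## Geometry of convex polygons -/

section cross
variable (a b c : Plane) (r : ℝ)

theorem cross_add_right : cross a (b + c) = cross a b + cross a c := by simp [cross]; ring
theorem cross_sub_right : cross a (b - c) = cross a b - cross a c := by simp [cross]; ring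
theorem cross_smul_left : cross (r • a) b = r * cross a b := by simp [cross]; ring
theorem cross_smul_right : cross a (r • b) = r * cross a b := by simp [cross]; ring
theorem cross_self : cross a a = 0 := by simp [cross]; ring
theorem cross_swap : cross a b = -cross b a := by simp [cross]; ring
theorem cross_zero_right : cross a 0 = 0 := by simp [cross]
-- Cramer's rule: it expands a vector in two given directions, later those of two consecutive edges.
theorem cross_smul_eq : cross a b • c = cross a c • b - cross b c • a := by
  ext k
  fin_cases k <;> simp [cross] <;> ring

end cross

namespace ConvexPolygon

variable (K : ConvexPolygon)

/-- The vector of the `i`-th edge. -/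
noncomputable def dvec (i : Fin (K.extra + 3)) : Plane := K.vert (i + 1) - K.vert i

/-- The affine function vanishing on the `i`-th edge, positive inside. -/
noncomputable def ell (i : Fin (K.extra + 3)) (x : Plane) : ℝ := cross (K.dvec i) (x - K.vert i)

/-- Parametrization of the line through the `i`-th edge. -/
noncomputable def edgePt (i : Fin (K.extra + 3)) (s : ℝ) : Plane := AffineMap.lineMap (K.vert i) (K.vert (i + 1)) s

variable {K} {i j k : Fin (K.extra + 3)} {x y : Plane} {s : ℝ}

theorem succ_ne (i : Fin (K.extra + 3)) : i + 1 ≠ i := by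
  intro h
  have : (1 : Fin (K.extra + 3)) = 0 := by simp at h
  simp at this

theorem two_ne_zero' : (1 : Fin (K.extra + 3)) + 1 ≠ 0 := by
  intro h
  rw [Fin.ext_iff, Fin.val_add] at h
  simp at h
  rw [Nat.mod_eq_of_lt (by omega)] at h
  omega

theorem succ_succ_ne (i : Fin (K.extra + 3)) : i + 1 + 1 ≠ i := by
  intro h
  rw [add_assoc] at h
  exact two_ne_zero' (by simpa using h)

theorem edgePt_eq (i : Fin (K.extra + 3)) (s : ℝ) : K.edgePt i s = K.vert i + s • K.dvec i := by
  simp [edgePt, AffineMap.lineMap_apply, dvec, add_comm]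

@[simp] theorem edgePt_zero : K.edgePt i 0 = K.vert i := by simp [edgePt]
@[simp] theorem edgePt_one : K.edgePt i 1 = K.vert (i + 1) := by simp [edgePt]

@[simp] theorem ell_vert_self : K.ell i (K.vert i) = 0 := by simp [ell, cross_zero_right]
@[simp] theorem ell_vert_succ : K.ell i (K.vert (i + 1)) = 0 := cross_self _

theorem ell_vert_pos (h1 : j ≠ i) (h2 : j ≠ i + 1) : 0 < K.ell i (K.vert j) := K.left i j h1 h2

theorem ell_vert_nonneg : 0 ≤ K.ell i (K.vert j) := by
  by_cases h1 : j = i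
  · simp [h1]
  by_cases h2 : j = i + 1
  · simp [h2]
  exact (ell_vert_pos h1 h2).le

theorem ell_combo {a b : ℝ} (hab : a + b = 1) : K.ell i (a • x + b • y) = a * K.ell i x + b * K.ell i y := by
  have : a • x + b • y - K.vert i = a • (x - K.vert i) + b • (y - K.vert i) := by
    have e : K.vert i = (a + b) • K.vert i := by rw [hab, one_smul]
    conv_lhs => rw [e]
    module
  rw [ell, this, cross_add_right, cross_smul_right, cross_smul_right, ell, ell]

theorem ell_edgePt (k : Fin (K.extra + 3)) : K.ell k (K.edgePt i s) =
    (1 - s) * K.ell k (K.vert i) + s * K.ell k (K.vert (i + 1)) := by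
  rw [← ell_combo (by ring), edgePt, AffineMap.lineMap_apply_module]

theorem ell_sub : K.ell i x - K.ell i y = cross (K.dvec i) (x - y) := by
  rw [ell, ell, ← cross_sub_right]; congr 1; abel

theorem contDiff_ell (i : Fin (K.extra + 3)) : ContDiff ℝ ∞ (K.ell i) := by
  unfold ell cross
  have h : ∀ a : Fin 2, ContDiff ℝ ∞ (fun x : Plane => (x - K.vert i) a) := fun a => by
    simp only [PiLp.sub_apply]
    exact (contDiff_piLp_apply (𝕜 := ℝ) (i := a) (p := 2)).sub contDiff_const
  exact (contDiff_const.mul (h 1)).sub (contDiff_const.mul (h 0))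

theorem continuous_ell (i : Fin (K.extra + 3)) : Continuous (K.ell i) := (contDiff_ell i).continuous

theorem pderiv_ell (i : Fin (K.extra + 3)) (a : Fin 2) (x : Plane) :
    pderiv a (K.ell i) x = cross (K.dvec i) (EuclideanSpace.single a 1) := by
  have h : HasLineDerivAt ℝ (K.ell i) (cross (K.dvec i) (EuclideanSpace.single a 1)) x
      (EuclideanSpace.single a 1) := by
    have : (fun t : ℝ => K.ell i (x + t • EuclideanSpace.single a 1)) =
        fun t => K.ell i x + t * cross (K.dvec i) (EuclideanSpace.single a 1) := by
      ext t
      rw [← cross_smul_right, ← sub_eq_iff_eq_add', ell_sub]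
      congr 1; abel
    unfold HasLineDerivAt
    rw [this]
    simpa using ((hasDerivAt_id (0:ℝ)).mul_const _).const_add (K.ell i x)
  unfold pderiv
  rw [← ((contDiff_ell i).differentiable (by simp) x).lineDeriv_eq_fderiv]
  exact h.lineDeriv

theorem vert_mem_carrier (i : Fin (K.extra + 3)) : K.vert i ∈ K.carrier :=
  subset_convexHull ℝ _ ⟨i, rfl⟩

theorem convex_carrier : Convex ℝ K.carrier := convex_convexHull ℝ _

theorem isCompact_carrier : IsCompact K.carrier := (Set.finite_range K.vert).isCompact_convexHull ℝ

theorem isClosed_carrier : IsClosed K.carrier := isCompact_carrier.isClosed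

theorem convex_ell_nonneg (i : Fin (K.extra + 3)) : Convex ℝ {x | 0 ≤ K.ell i x} := by
  intro x hx y hy a b ha hb hab
  show 0 ≤ K.ell i _
  rw [ell_combo hab]
  exact add_nonneg (mul_nonneg ha hx) (mul_nonneg hb hy)

theorem cross_dvec_pos (i : Fin (K.extra + 3)) : 0 < cross (K.dvec (i - 1)) (K.dvec i) := by
  have h := ell_vert_pos (K := K) (i := i - 1) (j := i + 1)
    (by intro h; exact succ_succ_ne (i - 1) (by rw [sub_add_cancel]; exact h))
    (by rw [sub_add_cancel]; exact succ_ne i)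
  have e : K.vert (i + 1) - K.vert (i - 1) = K.dvec (i - 1) + K.dvec i := by
    simp only [dvec, sub_add_cancel]; abel
  rwa [ell, e, cross_add_right, cross_self, zero_add] at h

/-- For the converse, suppose a functional `f` separates `x` from the polygon and is largest among
the vertices at `m`. By Cramer's rule `x - vert m` is a combination of the two edges leaving `vert
m`, with coefficients `ell (m - 1) x` and `ell m x` up to a positive factor. These are nonnegative,
and `f` does not increase along either edge, so `f x ≤ f (vert m)`. -/
theorem mem_carrier_iff : x ∈ K.carrier ↔ ∀ i, 0 ≤ K.ell i x := by
  constructor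
  · intro hx i
    refine convexHull_min ?_ (convex_ell_nonneg i) hx
    rintro _ ⟨j, rfl⟩
    exact ell_vert_nonneg
  · intro h
    by_contra hx
    obtain ⟨f, u, hu, hux⟩ := geometric_hahn_banach_closed_point convex_carrier isClosed_carrier hx
    obtain ⟨m, hm⟩ := Finite.exists_max (fun i => f (K.vert i))
    have hκ := cross_dvec_pos (K := K) m
    have e := cross_smul_eq (K.dvec (m - 1)) (K.dvec m) (x - K.vert m)
    have h1 : cross (K.dvec (m - 1)) (x - K.vert m) = K.ell (m - 1) x := by
      have : K.ell (m - 1) (K.vert m) = 0 := by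
        simpa using ell_vert_succ (K := K) (i := m - 1)
      rw [← ell_sub, this, sub_zero]
    have h2 := congrArg f e
    rw [h1] at h2
    simp only [map_smul, map_sub, smul_eq_mul, dvec, sub_add_cancel] at h2
    have h3 : cross (K.vert (m + 1) - K.vert m) (x - K.vert m) = K.ell m x := rfl
    rw [h3] at h2
    have h4 := hm (m + 1)
    have h5 := hm (m - 1)
    have h6 := hu _ (vert_mem_carrier m)
    have h7 : 0 < f x - f (K.vert m) := by linarith
    have h8 := h m
    have h9 := h (m - 1)
    have h10 := mul_nonneg h9 (sub_nonneg.2 h4)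
    have h11 := mul_nonneg h8 (sub_nonneg.2 h5)
    simp only [dvec, sub_add_cancel] at hκ
    have h12 := mul_pos hκ h7
    nlinarith

theorem isOpen_inner : IsOpen K.inner := isOpen_interior

theorem inner_subset_carrier : K.inner ⊆ K.carrier := interior_subset

theorem mem_inner_iff : x ∈ K.inner ↔ ∀ i, 0 < K.ell i x := by
  constructor
  · intro hx i
    by_contra hn
    have h0 : K.ell i x = 0 :=
      le_antisymm (not_lt.1 hn) (mem_carrier_iff.1 (inner_subset_carrier hx) i)
    -- At a point with `ell i = 0`, a small step in the direction of the preceding edge makes `ell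
    -- i` negative; an interior point would allow this step.
    have hc := cross_dvec_pos (K := K) i
    have hcont : Continuous (fun t : ℝ => x + t • K.dvec (i - 1)) := by fun_prop
    have hmem : ∀ᶠ t in 𝓝 (0:ℝ), x + t • K.dvec (i - 1) ∈ K.inner := by
      apply hcont.continuousAt.eventually_mem
      simpa using isOpen_inner.mem_nhds hx
    obtain ⟨ε, hε, hb⟩ := Metric.eventually_nhds_iff.1 hmem
    have := mem_carrier_iff.1 (inner_subset_carrier (hb (y := ε / 2) (by
      simp [abs_of_pos hε]; linarith))) i
    have e := ell_sub (K := K) (i := i) (x := x + (ε / 2) • K.dvec (i - 1)) (y := x)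
    rw [add_sub_cancel_left, cross_smul_right, cross_swap] at e
    nlinarith
  · intro h
    have ho : IsOpen {x | ∀ i, 0 < K.ell i x} := by
      rw [Set.ofPred_forall]
      exact isOpen_iInter_of_finite fun i => isOpen_lt continuous_const (continuous_ell i)
    exact interior_maximal (fun y hy => mem_carrier_iff.2 fun i => (hy i).le) ho h

theorem convex_inner : Convex ℝ K.inner := convex_carrier.interior

theorem isBounded_inner : Bornology.IsBounded K.inner :=
  isCompact_carrier.isBounded.subset inner_subset_carrier

theorem exists_vert_ell_pos (i : Fin (K.extra + 3)) : 0 < K.ell i (K.vert (i + 1 + 1)) :=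
  ell_vert_pos (succ_succ_ne i) (succ_ne (i + 1))

theorem inner_nonempty : K.inner.Nonempty := by
  have hn : (0:ℝ) < (K.extra + 3 : ℕ) := by positivity
  refine ⟨(((K.extra + 3 : ℕ) : ℝ)⁻¹) • ∑ j, K.vert j, mem_inner_iff.2 fun i => ?_⟩
  have e : K.ell i ((((K.extra + 3 : ℕ) : ℝ)⁻¹) • ∑ j, K.vert j) =
      (((K.extra + 3 : ℕ) : ℝ)⁻¹) * ∑ j, K.ell i (K.vert j) := by
    simp only [ell]
    have hl : ∀ v : Plane, cross (K.dvec i) v = K.dvec i 0 * v 1 - K.dvec i 1 * v 0 := fun v => rfl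
    simp only [hl, Finset.sum_sub_distrib, ← Finset.mul_sum, PiLp.sub_apply, PiLp.smul_apply,
      WithLp.ofLp_sum, Finset.sum_apply, smul_eq_mul, Finset.sum_const, Finset.card_univ, Fintype.card_fin,
      nsmul_eq_mul]
    field_simp
  rw [e]
  refine mul_pos (by positivity) (Finset.sum_pos' (fun j _ => ell_vert_nonneg) ⟨i + 1 + 1, Finset.mem_univ _, ?_⟩)
  exact exists_vert_ell_pos i

theorem closure_inner : closure K.inner = K.carrier := by
  have := convex_carrier (K := K).closure_interior_eq_closure_of_nonempty_interior inner_nonempty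
  rw [isClosed_carrier.closure_eq] at this
  exact this

theorem mem_frontier_iff : x ∈ frontier K.carrier ↔ x ∈ K.carrier ∧ ∃ i, K.ell i x = 0 := by
  have hi : interior K.carrier = K.inner := rfl
  rw [isClosed_carrier.frontier_eq, hi, Set.mem_sdiff, mem_inner_iff]
  refine and_congr_right fun hx => ?_
  push Not
  refine exists_congr fun i => ?_
  have := mem_carrier_iff.1 hx i
  constructor
  · intro h; linarith
  · intro h; linarith

theorem volume_frontier : volume (frontier K.carrier) = 0 := convex_carrier.addHaar_frontier volume

theorem restrict_inner_eq : volume.restrict K.inner = volume.restrict K.carrier := by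
  refine Measure.restrict_congr_set ?_
  have : ∀ᵐ x ∂(volume : Measure Plane), x ∉ frontier K.carrier := by
    rw [ae_iff]
    simpa using volume_frontier
  filter_upwards [this] with x hx
  refine propext ⟨fun h => inner_subset_carrier h, fun h => ?_⟩
  by_contra hn
  exact hx (by rw [isClosed_carrier.frontier_eq]; exact ⟨h, hn⟩)

/-! ### Edges -/

theorem mem_edge_iff_exists : x ∈ K.edge i ↔ ∃ s ∈ Set.Icc (0:ℝ) 1, K.edgePt i s = x := by
  rw [edge, segment_eq_image_lineMap]; rfl

theorem edgePt_mem_edge (hs : s ∈ Set.Icc (0:ℝ) 1) : K.edgePt i s ∈ K.edge i :=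
  mem_edge_iff_exists.2 ⟨s, hs, rfl⟩

theorem vert_mem_edge : K.vert i ∈ K.edge i := left_mem_segment _ _ _

theorem vert_succ_mem_edge : K.vert (i + 1) ∈ K.edge i := right_mem_segment _ _ _

theorem edge_subset_carrier : K.edge i ⊆ K.carrier :=
  convex_carrier.segment_subset (vert_mem_carrier i) (vert_mem_carrier (i + 1))

theorem ell_edgePt_self : K.ell i (K.edgePt i s) = 0 := by simp [ell_edgePt]

theorem ell_eq_zero_of_mem_edge (h : x ∈ K.edge i) : K.ell i x = 0 := by
  obtain ⟨s, _, rfl⟩ := mem_edge_iff_exists.1 h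
  exact ell_edgePt_self

theorem edge_subset_frontier : K.edge i ⊆ frontier K.carrier := fun _ hx =>
  mem_frontier_iff.2 ⟨edge_subset_carrier hx, i, ell_eq_zero_of_mem_edge hx⟩

theorem ell_edgePt_pos (hk : k ≠ i) (hs : s ∈ Set.Ioo (0:ℝ) 1) : 0 < K.ell k (K.edgePt i s) := by
  rw [ell_edgePt]
  have h1 : 0 < 1 - s := by linarith [hs.2]
  have h2 := hs.1
  have n1 := ell_vert_nonneg (K := K) (i := k) (j := i)
  have n2 := ell_vert_nonneg (K := K) (i := k) (j := i + 1)
  by_cases hik : i = k + 1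
  · have : 0 < K.ell k (K.vert (i + 1)) := by rw [hik]; exact exists_vert_ell_pos k
    nlinarith [mul_pos h2 this, mul_nonneg h1.le n1]
  · have : 0 < K.ell k (K.vert i) := ell_vert_pos hk.symm hik
    nlinarith [mul_pos h1 this, mul_nonneg h2.le n2]

theorem ell_succ_vert_pos (i : Fin (K.extra + 3)) : 0 < K.ell (i + 1) (K.vert i) :=
  ell_vert_pos (succ_ne i).symm (succ_succ_ne i).symm

theorem ell_pred_vert_pos (i : Fin (K.extra + 3)) : 0 < K.ell (i - 1) (K.vert (i + 1)) := by
  have := exists_vert_ell_pos (K := K) (i - 1)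
  rwa [sub_add_cancel] at this

theorem ell_succ_edgePt : K.ell (i + 1) (K.edgePt i s) = (1 - s) * K.ell (i + 1) (K.vert i) := by
  simp [ell_edgePt]

theorem ell_pred_edgePt : K.ell (i - 1) (K.edgePt i s) = s * K.ell (i - 1) (K.vert (i + 1)) := by
  have : K.ell (i - 1) (K.vert i) = 0 := by simpa using ell_vert_succ (K := K) (i := i - 1)
  simp [ell_edgePt, this]

theorem pred_ne (i : Fin (K.extra + 3)) : i - 1 ≠ i := fun h => by
  apply succ_ne (K := K) (i - 1)
  rw [sub_add_cancel]; exact h.symm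

theorem pred_ne_succ (i : Fin (K.extra + 3)) : i - 1 ≠ i + 1 := fun h => by
  apply succ_succ_ne (K := K) (i - 1)
  rw [sub_add_cancel]; exact h.symm

theorem mem_Icc_of_ell_nonneg (h1 : 0 ≤ K.ell (i + 1) (K.edgePt i s)) (h2 : 0 ≤ K.ell (i - 1) (K.edgePt i s)) :
    s ∈ Set.Icc (0:ℝ) 1 := by
  rw [ell_succ_edgePt] at h1
  rw [ell_pred_edgePt] at h2
  exact ⟨nonneg_of_mul_nonneg_left h2 (ell_pred_vert_pos i),
    by linarith [nonneg_of_mul_nonneg_left h1 (ell_succ_vert_pos i)]⟩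

theorem dvec_ne_zero (i : Fin (K.extra + 3)) : K.dvec i ≠ 0 := fun h => by
  have := cross_dvec_pos (K := K) i
  rw [h, cross_zero_right] at this
  exact this.false

theorem exists_edgePt_of_ell_eq_zero (h : K.ell i x = 0) : ∃ s, K.edgePt i s = x := by
  have hκ := cross_dvec_pos (K := K) i
  have e := cross_smul_eq (K.dvec (i - 1)) (K.dvec i) (x - K.vert i)
  have h0 : cross (K.dvec i) (x - K.vert i) = 0 := h
  rw [h0, zero_smul, sub_zero] at e
  refine ⟨cross (K.dvec (i - 1)) (x - K.vert i) / cross (K.dvec (i - 1)) (K.dvec i), ?_⟩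
  rw [edgePt_eq, div_eq_inv_mul, mul_smul, ← e, smul_smul, inv_mul_cancel₀ hκ.ne']
  simp

theorem mem_edge_iff : x ∈ K.edge i ↔ x ∈ K.carrier ∧ K.ell i x = 0 := by
  refine ⟨fun h => ⟨edge_subset_carrier h, ell_eq_zero_of_mem_edge h⟩, fun ⟨h1, h2⟩ => ?_⟩
  obtain ⟨s, rfl⟩ := exists_edgePt_of_ell_eq_zero h2
  exact edgePt_mem_edge (mem_Icc_of_ell_nonneg (mem_carrier_iff.1 h1 _) (mem_carrier_iff.1 h1 _))

theorem mem_frontier_iff_edge : x ∈ frontier K.carrier ↔ ∃ i, x ∈ K.edge i := by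
  rw [mem_frontier_iff]
  constructor
  · rintro ⟨h, i, hi⟩
    exact ⟨i, mem_edge_iff.2 ⟨h, hi⟩⟩
  · rintro ⟨i, hi⟩
    exact ⟨(mem_edge_iff.1 hi).1, i, (mem_edge_iff.1 hi).2⟩

/-- Near a point of the polygon all edges but two consecutive ones stay away. -/
theorem exists_vertex_ell_pos (hx : x ∈ K.carrier) : ∃ i, ∀ k, k ≠ i → k ≠ i - 1 → 0 < K.ell k x := by
  by_cases h : ∃ j, K.ell j x = 0
  · obtain ⟨j, hj⟩ := h
    obtain ⟨s, hs, rfl⟩ := mem_edge_iff_exists.1 (mem_edge_iff.2 ⟨hx, hj⟩)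
    rcases eq_or_lt_of_le hs.1 with h0 | h0
    · refine ⟨j, fun k hk hk' => ?_⟩
      rw [← h0, edgePt_zero]
      exact ell_vert_pos hk.symm (fun h => hk' (by rw [h]; simp))
    rcases eq_or_lt_of_le hs.2 with h1 | h1
    · refine ⟨j + 1, fun k hk hk' => ?_⟩
      rw [h1, edgePt_one]
      exact ell_vert_pos hk.symm (fun h => hk' (by rw [h]; simp))
    · exact ⟨j, fun k hk _ => ell_edgePt_pos hk ⟨h0, h1⟩⟩
  · push Not at h
    exact ⟨0, fun k _ _ => lt_of_le_of_ne (mem_carrier_iff.1 hx k) (h k).symm⟩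

theorem vert_injective : Function.Injective K.vert := by
  intro a b h
  by_contra hab
  by_cases h1 : b = a + 1
  · have := ell_vert_pos (K := K) (i := b) (j := a) hab (by rw [h1]; exact (succ_succ_ne a).symm)
    rw [h] at this
    simp at this
  · have := ell_vert_pos (K := K) (i := a) (j := b) (Ne.symm hab) h1
    rw [← h] at this
    simp at this

theorem edgeLength_pos (i : Fin (K.extra + 3)) : 0 < K.edgeLength i := by
  rw [edgeLength, dist_pos]
  exact fun h => succ_ne i (vert_injective h).symm

theorem edgeLength_eq (i : Fin (K.extra + 3)) : K.edgeLength i = ‖K.dvec i‖ := by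
  rw [edgeLength, dist_comm, dist_eq_norm]; rfl

theorem pderiv_ell_eq (i : Fin (K.extra + 3)) (a : Fin 2) (x : Plane) :
    pderiv a (K.ell i) x = -(K.edgeLength i * K.normal i a) := by
  have := (edgeLength_pos (K := K) i).ne'
  rw [pderiv_ell]
  fin_cases a <;> simp [cross, normal, dvec] <;> field_simp <;> ring

theorem continuous_edgePt (i : Fin (K.extra + 3)) : Continuous (K.edgePt i) :=
  AffineMap.lineMap_continuous

theorem integral_edgeMeasure (i : Fin (K.extra + 3)) {f : Plane → ℝ} (hf : AEStronglyMeasurable f (K.edgeMeasure i)) :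
    ∫ x, f x ∂(K.edgeMeasure i) = K.edgeLength i * ∫ s in Set.Icc (0:ℝ) 1, f (K.edgePt i s) := by
  have hc : Continuous (fun t : ℝ => AffineMap.lineMap (K.vert i) (K.vert (i + 1)) t) := continuous_edgePt i
  have hne : ENNReal.ofReal (K.edgeLength i) ≠ 0 := by simpa using edgeLength_pos i
  unfold edgeMeasure at hf ⊢
  have hf' := hf.mono_ac (Measure.AbsolutelyContinuous.rfl.smul_right hne)
  rw [integral_smul_measure, integral_map hc.aemeasurable hf', ENNReal.toReal_ofReal (edgeLength_pos i).le]
  rfl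

instance (i : Fin (K.extra + 3)) : IsFiniteMeasure (K.edgeMeasure i) := by
  unfold edgeMeasure
  exact Measure.smul_finite _ (by simp)

/-- The endpoints can be discarded. At the remaining points of an edge all the other functions `ell
k` are positive. -/
theorem ae_edgeMeasure_mem (i : Fin (K.extra + 3)) :
    ∀ᵐ x ∂(K.edgeMeasure i), ∃ s ∈ Set.Ioo (0:ℝ) 1, x = K.edgePt i s := by
  have hc : Continuous (fun t : ℝ => AffineMap.lineMap (K.vert i) (K.vert (i + 1)) t) := continuous_edgePt i
  unfold edgeMeasure
  refine Measure.ae_smul_measure ?_ _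
  have hinj : Function.Injective (K.edgePt i) := AffineMap.lineMap_injective _ fun h => succ_ne i (vert_injective h).symm
  have hm : MeasurableSet (K.edgePt i '' Set.Ioo (0:ℝ) 1) :=
    measurableSet_Ioo.image_of_continuousOn_injOn (continuous_edgePt i).continuousOn hinj.injOn
  have hset : {x | ∃ s ∈ Set.Ioo (0:ℝ) 1, x = K.edgePt i s} = K.edgePt i '' Set.Ioo (0:ℝ) 1 := by
    ext x; simp only [Set.mem_ofPred_eq, Set.mem_image, eq_comm]
  rw [ae_map_iff hc.aemeasurable (by rw [hset]; exact hm)]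
  rw [← restrict_Ioo_eq_restrict_Icc]
  filter_upwards [ae_restrict_mem measurableSet_Ioo] with s hs
  exact ⟨s, hs, rfl⟩

theorem ae_edgeMeasure_mem_edge (i : Fin (K.extra + 3)) : ∀ᵐ x ∂(K.edgeMeasure i), x ∈ K.edge i := by
  filter_upwards [ae_edgeMeasure_mem i] with x ⟨s, hs, hx⟩
  rw [hx]
  exact edgePt_mem_edge ⟨hs.1.le, hs.2.le⟩

end ConvexPolygon

end StrainGradientVEM

namespace StrainGradientVEM

/-! ## The divergence theorem on a convex polygon -/

theorem integral_affine_coords (v a b : Plane) (h : cross a b ≠ 0) (F : Plane → ℝ) :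
    ∫ x, F x = |cross a b| * ∫ p : ℝ × ℝ, F (v + p.1 • a + p.2 • b) := by
  set M : Matrix (Fin 2) (Fin 2) ℝ := !![a 0, b 0; a 1, b 1] with hM
  have hdet : M.det = cross a b := by simp [hM, Matrix.det_fin_two, cross]; ring
  have hdet0 : M.det ≠ 0 := by rwa [hdet]
  set e1 : (Fin 2 → ℝ) ≃ᵐ Plane := MeasurableEquiv.toLp 2 (Fin 2 → ℝ) with he1
  have p1 : MeasurePreserving e1 := (EuclideanSpace.volume_preserving_symm_measurableEquiv_toLp (Fin 2)).symm
  have s1 : ∫ x, F x = ∫ y : Fin 2 → ℝ, F (v + e1 y) := by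
    rw [← integral_add_left_eq_self F v, ← p1.integral_comp e1.measurableEmbedding (fun x => F (v + x))]
  have s2 : ∫ y : Fin 2 → ℝ, F (v + e1 y) = |cross a b| * ∫ y : Fin 2 → ℝ, F (v + e1 (Matrix.toLin' M y)) := by
    have hm := Real.map_matrix_volume_pi_eq_smul_volume_pi hdet0
    set L : (Fin 2 → ℝ) ≃ₗ[ℝ] (Fin 2 → ℝ) := LinearMap.GeneralLinearGroup.generalLinearEquiv ℝ _
      (Matrix.GeneralLinearGroup.toLin (Matrix.GeneralLinearGroup.mkOfDetNeZero M hdet0)) with hL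
    have hLe : ∀ y, L y = Matrix.toLin' M y := fun y => rfl
    have hemb : MeasurableEmbedding (Matrix.toLin' M) := by
      have := L.toContinuousLinearEquiv.toHomeomorph.measurableEmbedding
      exact this
    have := hemb.integral_map (μ := volume) (fun y => F (v + e1 y))
    rw [hm, integral_smul_measure, ENNReal.toReal_ofReal (abs_nonneg _), hdet, abs_inv, smul_eq_mul] at this
    rw [← this, ← mul_assoc, mul_inv_cancel₀ (abs_ne_zero.2 h), one_mul]
  rw [s1, s2]
  congr 1
  rw [← (volume_preserving_finTwoArrow ℝ).symm.integral_comp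
    (MeasurableEquiv.finTwoArrow (α := ℝ)).symm.measurableEmbedding]
  refine integral_congr_ae (ae_of_all _ fun p => ?_)
  simp only
  congr 1
  rw [add_assoc]
  congr 1
  ext k
  fin_cases k <;> simp [he1, hM, MeasurableEquiv.finTwoArrow, Matrix.toLin'_apply]

/-- Rotation by a right angle, scaled to have unit cross product with the original vector. -/
noncomputable def conormal (d : Plane) : Plane := (‖d‖ ^ 2)⁻¹ • !₂[-d 1, d 0]

theorem cross_conormal {d : Plane} (hd : d ≠ 0) : cross d (conormal d) = 1 := by
  have h : ‖d‖ ^ 2 = d 0 ^ 2 + d 1 ^ 2 := by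
    rw [EuclideanSpace.norm_sq_eq]; simp [Fin.sum_univ_two]
  have h0 : ‖d‖ ^ 2 ≠ 0 := by simpa using hd
  rw [conormal, cross_smul_right]
  simp only [cross]
  simp
  rw [show d 0 * d 0 + d 1 * d 1 = ‖d‖ ^ 2 by rw [h]; ring]
  exact inv_mul_cancel₀ h0

local notation "Θ" => Real.smoothTransition

theorem contDiff_smoothTransition : ContDiff ℝ ∞ Θ := Real.smoothTransition.contDiff

theorem continuous_deriv_smoothTransition : Continuous (deriv Θ) :=
  contDiff_smoothTransition.continuous_deriv (by simp)

theorem deriv_smoothTransition_eq_zero {s : ℝ} (hs : s ∉ Set.Icc (0:ℝ) 1) : deriv Θ s = 0 := by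
  rw [Set.mem_Icc, not_and_or, not_le, not_le] at hs
  rcases hs with h | h
  · have : Θ =ᶠ[𝓝 s] fun _ => 0 := by
      filter_upwards [gt_mem_nhds h] with y hy
      exact Real.smoothTransition.zero_of_nonpos hy.le
    rw [this.deriv_eq]; simp
  · have : Θ =ᶠ[𝓝 s] fun _ => 1 := by
      filter_upwards [lt_mem_nhds h] with y hy
      exact Real.smoothTransition.one_of_one_le hy.le
    rw [this.deriv_eq]; simp

theorem hasCompactSupport_deriv_smoothTransition : HasCompactSupport (deriv Θ) :=
  HasCompactSupport.intro isCompact_Icc fun _ hs => deriv_smoothTransition_eq_zero hs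

theorem integral_deriv_smoothTransition : ∫ s, deriv Θ s = 1 := by
  have := integral_of_hasDerivAt_of_tendsto (f := Θ) (f' := deriv Θ) (m := 0) (n := 1)
    (fun x => (contDiff_smoothTransition.differentiable (by simp) x).hasDerivAt)
    (continuous_deriv_smoothTransition.integrable_of_hasCompactSupport
      hasCompactSupport_deriv_smoothTransition) ?_ ?_
  · simpa using this
  · refine tendsto_const_nhds.congr' ?_
    filter_upwards [eventually_le_atBot 0] with s hs
    exact (Real.smoothTransition.zero_of_nonpos hs).symm
  · refine tendsto_const_nhds.congr' ?_
    filter_upwards [eventually_ge_atTop 1] with s hs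
    exact (Real.smoothTransition.one_of_one_le hs).symm

namespace ConvexPolygon
variable {K : ConvexPolygon}

/-- In coordinates along the edge and, scaled by `ε`, across it, the profile `Θ'(σ)` no longer
depends on `ε`. Every other factor `Θ (ell k / ε)` tends to one or zero according to the sign of
`ell k` at the foot point, and together they tend to the indicator of the edge. The end points `s =
0, 1` are excluded because there a second `ell k` vanishes. -/
theorem integrand_tendsto {f : Plane → ℝ} (hf : Continuous f) (i : Fin (K.extra + 3)) (w : Plane) {ε : ℕ → ℝ}
    (hε : ∀ m, 0 < ε m) (hε0 : Tendsto ε atTop (𝓝 0)) {s σ : ℝ} (h0 : s ≠ 0) (h1 : s ≠ 1) :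
    Tendsto (fun m => f (K.edgePt i s + (ε m * σ) • w) * (deriv Θ σ *
      ∏ k ∈ Finset.univ.erase i, Θ (K.ell k (K.edgePt i s + (ε m * σ) • w) / ε m))) atTop
      (𝓝 ((Set.Icc (0:ℝ) 1).indicator (fun s => f (K.edgePt i s)) s * deriv Θ σ)) := by
  have hx : Tendsto (fun m => K.edgePt i s + (ε m * σ) • w) atTop (𝓝 (K.edgePt i s)) := by
    have := ((hε0.mul_const σ).smul_const w).const_add (K.edgePt i s)
    simpa using this
  have hfx := (hf.tendsto (K.edgePt i s)).comp hx
  have hex : ∀ k, Tendsto (fun m => K.ell k (K.edgePt i s + (ε m * σ) • w)) atTop (𝓝 (K.ell k (K.edgePt i s))) :=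
    fun k => ((continuous_ell k).tendsto _).comp hx
  have hpos : ∀ k, 0 < K.ell k (K.edgePt i s) →
      ∀ᶠ m in atTop, Θ (K.ell k (K.edgePt i s + (ε m * σ) • w) / ε m) = 1 := by
    intro k hk
    filter_upwards [(hex k).eventually (lt_mem_nhds (half_lt_self hk)),
      hε0.eventually_lt_const (half_pos hk)] with m hm1 hm2
    refine Real.smoothTransition.one_of_one_le ?_
    rw [le_div_iff₀ (hε m)]
    linarith
  have hneg : ∀ k, K.ell k (K.edgePt i s) < 0 →
      ∀ᶠ m in atTop, Θ (K.ell k (K.edgePt i s + (ε m * σ) • w) / ε m) = 0 := by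
    intro k hk
    filter_upwards [(hex k).eventually (gt_mem_nhds hk)] with m hm1
    exact Real.smoothTransition.zero_of_nonpos (div_nonpos_of_nonpos_of_nonneg hm1.le (hε m).le)
  by_cases hs : s ∈ Set.Icc (0:ℝ) 1
  · have hs' : s ∈ Set.Ioo (0:ℝ) 1 := ⟨lt_of_le_of_ne hs.1 h0.symm, lt_of_le_of_ne hs.2 h1⟩
    rw [Set.indicator_of_mem hs]
    have hall : ∀ᶠ m in atTop, ∏ k ∈ Finset.univ.erase i,
        Θ (K.ell k (K.edgePt i s + (ε m * σ) • w) / ε m) = 1 := by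
      have : ∀ᶠ m in atTop, ∀ k ∈ Finset.univ.erase i,
          Θ (K.ell k (K.edgePt i s + (ε m * σ) • w) / ε m) = 1 := by
        rw [Filter.eventually_all_finset]
        exact fun k hk => hpos k (ell_edgePt_pos (Finset.ne_of_mem_erase hk) hs')
      filter_upwards [this] with m hm
      exact Finset.prod_eq_one hm
    refine (hfx.mul_const (deriv Θ σ)).congr' ?_
    filter_upwards [hall] with m hm
    rw [hm, mul_one]; rfl
  · rw [Set.indicator_of_notMem hs, zero_mul]
    have : ∃ k ∈ Finset.univ.erase i, K.ell k (K.edgePt i s) < 0 := by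
      by_contra hn
      push Not at hn
      exact hs (mem_Icc_of_ell_nonneg (hn _ (by simp)) (hn _ (by
        rw [Finset.mem_erase]; exact ⟨pred_ne i, Finset.mem_univ _⟩)))
    obtain ⟨k, hk, hk'⟩ := this
    refine tendsto_const_nhds.congr' ?_
    filter_upwards [hneg k hk'] with m hm
    rw [Finset.prod_eq_zero hk hm]; simp

theorem tendsto_integral_edge_layer {f : Plane → ℝ} (hf : Continuous f) (i : Fin (K.extra + 3)) {ε : ℕ → ℝ}
    (hε : ∀ m, 0 < ε m) (hε1 : ∀ m, ε m ≤ 1) (hε0 : Tendsto ε atTop (𝓝 0)) :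
    Tendsto (fun m => ∫ x, f x * ((ε m)⁻¹ * deriv Θ (K.ell i x / ε m) *
      ∏ k ∈ Finset.univ.erase i, Θ (K.ell k x / ε m))) atTop
      (𝓝 (∫ s in Set.Icc (0:ℝ) 1, f (K.edgePt i s))) := by
  set w := conormal (K.dvec i) with hw
  have hcw : cross (K.dvec i) w = 1 := cross_conormal (dvec_ne_zero i)
  set H : ℕ → ℝ × ℝ → ℝ := fun m p => f (K.edgePt i p.1 + (ε m * p.2) • w) * (deriv Θ p.2 *
      ∏ k ∈ Finset.univ.erase i, Θ (K.ell k (K.edgePt i p.1 + (ε m * p.2) • w) / ε m)) with hH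
  have hell : ∀ m s σ, K.ell i (K.edgePt i s + (ε m * σ) • w) = ε m * σ := by
    intro m s σ
    have := ell_sub (K := K) (i := i) (x := K.edgePt i s + (ε m * σ) • w) (y := K.edgePt i s)
    rw [ell_edgePt_self, sub_zero, add_sub_cancel_left, cross_smul_right, hcw, mul_one] at this
    exact this
  have e1 : ∀ m, ∫ x, f x * ((ε m)⁻¹ * deriv Θ (K.ell i x / ε m) *
      ∏ k ∈ Finset.univ.erase i, Θ (K.ell k x / ε m)) = ∫ p, H m p := by
    intro m
    -- The Jacobian `ε m` of these coordinates cancels the factor `(ε m)⁻¹` of the layer.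
    have hc : cross (K.dvec i) (ε m • w) = ε m := by rw [cross_smul_right, hcw, mul_one]
    rw [integral_affine_coords (K.vert i) (K.dvec i) (ε m • w) (by rw [hc]; exact (hε m).ne'), hc,
      abs_of_pos (hε m), ← integral_const_mul]
    refine integral_congr_ae (ae_of_all _ fun p => ?_)
    have hp : K.vert i + p.1 • K.dvec i + p.2 • ε m • w = K.edgePt i p.1 + (ε m * p.2) • w := by
      rw [edgePt_eq, smul_smul, mul_comm]
    simp only [hp, hell, hH]
    have := (hε m).ne'
    rw [mul_div_cancel_left₀ _ this]
    field_simp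
  simp only [e1]
  have hlim : ∫ s in Set.Icc (0:ℝ) 1, f (K.edgePt i s) = ∫ p : ℝ × ℝ,
      (Set.Icc (0:ℝ) 1).indicator (fun s => f (K.edgePt i s)) p.1 * deriv Θ p.2 := by
    rw [Measure.volume_eq_prod, integral_prod_mul (fun s => (Set.Icc (0:ℝ) 1).indicator (fun s => f (K.edgePt i s)) s) (deriv Θ),
      integral_deriv_smoothTransition, mul_one, integral_indicator measurableSet_Icc]
  rw [hlim]
  obtain ⟨C, hC⟩ := (isCompact_carrier (K := K)).exists_bound_of_continuousOn hf.continuousOn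
  obtain ⟨D, hD⟩ := hasCompactSupport_deriv_smoothTransition.exists_bound_of_continuous continuous_deriv_smoothTransition
  obtain ⟨R, hR⟩ := (isCompact_carrier (K := K)).isBounded.exists_norm_le
  -- Where the integrand does not vanish all `ell k` are nonnegative, so the point lies in the
  -- compact polygon. With `ε ≤ 1` its parameter along the edge is then at most `R'`, which gives
  -- one bounded box as domain of the dominating function.
  set R' := (R + ‖K.vert i‖ + ‖w‖) / ‖K.dvec i‖ with hR'
  have hd : 0 < ‖K.dvec i‖ := norm_pos_iff.2 (dvec_ne_zero i)
  refine tendsto_integral_of_dominated_convergence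
    (fun p => (Set.Icc (-R') R' ×ˢ Set.Icc (0:ℝ) 1).indicator (fun _ => C * D) p) (fun m => ?_) ?_ (fun m => ?_) ?_
  · have c1 : Continuous (fun p : ℝ × ℝ => K.edgePt i p.1 + (ε m * p.2) • w) :=
      ((continuous_edgePt i).comp continuous_fst).add (by fun_prop)
    refine Continuous.aestronglyMeasurable ((hf.comp c1).mul ((continuous_deriv_smoothTransition.comp continuous_snd).mul
      (continuous_finsetProd _ fun k _ => Real.smoothTransition.continuous.comp (((continuous_ell k).comp c1).div_const _))))
  · refine (integrable_indicator_iff (measurableSet_Icc.prod measurableSet_Icc)).2 ?_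
    exact integrableOn_const (isCompact_Icc.prod isCompact_Icc).measure_lt_top.ne
  · refine ae_of_all _ fun p => ?_
    have C0 : 0 ≤ C := (norm_nonneg _).trans (hC _ (vert_mem_carrier i))
    have D0 : 0 ≤ D := (norm_nonneg _).trans (hD 0)
    by_cases hz : H m p = 0
    · rw [hz, norm_zero]
      exact Set.indicator_nonneg (fun _ _ => mul_nonneg C0 D0) p
    have hz1 : deriv Θ p.2 ≠ 0 := fun h => hz (by simp [hH, h])
    have hz2 : ∏ k ∈ Finset.univ.erase i, Θ (K.ell k (K.edgePt i p.1 + (ε m * p.2) • w) / ε m) ≠ 0 :=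
      fun h => hz (by simp [hH, h])
    have hp2 : p.2 ∈ Set.Icc (0:ℝ) 1 := by
      by_contra h
      exact hz1 (deriv_smoothTransition_eq_zero h)
    have hmem : K.edgePt i p.1 + (ε m * p.2) • w ∈ K.carrier := by
      rw [mem_carrier_iff]
      intro k
      by_cases hk : k = i
      · rw [hk, hell]; exact mul_nonneg (hε m).le hp2.1
      · have := Finset.prod_ne_zero_iff.1 hz2 k (by simp [hk])
        by_contra hn
        exact this (Real.smoothTransition.zero_of_nonpos
          (div_nonpos_of_nonpos_of_nonneg (not_le.1 hn).le (hε m).le))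
    have hp1 : p.1 ∈ Set.Icc (-R') R' := by
      rw [Set.mem_Icc, ← abs_le, hR', le_div_iff₀ hd, ← Real.norm_eq_abs, ← norm_smul]
      have h1 := hR _ hmem
      have e : p.1 • K.dvec i = (K.edgePt i p.1 + (ε m * p.2) • w) - K.vert i - (ε m * p.2) • w := by
        rw [edgePt_eq]; abel
      rw [e]
      refine (norm_sub_le _ _).trans (add_le_add ((norm_sub_le _ _).trans (add_le_add h1 le_rfl)) ?_)
      rw [norm_smul, Real.norm_of_nonneg (mul_nonneg (hε m).le hp2.1)]
      have : ε m * p.2 ≤ 1 := mul_le_one₀ (hε1 m) hp2.1 hp2.2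
      exact mul_le_of_le_one_left (norm_nonneg _) this
    rw [Set.indicator_of_mem (Set.mk_mem_prod hp1 hp2 : p ∈ Set.Icc (-R') R' ×ˢ Set.Icc (0:ℝ) 1), hH]
    simp only [norm_mul]
    refine mul_le_mul (hC _ hmem) ?_ (by positivity) C0
    have hprod : ‖∏ k ∈ Finset.univ.erase i, Θ (K.ell k (K.edgePt i p.1 + (ε m * p.2) • w) / ε m)‖ ≤ 1 := by
      rw [norm_prod]
      refine Finset.prod_le_one (fun _ _ => norm_nonneg _) fun k _ => ?_
      rw [Real.norm_of_nonneg (Real.smoothTransition.nonneg _)]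
      exact Real.smoothTransition.le_one _
    calc _ ≤ D * 1 := mul_le_mul (hD _) hprod (norm_nonneg _) D0
      _ = D := mul_one D
  · have a0 : ∀ᵐ p : ℝ × ℝ, p.1 ≠ 0 :=
      Measure.quasiMeasurePreserving_fst.ae (p := fun s : ℝ => s ≠ 0) (Measure.ae_ne volume 0)
    have a1 : ∀ᵐ p : ℝ × ℝ, p.1 ≠ 1 :=
      Measure.quasiMeasurePreserving_fst.ae (p := fun s : ℝ => s ≠ 1) (Measure.ae_ne volume 1)
    filter_upwards [a0, a1] with p h0 h1
    exact integrand_tendsto hf i w hε hε0 h0 h1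

theorem contDiff_ell_layer (i : Fin (K.extra + 3)) (ε : ℝ) : ContDiff ℝ ∞ (fun x => Θ (K.ell i x / ε)) :=
  contDiff_smoothTransition.comp ((contDiff_ell i).div_const ε)

theorem pderiv_ell_layer (ε : ℝ) (a : Fin 2) (x : Plane) :
    pderiv a (fun x => ∏ k, Θ (K.ell k x / ε)) x = ∑ i, -(K.edgeLength i * K.normal i a) *
      (ε⁻¹ * deriv Θ (K.ell i x / ε) * ∏ k ∈ Finset.univ.erase i, Θ (K.ell k x / ε)) := by
  have h : ∀ k ∈ (Finset.univ : Finset (Fin (K.extra + 3))), HasFDerivAt (fun x => Θ (K.ell k x / ε))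
      (fderiv ℝ (fun x => Θ (K.ell k x / ε)) x) x :=
    fun k _ => ((contDiff_ell_layer k ε).differentiable (by simp) x).hasFDerivAt
  unfold pderiv
  rw [(HasFDerivAt.finsetProd h).fderiv, sum_apply]
  refine Finset.sum_congr rfl fun k _ => ?_
  have h1 : HasFDerivAt (fun x => Θ (K.ell k x / ε)) (deriv Θ (K.ell k x / ε) • (ε⁻¹ • fderiv ℝ (K.ell k) x)) x := by
    have hin : HasFDerivAt (fun x => K.ell k x / ε) (ε⁻¹ • fderiv ℝ (K.ell k) x) x := by
      simpa [div_eq_inv_mul] using (((contDiff_ell k).differentiable (by simp) x).hasFDerivAt).const_mul ε⁻¹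
    exact ((contDiff_smoothTransition.differentiable (by simp) _).hasDerivAt).comp_hasFDerivAt x hin
  have h2 := pderiv_ell_eq (K := K) k a x
  unfold pderiv at h2
  rw [h1.fderiv]
  simp only [smul_apply, smul_eq_mul, h2]
  ring

/-- The divergence theorem. -/
theorem integral_pderiv {f : Plane → ℝ} (hf : ContDiff ℝ ∞ f) (a : Fin 2) :
    ∫ x in K.inner, pderiv a f x = ∑ i, K.normal i a * ∫ x, f x ∂(K.edgeMeasure i) := by
  set ε : ℕ → ℝ := fun m => 1 / ((m:ℝ) + 1) with hε'
  have hε : ∀ m, 0 < ε m := fun m => by positivity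
  have hε1 : ∀ m, ε m ≤ 1 := fun m => by
    rw [hε', div_le_one (by positivity)]; linarith [(Nat.cast_nonneg m : (0:ℝ) ≤ m)]
  have hε0 : Tendsto ε atTop (𝓝 0) := tendsto_one_div_add_atTop_nhds_zero_nat
  -- Smooth functions with support in the polygon that increase to its indicator. Integration by
  -- parts against them is legitimate in the whole plane, and their gradients concentrate in one
  -- layer at each edge.
  set g : ℕ → Plane → ℝ := fun m x => ∏ k, Θ (K.ell k x / ε m) with hg
  have gd : ∀ m, ContDiff ℝ ∞ (g m) := fun m => contDiff_prod fun k _ => contDiff_ell_layer k (ε m)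
  have g0 : ∀ m x, x ∉ K.inner → g m x = 0 := by
    intro m x hx
    rw [mem_inner_iff] at hx
    push Not at hx
    obtain ⟨k, hk⟩ := hx
    exact Finset.prod_eq_zero (Finset.mem_univ k) (Real.smoothTransition.zero_of_nonpos
      (div_nonpos_of_nonpos_of_nonneg hk (hε m).le))
  have gc : ∀ m, HasCompactSupport (g m) := fun m =>
    HasCompactSupport.intro isCompact_carrier fun x hx => g0 m x fun h => hx (inner_subset_carrier h)
  have gle : ∀ m x, ‖g m x‖ ≤ 1 := by
    intro m x
    rw [hg, norm_prod]
    refine Finset.prod_le_one (fun _ _ => norm_nonneg _) fun k _ => ?_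
    rw [Real.norm_of_nonneg (Real.smoothTransition.nonneg _)]
    exact Real.smoothTransition.le_one _
  have ibp : ∀ m, ∫ x, f x * pderiv a (g m) x = -∫ x, pderiv a f x * g m x :=
    fun m => integral_mul_pderiv_eq_neg hf (gd m) (gc m) a
  have fc := (pderiv_contDiff hf a).continuous
  have l1 : Tendsto (fun m => ∫ x, pderiv a f x * g m x) atTop (𝓝 (∫ x in K.inner, pderiv a f x)) := by
    rw [← integral_indicator isOpen_inner.measurableSet]
    refine tendsto_integral_of_dominated_convergence (K.inner.indicator fun x => ‖pderiv a f x‖)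
      (fun m => (fc.mul (gd m).continuous).aestronglyMeasurable) ?_ (fun m => ae_of_all _ fun x => ?_)
      (ae_of_all _ fun x => ?_)
    · refine (integrable_indicator_iff isOpen_inner.measurableSet).2 ?_
      exact (fc.norm.continuousOn.integrableOn_compact isCompact_carrier).mono_set inner_subset_carrier
    · by_cases hx : x ∈ K.inner
      · rw [Set.indicator_of_mem hx, norm_mul]
        exact mul_le_of_le_one_right (norm_nonneg _) (gle m x)
      · simp [g0 m x hx, hx]
    · by_cases hx : x ∈ K.inner
      · rw [Set.indicator_of_mem hx]
        have : ∀ᶠ m in atTop, g m x = 1 := by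
          have : ∀ᶠ m in atTop, ∀ k ∈ Finset.univ, Θ (K.ell k x / ε m) = 1 := by
            rw [Filter.eventually_all_finset]
            intro k _
            have hk := mem_inner_iff.1 hx k
            filter_upwards [hε0.eventually_lt_const hk] with m hm
            exact Real.smoothTransition.one_of_one_le ((one_le_div (hε m)).2 hm.le)
          filter_upwards [this] with m hm
          exact Finset.prod_eq_one hm
        refine tendsto_const_nhds.congr' ?_
        filter_upwards [this] with m hm
        rw [hm, mul_one]
      · simp [g0 _ x hx, hx]
  have l2 : Tendsto (fun m => ∫ x, f x * pderiv a (g m) x) atTop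
      (𝓝 (∑ i, -(K.edgeLength i * K.normal i a) * ∫ s in Set.Icc (0:ℝ) 1, f (K.edgePt i s))) := by
    have hint : ∀ m i, Integrable (fun x => f x * ((ε m)⁻¹ * deriv Θ (K.ell i x / ε m) *
      ∏ k ∈ Finset.univ.erase i, Θ (K.ell k x / ε m))) := by
      intro m i
      refine Continuous.integrable_of_hasCompactSupport ?_ ?_
      · exact hf.continuous.mul ((continuous_const.mul (continuous_deriv_smoothTransition.comp
          ((continuous_ell i).div_const _))).mul (continuous_finsetProd _ fun k _ => (contDiff_ell_layer k _).continuous))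
      · refine HasCompactSupport.intro (isCompact_carrier (K := K)) fun x hx => ?_
        rw [mem_carrier_iff] at hx
        push Not at hx
        obtain ⟨k, hk⟩ := hx
        have hk' : K.ell k x / ε m < 0 := div_neg_of_neg_of_pos hk (hε m)
        by_cases hki : k = i
        · rw [deriv_smoothTransition_eq_zero (s := K.ell i x / ε m) (fun h => by
            rw [← hki] at h; linarith [h.1])]
          simp
        · rw [Finset.prod_eq_zero (i := k) (by simp [hki]) (Real.smoothTransition.zero_of_nonpos hk'.le)]
          simp
    have e : ∀ m, ∫ x, f x * pderiv a (g m) x = ∑ i, -(K.edgeLength i * K.normal i a) *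
        ∫ x, f x * ((ε m)⁻¹ * deriv Θ (K.ell i x / ε m) * ∏ k ∈ Finset.univ.erase i, Θ (K.ell k x / ε m)) := by
      intro m
      simp only [← integral_const_mul]
      rw [← integral_finsetSum _ fun i _ => (hint m i).const_mul _]
      refine integral_congr_ae (ae_of_all _ fun x => ?_)
      simp only [hg]
      rw [pderiv_ell_layer, Finset.mul_sum]
      refine Finset.sum_congr rfl fun i _ => ?_
      ring
    simp only [e]
    exact tendsto_finsetSum _ fun i _ => (tendsto_integral_edge_layer hf.continuous i hε hε1 hε0).const_mul _
  have l3 := tendsto_nhds_unique (l2.congr ibp) l1.neg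
  rw [← neg_eq_iff_eq_neg] at l3
  rw [← l3, ← Finset.sum_neg_distrib]
  refine Finset.sum_congr rfl fun i _ => ?_
  rw [integral_edgeMeasure i hf.continuous.aestronglyMeasurable]
  ring

end ConvexPolygon
end StrainGradientVEM

namespace StrainGradientVEM

/-! ## The embedding of `H²` in the continuous functions -/

/-- The `L²(μ)` norm as a real number. -/
noncomputable def l2n (μ : Measure Plane) (f : Plane → ℝ) : ℝ := (eLpNorm f 2 μ).toReal

theorem l2n_nonneg (μ : Measure Plane) (f : Plane → ℝ) : 0 ≤ l2n μ f := ENNReal.toReal_nonneg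

section l2n
variable {μ : Measure Plane} {f g : Plane → ℝ}

theorem l2n_congr (h : f =ᵐ[μ] g) : l2n μ f = l2n μ g := by
  rw [l2n, l2n, eLpNorm_congr_ae h]

theorem l2n_add_le (hf : MemLp f 2 μ) (hg : MemLp g 2 μ) : l2n μ (f + g) ≤ l2n μ f + l2n μ g := by
  rw [l2n, l2n, l2n, ← ENNReal.toReal_add hf.2.ne hg.2.ne]
  exact ENNReal.toReal_mono (ENNReal.add_ne_top.2 ⟨hf.2.ne, hg.2.ne⟩) (eLpNorm_add_le hf.1 hg.1 (by norm_num))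

theorem l2n_sub_le (hf : MemLp f 2 μ) (hg : MemLp g 2 μ) : l2n μ (f - g) ≤ l2n μ f + l2n μ g := by
  have := l2n_add_le hf hg.neg
  rwa [← sub_eq_add_neg, l2n, l2n, l2n, eLpNorm_neg] at this

theorem l2n_sq (hf : MemLp f 2 μ) : l2n μ f ^ 2 = ∫ x, f x ^ 2 ∂μ := toReal_eLpNorm_sq hf

theorem l2n_eq_sqrt (hf : MemLp f 2 μ) : l2n μ f = √(∫ x, f x ^ 2 ∂μ) := by
  rw [← l2n_sq hf, Real.sqrt_sq (l2n_nonneg _ _)]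

theorem l2n_const_smul (c : ℝ) : l2n μ (c • f) = |c| * l2n μ f := by
  rw [l2n, l2n, eLpNorm_const_smul, ENNReal.toReal_mul]; simp

theorem abs_integral_mul_le (hf : MemLp f 2 μ) (hg : MemLp g 2 μ) :
    |∫ x, f x * g x ∂μ| ≤ l2n μ f * l2n μ g := abs_integral_mul_le_eLpNorm hf hg

theorem l2n_eq_zero_iff (hf : MemLp f 2 μ) : l2n μ f = 0 ↔ f =ᵐ[μ] 0 := by
  rw [l2n, ENNReal.toReal_eq_zero_iff, or_iff_left hf.2.ne, eLpNorm_eq_zero_iff hf.1 (by norm_num)]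

theorem L2Lim.tendsto_l2n {φ : ℕ → Plane → ℝ} (h : L2Lim μ φ f) :
    Tendsto (fun m => l2n μ (φ m - f)) atTop (𝓝 0) := h.toReal

theorem l2Lim_of_tendsto {φ : ℕ → Plane → ℝ} (hφ : ∀ m, MemLp (φ m) 2 μ) (hf : MemLp f 2 μ)
    (h : Tendsto (fun m => l2n μ (φ m - f)) atTop (𝓝 0)) : L2Lim μ φ f := by
  have := ENNReal.tendsto_ofReal h
  rw [ENNReal.ofReal_zero] at this
  refine this.congr fun m => ?_
  rw [l2n, ENNReal.ofReal_toReal ((hφ m).sub hf).2.ne]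

theorem L2Lim.eventually_l2n_sub_lt {φ : ℕ → Plane → ℝ} (h : L2Lim μ φ f) (hφ : ∀ m, MemLp (φ m) 2 μ)
    (hf : MemLp f 2 μ) {ε : ℝ} (hε : 0 < ε) :
    ∃ N, ∀ m ≥ N, ∀ n ≥ N, l2n μ (φ m - φ n) < ε := by
  obtain ⟨N, hN⟩ := eventually_atTop.1 (h.tendsto_l2n.eventually_lt_const (half_pos hε))
  refine ⟨N, fun m hm n hn => ?_⟩
  have e : φ m - φ n = (φ m - f) - (φ n - f) := by abel
  rw [e]
  have := l2n_sub_le ((hφ m).sub hf) ((hφ n).sub hf)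
  linarith [hN m hm, hN n hn]

theorem exists_l2Lim_of_cauchy {φ : ℕ → Plane → ℝ} (hφ : ∀ m, MemLp (φ m) 2 μ)
    (h : ∀ ε > 0, ∃ N, ∀ m ≥ N, ∀ n ≥ N, l2n μ (φ m - φ n) < ε) :
    ∃ T, MemLp T 2 μ ∧ L2Lim μ φ T := by
  have hc : CauchySeq (fun m => (hφ m).toLp (φ m)) := by
    refine Metric.cauchySeq_iff.2 fun ε hε => ?_
    obtain ⟨N, hN⟩ := h ε hε
    refine ⟨N, fun m hm n hn => ?_⟩
    rw [dist_eq_norm, ← MemLp.toLp_sub, Lp.norm_toLp]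
    exact hN m hm n hn
  obtain ⟨T, hT⟩ := cauchySeq_tendsto_of_complete hc
  refine ⟨T, Lp.memLp T, ?_⟩
  have := (Lp.tendsto_Lp_iff_tendsto_eLpNorm' _ _).1 hT
  refine this.congr fun m => ?_
  exact eLpNorm_congr_ae ((hφ m).coeFn_toLp.sub (ae_eq_refl _))

end l2n

/-! ### Averaged Taylor expansion and the supremum bound -/

theorem hasDerivAt_comp_line {φ : Plane → ℝ} (hφ : ContDiff ℝ ∞ φ) (x v : Plane) (s : ℝ) :
    HasDerivAt (fun s : ℝ => φ (x + s • v)) (∑ i, v i * pderiv i φ (x + s • v)) s := by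
  have h1 : HasDerivAt (fun s : ℝ => x + s • v) v s := by
    simpa using ((hasDerivAt_id s).smul_const v).const_add x
  have := ((hφ.differentiable (by simp) (x + s • v)).hasFDerivAt).comp_hasDerivAt s h1
  rwa [fderiv_eq_sum_pderiv] at this

/-- The expansion is about the far end `x + v` and evaluated at `x`. The resulting weight `s` in the
remainder compensates the loss `s⁻¹` of `integral_ball_homothety_le`. -/
theorem taylor_backward {φ : Plane → ℝ} (hφ : ContDiff ℝ ∞ φ) (x v : Plane) :
    φ x = φ (x + v) - ∑ i, v i * pderiv i φ (x + v) +
      ∫ s in (0:ℝ)..1, s * ∑ i, ∑ j, v i * v j * pderiv j (pderiv i φ) (x + s • v) := by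
  have h1 := hasDerivAt_comp_line hφ x v
  have h2 : ∀ s : ℝ, HasDerivAt (fun s : ℝ => ∑ i, v i * pderiv i φ (x + s • v))
      (∑ i, ∑ j, v i * v j * pderiv j (pderiv i φ) (x + s • v)) s := by
    intro s
    have := ((hasDerivAt_comp_line (pderiv_contDiff hφ 0) x v s).const_mul (v 0)).add
      ((hasDerivAt_comp_line (pderiv_contDiff hφ 1) x v s).const_mul (v 1))
    have e : (fun s : ℝ => ∑ i, v i * pderiv i φ (x + s • v)) =
        (fun y => v 0 * pderiv 0 φ (x + y • v)) + fun y => v 1 * pderiv 1 φ (x + y • v) := by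
      funext s; exact Fin.sum_univ_two _
    rw [e]
    refine this.congr_deriv ?_
    simp only [Fin.sum_univ_two]; ring
  have cl : Continuous fun s : ℝ => x + s • v := by fun_prop
  have c1 : Continuous (fun s : ℝ => ∑ i, v i * pderiv i φ (x + s • v)) :=
    continuous_finsetSum _ fun i _ => continuous_const.mul ((pderiv_contDiff hφ i).continuous.comp cl)
  have c2 : Continuous (fun s : ℝ => ∑ i, ∑ j, v i * v j * pderiv j (pderiv i φ) (x + s • v)) :=
    continuous_finsetSum _ fun i _ => continuous_finsetSum _ fun j _ =>
      continuous_const.mul ((pderiv_contDiff (pderiv_contDiff hφ i) j).continuous.comp cl)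
  have i1 := intervalIntegral.integral_mul_deriv_eq_deriv_mul (a := 0) (b := 1) (u := fun s : ℝ => s) (u' := fun _ => 1)
    (fun s _ => hasDerivAt_id s) (fun s _ => h2 s) (by simp) (c2.intervalIntegrable _ _)
  have i2 := intervalIntegral.integral_eq_sub_of_hasDerivAt (a := 0) (b := 1) (fun s _ => h1 s) (c1.intervalIntegrable _ _)
  simp only [one_mul, i2, one_smul, zero_smul, add_zero, zero_mul, sub_zero] at i1
  rw [i1]
  ring

/-- By convexity the homothety with centre `x` maps the ball into `U`, even when `x` is only in the
closure. Its Jacobian is `s²`, so the `L²` norm grows by `s⁻¹`. -/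
theorem integral_ball_homothety_le {U : Set Plane} (hU : IsOpen U) (hUc : Convex ℝ U) (hUb : Bornology.IsBounded U) {c : Plane} {r : ℝ}
    (hr : Metric.closedBall c r ⊆ U) {x : Plane} (hx : x ∈ closure U) {s : ℝ} (hs : 0 < s) (hs1 : s ≤ 1)
    {ψ : Plane → ℝ} (hψ : Continuous ψ) :
    ∫ z in Metric.closedBall c r, |ψ (x + s • (z - x))| ≤
      l2n (volume.restrict (Metric.closedBall c r)) (fun _ => 1) * s⁻¹ * l2n (volume.restrict U) ψ := by
  set B := Metric.closedBall c r
  set A : Plane → Plane := fun z => x + s • (z - x) with hA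
  have hAc : Continuous A := by fun_prop
  have hmap : Measure.map A (volume.restrict B) ≤ ENNReal.ofReal ((s ^ 2)⁻¹) • volume.restrict U := by
    have h1 : A = (fun y => (x - s • x) + y) ∘ (fun z => s • z) := by
      ext1 z; simp only [hA, Function.comp]; module
    have h2 : Measure.map A volume = ENNReal.ofReal ((s ^ 2)⁻¹) • volume := by
      rw [h1, ← Measure.map_map (by fun_prop) (by fun_prop), Measure.map_addHaar_smul _ hs.ne',
        Measure.map_smul, (measurePreserving_add_left volume (x - s • x)).map_eq, finrank_euclideanSpace,
        Fintype.card_fin, abs_of_pos (by positivity)]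
    have h3 : B ⊆ A ⁻¹' U := by
      intro z hz
      have hzi : z ∈ interior U := by rw [hU.interior_eq]; exact hr hz
      have := hUc.add_smul_sub_mem_interior' hx hzi ⟨hs, hs1⟩
      rwa [hU.interior_eq] at this
    calc Measure.map A (volume.restrict B) ≤ Measure.map A (volume.restrict (A ⁻¹' U)) :=
          Measure.map_mono (Measure.restrict_mono h3 le_rfl) hAc.measurable
      _ = (Measure.map A volume).restrict U := (Measure.restrict_map hAc.measurable hU.measurableSet).symm
      _ = _ := by rw [h2, Measure.restrict_smul]
  have hBb : Bornology.IsBounded B := Metric.isBounded_closedBall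
  have m1 : MemLp (fun z => |ψ (A z)|) 2 (volume.restrict B) :=
    memLp_of_continuous hBb (hψ.comp hAc).abs
  have m2 : MemLp (fun _ : Plane => (1:ℝ)) 2 (volume.restrict B) := memLp_of_continuous hBb continuous_const
  have m3 := memLp_of_continuous hUb hψ
  have h4 := abs_integral_mul_le m2 m1
  simp only [one_mul] at h4
  refine ((le_abs_self _).trans h4).trans ?_
  rw [mul_assoc]
  refine mul_le_mul_of_nonneg_left ?_ (l2n_nonneg _ _)
  have e1 : l2n (volume.restrict B) (fun z => |ψ (A z)|) = l2n (Measure.map A (volume.restrict B)) ψ := by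
    rw [l2n, l2n, eLpNorm_map_measure hψ.aestronglyMeasurable hAc.aemeasurable]
    congr 1
    exact eLpNorm_norm (ψ ∘ A)
  rw [e1]
  have h5 : eLpNorm ψ 2 (Measure.map A (volume.restrict B)) ≤
      ENNReal.ofReal s⁻¹ * eLpNorm ψ 2 (volume.restrict U) := by
    refine (eLpNorm_mono_measure _ hmap).trans (le_of_eq ?_)
    rw [eLpNorm_smul_measure_of_ne_top (by norm_num), smul_eq_mul]
    congr 1
    rw [ENNReal.ofReal_rpow_of_pos (by positivity), ← inv_pow, ← Real.rpow_natCast, ← Real.rpow_mul (by positivity)]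
    norm_num
  have h6 := ENNReal.toReal_mono (ENNReal.mul_ne_top (by simp) m3.2.ne) h5
  rwa [ENNReal.toReal_mul, ENNReal.toReal_ofReal (by positivity)] at h6

theorem abs_coord_le_norm (v : Plane) (i : Fin 2) : |v i| ≤ ‖v‖ := by
  simpa using PiLp.norm_apply_le v i

/-- The `H²` norm of a smooth function. -/
noncomputable def h2n (μ : Measure Plane) (φ : Plane → ℝ) : ℝ :=
  l2n μ φ + ∑ i, l2n μ (pderiv i φ) + ∑ i, ∑ j, l2n μ (pderiv j (pderiv i φ))

/-- Average the Taylor formula over the end points in a ball inside `U`. The first two terms are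
controlled by `L²` norms on the ball. In the remainder the weight `s` meets `s⁻¹` from the
homothety, so the integral over `s` stays bounded; a first-order expansion would leave a divergent
`∫ s⁻¹`. -/
theorem sobolev_sup_le {U : Set Plane} (hU : IsOpen U) (hUc : Convex ℝ U) (hUb : Bornology.IsBounded U)
    (hne : U.Nonempty) :
    ∃ C, 0 ≤ C ∧ ∀ φ : Plane → ℝ, ContDiff ℝ ∞ φ → ∀ x ∈ closure U,
      |φ x| ≤ C * h2n (volume.restrict U) φ := by
  obtain ⟨c, hc⟩ := hne
  obtain ⟨r, hr, hrU⟩ := Metric.nhds_basis_closedBall.mem_iff.1 (hU.mem_nhds hc)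
  set B := Metric.closedBall c r with hB
  obtain ⟨M, hM⟩ := (Metric.isBounded_iff.1 hUb.closure)
  set a := l2n (volume.restrict B) (fun _ => 1) with ha
  have a0 : 0 ≤ a := l2n_nonneg _ _
  set b := volume.real B with hb
  have b0 : 0 < b := ENNReal.toReal_pos (Metric.measure_closedBall_pos _ _ hr).ne' (measure_closedBall_lt_top).ne
  have M0 : 0 ≤ M := dist_nonneg.trans (hM (subset_closure hc) (subset_closure hc))
  refine ⟨b⁻¹ * (a * (1 + M + M * M)), by positivity, fun φ hφ x hx => ?_⟩
  set μ := volume.restrict U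
  have hv : ∀ z ∈ B, ∀ i, |(z - x) i| ≤ M := fun z hz i =>
    (abs_coord_le_norm _ i).trans (by rw [← dist_eq_norm]; exact hM (subset_closure (hrU hz)) hx)
  have cB : IsCompact B := isCompact_closedBall c r
  have line1 : ∀ z, x + (1:ℝ) • (z - x) = z := fun z => by simp
  set d2 : ℝ → Plane → ℝ := fun s z => s * ∑ i, ∑ j, (z - x) i * (z - x) j * pderiv j (pderiv i φ) (x + s • (z - x)) with hd2
  have cd2 : Continuous (Function.uncurry d2) := by
    have c0 : Continuous (fun p : ℝ × Plane => x + p.1 • (p.2 - x)) := by fun_prop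
    have cc : ∀ i, Continuous (fun p : ℝ × Plane => (p.2 - x) i) := fun i => by fun_prop
    exact continuous_fst.mul (continuous_finsetSum _ fun i _ => continuous_finsetSum _ fun j _ =>
      ((cc i).mul (cc j)).mul ((pderiv_contDiff (pderiv_contDiff hφ i) j).continuous.comp c0))
  set d1 : Plane → ℝ := fun z => ∑ i, (z - x) i * pderiv i φ z with hd1
  have cd1 : Continuous d1 := by
    have cc : ∀ i, Continuous (fun z : Plane => (z - x) i) := fun i => by fun_prop
    exact continuous_finsetSum _ fun i _ => (cc i).mul (pderiv_contDiff hφ i).continuous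
  have tay : ∀ z, φ x = φ z - d1 z + ∫ s in (0:ℝ)..1, d2 s z := by
    intro z
    have := taylor_backward hφ x (z - x)
    simpa [hd1, hd2] using this
  have cI : Continuous (fun z => ∫ s in (0:ℝ)..1, d2 s z) := by
    have c2 : Continuous (Function.uncurry fun z s => d2 s z) := cd2.comp continuous_swap
    exact intervalIntegral.continuous_parametric_intervalIntegral_of_continuous' c2 0 1
  have key : b * φ x = (∫ z in B, φ z) - (∫ z in B, d1 z) + ∫ z in B, ∫ s in (0:ℝ)..1, d2 s z := by
    have i1 := hφ.continuous.continuousOn.integrableOn_compact (μ := volume) cB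
    have i2 := cd1.continuousOn.integrableOn_compact (μ := volume) cB
    have i3 := cI.continuousOn.integrableOn_compact (μ := volume) cB
    rw [← integral_sub i1 i2, ← integral_add (f := fun z => φ z - d1 z) (i1.sub i2) i3]
    have : ∫ z in B, (φ x) = b * φ x := by simp [hb]
    rw [← this]
    exact integral_congr_ae (ae_of_all _ fun z => tay z)
  have swap : ∫ z in B, ∫ s in (0:ℝ)..1, d2 s z = ∫ s in (0:ℝ)..1, ∫ z in B, d2 s z := by
    simp only [intervalIntegral.integral_of_le zero_le_one]
    refine integral_integral_swap ?_
    have c2 : Continuous (Function.uncurry fun z s => d2 s z) := cd2.comp continuous_swap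
    have := (c2.continuousOn (s := B ×ˢ Set.Icc (0:ℝ) 1)).integrableOn_compact (μ := volume.prod volume) (cB.prod isCompact_Icc)
    rw [IntegrableOn, ← Measure.prod_restrict] at this
    rw [restrict_Ioc_eq_restrict_Icc]
    exact this
  have hBle : ∀ (ψ : Plane → ℝ), Continuous ψ → ∫ z in B, |ψ z| ≤ a * l2n μ ψ := by
    intro ψ hψ
    have := integral_ball_homothety_le hU hUc hUb hrU hx one_pos le_rfl hψ
    simpa using this
  have t1 : |∫ z in B, φ z| ≤ a * l2n μ φ :=
    abs_integral_le_integral_abs.trans (hBle φ hφ.continuous)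
  have t2 : |∫ z in B, d1 z| ≤ a * M * ∑ i, l2n μ (pderiv i φ) := by
    have e : |∫ z in B, d1 z| ≤ ∫ z in B, ∑ i, M * |pderiv i φ z| := by
      refine abs_integral_le_integral_abs.trans ?_
      refine setIntegral_mono_on ?_ ?_ measurableSet_closedBall fun z hz => ?_
      · exact cd1.abs.continuousOn.integrableOn_compact cB
      · exact (continuous_finsetSum _ fun i _ => continuous_const.mul (pderiv_contDiff hφ i).continuous.abs).continuousOn.integrableOn_compact cB
      · refine (Finset.abs_sum_le_sum_abs _ _).trans (Finset.sum_le_sum fun i _ => ?_)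
        rw [abs_mul]
        exact mul_le_mul_of_nonneg_right (hv z hz i) (abs_nonneg _)
    refine e.trans ?_
    rw [integral_finsetSum _ fun i _ => ((pderiv_contDiff hφ i).continuous.abs.continuousOn.integrableOn_compact cB).const_mul _,
      Finset.mul_sum]
    refine Finset.sum_le_sum fun i _ => ?_
    rw [integral_const_mul]
    have := mul_le_mul_of_nonneg_left (hBle _ (pderiv_contDiff hφ i).continuous) M0
    linarith
  have t3 : |∫ s in (0:ℝ)..1, ∫ z in B, d2 s z| ≤ a * (M * M) * ∑ i, ∑ j, l2n μ (pderiv j (pderiv i φ)) := by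
    have hb2 : ∀ s ∈ Set.Ioc (0:ℝ) 1, ‖∫ z in B, d2 s z‖ ≤ a * (M * M) * ∑ i, ∑ j, l2n μ (pderiv j (pderiv i φ)) := by
      intro s hs
      have cl : Continuous (fun z : Plane => x + s • (z - x)) := by fun_prop
      have cij : ∀ i j, Continuous (fun z : Plane => |pderiv j (pderiv i φ) (x + s • (z - x))|) := fun i j =>
        ((pderiv_contDiff (pderiv_contDiff hφ i) j).continuous.comp cl).abs
      have cs : Continuous (d2 s) := cd2.comp (by fun_prop : Continuous fun z : Plane => (s, z))
      have e : |∫ z in B, d2 s z| ≤ ∫ z in B, ∑ i, ∑ j, s * (M * M) * |pderiv j (pderiv i φ) (x + s • (z - x))| := by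
        refine abs_integral_le_integral_abs.trans ?_
        refine setIntegral_mono_on (cs.abs.continuousOn.integrableOn_compact cB) ?_ measurableSet_closedBall fun z hz => ?_
        · exact (continuous_finsetSum _ fun i _ => continuous_finsetSum _ fun j _ =>
            continuous_const.mul (cij i j)).continuousOn.integrableOn_compact cB
        · simp only [hd2]
          rw [abs_mul, abs_of_pos hs.1, ← Finset.sum_product', ← Finset.sum_product']
          rw [Finset.sum_congr rfl (fun p _ => mul_assoc s (M * M) _), ← Finset.mul_sum]
          refine mul_le_mul_of_nonneg_left ?_ hs.1.le
          refine (Finset.abs_sum_le_sum_abs _ _).trans (Finset.sum_le_sum fun p _ => ?_)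
          rw [abs_mul, abs_mul]
          gcongr
          exacts [hv z hz _, hv z hz _]
      refine e.trans ?_
      have j1 : ∀ i j, IntegrableOn (fun z => s * (M * M) * |pderiv j (pderiv i φ) (x + s • (z - x))|) B := fun i j =>
        (continuous_const.mul (cij i j)).continuousOn.integrableOn_compact cB
      have j2 : ∀ i, IntegrableOn (fun z => ∑ j, s * (M * M) * |pderiv j (pderiv i φ) (x + s • (z - x))|) B := fun i =>
        integrable_finsetSum _ fun j _ => j1 i j
      rw [integral_finsetSum _ fun i _ => j2 i, Finset.mul_sum]
      refine Finset.sum_le_sum fun i _ => ?_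
      rw [integral_finsetSum _ fun j _ => j1 i j, Finset.mul_sum]
      refine Finset.sum_le_sum fun j _ => ?_
      rw [integral_const_mul]
      have h1 := integral_ball_homothety_le hU hUc hUb hrU hx hs.1 hs.2 (pderiv_contDiff (pderiv_contDiff hφ i) j).continuous
      have h2 := mul_le_mul_of_nonneg_left h1 (by have := hs.1; positivity : 0 ≤ s * (M * M))
      refine h2.trans (le_of_eq ?_)
      have := hs.1.ne'
      field_simp
      rw [ha]
    have := intervalIntegral.norm_integral_le_of_norm_le_const (a := (0:ℝ)) (b := 1) (by
      rw [Set.uIoc_of_le zero_le_one]; exact hb2)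
    simpa using this
  have n0 : 0 ≤ l2n μ φ := l2n_nonneg _ _
  have n1 : 0 ≤ ∑ i, l2n μ (pderiv i φ) := Finset.sum_nonneg fun i _ => l2n_nonneg _ _
  have n2 : 0 ≤ ∑ i, ∑ j, l2n μ (pderiv j (pderiv i φ)) :=
    Finset.sum_nonneg fun i _ => Finset.sum_nonneg fun j _ => l2n_nonneg _ _
  have fin : b * |φ x| ≤ a * (1 + M + M * M) * h2n μ φ := by
    rw [← abs_of_pos b0, ← abs_mul, key, swap]
    have t := (abs_add_le ((∫ z in B, φ z) - (∫ z in B, d1 z)) (∫ s in (0:ℝ)..1, ∫ z in B, d2 s z)).trans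
      (add_le_add ((abs_sub _ _).trans (add_le_add t1 t2)) t3)
    refine t.trans ?_
    unfold h2n
    have q1 := mul_nonneg a0 n1
    have q2 := mul_nonneg a0 n2
    have q0 := mul_nonneg a0 n0
    nlinarith [mul_nonneg q0 M0, mul_nonneg q0 (mul_nonneg M0 M0), mul_nonneg q1 (mul_nonneg M0 M0), mul_nonneg q2 M0]
  rw [mul_assoc, ← div_eq_inv_mul, le_div_iff₀ b0]
  linarith

theorem Approx2.l2Lim {U : Set Plane} {f : Plane → ℝ} {φ : ℕ → Plane → ℝ} (h : Approx2 U f φ) :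
    L2Lim (volume.restrict U) φ f := h.1.2.1

theorem Approx2.uniformCauchy {U : Set Plane} (hU : IsOpen U) (hUc : Convex ℝ U) (hUb : Bornology.IsBounded U)
    (hne : U.Nonempty) {f : Plane → ℝ} (hf : MemH2 U f) {φ : ℕ → Plane → ℝ} (h : Approx2 U f φ) :
    UniformCauchySeqOn φ atTop (closure U) := by
  obtain ⟨C, hC0, hC⟩ := sobolev_sup_le hU hUc hUb hne
  rw [Metric.uniformCauchySeqOn_iff]
  intro ε hε
  -- The `H²` norm is a sum of `1 + 2 + 4 = 7` terms.
  set δ := ε / (7 * (C + 1)) with hδ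
  have δ0 : 0 < δ := by positivity
  have mm : ∀ {ψ : Plane → ℝ}, ContDiff ℝ ∞ ψ → MemLp ψ 2 (volume.restrict U) :=
    fun hψ => memLp_of_continuous hUb hψ.continuous
  have c := h.1.1
  obtain ⟨N0, h0⟩ := h.l2Lim.eventually_l2n_sub_lt (fun m => mm (c m)) hf.1.1 δ0
  have h1 := fun i => (h.1.2.2 i).eventually_l2n_sub_lt (fun m => mm (pderiv_contDiff (c m) i))
    (hf.1.memLp_weakPartial hU i) δ0
  choose N1 h1 using h1
  have h2 := fun i j => ((h.2 i).2.2 j).eventually_l2n_sub_lt (fun m => mm (pderiv_contDiff (pderiv_contDiff (c m) i) j))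
    ((hf.2 i).memLp_weakPartial hU j) δ0
  choose N2 h2 using h2
  refine ⟨N0 + (∑ i, N1 i) + ∑ i, ∑ j, N2 i j, fun m hm n hn x hx => ?_⟩
  have b1 : ∀ i, N1 i ≤ ∑ i, N1 i := fun i => Finset.single_le_sum (f := N1) (fun _ _ => Nat.zero_le _) (Finset.mem_univ i)
  have b2 : ∀ i j, N2 i j ≤ ∑ i, ∑ j, N2 i j := fun i j =>
    (Finset.single_le_sum (f := N2 i) (fun _ _ => Nat.zero_le _) (Finset.mem_univ j)).trans
      (Finset.single_le_sum (f := fun i => ∑ j, N2 i j) (fun _ _ => Nat.zero_le _) (Finset.mem_univ i))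
  have e1 : ∀ i, pderiv i (φ m - φ n) = pderiv i (φ m) - pderiv i (φ n) := fun i => by
    ext y; exact pderiv_sub ((c m).differentiable (by simp)) ((c n).differentiable (by simp)) i y
  have e2 : ∀ i j, pderiv j (pderiv i (φ m - φ n)) = pderiv j (pderiv i (φ m)) - pderiv j (pderiv i (φ n)) := fun i j => by
    ext y
    rw [e1]
    exact pderiv_sub ((pderiv_contDiff (c m) i).differentiable (by simp)) ((pderiv_contDiff (c n) i).differentiable (by simp)) j y
  have hb := hC (φ m - φ n) ((c m).sub (c n)) x hx
  have : h2n (volume.restrict U) (φ m - φ n) ≤ 7 * δ := by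
    unfold h2n
    have a0 := (h0 m (by omega) n (by omega)).le
    have a1 : ∑ i, l2n (volume.restrict U) (pderiv i (φ m - φ n)) ≤ ∑ i : Fin 2, δ :=
      Finset.sum_le_sum fun i _ => by
        rw [e1]; exact (h1 i m (by have := b1 i; omega) n (by have := b1 i; omega)).le
    have a2 : ∑ i, ∑ j, l2n (volume.restrict U) (pderiv j (pderiv i (φ m - φ n))) ≤ ∑ i : Fin 2, ∑ j : Fin 2, δ :=
      Finset.sum_le_sum fun i _ => Finset.sum_le_sum fun j _ => by
        rw [e2]; exact (h2 i j m (by have := b2 i j; omega) n (by have := b2 i j; omega)).le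
    simp only [Fin.sum_univ_two] at a1 a2 ⊢
    linarith
  rw [Real.dist_eq]
  calc |φ m x - φ n x| ≤ C * (7 * δ) := hb.trans (by gcongr)
    _ < (C + 1) * (7 * δ) := by gcongr; linarith
    _ = ε := by rw [hδ]; field_simp

/-- The uniform limit on the closure and the `L²` limit are both limits in measure, hence agree
almost everywhere. -/
theorem Approx2.exists_continuous {U : Set Plane} (hU : IsOpen U) (hUc : Convex ℝ U) (hUb : Bornology.IsBounded U)
    (hne : U.Nonempty) {f : Plane → ℝ} (hf : MemH2 U f) {φ : ℕ → Plane → ℝ} (h : Approx2 U f φ) :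
    ∃ g : Plane → ℝ, ContinuousOn g (closure U) ∧ f =ᵐ[volume.restrict U] g ∧
      TendstoUniformlyOn φ g atTop (closure U) := by
  have huc := h.uniformCauchy hU hUc hUb hne hf
  have hlim : ∀ x, ∃ y, x ∈ closure U → Tendsto (fun m => φ m x) atTop (𝓝 y) := by
    intro x
    by_cases hx : x ∈ closure U
    · obtain ⟨y, hy⟩ := cauchySeq_tendsto_of_complete (huc.cauchySeq hx)
      exact ⟨y, fun _ => hy⟩
    · exact ⟨0, fun h => absurd h hx⟩
  choose g hg using hlim
  have hu := huc.tendstoUniformlyOn_of_tendsto fun x hx => hg x hx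
  have hgc : ContinuousOn g (closure U) :=
    hu.continuousOn (Frequently.of_forall fun m => (h.1.1 m).continuous.continuousOn)
  refine ⟨g, hgc, ?_, hu⟩
  have : IsFiniteMeasure (volume.restrict U) := isFiniteMeasure_restrict.2 hUb.measure_lt_top.ne
  have hgm : AEStronglyMeasurable g (volume.restrict U) :=
    (hgc.mono subset_closure).aestronglyMeasurable hU.measurableSet
  have hae : ∀ᵐ x ∂(volume.restrict U), Tendsto (fun m => φ m x) atTop (𝓝 (g x)) := by
    filter_upwards [ae_restrict_mem hU.measurableSet] with x hx
    exact hg x (subset_closure hx)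
  have t1 := tendstoInMeasure_of_tendsto_ae (fun m => (h.1.1 m).continuous.aestronglyMeasurable) hae
  have t2 : TendstoInMeasure (volume.restrict U) φ atTop f :=
    tendstoInMeasure_of_tendsto_eLpNorm (by norm_num) (fun m => (h.1.1 m).continuous.aestronglyMeasurable) hf.1.1.1 h.l2Lim
  exact tendstoInMeasure_ae_unique t2 t1

/-! ## The continuous representative -/

section contRep
variable {K : ConvexPolygon} {f f' g : Plane → ℝ}

theorem exists_contRep (hf : MemH2 K.inner f) :
    ∃ g : Plane → ℝ, ContinuousOn g K.carrier ∧ f =ᵐ[volume.restrict K.inner] g := by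
  obtain ⟨φ, hφ⟩ := (exists_approx K.isOpen_inner K.convex_inner K.isBounded_inner K.inner_nonempty).2 hf
  obtain ⟨g, h1, h2, _⟩ := hφ.exists_continuous K.isOpen_inner K.convex_inner K.isBounded_inner K.inner_nonempty hf
  rw [ConvexPolygon.closure_inner] at h1
  exact ⟨g, h1, h2⟩

theorem contRep_spec (h : ∃ g : Plane → ℝ, ContinuousOn g K.carrier ∧ f =ᵐ[volume.restrict K.inner] g) :
    ContinuousOn (contRep K f) K.carrier ∧ f =ᵐ[volume.restrict K.inner] contRep K f := by
  unfold contRep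
  rw [dif_pos h]
  exact h.choose_spec

theorem MemH2.continuousOn_contRep (hf : MemH2 K.inner f) : ContinuousOn (contRep K f) K.carrier :=
  (contRep_spec (exists_contRep hf)).1

theorem MemH2.ae_eq_contRep (hf : MemH2 K.inner f) : f =ᵐ[volume.restrict K.inner] contRep K f :=
  (contRep_spec (exists_contRep hf)).2

theorem eqOn_closure_of_ae_eq {U V : Set Plane} (hU : IsOpen U) (hVU : V ⊆ closure U) (hf : ContinuousOn f V) (hg : ContinuousOn g V)
    (hUV : U ⊆ V) (h : f =ᵐ[volume.restrict U] g) : Set.EqOn f g V := by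
  have h1 : Set.EqOn f g U :=
    Measure.eqOn_open_of_ae_eq h hU (hf.mono hUV) (hg.mono hUV)
  intro x hx
  have hx' : x ∈ closure U := hVU hx
  have : (𝓝[U] x).NeBot := mem_closure_iff_nhdsWithin_neBot.1 hx'
  have t1 : Tendsto f (𝓝[U] x) (𝓝 (f x)) := (hf x hx).mono_left (nhdsWithin_mono _ hUV)
  have t2 : Tendsto g (𝓝[U] x) (𝓝 (g x)) := (hg x hx).mono_left (nhdsWithin_mono _ hUV)
  refine tendsto_nhds_unique (t1.congr' ?_) t2
  filter_upwards [self_mem_nhdsWithin] with y hy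
  exact h1 hy

theorem contRep_eqOn (hg : ContinuousOn g K.carrier) (h : f =ᵐ[volume.restrict K.inner] g) :
    Set.EqOn (contRep K f) g K.carrier := by
  obtain ⟨h1, h2⟩ := contRep_spec ⟨g, hg, h⟩
  refine eqOn_closure_of_ae_eq K.isOpen_inner ?_ h1 hg K.inner_subset_carrier (h2.symm.trans h)
  rw [ConvexPolygon.closure_inner]

open Classical in
-- A choice with default value depends only on the predicate. This turns almost everywhere equality
-- into honest equality of continuous representatives, traces and projections.
theorem dite_choose_congr {α : Type*} [Zero α] {P Q : α → Prop} (h : P = Q) :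
    (if h : ∃ g, P g then h.choose else 0) = (if h : ∃ g, Q g then h.choose else 0) := by
  subst h; rfl

theorem contRep_congr (h : f =ᵐ[volume.restrict K.inner] f') : contRep K f = contRep K f' := by
  have : (fun g : Plane → ℝ => ContinuousOn g K.carrier ∧ f =ᵐ[volume.restrict K.inner] g) =
      fun g : Plane → ℝ => ContinuousOn g K.carrier ∧ f' =ᵐ[volume.restrict K.inner] g := by
    funext g
    exact propext ⟨fun h' => ⟨h'.1, h.symm.trans h'.2⟩, fun h' => ⟨h'.1, h.trans h'.2⟩⟩
  exact dite_choose_congr this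

theorem contRep_add (hf : MemH2 K.inner f) (hg : MemH2 K.inner g) :
    Set.EqOn (contRep K (f + g)) (contRep K f + contRep K g) K.carrier :=
  contRep_eqOn (hf.continuousOn_contRep.add hg.continuousOn_contRep) (hf.ae_eq_contRep.add hg.ae_eq_contRep)

theorem contRep_sub (hf : MemH2 K.inner f) (hg : MemH2 K.inner g) :
    Set.EqOn (contRep K (f - g)) (contRep K f - contRep K g) K.carrier :=
  contRep_eqOn (hf.continuousOn_contRep.sub hg.continuousOn_contRep) (hf.ae_eq_contRep.sub hg.ae_eq_contRep)

theorem contRep_const_smul (hf : MemH2 K.inner f) (c : ℝ) :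
    Set.EqOn (contRep K (c • f)) (c • contRep K f) K.carrier :=
  contRep_eqOn (hf.continuousOn_contRep.const_smul c) (hf.ae_eq_contRep.const_smul c)

theorem contRep_of_continuousOn (hf : ContinuousOn f K.carrier) : Set.EqOn (contRep K f) f K.carrier :=
  contRep_eqOn hf (ae_eq_refl _)

theorem Approx2.tendstoUniformlyOn_contRep (hf : MemH2 K.inner f) {φ : ℕ → Plane → ℝ} (h : Approx2 K.inner f φ) :
    TendstoUniformlyOn φ (contRep K f) atTop K.carrier := by
  obtain ⟨g, h1, h2, h3⟩ := h.exists_continuous K.isOpen_inner K.convex_inner K.isBounded_inner K.inner_nonempty hf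
  rw [ConvexPolygon.closure_inner] at h1 h3
  exact h3.congr_right (contRep_eqOn h1 h2).symm

end contRep
end StrainGradientVEM

namespace StrainGradientVEM

/-! ## Traces on the edges -/

section approx
variable {U : Set Plane} {f g p : Plane → ℝ} {φ ψ : ℕ → Plane → ℝ}

theorem Approx1.add (hU : IsOpen U) (hf : MemH1 U f) (hg : MemH1 U g)
    (h : Approx1 U f φ) (h' : Approx1 U g ψ) : Approx1 U (f + g) (fun m => φ m + ψ m) := by
  refine ⟨fun m => (h.1 m).add (h'.1 m), h.2.1.add h'.2.1 (fun m => (h.1 m).continuous.aestronglyMeasurable)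
    (fun m => (h'.1 m).continuous.aestronglyMeasurable) hf.1.1 hg.1.1, fun j => ?_⟩
  refine ((h.2.2 j).add (h'.2.2 j) (fun m => (pderiv_contDiff (h.1 m) j).continuous.aestronglyMeasurable)
    (fun m => (pderiv_contDiff (h'.1 m) j).continuous.aestronglyMeasurable)
    (hf.memLp_weakPartial hU j).1 (hg.memLp_weakPartial hU j).1).congr (fun m => ?_) (weakPartial_add hU hf hg j).symm
  refine ae_of_all _ fun x => ?_
  exact (pderiv_add ((h.1 m).differentiable (by simp)) ((h'.1 m).differentiable (by simp)) j x).symm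

theorem Approx1.const_smul (hU : IsOpen U) (hf : MemH1 U f)
    (h : Approx1 U f φ) (c : ℝ) : Approx1 U (c • f) (fun m => c • φ m) := by
  refine ⟨fun m => (h.1 m).const_smul c, h.2.1.const_smul c, fun j => ?_⟩
  refine ((h.2.2 j).const_smul c).congr (fun m => ?_) (weakPartial_const_smul hU hf c j).symm
  exact ae_of_all _ fun x => (pderiv_const_smul ((h.1 m).differentiable (by simp)) c j x).symm

theorem exists_bound_of_bounded (hUb : Bornology.IsBounded U) (hp : Continuous p) :
    ∃ C, ∀ x ∈ U, |p x| ≤ C := by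
  obtain ⟨C, hC⟩ := hUb.isCompact_closure.exists_bound_of_continuousOn hp.continuousOn
  exact ⟨C, fun x hx => hC x (subset_closure hx)⟩

theorem L2Lim.continuous_mul (hU : MeasurableSet U) (hUb : Bornology.IsBounded U) (hp : Continuous p)
    (h : L2Lim (volume.restrict U) φ f) : L2Lim (volume.restrict U) (fun m => p * φ m) (p * f) := by
  obtain ⟨C, hC⟩ := exists_bound_of_bounded hUb hp
  refine h.bdd_mul (C := C) ?_
  filter_upwards [ae_restrict_mem hU] with x hx using hC x hx

theorem Approx1.smooth_mul (hU : IsOpen U) (hUb : Bornology.IsBounded U) (hf : MemH1 U f)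
    (h : Approx1 U f φ) (hp : ContDiff ℝ ∞ p) : Approx1 U (p * f) (fun m => p * φ m) := by
  refine ⟨fun m => hp.mul (h.1 m), h.2.1.continuous_mul hU.measurableSet hUb hp.continuous, fun j => ?_⟩
  have mf := hf.memLp_weakPartial hU j
  refine (((h.2.2 j).continuous_mul hU.measurableSet hUb hp.continuous).add
    (h.2.1.continuous_mul hU.measurableSet hUb (pderiv_contDiff hp j).continuous)
    (fun m => (hp.continuous.mul (pderiv_contDiff (h.1 m) j).continuous).aestronglyMeasurable)
    (fun m => ((pderiv_contDiff hp j).continuous.mul (h.1 m).continuous).aestronglyMeasurable)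
    (hp.continuous.aestronglyMeasurable.mul mf.1)
    ((pderiv_contDiff hp j).continuous.aestronglyMeasurable.mul hf.1.1)).congr (fun m => ?_)
    (weakPartial_smooth_mul hU hp hf j).symm
  exact ae_of_all _ fun x => (pderiv_mul (hp.differentiable (by simp)) ((h.1 m).differentiable (by simp)) j x).symm

theorem approx1_const (hU : IsOpen U) (hp : ContDiff ℝ ∞ p) : Approx1 U p (fun _ => p) :=
  ⟨fun _ => hp, L2Lim.const _ _, fun j => (L2Lim.const _ _).congr (fun _ => ae_eq_refl _)
    (weakPartial_of_contDiff hU hp j).symm⟩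

end approx

variable {K : ConvexPolygon} {i : Fin (K.extra + 3)} {f f' g p w : Plane → ℝ} {φ ψ : ℕ → Plane → ℝ}

namespace ConvexPolygon

theorem restrict_edgeMeasure (i : Fin (K.extra + 3)) : (K.edgeMeasure i).restrict (K.edge i) = K.edgeMeasure i :=
  Measure.restrict_eq_self_of_ae_mem (ae_edgeMeasure_mem_edge i)

theorem isCompact_edge (i : Fin (K.extra + 3)) : IsCompact (K.edge i) := by
  have : K.edge i = K.edgePt i '' Set.Icc 0 1 := by
    ext x; rw [mem_edge_iff_exists]; rfl
  rw [this]
  exact isCompact_Icc.image (continuous_edgePt i)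

theorem memLp_edge (hf : ContinuousOn f (K.edge i)) : MemLp f 2 (K.edgeMeasure i) := by
  obtain ⟨C, hC⟩ := (isCompact_edge i).exists_bound_of_continuousOn hf
  have hm : AEStronglyMeasurable f (K.edgeMeasure i) := by
    rw [← restrict_edgeMeasure]
    exact hf.aestronglyMeasurable (isCompact_edge i).measurableSet
  refine MemLp.of_bound hm C ?_
  filter_upwards [ae_edgeMeasure_mem_edge i] with x hx using hC x hx

theorem memLp_edge_of_continuous (hf : Continuous f) : MemLp f 2 (K.edgeMeasure i) :=
  memLp_edge hf.continuousOn

/-- On the `i`-th edge `ell i x = 0`, so there `n · (x - c)` is the constant `ell i c / |e_i|`,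
positive for interior `c`. The trace inequality rests on this. -/
theorem sum_normal_mul_sub (i : Fin (K.extra + 3)) (x c : Plane) :
    ∑ a, K.normal i a * (x a - c a) = (K.ell i c - K.ell i x) / K.edgeLength i := by
  have h := K.edgeLength_pos i
  have e : ∀ a, K.normal i a = -pderiv a (K.ell i) x / K.edgeLength i := fun a => by
    rw [pderiv_ell_eq]; field_simp
  have e2 : K.ell i c - K.ell i x = cross (K.dvec i) (c - x) := ell_sub
  rw [e2]
  simp only [e, pderiv_ell, Fin.sum_univ_two, cross]
  simp
  field_simp
  ring

theorem integral_mul_pderiv {φ ψ : Plane → ℝ} (hφ : ContDiff ℝ ∞ φ) (hψ : ContDiff ℝ ∞ ψ) (a : Fin 2) :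
    (∫ x in K.inner, pderiv a φ x * ψ x) + ∫ x in K.inner, φ x * pderiv a ψ x =
      ∑ i, K.normal i a * ∫ x, φ x * ψ x ∂(K.edgeMeasure i) := by
  have hb := K.isBounded_inner
  have m := fun {q : Plane → ℝ} (hq : Continuous q) => memLp_of_continuous (U := K.inner) hb hq
  rw [← integral_add ((m (pderiv_contDiff hφ a).continuous).integrable_mul' (m hψ.continuous))
    ((m hφ.continuous).integrable_mul' (m (pderiv_contDiff hψ a).continuous))]
  have := integral_pderiv (K := K) (hφ.mul hψ) a
  refine Eq.trans ?_ this
  refine integral_congr_ae (ae_of_all _ fun x => ?_)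
  have := pderiv_mul (hφ.differentiable (by simp)) (hψ.differentiable (by simp)) a x
  change _ = pderiv a (φ * ψ) x
  simp only [this]; ring

/-- Apply the divergence theorem to the field `φ² (x - c)` with `c` an interior point. Its flux
through every edge is a positive multiple of `∫ φ²`, so the flux through one edge is at most the
total flux, and Cauchy-Schwarz bounds the latter. -/
theorem trace_inequality (i : Fin (K.extra + 3)) : ∃ C, 0 ≤ C ∧ ∀ φ : Plane → ℝ, ContDiff ℝ ∞ φ →
    l2n (K.edgeMeasure i) φ ≤ C * (l2n (volume.restrict K.inner) φ +
      ∑ a, l2n (volume.restrict K.inner) (pderiv a φ)) := by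
  obtain ⟨c, hc⟩ := K.inner_nonempty
  obtain ⟨M, hM⟩ := Metric.isBounded_iff.1 K.isBounded_inner
  have M0 : 0 ≤ M := dist_nonneg.trans (hM hc hc)
  have hpos : ∀ j, 0 < K.ell j c := mem_inner_iff.1 hc
  have hl := K.edgeLength_pos
  set r := K.edgeLength i / K.ell i c with hr
  have r0 : 0 < r := div_pos (hl i) (hpos i)
  refine ⟨r * (2 + 2 * M) + 1, by positivity, fun φ hφ => ?_⟩
  set μ := volume.restrict K.inner
  have hb := K.isBounded_inner
  have m := fun {q : Plane → ℝ} (hq : Continuous q) => memLp_of_continuous (U := K.inner) hb hq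
  have mφ := m hφ.continuous
  have md := fun a => m (pderiv_contDiff hφ a).continuous
  have hco : ∀ a : Fin 2, ContDiff ℝ ∞ (fun x : Plane => x a - c a) := fun a => by fun_prop
  have hpd : ∀ (a : Fin 2) (x : Plane), pderiv a (fun x : Plane => x a - c a) x = 1 := fun a x => by
    have h1 : HasFDerivAt (fun x : Plane => x a - c a) (EuclideanSpace.proj a : Plane →L[ℝ] ℝ) x :=
      ((EuclideanSpace.proj a : Plane →L[ℝ] ℝ).hasFDerivAt).sub_const _
    rw [pderiv, h1.fderiv]; simp
  have G : ∀ a, (∫ x in K.inner, 2 * (φ x * ((x a - c a) * pderiv a φ x))) + ∫ x in K.inner, φ x ^ 2 =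
      ∑ j, ∫ x, φ x ^ 2 * (K.normal j a * (x a - c a)) ∂(K.edgeMeasure j) := fun a => by
    have h := integral_mul_pderiv (K := K) (hφ.mul hφ) (hco a) a
    convert h using 1
    · congr 1
      · refine integral_congr_ae (ae_of_all _ fun x => ?_)
        have := pderiv_mul (hφ.differentiable (by simp)) (hφ.differentiable (by simp)) a x
        change _ = pderiv a (φ * φ) x * _
        simp only [this]; ring
      · refine integral_congr_ae (ae_of_all _ fun x => ?_)
        simp only [hpd]; ring
    · refine Finset.sum_congr rfl fun j _ => ?_
      rw [← integral_const_mul]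
      refine integral_congr_ae (ae_of_all _ fun x => ?_)
      simp only; ring
  have G2 : ∑ j, K.ell j c / K.edgeLength j * ∫ x, φ x ^ 2 ∂(K.edgeMeasure j) =
      ∑ a, ((∫ x in K.inner, 2 * (φ x * ((x a - c a) * pderiv a φ x))) + ∫ x in K.inner, φ x ^ 2) := by
    simp only [G]
    rw [Finset.sum_comm]
    refine Finset.sum_congr rfl fun j _ => ?_
    have hi : ∀ a : Fin 2, Integrable (fun x => φ x ^ 2 * (K.normal j a * (x a - c a))) (K.edgeMeasure j) := fun a => by
      have := (memLp_edge_of_continuous (K := K) (i := j) (hφ.continuous.pow 2)).integrable_mul'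
        (memLp_edge_of_continuous (K := K) (i := j) (continuous_const.mul (hco a).continuous : Continuous fun x : Plane => K.normal j a * (x a - c a)))
      exact this
    rw [← integral_finsetSum _ fun a _ => hi a, ← integral_const_mul]
    refine integral_congr_ae ?_
    filter_upwards [ae_edgeMeasure_mem_edge j] with x hx
    rw [← Finset.mul_sum, sum_normal_mul_sub, ell_eq_zero_of_mem_edge hx]
    ring
  have T : ∀ a, |∫ x in K.inner, 2 * (φ x * ((x a - c a) * pderiv a φ x))| ≤ 2 * (l2n μ φ * (M * l2n μ (pderiv a φ))) := fun a => by
    rw [integral_const_mul, abs_mul, abs_two]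
    have h1 := abs_integral_mul_le mφ (m ((hco a).continuous.mul (pderiv_contDiff hφ a).continuous))
    refine mul_le_mul_of_nonneg_left (h1.trans (mul_le_mul_of_nonneg_left ?_ (l2n_nonneg _ _))) (by norm_num)
    have : M * l2n μ (pderiv a φ) = l2n μ (M • pderiv a φ) := by rw [l2n_const_smul, abs_of_nonneg M0]
    rw [this]
    refine ENNReal.toReal_mono ((md a).const_smul M).2.ne (eLpNorm_mono_ae ?_)
    filter_upwards [ae_restrict_mem K.isOpen_inner.measurableSet] with x hx
    rw [Pi.mul_apply, norm_mul, Pi.smul_apply, norm_smul]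
    refine mul_le_mul_of_nonneg_right ?_ (norm_nonneg _)
    rw [Real.norm_of_nonneg M0]
    have := abs_coord_le_norm (x - c) a
    rw [← dist_eq_norm] at this
    exact this.trans (hM hx hc)
  have S1 : K.ell i c / K.edgeLength i * ∫ x, φ x ^ 2 ∂(K.edgeMeasure i) ≤
      ∑ j, K.ell j c / K.edgeLength j * ∫ x, φ x ^ 2 ∂(K.edgeMeasure j) :=
    Finset.single_le_sum (f := fun j => K.ell j c / K.edgeLength j * ∫ x, φ x ^ 2 ∂(K.edgeMeasure j))
      (fun j _ => mul_nonneg (div_nonneg (hpos j).le (hl j).le) (integral_nonneg fun x => sq_nonneg _)) (Finset.mem_univ i)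
  have A0 := l2n_nonneg μ φ
  have B0 : 0 ≤ ∑ a, l2n μ (pderiv a φ) := Finset.sum_nonneg fun a _ => l2n_nonneg _ _
  set A := l2n μ φ
  set B := ∑ a, l2n μ (pderiv a φ) with hB
  have S2 : ∫ x, φ x ^ 2 ∂(K.edgeMeasure i) ≤ r * (2 * A ^ 2 + 2 * M * A * B) := by
    have h1 : ∑ a, ((∫ x in K.inner, 2 * (φ x * ((x a - c a) * pderiv a φ x))) + ∫ x in K.inner, φ x ^ 2) ≤
        2 * A ^ 2 + 2 * M * A * B := by
      have hA : ∫ x in K.inner, φ x ^ 2 = A ^ 2 := (l2n_sq mφ).symm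
      rw [Fin.sum_univ_two, hA, hB, Fin.sum_univ_two]
      have t0 := (le_abs_self _).trans (T 0)
      have t1 := (le_abs_self _).trans (T 1)
      nlinarith
    rw [G2] at S1
    have h2 := S1.trans h1
    rw [hr, div_mul_eq_mul_div, le_div_iff₀ (hpos i)]
    rw [div_mul_eq_mul_div, div_le_iff₀ (hl i)] at h2
    linarith
  rw [← l2n_sq (memLp_edge_of_continuous hφ.continuous)] at S2
  have D1 : 1 ≤ r * (2 + 2 * M) + 1 := by
    have : 0 ≤ r * (2 + 2 * M) := by positivity
    linarith
  refine (sq_le_sq₀ (l2n_nonneg _ _) (mul_nonneg (by linarith) (add_nonneg A0 B0))).1 ?_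
  refine S2.trans ?_
  have h3 : r * (2 * A ^ 2 + 2 * M * A * B) ≤ (r * (2 + 2 * M) + 1) * (A + B) ^ 2 := by
    have : r * (2 * A ^ 2 + 2 * M * A * B) ≤ r * ((2 + 2 * M) * (A + B) ^ 2) := by
      refine mul_le_mul_of_nonneg_left ?_ r0.le
      nlinarith [mul_nonneg A0 B0, mul_nonneg M0 (mul_nonneg A0 B0), mul_nonneg M0 (sq_nonneg A), mul_nonneg M0 (sq_nonneg B), sq_nonneg B]
    nlinarith [sq_nonneg (A + B)]
  refine h3.trans ?_
  rw [mul_pow]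
  refine mul_le_mul_of_nonneg_right ?_ (sq_nonneg _)
  exact le_self_pow₀ D1 two_ne_zero

end ConvexPolygon

open ConvexPolygon

/-- Two approximating sequences have the same boundary limit, so the choice hidden in `trace` does
no harm. -/
theorem Approx1.l2Lim_edge_diff (hf : MemH1 K.inner f) (h : Approx1 K.inner f φ) (h' : Approx1 K.inner f ψ) (i : Fin (K.extra + 3)) :
    Tendsto (fun m => l2n (K.edgeMeasure i) (φ m - ψ m)) atTop (𝓝 0) := by
  obtain ⟨C, C0, hC⟩ := trace_inequality (K := K) i
  have hb := K.isBounded_inner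
  have m := fun {q : Plane → ℝ} (hq : Continuous q) => memLp_of_continuous (U := K.inner) hb hq
  set μ := volume.restrict K.inner
  have lim : Tendsto (fun m => C * ((l2n μ (φ m - f) + l2n μ (ψ m - f)) +
      ∑ a, (l2n μ (pderiv a (φ m) - weakPartial K.inner a f) + l2n μ (pderiv a (ψ m) - weakPartial K.inner a f)))) atTop (𝓝 0) := by
    have t := ((h.2.1.tendsto_l2n.add h'.2.1.tendsto_l2n).add (tendsto_finsetSum Finset.univ fun a _ =>
      (h.2.2 a).tendsto_l2n.add (h'.2.2 a).tendsto_l2n)).const_mul C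
    simpa using t
  refine squeeze_zero (fun _ => l2n_nonneg _ _) (fun n => ?_) lim
  refine (hC (φ n - ψ n) ((h.1 n).sub (h'.1 n))).trans ?_
  have sub3 : ∀ {q1 q2 q : Plane → ℝ}, MemLp q1 2 μ → MemLp q2 2 μ → MemLp q 2 μ → l2n μ (q1 - q2) ≤ l2n μ (q1 - q) + l2n μ (q2 - q) := by
    intro q1 q2 q h1 h2 h3
    have e : q1 - q2 = (q1 - q) - (q2 - q) := by abel
    rw [e]; exact l2n_sub_le (h1.sub h3) (h2.sub h3)
  gcongr with a
  · exact sub3 (m (h.1 n).continuous) (m (h'.1 n).continuous) hf.1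
  · have e : pderiv a (φ n - ψ n) = pderiv a (φ n) - pderiv a (ψ n) := by
      ext x; exact pderiv_sub ((h.1 n).differentiable (by simp)) ((h'.1 n).differentiable (by simp)) a x
    rw [e]
    exact sub3 (m (pderiv_contDiff (h.1 n) a).continuous) (m (pderiv_contDiff (h'.1 n) a).continuous) (hf.memLp_weakPartial K.isOpen_inner a)

theorem Approx1.exists_l2Lim_edge (hf : MemH1 K.inner f) (h : Approx1 K.inner f φ) (i : Fin (K.extra + 3)) :
    ∃ T, MemLp T 2 (K.edgeMeasure i) ∧ L2Lim (K.edgeMeasure i) φ T := by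
  obtain ⟨C, C0, hC⟩ := trace_inequality (K := K) i
  have hb := K.isBounded_inner
  have m := fun {q : Plane → ℝ} (hq : Continuous q) => memLp_of_continuous (U := K.inner) hb hq
  set μ := volume.restrict K.inner
  refine exists_l2Lim_of_cauchy (fun n => memLp_edge_of_continuous (h.1 n).continuous) fun ε hε => ?_
  set δ := ε / (3 * C + 1) with hδ
  have δ0 : 0 < δ := by positivity
  obtain ⟨N0, h0⟩ := h.2.1.eventually_l2n_sub_lt (fun n => m (h.1 n).continuous) hf.1 δ0
  have h1 := fun a => (h.2.2 a).eventually_l2n_sub_lt (fun n => m (pderiv_contDiff (h.1 n) a).continuous)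
    (hf.memLp_weakPartial K.isOpen_inner a) δ0
  choose N h1 using h1
  refine ⟨N0 + (N 0 + N 1), fun n hn n' hn' => ?_⟩
  refine (hC (φ n - φ n') ((h.1 n).sub (h.1 n'))).trans_lt ?_
  have e : ∀ a, pderiv a (φ n - φ n') = pderiv a (φ n) - pderiv a (φ n') := fun a => by
    ext x; exact pderiv_sub ((h.1 n).differentiable (by simp)) ((h.1 n').differentiable (by simp)) a x
  have a0 := h0 n (by omega) n' (by omega)
  have a1 := h1 0 n (by omega) n' (by omega)
  have a2 := h1 1 n (by omega) n' (by omega)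
  rw [Fin.sum_univ_two, e, e]
  calc _ ≤ C * (δ + (δ + δ)) := by gcongr
    _ < (3 * C + 1) * δ := by nlinarith
    _ = ε := by rw [hδ]; field_simp

theorem Approx1.isTrace (hf : MemH1 K.inner f) (h : Approx1 K.inner f φ) (i : Fin (K.extra + 3)) :
    ∃ T, IsTrace K i f T := by
  obtain ⟨T, h1, h2⟩ := h.exists_l2Lim_edge hf i
  exact ⟨T, h1, φ, h.1, h.2.1, h.2.2, h2⟩

theorem MemH1.exists_approx (hf : MemH1 K.inner f) : ∃ φ, Approx1 K.inner f φ :=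
  (StrainGradientVEM.exists_approx K.isOpen_inner K.convex_inner K.isBounded_inner K.inner_nonempty).1 hf

theorem MemH2.exists_approx (hf : MemH2 K.inner f) : ∃ φ, Approx2 K.inner f φ :=
  (StrainGradientVEM.exists_approx K.isOpen_inner K.convex_inner K.isBounded_inner K.inner_nonempty).2 hf

theorem MemH1.isTrace_trace (hf : MemH1 K.inner f) (i : Fin (K.extra + 3)) : IsTrace K i f (trace K i f) := by
  obtain ⟨φ, hφ⟩ := hf.exists_approx
  have h := hφ.isTrace hf i
  unfold trace
  rw [dif_pos h]
  exact h.choose_spec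

theorem MemH1.memLp_trace (hf : MemH1 K.inner f) (i : Fin (K.extra + 3)) : MemLp (trace K i f) 2 (K.edgeMeasure i) :=
  (hf.isTrace_trace i).1

theorem Approx1.l2Lim_trace (hf : MemH1 K.inner f) (h : Approx1 K.inner f φ) (i : Fin (K.extra + 3)) :
    L2Lim (K.edgeMeasure i) φ (trace K i f) := by
  obtain ⟨hT, ψ, h1, h2, h3, h4⟩ := hf.isTrace_trace i
  have h' : Approx1 K.inner f ψ := ⟨h1, h2, h3⟩
  refine l2Lim_of_tendsto (fun n => memLp_edge_of_continuous (h.1 n).continuous) hT ?_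
  have h4' : L2Lim (K.edgeMeasure i) ψ (trace K i f) := h4
  have lim := (h.l2Lim_edge_diff hf h' i).add h4'.tendsto_l2n
  rw [add_zero] at lim
  refine squeeze_zero (fun _ => l2n_nonneg _ _) (fun n => ?_) lim
  have e : φ n - trace K i f = (φ n - ψ n) + (ψ n - trace K i f) := by abel
  rw [e]
  exact l2n_add_le ((memLp_edge_of_continuous (h.1 n).continuous).sub (memLp_edge_of_continuous (h1 n).continuous))
    ((memLp_edge_of_continuous (h1 n).continuous).sub hT)

theorem Approx1.trace_ae_eq (hf : MemH1 K.inner f) (h : Approx1 K.inner f φ) {T : Plane → ℝ}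
    (hT : AEStronglyMeasurable T (K.edgeMeasure i)) (hl : L2Lim (K.edgeMeasure i) φ T) :
    trace K i f =ᵐ[K.edgeMeasure i] T :=
  (h.l2Lim_trace hf i).unique hl (fun n => (h.1 n).continuous.aestronglyMeasurable) (hf.memLp_trace i).1 hT

theorem trace_congr (h : f =ᵐ[volume.restrict K.inner] f') (i : Fin (K.extra + 3)) : trace K i f = trace K i f' := by
  have : IsTrace K i f = IsTrace K i f' := by
    funext T
    have e : ∀ φ : ℕ → Plane → ℝ, (fun m => eLpNorm (φ m - f) 2 (volume.restrict K.inner)) =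
        fun m => eLpNorm (φ m - f') 2 (volume.restrict K.inner) := fun φ => by
      funext m; exact eLpNorm_congr_ae ((ae_eq_refl _).sub h)
    simp only [IsTrace, e, weakPartial_congr h]
  exact dite_choose_congr this

theorem trace_add (hf : MemH1 K.inner f) (hg : MemH1 K.inner g) (i : Fin (K.extra + 3)) :
    trace K i (f + g) =ᵐ[K.edgeMeasure i] trace K i f + trace K i g := by
  obtain ⟨φ, hφ⟩ := hf.exists_approx
  obtain ⟨ψ, hψ⟩ := hg.exists_approx
  refine (hφ.add K.isOpen_inner hf hg hψ).trace_ae_eq (hf.add K.isOpen_inner hg)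
    ((hf.memLp_trace i).1.add (hg.memLp_trace i).1) ?_
  exact (hφ.l2Lim_trace hf i).add (hψ.l2Lim_trace hg i) (fun n => (hφ.1 n).continuous.aestronglyMeasurable)
    (fun n => (hψ.1 n).continuous.aestronglyMeasurable) (hf.memLp_trace i).1 (hg.memLp_trace i).1

theorem trace_const_smul (hf : MemH1 K.inner f) (c : ℝ) (i : Fin (K.extra + 3)) :
    trace K i (c • f) =ᵐ[K.edgeMeasure i] c • trace K i f := by
  obtain ⟨φ, hφ⟩ := hf.exists_approx
  exact (hφ.const_smul K.isOpen_inner hf c).trace_ae_eq (hf.const_smul K.isOpen_inner c)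
    ((hf.memLp_trace i).1.const_smul c) ((hφ.l2Lim_trace hf i).const_smul c)

theorem trace_sub (hf : MemH1 K.inner f) (hg : MemH1 K.inner g) (i : Fin (K.extra + 3)) :
    trace K i (f - g) =ᵐ[K.edgeMeasure i] trace K i f - trace K i g := by
  have e : f - g = f + (-1 : ℝ) • g := by rw [neg_one_smul, sub_eq_add_neg]
  rw [e]
  refine (trace_add hf (hg.const_smul K.isOpen_inner (-1)) i).trans ?_
  filter_upwards [trace_const_smul hg (-1) i] with x hx
  simp only [Pi.add_apply, Pi.sub_apply, hx, Pi.smul_apply, smul_eq_mul]; ring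

theorem L2Lim.edge_mul (hp : Continuous p) (h : L2Lim (K.edgeMeasure i) φ f) :
    L2Lim (K.edgeMeasure i) (fun m => p * φ m) (p * f) := by
  obtain ⟨C, hC⟩ := (isCompact_edge (K := K) i).exists_bound_of_continuousOn hp.continuousOn
  refine h.bdd_mul (C := C) ?_
  filter_upwards [ae_edgeMeasure_mem_edge i] with x hx using hC x hx

theorem trace_smooth_mul (hp : ContDiff ℝ ∞ p) (hf : MemH1 K.inner f) (i : Fin (K.extra + 3)) :
    trace K i (p * f) =ᵐ[K.edgeMeasure i] p * trace K i f := by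
  obtain ⟨φ, hφ⟩ := hf.exists_approx
  exact (hφ.smooth_mul K.isOpen_inner K.isBounded_inner hf hp).trace_ae_eq
    (hf.smooth_mul K.isOpen_inner K.isBounded_inner hp)
    (hp.continuous.aestronglyMeasurable.mul (hf.memLp_trace i).1) ((hφ.l2Lim_trace hf i).edge_mul hp.continuous)

theorem trace_of_contDiff (hp : ContDiff ℝ ∞ p) (i : Fin (K.extra + 3)) :
    trace K i p =ᵐ[K.edgeMeasure i] p :=
  (approx1_const K.isOpen_inner hp).trace_ae_eq (memH1_of_contDiff K.isBounded_inner hp)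
    hp.continuous.aestronglyMeasurable (L2Lim.const _ _)

theorem l2Lim_edge_of_tendstoUniformlyOn (hφ : ∀ m, Continuous (φ m)) (hf : ContinuousOn f (K.edge i))
    (h : TendstoUniformlyOn φ f atTop (K.edge i)) : L2Lim (K.edgeMeasure i) φ f := by
  refine l2Lim_of_tendsto (fun n => memLp_edge_of_continuous (hφ n)) (memLp_edge hf) ?_
  have m1 : MemLp (fun _ : Plane => (1:ℝ)) 2 (K.edgeMeasure i) := memLp_edge_of_continuous continuous_const
  rw [Metric.tendsto_atTop]
  intro ε hε
  set δ := ε / (l2n (K.edgeMeasure i) (fun _ => 1) + 1) with hδ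
  have l0 := l2n_nonneg (K.edgeMeasure i) (fun _ => 1)
  have δ0 : 0 < δ := by positivity
  obtain ⟨N, hN⟩ := eventually_atTop.1 (Metric.tendstoUniformlyOn_iff.1 h δ δ0)
  refine ⟨N, fun n hn => ?_⟩
  rw [Real.dist_eq, sub_zero, abs_of_nonneg (l2n_nonneg _ _)]
  have : l2n (K.edgeMeasure i) (φ n - f) ≤ l2n (K.edgeMeasure i) (δ • fun _ => (1:ℝ)) := by
    refine ENNReal.toReal_mono (m1.const_smul δ).2.ne (eLpNorm_mono_ae ?_)
    filter_upwards [ae_edgeMeasure_mem_edge i] with x hx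
    have := (hN n hn x hx).le
    rw [dist_comm, dist_eq_norm] at this
    simpa [abs_of_pos δ0] using this
  rw [l2n_const_smul, abs_of_pos δ0] at this
  refine this.trans_lt ?_
  calc _ < δ * (l2n (K.edgeMeasure i) (fun _ => 1) + 1) := by gcongr; linarith
    _ = ε := by rw [hδ]; field_simp

theorem trace_ae_eq_contRep (hf : MemH2 K.inner f) (i : Fin (K.extra + 3)) :
    trace K i f =ᵐ[K.edgeMeasure i] contRep K f := by
  obtain ⟨φ, hφ⟩ := hf.exists_approx
  have hc := hf.continuousOn_contRep.mono (edge_subset_carrier (i := i))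
  exact hφ.1.trace_ae_eq hf.1 (memLp_edge hc).1 (l2Lim_edge_of_tendstoUniformlyOn (fun m => (hφ.1.1 m).continuous) hc
    ((hφ.tendstoUniformlyOn_contRep hf).mono edge_subset_carrier))

/-- Green's formula for `H¹` functions. -/
theorem integral_mul_weakPartial (hf : MemH1 K.inner f) (hg : MemH1 K.inner g) (a : Fin 2) :
    (∫ x in K.inner, weakPartial K.inner a f x * g x) + ∫ x in K.inner, f x * weakPartial K.inner a g x =
      ∑ i, K.normal i a * ∫ x, trace K i f x * trace K i g x ∂(K.edgeMeasure i) := by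
  obtain ⟨φ, hφ⟩ := hf.exists_approx
  obtain ⟨ψ, hψ⟩ := hg.exists_approx
  have m := fun {q : Plane → ℝ} (hq : Continuous q) => memLp_of_continuous (U := K.inner) K.isBounded_inner hq
  have l1 := (hφ.2.2 a).integral_mul hψ.2.1 (fun n => m (pderiv_contDiff (hφ.1 n) a).continuous) (fun n => m (hψ.1 n).continuous)
    (hf.memLp_weakPartial K.isOpen_inner a) hg.1
  have l2 := hφ.2.1.integral_mul (hψ.2.2 a) (fun n => m (hφ.1 n).continuous) (fun n => m (pderiv_contDiff (hψ.1 n) a).continuous)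
    hf.1 (hg.memLp_weakPartial K.isOpen_inner a)
  have l3 := tendsto_finsetSum Finset.univ fun i _ => ((hφ.l2Lim_trace hf i).integral_mul (hψ.l2Lim_trace hg i)
    (fun n => memLp_edge_of_continuous (hφ.1 n).continuous) (fun n => memLp_edge_of_continuous (hψ.1 n).continuous)
    (hf.memLp_trace i) (hg.memLp_trace i)).const_mul (K.normal i a)
  refine tendsto_nhds_unique (l1.add l2) (l3.congr fun n => ?_)
  exact (ConvexPolygon.integral_mul_pderiv (hφ.1 n) (hψ.1 n) a).symm

/-! ### Tangential and normal derivatives on an edge -/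

/-- Integration by parts along an edge, for smooth functions. -/
theorem integral_edge_tangential {φ : Plane → ℝ} (hφ : ContDiff ℝ ∞ φ) (hp : ContDiff ℝ ∞ p) (i : Fin (K.extra + 3)) :
    ∫ x, p x * ∑ a, K.dvec i a * pderiv a φ x ∂(K.edgeMeasure i) =
      K.edgeLength i * (p (K.vert (i + 1)) * φ (K.vert (i + 1)) - p (K.vert i) * φ (K.vert i)) -
      ∫ x, (∑ a, K.dvec i a * pderiv a p x) * φ x ∂(K.edgeMeasure i) := by
  have cD : ∀ {q : Plane → ℝ}, ContDiff ℝ ∞ q → Continuous fun x => ∑ a, K.dvec i a * pderiv a q x := fun hq =>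
    continuous_finsetSum _ fun a _ => continuous_const.mul (pderiv_contDiff hq a).continuous
  have c1 : Continuous fun x => p x * ∑ a, K.dvec i a * pderiv a φ x := hp.continuous.mul (cD hφ)
  have c2 : Continuous fun x => (∑ a, K.dvec i a * pderiv a p x) * φ x := (cD hp).mul hφ.continuous
  rw [integral_edgeMeasure i c1.aestronglyMeasurable, integral_edgeMeasure i c2.aestronglyMeasurable, ← mul_sub]
  congr 1
  have hd : ∀ {q : Plane → ℝ}, ContDiff ℝ ∞ q → ∀ s, HasDerivAt (fun s => q (K.edgePt i s)) (∑ a, K.dvec i a * pderiv a q (K.edgePt i s)) s := by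
    intro q hq s
    have := hasDerivAt_comp_line hq (K.vert i) (K.dvec i) s
    simpa only [← edgePt_eq] using this
  have ce := K.continuous_edgePt i
  have := intervalIntegral.integral_mul_deriv_eq_deriv_mul (a := 0) (b := 1) (fun s _ => hd hp s) (fun s _ => hd hφ s)
    (((cD hp).comp ce).intervalIntegrable _ _) (((cD hφ).comp ce).intervalIntegrable _ _)
  rw [edgePt_zero, edgePt_one] at this
  simpa only [integral_Icc_eq_integral_Ioc, ← intervalIntegral.integral_of_le zero_le_one] using this

/-- The derivative along the `i`-th edge (not normalized) of an `H²` function. -/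
noncomputable def tangentialDeriv (K : ConvexPolygon) (i : Fin (K.extra + 3)) (f : Plane → ℝ) (x : Plane) : ℝ :=
  ∑ a, K.dvec i a * trace K i (weakPartial K.inner a f) x

theorem memLp_tangentialDeriv (hf : MemH2 K.inner f) (i : Fin (K.extra + 3)) :
    MemLp (tangentialDeriv K i f) 2 (K.edgeMeasure i) :=
  memLp_finsetSum _ fun a _ => ((hf.2 a).memLp_trace i).const_mul _

theorem memLp_normalDeriv (hf : MemH2 K.inner f) (i : Fin (K.extra + 3)) :
    MemLp (normalDeriv K i f) 2 (K.edgeMeasure i) :=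
  memLp_finsetSum _ fun a _ => ((hf.2 a).memLp_trace i).const_mul _

theorem Approx2.l2Lim_tangentialDeriv (hf : MemH2 K.inner f) (h : Approx2 K.inner f φ) (i : Fin (K.extra + 3)) :
    L2Lim (K.edgeMeasure i) (fun m x => ∑ a, K.dvec i a * pderiv a (φ m) x) (tangentialDeriv K i f) := by
  have l := fun a => ((h.2 a).l2Lim_trace (hf.2 a) i).const_smul (K.dvec i a)
  have c := fun a m => (pderiv_contDiff (h.1.1 m) a).continuous.const_smul (K.dvec i a)
  refine ((l 0).add (l 1) (fun m => (c 0 m).aestronglyMeasurable) (fun m => (c 1 m).aestronglyMeasurable)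
    (((hf.2 0).memLp_trace i).1.const_smul _) (((hf.2 1).memLp_trace i).1.const_smul _)).congr (fun m => ?_) ?_
  · exact ae_of_all _ fun x => by simp [Fin.sum_univ_two]
  · exact ae_of_all _ fun x => by simp [Fin.sum_univ_two, tangentialDeriv]

theorem integral_tangentialDeriv (hf : MemH2 K.inner f) (hp : ContDiff ℝ ∞ p) (i : Fin (K.extra + 3)) :
    ∫ x, p x * tangentialDeriv K i f x ∂(K.edgeMeasure i) =
      K.edgeLength i * (p (K.vert (i + 1)) * contRep K f (K.vert (i + 1)) - p (K.vert i) * contRep K f (K.vert i)) -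
      ∫ x, (∑ a, K.dvec i a * pderiv a p x) * contRep K f x ∂(K.edgeMeasure i) := by
  obtain ⟨φ, hφ⟩ := hf.exists_approx
  have hu := hφ.tendstoUniformlyOn_contRep hf
  have hc := hf.continuousOn_contRep.mono (edge_subset_carrier (i := i))
  have cD : ∀ {q : Plane → ℝ}, ContDiff ℝ ∞ q → Continuous fun x => ∑ a, K.dvec i a * pderiv a q x := fun hq =>
    continuous_finsetSum _ fun a _ => continuous_const.mul (pderiv_contDiff hq a).continuous
  have l1 := (L2Lim.const (K.edgeMeasure i) p).integral_mul (hφ.l2Lim_tangentialDeriv hf i)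
    (fun _ => memLp_edge_of_continuous hp.continuous) (fun m => memLp_edge_of_continuous (cD (hφ.1.1 m)))
    (memLp_edge_of_continuous hp.continuous) (memLp_tangentialDeriv hf i)
  have l2 := (L2Lim.const (K.edgeMeasure i) (fun x => ∑ a, K.dvec i a * pderiv a p x)).integral_mul
    (l2Lim_edge_of_tendstoUniformlyOn (fun m => (hφ.1.1 m).continuous) hc (hu.mono edge_subset_carrier))
    (fun _ => memLp_edge_of_continuous (cD hp)) (fun m => memLp_edge_of_continuous (hφ.1.1 m).continuous)
    (memLp_edge_of_continuous (cD hp)) (memLp_edge hc)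
  have pt := fun j => (hu.tendsto_at (vert_mem_carrier (K := K) j))
  have l3 := ((((pt (i + 1)).const_mul (p (K.vert (i + 1)))).sub ((pt i).const_mul (p (K.vert i)))).const_mul (K.edgeLength i)).sub l2
  refine tendsto_nhds_unique l1 (l3.congr fun m => ?_)
  exact (integral_edge_tangential (hφ.1.1 m) hp i).symm

/-- Integration along the edge shows that the tangential derivative is orthogonal to every smooth
function. It is itself an `L²` limit of smooth functions, hence orthogonal to itself. -/
theorem tangentialDeriv_eq_zero (hf : MemH2 K.inner f) (h : ∀ x ∈ K.edge i, contRep K f x = 0) :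
    tangentialDeriv K i f =ᵐ[K.edgeMeasure i] 0 := by
  have h0 : ∀ p : Plane → ℝ, ContDiff ℝ ∞ p → ∫ x, p x * tangentialDeriv K i f x ∂(K.edgeMeasure i) = 0 := by
    intro p hp
    rw [integral_tangentialDeriv hf hp, h _ vert_mem_edge, h _ vert_succ_mem_edge, integral_eq_zero_of_ae]
    · simp
    · filter_upwards [ae_edgeMeasure_mem_edge i] with x hx
      simp [h x hx]
  obtain ⟨φ, hφ⟩ := hf.exists_approx
  have hs : ∀ m, ContDiff ℝ ∞ fun x => ∑ a, K.dvec i a * pderiv a (φ m) x := fun m =>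
    ContDiff.sum fun a _ => contDiff_const.mul (pderiv_contDiff (hφ.1.1 m) a)
  have mT := memLp_tangentialDeriv hf i
  have l := (hφ.l2Lim_tangentialDeriv hf i).integral_mul_const (fun m => memLp_edge_of_continuous (hs m).continuous)
    mT mT
  simp only [h0 _ (hs _)] at l
  have e := tendsto_nhds_unique tendsto_const_nhds l
  rw [← l2n_eq_zero_iff mT, ← sq_eq_zero_iff, l2n_sq mT, e]
  simp only [sq]

end StrainGradientVEM

namespace StrainGradientVEM
open ConvexPolygon

/-! ## The space `H² ∩ H¹₀` on a convex polygon -/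

/-- A smooth function on the line that agrees with `1 / (s + ε)` for `s > -ε / 2`. -/
theorem exists_smooth_reciprocal {ε : ℝ} (hε : 0 < ε) :
    ∃ r : ℝ → ℝ, ContDiff ℝ ∞ r ∧ ∀ s, 0 ≤ s → r s = (s + ε)⁻¹ := by
  refine ⟨fun s => Real.smoothTransition (2 * s / ε + 1) * (s + ε)⁻¹, ?_, fun s h0 => ?_⟩
  · rw [contDiff_iff_contDiffAt]
    intro s
    by_cases hs : s + ε = 0
    · have : (fun s => Real.smoothTransition (2 * s / ε + 1) * (s + ε)⁻¹) =ᶠ[𝓝 s] fun _ => 0 := by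
        have : ∀ᶠ t in 𝓝 s, t < -(ε / 2) := gt_mem_nhds (by linarith)
        filter_upwards [this] with t ht
        rw [Real.smoothTransition.zero_of_nonpos, zero_mul]
        have : 2 * t / ε ≤ -1 := by rw [div_le_iff₀ hε]; linarith
        linarith
      exact contDiffAt_const.congr_of_eventuallyEq this
    · have h1 : ContDiff ℝ ∞ fun s => Real.smoothTransition (2 * s / ε + 1) :=
        contDiff_smoothTransition.comp (by fun_prop)
      exact h1.contDiffAt.mul ((contDiffAt_id.add contDiffAt_const).inv hs)
  · simp only
    rw [Real.smoothTransition.one_of_one_le, one_mul]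
    have : 0 ≤ 2 * s / ε := by positivity
    linarith

theorem pderiv_comp {r : ℝ → ℝ} (hr : Differentiable ℝ r) {σ : Plane → ℝ} (hσ : Differentiable ℝ σ) (a : Fin 2) (x : Plane) :
    pderiv a (fun x => r (σ x)) x = deriv r (σ x) * pderiv a σ x := by
  have := (hr (σ x)).hasDerivAt.comp_hasFDerivAt x (hσ x).hasFDerivAt
  have e : fderiv ℝ (fun x => r (σ x)) x = deriv r (σ x) • fderiv ℝ σ x := this.fderiv
  rw [pderiv, e]; rfl

variable {K : ConvexPolygon} {i : Fin (K.extra + 3)} {f f' g h p w χ : Plane → ℝ} {φ ψ : ℕ → Plane → ℝ}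

/-- The `H²` functions with zero boundary values. -/
def MemH2H10 (K : ConvexPolygon) (w : Plane → ℝ) : Prop :=
  MemH2 K.inner w ∧ ∀ x ∈ frontier K.carrier, contRep K w x = 0

theorem MemH2H10.edge (hw : MemH2H10 K w) (i : Fin (K.extra + 3)) : ∀ x ∈ K.edge i, contRep K w x = 0 :=
  fun x hx => hw.2 x (edge_subset_frontier hx)

theorem MemH2H10.add (hw : MemH2H10 K w) (hg : MemH2H10 K g) : MemH2H10 K (w + g) :=
  ⟨hw.1.add K.isOpen_inner hg.1, fun x hx => by
    rw [contRep_add hw.1 hg.1 (K.isClosed_carrier.frontier_subset hx), Pi.add_apply, hw.2 x hx, hg.2 x hx, add_zero]⟩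

theorem MemH2H10.const_smul (hw : MemH2H10 K w) (c : ℝ) : MemH2H10 K (c • w) :=
  ⟨hw.1.const_smul K.isOpen_inner c, fun x hx => by
    rw [contRep_const_smul hw.1 c (K.isClosed_carrier.frontier_subset hx), Pi.smul_apply, hw.2 x hx, smul_zero]⟩

theorem MemH2H10.trace_eq_zero (hw : MemH2H10 K w) (i : Fin (K.extra + 3)) : trace K i w =ᵐ[K.edgeMeasure i] 0 := by
  filter_upwards [trace_ae_eq_contRep hw.1 i, ae_edgeMeasure_mem_edge i] with x hx hxe
  rw [hx, hw.edge i x hxe]; rfl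

theorem pderiv_coord_sub (a b : Fin 2) (t : ℝ) (x : Plane) :
    pderiv b (fun x : Plane => x a - t) x = if a = b then 1 else 0 := by
  have h1 : HasFDerivAt (fun x : Plane => x a - t) (EuclideanSpace.proj a : Plane →L[ℝ] ℝ) x :=
    ((EuclideanSpace.proj a : Plane →L[ℝ] ℝ).hasFDerivAt).sub_const _
  rw [pderiv, h1.fderiv]; simp

theorem l2n_mul_le {U : Set Plane} (hU : MeasurableSet U) {q : Plane → ℝ} {M : ℝ} (M0 : 0 ≤ M) (hM : ∀ x ∈ U, |q x| ≤ M)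
    (hf : MemLp f 2 (volume.restrict U)) : l2n (volume.restrict U) (q * f) ≤ M * l2n (volume.restrict U) f := by
  have : M * l2n (volume.restrict U) f = l2n (volume.restrict U) (M • f) := by rw [l2n_const_smul, abs_of_nonneg M0]
  rw [this]
  refine ENNReal.toReal_mono (hf.const_smul M).2.ne (eLpNorm_mono_ae ?_)
  filter_upwards [ae_restrict_mem hU] with x hx
  rw [Pi.mul_apply, norm_mul, Pi.smul_apply, norm_smul, Real.norm_of_nonneg M0]
  exact mul_le_mul_of_nonneg_right (hM x hx) (norm_nonneg _)

theorem dist_le_diam {x y : Plane} (hx : x ∈ K.carrier) (hy : y ∈ K.carrier) : dist x y ≤ K.diam :=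
  Metric.dist_le_diam_of_mem K.isCompact_carrier.isBounded hx hy

theorem diam_pos (K : ConvexPolygon) : 0 < K.diam :=
  (edgeLength_pos (K := K) 0).trans_le (dist_le_diam (vert_mem_carrier _) (vert_mem_carrier _))

/-- Green's formula for `w` and `q w` with `q = x_a - c_a` has no boundary term and reads `∫ w² = -2
∫ q w ∂_a w`, where `|q| ≤ diam K`. One partial derivative suffices. -/
theorem friedrichs (hw : MemH1 K.inner w) (h0 : ∀ i, trace K i w =ᵐ[K.edgeMeasure i] 0) (a : Fin 2) :
    l2n (volume.restrict K.inner) w ≤ 2 * K.diam * l2n (volume.restrict K.inner) (weakPartial K.inner a w) := by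
  obtain ⟨c, hc⟩ := K.inner_nonempty
  set μ := volume.restrict K.inner
  have hU := K.isOpen_inner
  set q : Plane → ℝ := fun x => x a - c a with hq
  have hqs : ContDiff ℝ ∞ q := by fun_prop
  have hqw := hw.smooth_mul hU K.isBounded_inner hqs
  have mw := hw.memLp_weakPartial hU a
  have mq := memLp_continuous_mul K.isBounded_inner hqs.continuous mw hU.measurableSet
  have G := integral_mul_weakPartial hw hqw a
  rw [Finset.sum_eq_zero] at G
  swap
  · intro j _
    rw [integral_eq_zero_of_ae, mul_zero]
    filter_upwards [h0 j] with x hx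
    simp [hx]
  have e1 : ∫ x in K.inner, w x * weakPartial K.inner a (q * w) x =
      (∫ x in K.inner, weakPartial K.inner a w x * (q * w) x) + ∫ x in K.inner, w x ^ 2 := by
    rw [← integral_add (mw.integrable_mul' hqw.1) hw.1.integrable_sq]
    refine integral_congr_ae ?_
    filter_upwards [weakPartial_smooth_mul hU hqs hw a] with x hx
    have hp : pderiv a q x = 1 := by rw [hq, pderiv_coord_sub, if_pos rfl]
    simp only [hx, Pi.add_apply, Pi.mul_apply, hp]
    ring
  rw [e1, ← l2n_sq hw.1] at G
  have e2 : ∫ x in K.inner, weakPartial K.inner a w x * (q * w) x = ∫ x in K.inner, w x * (q * weakPartial K.inner a w) x :=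
    integral_congr_ae (ae_of_all _ fun x => by simp only [Pi.mul_apply]; ring)
  have h1 := abs_integral_mul_le hw.1 mq
  have h2 : l2n μ (q * weakPartial K.inner a w) ≤ K.diam * l2n μ (weakPartial K.inner a w) := by
    refine l2n_mul_le hU.measurableSet (diam_pos K).le (fun x hx => ?_) mw
    have := abs_coord_le_norm (x - c) a
    rw [← dist_eq_norm] at this
    exact this.trans (dist_le_diam (inner_subset_carrier hx) (inner_subset_carrier hc))
  rw [e2] at G
  have h3 := neg_abs_le (∫ x in K.inner, w x * (q * weakPartial K.inner a w) x)
  have n0 := l2n_nonneg μ w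
  have h4 := h1.trans (mul_le_mul_of_nonneg_left h2 n0)
  by_contra hlt
  push Not at hlt
  have n1 := l2n_nonneg μ (weakPartial K.inner a w)
  have : 0 < l2n μ w := lt_of_le_of_lt (by have := (diam_pos K).le; positivity) hlt
  nlinarith

/-- Green's formula for the gradient of a function with zero boundary values. -/
theorem MemH2H10.integral_grad_sq (hw : MemH2H10 K w) :
    ∑ a, ∫ x in K.inner, weakPartial K.inner a w x ^ 2 = -∫ x in K.inner, w x * weakLaplacian K.inner w x := by
  have G := fun a => integral_mul_weakPartial hw.1.1 (hw.1.2 a) a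
  have hz : ∀ a, ∑ i, K.normal i a * ∫ x, trace K i w x * trace K i (weakPartial K.inner a w) x ∂(K.edgeMeasure i) = 0 := fun a => by
    refine Finset.sum_eq_zero fun j _ => ?_
    rw [integral_eq_zero_of_ae, mul_zero]
    filter_upwards [hw.trace_eq_zero j] with x hx
    simp [hx]
  simp only [hz] at G
  have m2 := fun a => (hw.1.2 a).memLp_weakPartial K.isOpen_inner a
  have e : ∫ x in K.inner, w x * weakLaplacian K.inner w x =
      ∑ a, ∫ x in K.inner, w x * weakPartial K.inner a (weakPartial K.inner a w) x := by
    rw [← integral_finsetSum _ fun a _ => hw.1.1.1.integrable_mul' (m2 a)]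
    exact integral_congr_ae (ae_of_all _ fun x => by simp only [weakLaplacian, Finset.mul_sum])
  rw [e, ← Finset.sum_neg_distrib]
  refine Finset.sum_congr rfl fun a _ => ?_
  have := G a
  have e2 : ∫ x in K.inner, weakPartial K.inner a w x ^ 2 = ∫ x in K.inner, weakPartial K.inner a w x * weakPartial K.inner a w x :=
    integral_congr_ae (ae_of_all _ fun x => by simp only [sq])
  rw [e2]; linarith

/-- From `|w|₁² = -∫ w Δw ≤ ‖w‖ ‖Δw‖` and Friedrichs' inequality for `‖w‖`, after dividing by
`|w|₁`. -/
theorem MemH2H10.grad_le (hw : MemH2H10 K w) :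
    √(∑ a, ∫ x in K.inner, weakPartial K.inner a w x ^ 2) ≤ 2 * K.diam * l2n (volume.restrict K.inner) (weakLaplacian K.inner w) := by
  set μ := volume.restrict K.inner
  have hU := K.isOpen_inner
  have m1 := fun a => hw.1.1.memLp_weakPartial hU a
  set S := ∑ a, ∫ x in K.inner, weakPartial K.inner a w x ^ 2 with hS
  have S0 : 0 ≤ S := Finset.sum_nonneg fun a _ => integral_nonneg fun x => sq_nonneg _
  have h1 := abs_integral_mul_le hw.1.1.1 (hw.1.memLp_weakLaplacian hU)
  have h2 := friedrichs hw.1.1 hw.trace_eq_zero 0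
  have h3 : l2n μ (weakPartial K.inner 0 w) ≤ √S := by
    rw [l2n_eq_sqrt (m1 0)]
    refine Real.sqrt_le_sqrt ?_
    exact Finset.single_le_sum (f := fun a => ∫ x in K.inner, weakPartial K.inner a w x ^ 2)
      (fun a _ => integral_nonneg fun x => sq_nonneg _) (Finset.mem_univ 0)
  have h4 := hw.integral_grad_sq
  rw [← hS] at h4
  have h5 := neg_abs_le (∫ x in K.inner, w x * weakLaplacian K.inner w x)
  have sq : √S ^ 2 = S := Real.sq_sqrt S0
  have d0 := (diam_pos K).le
  have nΔ := l2n_nonneg μ (weakLaplacian K.inner w)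
  have h6 : √S ^ 2 ≤ (2 * K.diam * √S) * l2n μ (weakLaplacian K.inner w) := by
    rw [sq.trans h4]
    have : l2n μ w ≤ 2 * K.diam * √S := h2.trans (by gcongr)
    have := mul_le_mul_of_nonneg_right this nΔ
    linarith
  by_contra hlt
  push Not at hlt
  have : 0 < √S := lt_of_le_of_lt (by positivity) hlt
  nlinarith

/-! ### The Jacobian identity -/

/-- The Jacobian is a divergence: the mixed derivatives of `ψ` cancel, and the edge terms are `g`
times the tangential derivative of `ψ`. -/
theorem integral_jacobian_smooth {ψ : Plane → ℝ} (hg : MemH1 K.inner g) (hψ : ContDiff ℝ ∞ ψ)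
    (h : ∀ j, ∀ᵐ x ∂(K.edgeMeasure j), trace K j g x * (K.normal j 0 * pderiv 1 ψ x - K.normal j 1 * pderiv 0 ψ x) = 0) :
    (∫ x in K.inner, weakPartial K.inner 0 g x * pderiv 1 ψ x) - ∫ x in K.inner, weakPartial K.inner 1 g x * pderiv 0 ψ x = 0 := by
  have hs := fun a => pderiv_contDiff hψ a
  have m := fun a => memH1_of_contDiff (U := K.inner) K.isBounded_inner (hs a)
  have G0 := integral_mul_weakPartial hg (m 1) 0
  have G1 := integral_mul_weakPartial hg (m 0) 1
  have e0 : ∫ x in K.inner, g x * weakPartial K.inner 0 (pderiv 1 ψ) x = ∫ x in K.inner, g x * weakPartial K.inner 1 (pderiv 0 ψ) x := by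
    refine integral_congr_ae ?_
    filter_upwards [weakPartial_of_contDiff K.isOpen_inner (hs 1) 0, weakPartial_of_contDiff K.isOpen_inner (hs 0) 1] with x h0 h1
    rw [h0, h1, pderiv_comm hψ]
  have e1 : ∑ i, K.normal i 0 * ∫ x, trace K i g x * trace K i (pderiv 1 ψ) x ∂(K.edgeMeasure i) =
      ∑ i, K.normal i 1 * ∫ x, trace K i g x * trace K i (pderiv 0 ψ) x ∂(K.edgeMeasure i) := by
    refine Finset.sum_congr rfl fun j _ => ?_
    rw [← integral_const_mul, ← integral_const_mul]
    refine integral_congr_ae ?_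
    filter_upwards [h j, trace_of_contDiff (hs 1) j, trace_of_contDiff (hs 0) j] with x hx h1 h0
    rw [h1, h0]; linarith
  rw [e0] at G0
  linarith

/-- The edge condition is imposed on the approximations of `h`, because the gradient of an `H¹`
function has no trace. -/
theorem integral_jacobian (hg : MemH1 K.inner g) (hh : MemH1 K.inner h) (hψ : Approx1 K.inner h ψ)
    (hc : ∀ m j, ∀ᵐ x ∂(K.edgeMeasure j), trace K j g x * (K.normal j 0 * pderiv 1 (ψ m) x - K.normal j 1 * pderiv 0 (ψ m) x) = 0) :
    (∫ x in K.inner, weakPartial K.inner 0 g x * weakPartial K.inner 1 h x) -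
      ∫ x in K.inner, weakPartial K.inner 1 g x * weakPartial K.inner 0 h x = 0 := by
  have m := fun {q : Plane → ℝ} (hq : Continuous q) => memLp_of_continuous (U := K.inner) K.isBounded_inner hq
  have mg := fun a => hg.memLp_weakPartial K.isOpen_inner a
  have mh := fun a => hh.memLp_weakPartial K.isOpen_inner a
  have l := fun a b => (L2Lim.const (volume.restrict K.inner) (weakPartial K.inner b g)).integral_mul (hψ.2.2 a) (fun _ => mg b)
    (fun n => m (pderiv_contDiff (hψ.1 n) a).continuous) (mg b) (mh a)
  refine tendsto_nhds_unique ((l 1 0).sub (l 0 1)) ?_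
  simp only [integral_jacobian_smooth hg (hψ.1 _) (hc _)]
  exact tendsto_const_nhds

theorem pderiv_tangential_eq_zero {ψ : Plane → ℝ} (hψ : ContDiff ℝ ∞ ψ) (h : ∀ x ∈ K.edge i, ψ x = 0) :
    ∀ᵐ x ∂(K.edgeMeasure i), K.normal i 0 * pderiv 1 ψ x - K.normal i 1 * pderiv 0 ψ x = 0 := by
  filter_upwards [ae_edgeMeasure_mem i] with x hx
  obtain ⟨s, hs, rfl⟩ := hx
  have h1 := hasDerivAt_comp_line hψ (K.vert i) (K.dvec i) s
  simp only [← edgePt_eq] at h1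
  have h2 : HasDerivAt (fun s => ψ (K.edgePt i s)) 0 s := by
    refine (hasDerivAt_const s (0:ℝ)).congr_of_eventuallyEq ?_
    filter_upwards [Ioo_mem_nhds hs.1 hs.2] with t ht
    exact h _ (edgePt_mem_edge ⟨ht.1.le, ht.2.le⟩)
  have h3 := h1.unique h2
  rw [Fin.sum_univ_two] at h3
  have e0 : K.normal i 0 = (K.edgeLength i)⁻¹ * K.dvec i 1 := by simp [ConvexPolygon.normal, ConvexPolygon.dvec]
  have e1 : K.normal i 1 = -((K.edgeLength i)⁻¹ * K.dvec i 0) := by simp [ConvexPolygon.normal, ConvexPolygon.dvec]; ring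
  rw [e0, e1]
  linear_combination (K.edgeLength i)⁻¹ * h3

/-- The integrand of the weighted Jacobian identity. -/
noncomputable def jacWeight (K : ConvexPolygon) (w χ : Plane → ℝ) (x : Plane) : ℝ :=
  2 * χ x * (weakPartial K.inner 0 (weakPartial K.inner 0 w) x * weakPartial K.inner 1 (weakPartial K.inner 1 w) x -
    weakPartial K.inner 1 (weakPartial K.inner 0 w) x * weakPartial K.inner 0 (weakPartial K.inner 1 w) x) +
  (weakPartial K.inner 0 w x * (pderiv 0 χ x * weakPartial K.inner 1 (weakPartial K.inner 1 w) x -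
      pderiv 1 χ x * weakPartial K.inner 0 (weakPartial K.inner 1 w) x) -
    weakPartial K.inner 1 w x * (pderiv 0 χ x * weakPartial K.inner 1 (weakPartial K.inner 0 w) x -
      pderiv 1 χ x * weakPartial K.inner 0 (weakPartial K.inner 0 w) x))

/-- Take `g` and `h` to be the derivatives of `w` along and across the `i`-th edge. The Jacobians of
`(χ g, h)` and of `(g, χ h)` both integrate to zero: on the `i`-th edge `g = 0`, on the others `χ =
0`, a property shared by the approximations `χ ψ m`. The sum of the two Jacobians contains only
first derivatives of `χ` and undifferentiated components of `∇w`. -/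
theorem integral_jacWeight_edge (hw : MemH2H10 K w) (hχ : ContDiff ℝ ∞ χ) (hz : ∀ j, j ≠ i → ∀ x ∈ K.edge j, χ x = 0) :
    ∫ x in K.inner, jacWeight K w χ x = 0 := by
  have hU := K.isOpen_inner
  have hb := K.isBounded_inner
  set f0 := weakPartial K.inner 0 w with hf0
  set f1 := weakPartial K.inner 1 w with hf1
  have H0 : MemH1 K.inner f0 := hw.1.2 0
  have H1 : MemH1 K.inner f1 := hw.1.2 1
  set d := K.dvec i
  set g : Plane → ℝ := d 0 • f0 + d 1 • f1 with hg
  set h : Plane → ℝ := (-d 1) • f0 + d 0 • f1 with hh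
  have Hg : MemH1 K.inner g := (H0.const_smul hU _).add hU (H1.const_smul hU _)
  have Hh : MemH1 K.inner h := (H0.const_smul hU _).add hU (H1.const_smul hU _)
  have tg : trace K i g =ᵐ[K.edgeMeasure i] 0 := by
    filter_upwards [trace_add (H0.const_smul hU (d 0)) (H1.const_smul hU (d 1)) i, trace_const_smul H0 (d 0) i,
      trace_const_smul H1 (d 1) i, tangentialDeriv_eq_zero hw.1 (hw.edge i)] with x h1 h2 h3 h4
    rw [h1, Pi.add_apply, h2, h3, ← h4, tangentialDeriv, Fin.sum_univ_two]
    rfl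
  obtain ⟨ψ, hψ⟩ := Hh.exists_approx
  have I1 := integral_jacobian (Hg.smooth_mul hU hb hχ) Hh hψ (by
    intro m j
    by_cases hj : j = i
    · subst hj
      filter_upwards [trace_smooth_mul hχ Hg j, tg] with x h1 h2
      rw [h1, Pi.mul_apply, h2]; simp
    · filter_upwards [trace_smooth_mul hχ Hg j, ae_edgeMeasure_mem_edge j] with x h1 h2
      rw [h1, Pi.mul_apply, hz j hj x h2]; ring)
  have I2 := integral_jacobian Hg (Hh.smooth_mul hU hb hχ) (hψ.smooth_mul hU hb Hh hχ) (by
    intro m j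
    by_cases hj : j = i
    · subst hj
      filter_upwards [tg] with x h1
      rw [h1]; simp
    · filter_upwards [pderiv_tangential_eq_zero (i := j) (hχ.mul (hψ.1 m)) (fun x hx => by simp only [hz j hj x hx, zero_mul])] with x h1
      have h1' : K.normal j 0 * pderiv 1 (χ * ψ m) x - K.normal j 1 * pderiv 0 (χ * ψ m) x = 0 := h1
      rw [h1', mul_zero])
  have mg := fun a => Hg.memLp_weakPartial hU a
  have mh := fun a => Hh.memLp_weakPartial hU a
  have mχg := fun a => (Hg.smooth_mul hU hb hχ).memLp_weakPartial hU a
  have mχh := fun a => (Hh.smooth_mul hU hb hχ).memLp_weakPartial hU a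
  rw [← integral_sub ((mχg 0).integrable_mul' (mh 1)) ((mχg 1).integrable_mul' (mh 0))] at I1
  rw [← integral_sub ((mg 0).integrable_mul' (mχh 1)) ((mg 1).integrable_mul' (mχh 0))] at I2
  have I := (integral_add (((mχg 0).integrable_mul' (mh 1)).sub ((mχg 1).integrable_mul' (mh 0)))
    (((mg 0).integrable_mul' (mχh 1)).sub ((mg 1).integrable_mul' (mχh 0)))).trans (congrArg₂ (· + ·) I1 I2)
  rw [add_zero] at I
  have D : ∀ (a b : ℝ) (c : Fin 2), weakPartial K.inner c (a • f0 + b • f1) =ᵐ[volume.restrict K.inner]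
      a • weakPartial K.inner c f0 + b • weakPartial K.inner c f1 := fun a b c =>
    (((H0.isWeakPartial c).const_smul a).add ((H1.isWeakPartial c).const_smul b)).weakPartial_ae hU
  -- The sum is alternating in the pair `(g, h)`. Passing from `(g, h)` to `(∂₀ w, ∂₁ w)` therefore
  -- only costs the determinant `|d|²`, and the edge disappears from the integrand. This is what
  -- allows the identities of different edges to be added.
  have e : ∫ x in K.inner, (d 0 ^ 2 + d 1 ^ 2) * jacWeight K w χ x = 0 := by
    rw [← I]
    refine integral_congr_ae ?_
    filter_upwards [weakPartial_smooth_mul hU hχ Hg 0, weakPartial_smooth_mul hU hχ Hg 1, weakPartial_smooth_mul hU hχ Hh 0,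
      weakPartial_smooth_mul hU hχ Hh 1, D (d 0) (d 1) 0, D (d 0) (d 1) 1, D (-d 1) (d 0) 0, D (-d 1) (d 0) 1] with x a1 a2 a3 a4 a5 a6 a7 a8
    simp only [a1, a2, a3, a4, Pi.add_apply, Pi.mul_apply, Pi.sub_apply]
    rw [← hg] at a5 a6
    rw [← hh] at a7 a8
    rw [a5, a6, a7, a8]
    simp only [hg, hh, Pi.add_apply, Pi.smul_apply, smul_eq_mul, jacWeight, ← hf0, ← hf1]
    ring
  rw [integral_const_mul, mul_eq_zero] at e
  refine e.resolve_left fun h0 => dvec_ne_zero (K := K) i ?_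
  ext a
  have z0 : d 0 = 0 := by nlinarith [sq_nonneg (d 0), sq_nonneg (d 1)]
  have z1 : d 1 = 0 := by nlinarith [sq_nonneg (d 0), sq_nonneg (d 1)]
  fin_cases a
  exacts [z0, z1]

/-! ### Polynomial weights attached to edges and vertices -/

/-- The product of all `ell k` except the `i`-th one. -/
noncomputable def coProd (K : ConvexPolygon) (i : Fin (K.extra + 3)) (x : Plane) : ℝ := ∏ k ∈ Finset.univ.erase i, K.ell k x

theorem contDiff_coProd (i : Fin (K.extra + 3)) : ContDiff ℝ ∞ (coProd K i) :=
  contDiff_prod fun k _ => contDiff_ell k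

theorem coProd_eq_zero {j : Fin (K.extra + 3)} (hj : j ≠ i) {x : Plane} (hx : x ∈ K.edge j) : coProd K i x = 0 :=
  Finset.prod_eq_zero (Finset.mem_erase.2 ⟨hj, Finset.mem_univ _⟩) (ell_eq_zero_of_mem_edge hx)

theorem coProd_nonneg {x : Plane} (hx : x ∈ K.carrier) : 0 ≤ coProd K i x :=
  Finset.prod_nonneg fun k _ => mem_carrier_iff.1 hx k

/-- The product of all `ell k` except those of the two edges at the `i`-th vertex. -/
noncomputable def vertProd (K : ConvexPolygon) (i : Fin (K.extra + 3)) (x : Plane) : ℝ :=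
  ∏ k ∈ (Finset.univ.erase i).erase (i - 1), K.ell k x

theorem contDiff_vertProd (i : Fin (K.extra + 3)) : ContDiff ℝ ∞ (vertProd K i) :=
  contDiff_prod fun k _ => contDiff_ell k

theorem vertProd_nonneg {x : Plane} (hx : x ∈ K.carrier) : 0 ≤ vertProd K i x :=
  Finset.prod_nonneg fun k _ => mem_carrier_iff.1 hx k

theorem coProd_eq_vertProd (i : Fin (K.extra + 3)) (x : Plane) : coProd K i x = K.ell (i - 1) x * vertProd K i x :=
  (Finset.mul_prod_erase _ (fun k => K.ell k x) (Finset.mem_erase.2 ⟨pred_ne i, Finset.mem_univ _⟩)).symm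

theorem coProd_pred_eq_vertProd (i : Fin (K.extra + 3)) (x : Plane) : coProd K (i - 1) x = K.ell i x * vertProd K i x := by
  rw [vertProd, Finset.erase_right_comm]
  exact (Finset.mul_prod_erase _ (fun k => K.ell k x) (Finset.mem_erase.2 ⟨(pred_ne i).symm, Finset.mem_univ _⟩)).symm

theorem exists_vertProd_pos {x : Plane} (hx : x ∈ K.carrier) : ∃ i, 0 < vertProd K i x := by
  obtain ⟨i, hi⟩ := exists_vertex_ell_pos hx
  refine ⟨i, Finset.prod_pos fun k hk => ?_⟩
  simp only [Finset.mem_erase, Finset.mem_univ, and_true] at hk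
  exact hi k hk.2 hk.1

/-- At a point of the polygon only two consecutive `ell k` can vanish, so some `vertProd` is
positive there; compactness gives a uniform bound. -/
theorem exists_le_sum_vertProd (K : ConvexPolygon) (κ : Fin (K.extra + 3) → ℝ) (hκ : ∀ i, 0 < κ i) :
    ∃ δ > 0, ∀ x ∈ K.carrier, δ ≤ ∑ i, κ i * vertProd K i x := by
  have hc : ContinuousOn (fun x => ∑ i, κ i * vertProd K i x) K.carrier :=
    (continuous_finsetSum _ fun i _ => continuous_const.mul (contDiff_vertProd i).continuous).continuousOn
  obtain ⟨x, hx, hmin⟩ := K.isCompact_carrier.exists_isMinOn ⟨_, vert_mem_carrier 0⟩ hc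
  refine ⟨_, ?_, fun y hy => hmin hy⟩
  obtain ⟨i, hi⟩ := exists_vertProd_pos hx
  exact Finset.sum_pos' (fun j _ => mul_nonneg (hκ j).le (vertProd_nonneg hx)) ⟨i, Finset.mem_univ _, mul_pos (hκ i) hi⟩


/-! ### Hardy's inequality at the vertices -/

theorem sum_normal_mul (i : Fin (K.extra + 3)) (v : Plane) :
    ∑ a, K.normal i a * v a = -(cross (K.dvec i) v) / K.edgeLength i := by
  have h := sum_normal_mul_sub (K := K) i v 0
  have e : K.ell i 0 - K.ell i v = cross (K.dvec i) (0 - v) := ell_sub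
  rw [e, zero_sub] at h
  simp only [PiLp.zero_apply, sub_zero] at h
  rw [h]; simp [cross]; ring

/-- Green's formula for `g² p` along the constant field `X`, with `p = 1 / (σ + ε)`. Since `X · ∇p =
κ p²`, the volume term contains `κ ‖p g‖²`, while the other volume term is at most `2 ‖p g‖ ‖X ·
∇g‖`. Each edge term is bounded independently of `ε`, for one of three reasons: `g` vanishes on the
edge, `X` is tangential to it, or `σ` is bounded below on it. -/
theorem hardy {σ : Plane → ℝ} (hσ : ContDiff ℝ ∞ σ) (hσ0 : ∀ x ∈ K.carrier, 0 ≤ σ x) (hσ1 : ∀ x ∈ K.inner, 0 < σ x)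
    {X : Plane} {κ : ℝ} (hκ : 0 < κ) (hX : ∀ x, ∑ a, X a * pderiv a σ x = -κ) (hg : MemH1 K.inner g)
    (hc : ∀ j, trace K j g =ᵐ[K.edgeMeasure j] 0 ∨ ∑ a, K.normal j a * X a = 0 ∨ ∃ δ > 0, ∀ x ∈ K.edge j, δ ≤ σ x) :
    MemLp (fun x => g x / σ x) 2 (volume.restrict K.inner) := by
  have hU := K.isOpen_inner
  set μ := volume.restrict K.inner with hμ
  set G : Plane → ℝ := fun x => ∑ a, X a * weakPartial K.inner a g x with hG
  have mg := fun a => hg.memLp_weakPartial hU a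
  have mG : MemLp G 2 μ := memLp_finsetSum _ fun a _ => (mg a).const_mul _
  have hbd : ∀ j, ∃ c, ∀ p : Plane → ℝ, ContDiff ℝ ∞ p → (∀ x ∈ K.carrier, 0 ≤ p x ∧ p x * σ x ≤ 1) →
      (∑ a, K.normal j a * X a) * ∫ x, trace K j g x * trace K j (p * g) x ∂(K.edgeMeasure j) ≤ c := by
    intro j
    rcases hc j with h | h | ⟨δ, δ0, h⟩
    · refine ⟨0, fun p _ _ => ?_⟩
      rw [integral_eq_zero_of_ae, mul_zero]
      filter_upwards [h] with x hx
      simp [hx]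
    · exact ⟨0, fun p _ _ => by rw [h, zero_mul]⟩
    · have mt := hg.memLp_trace j
      refine ⟨|∑ a, K.normal j a * X a| * ∫ x, δ⁻¹ * trace K j g x ^ 2 ∂(K.edgeMeasure j), fun p hp hp1 => ?_⟩
      refine (le_abs_self _).trans ?_
      rw [abs_mul]
      refine mul_le_mul_of_nonneg_left (abs_integral_le_integral_abs.trans ?_) (abs_nonneg _)
      refine integral_mono_ae (mt.integrable_mul' ((hg.smooth_mul hU K.isBounded_inner hp).memLp_trace j)).abs (mt.integrable_sq.const_mul _) ?_
      filter_upwards [trace_smooth_mul hp hg j, ae_edgeMeasure_mem_edge j] with x h1 h2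
      have h3 := h x h2
      have h4 := hp1 x (edge_subset_carrier h2)
      have h5 : p x ≤ δ⁻¹ := by
        rw [← one_div, le_div_iff₀ δ0]
        exact (mul_le_mul_of_nonneg_left h3 h4.1).trans h4.2
      simp only [h1, Pi.mul_apply]
      rw [show trace K j g x * (p x * trace K j g x) = p x * trace K j g x ^ 2 by ring, abs_of_nonneg (mul_nonneg h4.1 (sq_nonneg _))]
      exact mul_le_mul_of_nonneg_right h5 (sq_nonneg _)
  choose c hc' using hbd
  -- Obtained from `κ Y² ≤ ∑ c j + 2 Y ‖G‖` by absorbing half of the left side through Young's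
  -- inequality. It does not depend on `ε`.
  set R := (2 * |∑ j, c j| + 4 * l2n μ G ^ 2 / κ) / κ with hR
  have key : ∀ ε : ℝ, 0 < ε → MemLp (fun x => (σ x + ε)⁻¹ * g x) 2 μ ∧ l2n μ (fun x => (σ x + ε)⁻¹ * g x) ≤ √R := by
    intro ε hε
    obtain ⟨r, hr, hr1⟩ := exists_smooth_reciprocal hε
    set p : Plane → ℝ := fun x => r (σ x) with hp
    have hps : ContDiff ℝ ∞ p := hr.comp hσ
    have hpe : ∀ x ∈ K.carrier, p x = (σ x + ε)⁻¹ := fun x hx => hr1 _ (hσ0 x hx)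
    have hpb : ∀ x ∈ K.carrier, 0 ≤ p x ∧ p x * σ x ≤ 1 := by
      intro x hx
      have h0 := hσ0 x hx
      rw [hpe x hx]
      refine ⟨by positivity, ?_⟩
      rw [inv_mul_le_iff₀ (by linarith)]; linarith
    have hpg := hg.smooth_mul hU K.isBounded_inner hps
    have hXp : ∀ x ∈ K.inner, ∑ a, X a * pderiv a p x = κ * p x ^ 2 := by
      intro x hx
      have hs := hσ1 x hx
      have hd : deriv r (σ x) = -(p x ^ 2) := by
        have e : r =ᶠ[𝓝 (σ x)] fun s => (s + ε)⁻¹ := by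
          filter_upwards [lt_mem_nhds hs] with s hs using hr1 s hs.le
        have h1 : HasDerivAt (fun s : ℝ => (s + ε)⁻¹) (-1 / (σ x + ε) ^ 2) (σ x) :=
          ((hasDerivAt_id _).add_const ε).inv (by simp; linarith)
        rw [e.deriv_eq, h1.deriv, hpe x (inner_subset_carrier hx)]
        rw [inv_pow, neg_div, one_div]
      have : ∀ a, pderiv a p x = -(p x ^ 2) * pderiv a σ x := fun a => by
        rw [← hd]; exact pderiv_comp (hr.differentiable (by simp)) (hσ.differentiable (by simp)) a x
      simp only [this]
      rw [show ∑ a, X a * (-(p x ^ 2) * pderiv a σ x) = -(p x ^ 2) * ∑ a, X a * pderiv a σ x by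
        rw [Finset.mul_sum]; exact Finset.sum_congr rfl fun a _ => by ring, hX]
      ring
    set Y := l2n μ (p * g) with hY
    have green : ∑ a, X a * ((∫ x in K.inner, weakPartial K.inner a g x * (p * g) x) + ∫ x in K.inner, g x * weakPartial K.inner a (p * g) x) =
        2 * (∫ x in K.inner, (p * g) x * G x) + κ * Y ^ 2 := by
      have e : ∀ a, X a * ((∫ x in K.inner, weakPartial K.inner a g x * (p * g) x) + ∫ x in K.inner, g x * weakPartial K.inner a (p * g) x) =
          ∫ x in K.inner, X a * (weakPartial K.inner a g x * (p * g) x + g x * weakPartial K.inner a (p * g) x) := fun a => by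
        rw [integral_const_mul, integral_add ((mg a).integrable_mul' hpg.1) (hg.1.integrable_mul' (hpg.memLp_weakPartial hU a))]
      simp only [e]
      have iI : ∀ a, Integrable (fun x => X a * (weakPartial K.inner a g x * (p * g) x + g x * weakPartial K.inner a (p * g) x)) μ := fun a =>
        (((mg a).integrable_mul' hpg.1).add (hg.1.integrable_mul' (hpg.memLp_weakPartial hU a))).const_mul _
      rw [← integral_finsetSum _ fun a _ => iI a, hY, l2n_sq hpg.1, ← integral_const_mul, ← integral_const_mul,
        ← integral_add ((hpg.1.integrable_mul' mG).const_mul 2) (hpg.1.integrable_sq.const_mul κ)]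
      refine integral_congr_ae ?_
      filter_upwards [weakPartial_smooth_mul hU hps hg 0, weakPartial_smooth_mul hU hps hg 1, ae_restrict_mem hU.measurableSet] with x h0 h1 hx
      have h3 := hXp x hx
      rw [Fin.sum_univ_two] at h3
      simp only [Fin.sum_univ_two, h0, h1, Pi.add_apply, Pi.mul_apply, hG]
      linear_combination (g x ^ 2) * h3
    have bdry : ∑ a, X a * ((∫ x in K.inner, weakPartial K.inner a g x * (p * g) x) + ∫ x in K.inner, g x * weakPartial K.inner a (p * g) x) ≤ ∑ j, c j := by
      simp only [integral_mul_weakPartial hg hpg, Finset.mul_sum]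
      rw [Finset.sum_comm]
      refine Finset.sum_le_sum fun j _ => (le_of_eq ?_).trans (hc' j p hps hpb)
      rw [Finset.sum_mul]
      exact Finset.sum_congr rfl fun a _ => by ring
    rw [green] at bdry
    have h1 := neg_le_of_abs_le (abs_integral_mul_le hpg.1 mG)
    have e : l2n μ (fun x => (σ x + ε)⁻¹ * g x) = Y := l2n_congr (by
      filter_upwards [ae_restrict_mem hU.measurableSet] with x hx
      rw [Pi.mul_apply, hpe x (inner_subset_carrier hx)])
    refine ⟨(memLp_congr_ae ?_).1 hpg.1, ?_⟩
    · filter_upwards [ae_restrict_mem hU.measurableSet] with x hx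
      rw [Pi.mul_apply, hpe x (inner_subset_carrier hx)]
    · rw [e]
      refine Real.le_sqrt_of_sq_le ?_
      rw [hR, le_div_iff₀ hκ]
      have h2 : 2 * Y * l2n μ G ≤ κ / 2 * Y ^ 2 + 2 * l2n μ G ^ 2 / κ := by
        have := sq_nonneg (κ / 2 * Y - l2n μ G)
        have e : κ / 2 * Y ^ 2 + 2 * l2n μ G ^ 2 / κ - 2 * Y * l2n μ G = 2 / κ * (κ / 2 * Y - l2n μ G) ^ 2 := by field_simp; ring
        have : 0 ≤ 2 / κ * (κ / 2 * Y - l2n μ G) ^ 2 := by positivity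
        linarith
      have h3 := le_abs_self (∑ j, c j)
      have h4 : 2 * l2n μ G ^ 2 / κ * 2 = 4 * l2n μ G ^ 2 / κ := by ring
      linarith
  have hm : AEStronglyMeasurable (fun x => g x / σ x) μ :=
    (hg.1.1.aemeasurable.div hσ.continuous.measurable.aemeasurable).aestronglyMeasurable
  refine ⟨hm, ?_⟩
  have ε0 : ∀ n : ℕ, 0 < 1 / ((n : ℝ) + 1) := fun n => Nat.one_div_pos_of_nat
  -- Fatou's lemma as `ε` tends to zero; only square integrability is needed, not a bound.
  have hlim := Lp.eLpNorm_lim_le_liminf_eLpNorm (p := 2) (μ := μ) (f := fun (n : ℕ) x => (σ x + 1 / ((n : ℝ) + 1))⁻¹ * g x)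
    (fun n => (key _ (ε0 n)).1.1) (fun x => g x / σ x) (by
      filter_upwards [ae_restrict_mem hU.measurableSet] with x hx
      have h1 : Tendsto (fun n : ℕ => σ x + 1 / ((n : ℝ) + 1)) atTop (𝓝 (σ x + 0)) :=
        tendsto_const_nhds.add tendsto_one_div_add_atTop_nhds_zero_nat
      rw [add_zero] at h1
      have := (h1.inv₀ (hσ1 x hx).ne').mul_const (g x)
      rwa [← div_eq_inv_mul] at this)
  refine hlim.trans_lt (lt_of_le_of_lt (b := ENNReal.ofReal √R) ?_ ENNReal.ofReal_lt_top)
  refine liminf_le_of_le (by isBoundedDefault) fun b hb => ?_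
  obtain ⟨n, hn⟩ := hb.exists
  refine hn.trans ?_
  rw [← ENNReal.ofReal_toReal (key _ (ε0 n)).1.2.ne]
  exact ENNReal.ofReal_le_ofReal (key _ (ε0 n)).2

/-- The sum of the `ell` functions of the two edges at the `i`-th vertex. -/
noncomputable def vertDist (K : ConvexPolygon) (i : Fin (K.extra + 3)) (x : Plane) : ℝ := K.ell i x + K.ell (i - 1) x

theorem contDiff_vertDist (i : Fin (K.extra + 3)) : ContDiff ℝ ∞ (vertDist K i) := (contDiff_ell i).add (contDiff_ell (i - 1))

theorem sum_mul_pderiv_vertDist (i : Fin (K.extra + 3)) (X x : Plane) :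
    ∑ a, X a * pderiv a (vertDist K i) x = cross (K.dvec i) X + cross (K.dvec (i - 1)) X := by
  have : ∀ a, pderiv a (vertDist K i) x = pderiv a (K.ell i) x + pderiv a (K.ell (i - 1)) x := fun a =>
    pderiv_add ((contDiff_ell i).differentiable (by simp)) ((contDiff_ell (i - 1)).differentiable (by simp)) a x
  simp only [this, pderiv_ell, Fin.sum_univ_two, cross]
  simp
  ring

/-- A zero would be a point where three different functions `ell k` vanish, and there is none. -/
theorem exists_le_vertDist {j : Fin (K.extra + 3)} (h1 : j ≠ i) (h2 : j ≠ i - 1) : ∃ δ > 0, ∀ x ∈ K.edge j, δ ≤ vertDist K i x := by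
  obtain ⟨x, hx, hmin⟩ := (isCompact_edge (K := K) j).exists_isMinOn ⟨_, vert_mem_edge⟩ (contDiff_vertDist i).continuous.continuousOn
  refine ⟨_, ?_, fun y hy => hmin hy⟩
  have hxc := edge_subset_carrier hx
  have a1 := mem_carrier_iff.1 hxc i
  have a2 := mem_carrier_iff.1 hxc (i - 1)
  refine lt_of_le_of_ne (add_nonneg a1 a2) fun h0 => ?_
  have z1 : K.ell i x = 0 := by unfold vertDist at h0; linarith
  have z2 : K.ell (i - 1) x = 0 := by unfold vertDist at h0; linarith
  have z3 := ell_eq_zero_of_mem_edge hx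
  obtain ⟨m, hm⟩ := exists_vertex_ell_pos hxc
  have b1 : i = m ∨ i = m - 1 := by by_contra hcon; push Not at hcon; exact (hm i hcon.1 hcon.2).ne' z1
  have b2 : i - 1 = m ∨ i - 1 = m - 1 := by by_contra hcon; push Not at hcon; exact (hm _ hcon.1 hcon.2).ne' z2
  have b3 : j = m ∨ j = m - 1 := by by_contra hcon; push Not at hcon; exact (hm j hcon.1 hcon.2).ne' z3
  have hp := pred_ne (K := K) i
  grind

/-- The sum of the products of all `ell k` but one; it vanishes at the vertices only. -/
noncomputable def vertexWeight (K : ConvexPolygon) (x : Plane) : ℝ := ∑ i, coProd K i x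

theorem contDiff_vertexWeight (K : ConvexPolygon) : ContDiff ℝ ∞ (vertexWeight K) :=
  ContDiff.sum fun i _ => contDiff_coProd i

theorem vertexWeight_pos {x : Plane} (hx : x ∈ K.inner) : 0 < vertexWeight K x :=
  Finset.sum_pos (fun _ _ => Finset.prod_pos fun k _ => mem_inner_iff.1 hx k) ⟨0, Finset.mem_univ _⟩

theorem vertProd_mul_vertDist_le (i : Fin (K.extra + 3)) {x : Plane} (hx : x ∈ K.carrier) :
    vertProd K i x * vertDist K i x ≤ vertexWeight K x := by
  have : vertProd K i x * vertDist K i x = ∑ j ∈ {i, i - 1}, coProd K j x := by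
    rw [Finset.sum_pair (pred_ne i).symm, coProd_eq_vertProd, coProd_pred_eq_vertProd, vertDist]; ring
  rw [this]
  exact Finset.sum_le_univ_sum_of_nonneg fun j => coProd_nonneg hx

/-- Hardy's inequality is applied to the derivatives of `w` along the two edges at the vertex. For
the derivative along one of them, which vanishes on that edge, the field `X` points along the other,
so no edge term arises near the vertex; on the remaining edges `vertDist` is bounded below. The two
directions are independent, and Cramer's rule recovers the full gradient. -/
theorem MemH2H10.memLp_grad_div_vertDist (hw : MemH2H10 K w) (i : Fin (K.extra + 3)) (a : Fin 2) :
    MemLp (fun x => weakPartial K.inner a w x / vertDist K i x) 2 (volume.restrict K.inner) := by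
  have hU := K.isOpen_inner
  have hσ := contDiff_vertDist (K := K) i
  have hσ0 : ∀ x ∈ K.carrier, 0 ≤ vertDist K i x := fun x hx => add_nonneg (mem_carrier_iff.1 hx _) (mem_carrier_iff.1 hx _)
  have hσ1 : ∀ x ∈ K.inner, 0 < vertDist K i x := fun x hx => add_pos (mem_inner_iff.1 hx _) (mem_inner_iff.1 hx _)
  have κ0 := cross_dvec_pos (K := K) i
  set κ := cross (K.dvec (i - 1)) (K.dvec i) with hκ
  have T : ∀ j, MemH1 K.inner (K.dvec j 0 • weakPartial K.inner 0 w + K.dvec j 1 • weakPartial K.inner 1 w) ∧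
      trace K j (K.dvec j 0 • weakPartial K.inner 0 w + K.dvec j 1 • weakPartial K.inner 1 w) =ᵐ[K.edgeMeasure j] 0 := fun j => by
    have H0 : MemH1 K.inner (K.dvec j 0 • weakPartial K.inner 0 w) := (hw.1.2 0).const_smul hU _
    have H1 : MemH1 K.inner (K.dvec j 1 • weakPartial K.inner 1 w) := (hw.1.2 1).const_smul hU _
    refine ⟨H0.add hU H1, ?_⟩
    filter_upwards [trace_add H0 H1 j, trace_const_smul (hw.1.2 0) (K.dvec j 0) j,
      trace_const_smul (hw.1.2 1) (K.dvec j 1) j, tangentialDeriv_eq_zero hw.1 (hw.edge j)] with x h1 h2 h3 h4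
    rw [h1, Pi.add_apply, h2, h3, ← h4, tangentialDeriv, Fin.sum_univ_two]
    rfl
  have n0 : ∀ j, ∑ a, K.normal j a * K.dvec j a = 0 := fun j => by rw [sum_normal_mul, cross_self]; simp
  have M1 := hardy hσ hσ0 hσ1 (X := K.dvec (i - 1)) κ0 (fun x => by
    rw [sum_mul_pderiv_vertDist, cross_self, add_zero, cross_swap]) (T i).1 (fun j => by
    by_cases h1 : j = i
    · subst h1; exact Or.inl (T j).2
    by_cases h2 : j = i - 1
    · subst h2; exact Or.inr (Or.inl (n0 _))
    exact Or.inr (Or.inr (exists_le_vertDist h1 h2)))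
  have M2 := hardy hσ hσ0 hσ1 (X := (-1 : ℝ) • K.dvec i) κ0 (fun x => by
    rw [sum_mul_pderiv_vertDist, cross_smul_right, cross_smul_right, cross_self, hκ]; ring) (T (i - 1)).1 (fun j => by
    by_cases h1 : j = i - 1
    · subst h1; exact Or.inl (T _).2
    by_cases h2 : j = i
    · subst h2
      refine Or.inr (Or.inl ?_)
      rw [sum_normal_mul, cross_smul_right, cross_self]; simp
    exact Or.inr (Or.inr (exists_le_vertDist h2 h1)))
  have M3 := ((M2.const_mul (K.dvec i 1 / κ)).sub (M1.const_mul (K.dvec (i - 1) 1 / κ)))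
  have M4 := ((M1.const_mul (K.dvec (i - 1) 0 / κ)).sub (M2.const_mul (K.dvec i 0 / κ)))
  have hne := κ0.ne'
  fin_cases a
  · convert M3 using 1
    ext x
    simp only [Pi.sub_apply, Pi.add_apply, Pi.smul_apply, smul_eq_mul]
    have : (K.dvec i 1 * (K.dvec (i - 1) 0 * weakPartial K.inner 0 w x + K.dvec (i - 1) 1 * weakPartial K.inner 1 w x) -
      K.dvec (i - 1) 1 * (K.dvec i 0 * weakPartial K.inner 0 w x + K.dvec i 1 * weakPartial K.inner 1 w x)) = κ * weakPartial K.inner 0 w x := by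
      rw [hκ, cross]; ring
    rw [div_mul_div_comm, div_mul_div_comm, ← sub_div, this, mul_div_mul_left _ _ hne]
    rfl
  · convert M4 using 1
    ext x
    simp only [Pi.sub_apply, Pi.add_apply, Pi.smul_apply, smul_eq_mul]
    have : (K.dvec (i - 1) 0 * (K.dvec i 0 * weakPartial K.inner 0 w x + K.dvec i 1 * weakPartial K.inner 1 w x) -
      K.dvec i 0 * (K.dvec (i - 1) 0 * weakPartial K.inner 0 w x + K.dvec (i - 1) 1 * weakPartial K.inner 1 w x)) = κ * weakPartial K.inner 1 w x := by
      rw [hκ, cross]; ring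
    rw [div_mul_div_comm, div_mul_div_comm, ← sub_div, this, mul_div_mul_left _ _ hne]
    rfl

/-- From `δ ≤ ∑ vertProd i` and `vertProd i * vertDist i ≤ B` with `B = vertexWeight`, one gets `1 /
B ≤ δ⁻¹ ∑ 1 / vertDist i`. -/
theorem MemH2H10.memLp_grad_div_vertexWeight (hw : MemH2H10 K w) (a : Fin 2) :
    MemLp (fun x => weakPartial K.inner a w x / vertexWeight K x) 2 (volume.restrict K.inner) := by
  have hU := K.isOpen_inner
  obtain ⟨δ, δ0, hδ⟩ := exists_le_sum_vertProd K (fun _ => 1) (fun _ => one_pos)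
  have hm := (memLp_finsetSum Finset.univ fun i _ => (hw.memLp_grad_div_vertDist i a).norm).const_mul δ⁻¹
  refine hm.mono' (((hw.1.1.memLp_weakPartial hU a).1.aemeasurable.div
    (contDiff_vertexWeight K).continuous.measurable.aemeasurable).aestronglyMeasurable) ?_
  filter_upwards [ae_restrict_mem hU.measurableSet] with x hx
  have hxc := inner_subset_carrier hx
  have B0 := vertexWeight_pos hx
  simp only [Real.norm_eq_abs, abs_div, abs_of_pos B0]
  rw [← div_eq_inv_mul, div_le_div_iff₀ B0 δ0, Finset.sum_mul]
  calc |weakPartial K.inner a w x| * δ ≤ |weakPartial K.inner a w x| * ∑ i, 1 * vertProd K i x := by gcongr; exact hδ x hxc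
    _ = ∑ i, |weakPartial K.inner a w x| * vertProd K i x := by simp only [one_mul, Finset.mul_sum]
    _ ≤ _ := by
      refine Finset.sum_le_sum fun i _ => ?_
      have s0 : 0 < vertDist K i x := add_pos (mem_inner_iff.1 hx _) (mem_inner_iff.1 hx _)
      rw [abs_of_pos s0, div_mul_eq_mul_div, le_div_iff₀ s0, mul_assoc]
      exact mul_le_mul_of_nonneg_left (vertProd_mul_vertDist_le i hxc) (abs_nonneg _)

/-! ### Removing the weight: the Miranda-Talenti identity -/

theorem integrable_jacWeight (hw : MemH2 K.inner w) (hχ : ContDiff ℝ ∞ χ) : Integrable (jacWeight K w χ) (volume.restrict K.inner) := by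
  have hU := K.isOpen_inner
  have m1 := fun a => hw.1.memLp_weakPartial hU a
  have m2 := fun a b => (hw.2 a).memLp_weakPartial hU b
  have q := fun {p f : Plane → ℝ} (hp : Continuous p) (hf : MemLp f 2 (volume.restrict K.inner)) =>
    memLp_continuous_mul K.isBounded_inner hp hf hU.measurableSet
  have c1 : Continuous fun x => 2 * χ x := continuous_const.mul hχ.continuous
  have cd := fun a => (pderiv_contDiff hχ a).continuous
  have I := ((((q c1 (m2 0 0)).integrable_mul' (m2 1 1)).sub ((q c1 (m2 0 1)).integrable_mul' (m2 1 0))).add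
    ((((q (cd 0) (m1 0)).integrable_mul' (m2 1 1)).sub ((q (cd 1) (m1 0)).integrable_mul' (m2 1 0))).sub
    (((q (cd 0) (m1 1)).integrable_mul' (m2 0 1)).sub ((q (cd 1) (m1 1)).integrable_mul' (m2 0 0)))))
  refine I.congr (ae_of_all _ fun x => ?_)
  simp only [Pi.add_apply, Pi.sub_apply, Pi.mul_apply, jacWeight]
  ring

theorem jacWeight_sum {ι : Type*} (s : Finset ι) {χ : ι → Plane → ℝ} (hχ : ∀ i ∈ s, ContDiff ℝ ∞ (χ i)) (x : Plane) :
    jacWeight K w (fun x => ∑ i ∈ s, χ i x) x = ∑ i ∈ s, jacWeight K w (χ i) x := by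
  have hd : ∀ a, pderiv a (fun x => ∑ i ∈ s, χ i x) x = ∑ i ∈ s, pderiv a (χ i) x := fun a => by
    simp only [pderiv]
    rw [fderiv_fun_sum fun i hi => (hχ i hi).differentiable (by simp) x, sum_apply]
  simp only [jacWeight, hd, Finset.sum_add_distrib, Finset.sum_sub_distrib, ← Finset.sum_mul, ← Finset.mul_sum]

/-- The weight is the sum of the functions `coProd i * r`, and each of them vanishes on all edges
but the `i`-th. -/
theorem integral_jacWeight_vertexWeight (hw : MemH2H10 K w) {r : ℝ → ℝ} (hr : ContDiff ℝ ∞ r) :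
    ∫ x in K.inner, jacWeight K w (fun x => vertexWeight K x * r (vertexWeight K x)) x = 0 := by
  have hs : ∀ i, ContDiff ℝ ∞ fun x => coProd K i x * r (vertexWeight K x) := fun i =>
    (contDiff_coProd i).mul (hr.comp (contDiff_vertexWeight K))
  have e : (fun x => vertexWeight K x * r (vertexWeight K x)) = fun x => ∑ i, coProd K i x * r (vertexWeight K x) := by
    ext x; rw [← Finset.sum_mul]; rfl
  rw [e]
  simp only [jacWeight_sum Finset.univ fun i _ => hs i]
  rw [integral_finsetSum _ fun i _ => integrable_jacWeight hw.1 (hs i)]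
  exact Finset.sum_eq_zero fun i _ => integral_jacWeight_edge hw (hs i) fun j hj x hx => by rw [coProd_eq_zero hj hx, zero_mul]

/-- The weight is sent to one by dominated convergence. The gradient of the weight is at most `M /
B`, and `∇w / B` is square integrable, so the terms with the differentiated weight have an
integrable bound and tend to zero pointwise. -/
theorem MemH2H10.integral_jacobian_eq_zero (hw : MemH2H10 K w) :
    ∫ x in K.inner, 2 * (weakPartial K.inner 0 (weakPartial K.inner 0 w) x * weakPartial K.inner 1 (weakPartial K.inner 1 w) x -
      weakPartial K.inner 1 (weakPartial K.inner 0 w) x * weakPartial K.inner 0 (weakPartial K.inner 1 w) x) = 0 := by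
  have hU := K.isOpen_inner
  have m2 := fun a b => (hw.1.2 a).memLp_weakPartial hU b
  have m3 := hw.memLp_grad_div_vertexWeight
  set B := vertexWeight K with hB
  have hBs := contDiff_vertexWeight K
  set ε : ℕ → ℝ := fun n => 1 / ((n : ℝ) + 1) with hε
  have ε0 : ∀ n, 0 < ε n := fun n => Nat.one_div_pos_of_nat
  have ε1 : Tendsto ε atTop (𝓝 0) := tendsto_one_div_add_atTop_nhds_zero_nat
  -- The weight becomes `B² / (B² + ε)`. Its derivative with respect to `B` is `2 ε B / (B² + ε)²`,
  -- which is at most `1 / B` because `2 ε B² ≤ (B² + ε)²`.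
  set r : ℕ → ℝ → ℝ := fun n s => s / (s ^ 2 + ε n) with hrdef
  have hne : ∀ n (s : ℝ), s ^ 2 + ε n ≠ 0 := fun n s => by have := ε0 n; positivity
  have hr : ∀ n, ContDiff ℝ ∞ (r n) := fun n => contDiff_id.div (by fun_prop) (hne n)
  have hrd : ∀ n s, HasDerivAt (fun s => s * r n s) (2 * ε n * s / (s ^ 2 + ε n) ^ 2) s := by
    intro n s
    have h1 : HasDerivAt (fun s : ℝ => s ^ 2 + ε n) (2 * s) s := by simpa using (hasDerivAt_pow 2 s).add_const (ε n)
    have h2 := (hasDerivAt_id s).mul ((hasDerivAt_id s).div h1 (hne n s))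
    refine h2.congr_deriv ?_
    have := hne n s
    simp only [id, Pi.div_apply]
    field_simp
    ring
  have hpd : ∀ n a x, pderiv a (fun x => B x * r n (B x)) x = 2 * ε n * B x / (B x ^ 2 + ε n) ^ 2 * pderiv a B x := by
    intro n a x
    have := pderiv_comp (r := fun s => s * r n s) (fun s => (hrd n s).differentiableAt) (hBs.differentiable (by simp)) a x
    rw [(hrd n (B x)).deriv] at this
    exact this
  obtain ⟨M, hM⟩ : ∃ M, ∀ a, ∀ x ∈ K.inner, |pderiv a B x| ≤ M := by
    have h := fun a => exists_bound_of_bounded K.isBounded_inner (pderiv_contDiff hBs a).continuous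
    choose M hM using h
    exact ⟨max (M 0) (M 1), fun a x hx => (hM a x hx).trans (by fin_cases a; exacts [le_max_left _ _, le_max_right _ _])⟩
  set F := fun (a b : Fin 2) (x : Plane) => |weakPartial K.inner b (weakPartial K.inner a w) x| with hF
  set f := fun (a : Fin 2) (x : Plane) => |weakPartial K.inner a w x / B x| with hf
  have bI : Integrable (fun x => 2 * (F 0 0 x * F 1 1 x + F 0 1 x * F 1 0 x) +
      M * (f 0 x * F 1 1 x + f 0 x * F 1 0 x + (f 1 x * F 0 1 x + f 1 x * F 0 0 x))) (volume.restrict K.inner) := by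
    have i1 := fun a b c d => (m2 a b).abs.integrable_mul' (m2 c d).abs
    have i2 := fun a b c => (m3 a).abs.integrable_mul' (m2 b c).abs
    exact (((i1 0 0 1 1).add (i1 0 1 1 0)).const_mul 2).add
      ((((i2 0 1 1).add (i2 0 1 0)).add ((i2 1 0 1).add (i2 1 0 0))).const_mul M)
  have lim := tendsto_integral_of_dominated_convergence (μ := volume.restrict K.inner)
    (F := fun n x => jacWeight K w (fun x => B x * r n (B x)) x)
    (f := fun x => 2 * (weakPartial K.inner 0 (weakPartial K.inner 0 w) x * weakPartial K.inner 1 (weakPartial K.inner 1 w) x -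
      weakPartial K.inner 1 (weakPartial K.inner 0 w) x * weakPartial K.inner 0 (weakPartial K.inner 1 w) x))
    _ (fun n => (integrable_jacWeight hw.1 (hBs.mul ((hr n).comp hBs))).1) bI (fun n => ?_) ?_
  · simp only [hB, integral_jacWeight_vertexWeight hw (hr _)] at lim
    exact tendsto_nhds_unique lim tendsto_const_nhds
  · filter_upwards [ae_restrict_mem hU.measurableSet] with x hx
    have B0 : 0 < B x := vertexWeight_pos hx
    have c1 : |B x * r n (B x)| ≤ 1 := by
      have e := ε0 n
      rw [abs_of_nonneg (by positivity), hrdef, ← mul_div_assoc, div_le_one (by positivity)]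
      nlinarith
    have c2 : ∀ a, |pderiv a (fun x => B x * r n (B x)) x| ≤ M / B x := by
      intro a
      rw [hpd, abs_mul]
      have e := ε0 n
      have h1 : |2 * ε n * B x / (B x ^ 2 + ε n) ^ 2| ≤ 1 / B x := by
        rw [abs_of_nonneg (by positivity), div_le_div_iff₀ (by positivity) B0]
        nlinarith [sq_nonneg (B x ^ 2), sq_nonneg (ε n), mul_pos e (mul_pos B0 B0)]
      calc _ ≤ 1 / B x * M := mul_le_mul h1 (hM a x hx) (abs_nonneg _) (by positivity)
        _ = M / B x := by ring
    have M0 : 0 ≤ M := (abs_nonneg _).trans (hM 0 x hx)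
    have d : ∀ (a b : Fin 2) (p q : ℝ), |weakPartial K.inner a w x * (pderiv 0 (fun x => B x * r n (B x)) x * p -
        pderiv 1 (fun x => B x * r n (B x)) x * q)| ≤ M * (f a x * |p| + f a x * |q|) := by
      intro a b p q
      have hfa : f a x = |weakPartial K.inner a w x| / B x := by simp only [hf, abs_div, abs_of_pos B0]
      rw [abs_mul, hfa]
      calc _ ≤ |weakPartial K.inner a w x| * (M / B x * |p| + M / B x * |q|) := by
            refine mul_le_mul_of_nonneg_left ((abs_sub _ _).trans ?_) (abs_nonneg _)
            rw [abs_mul, abs_mul]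
            exact add_le_add (mul_le_mul_of_nonneg_right (c2 0) (abs_nonneg _)) (mul_le_mul_of_nonneg_right (c2 1) (abs_nonneg _))
        _ = _ := by ring
    have t1 : ∀ p q u v : ℝ, |2 * (B x * r n (B x)) * (p * q - u * v)| ≤ 2 * (|p| * |q| + |u| * |v|) := by
      intro p q u v
      rw [abs_mul, abs_mul, abs_two, ← abs_mul, ← abs_mul]
      have := abs_sub (p * q) (u * v)
      have h3 := mul_le_mul c1 this (abs_nonneg _) zero_le_one
      linarith
    rw [Real.norm_eq_abs]
    refine (abs_add_le _ _).trans (add_le_add (t1 _ _ _ _) ((abs_sub _ _).trans ?_))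
    have := add_le_add (d 0 0 (weakPartial K.inner 1 (weakPartial K.inner 1 w) x) (weakPartial K.inner 0 (weakPartial K.inner 1 w) x))
      (d 1 0 (weakPartial K.inner 1 (weakPartial K.inner 0 w) x) (weakPartial K.inner 0 (weakPartial K.inner 0 w) x))
    refine this.trans (le_of_eq ?_)
    simp only [hF]; ring
  · filter_upwards [ae_restrict_mem hU.measurableSet] with x hx
    have B0 : 0 < B x := vertexWeight_pos hx
    have hden : Tendsto (fun n => B x ^ 2 + ε n) atTop (𝓝 (B x ^ 2)) := by
      simpa using (tendsto_const_nhds (x := B x ^ 2)).add ε1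
    have l1 : Tendsto (fun n => B x * r n (B x)) atTop (𝓝 1) := by
      have := (tendsto_const_nhds (x := B x)).mul ((tendsto_const_nhds (x := B x)).div hden (by positivity))
      have e : B x * (B x / B x ^ 2) = 1 := by field_simp
      rwa [e] at this
    have l2 : ∀ a, Tendsto (fun n => pderiv a (fun x => B x * r n (B x)) x) atTop (𝓝 0) := by
      intro a
      simp only [hpd]
      have h1 : Tendsto (fun n => 2 * ε n * B x) atTop (𝓝 0) := by simpa using (ε1.const_mul 2).mul_const (B x)
      have := (h1.div (hden.pow 2) (by positivity)).mul_const (pderiv a B x)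
      simpa using this
    have := ((l1.const_mul 2).mul_const (weakPartial K.inner 0 (weakPartial K.inner 0 w) x * weakPartial K.inner 1 (weakPartial K.inner 1 w) x -
      weakPartial K.inner 1 (weakPartial K.inner 0 w) x * weakPartial K.inner 0 (weakPartial K.inner 1 w) x)).add
      (((((l2 0).mul_const (weakPartial K.inner 1 (weakPartial K.inner 1 w) x)).sub ((l2 1).mul_const (weakPartial K.inner 0 (weakPartial K.inner 1 w) x))).const_mul
        (weakPartial K.inner 0 w x)).sub
      ((((l2 0).mul_const (weakPartial K.inner 1 (weakPartial K.inner 0 w) x)).sub ((l2 1).mul_const (weakPartial K.inner 0 (weakPartial K.inner 0 w) x))).const_mul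
        (weakPartial K.inner 1 w x)))
    simpa [jacWeight] using this

/-- The Miranda-Talenti identity on a convex polygon. -/
theorem MemH2H10.sum_integral_hessian_sq (hw : MemH2H10 K w) :
    ∑ i, ∑ j, ∫ x in K.inner, weakPartial K.inner j (weakPartial K.inner i w) x ^ 2 =
      l2n (volume.restrict K.inner) (weakLaplacian K.inner w) ^ 2 := by
  have hU := K.isOpen_inner
  have m2 := fun a b => (hw.1.2 a).memLp_weakPartial hU b
  rw [l2n_sq (hw.1.memLp_weakLaplacian hU), ← sub_eq_zero]
  have I := fun a b => (m2 a b).integrable_sq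
  simp only [Fin.sum_univ_two]
  have J : Integrable (fun x => weakLaplacian K.inner w x ^ 2) (volume.restrict K.inner) := (hw.1.memLp_weakLaplacian hU).integrable_sq
  have S := integral_sub ((((I 0 0).add (I 0 1)).add ((I 1 0).add (I 1 1)))) J
  have S2 := integral_add ((I 0 0).add (I 0 1)) ((I 1 0).add (I 1 1))
  have S3 := integral_add (I 0 0) (I 0 1)
  have S4 := integral_add (I 1 0) (I 1 1)
  simp only [Pi.add_apply] at S S2 S3 S4
  rw [S2, S3, S4] at S
  rw [← S, ← neg_eq_zero, ← integral_neg, ← hw.integral_jacobian_eq_zero]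
  refine integral_congr_ae ?_
  filter_upwards [weakPartial_comm hU hw.1 0 1] with x hx
  simp only [weakLaplacian, Fin.sum_univ_two]
  rw [hx]; ring

end StrainGradientVEM

namespace StrainGradientVEM
open ConvexPolygon

/-! ## Polynomials and linear systems -/

section linear
variable {V E : Type*} [AddCommGroup V] [Module ℝ V] [FiniteDimensional ℝ V] [AddCommGroup E] [Module ℝ E]

/-- The Fredholm alternative with finitely many unknown tests: in the dual of the finite-dimensional
`V` the range of `b.flip` is the annihilator of what it annihilates. The space `E` of candidates may
have infinite dimension. -/
theorem exists_forall_eq_of_annihilator (b : V →ₗ[ℝ] E →ₗ[ℝ] ℝ) (t : V →ₗ[ℝ] ℝ) (h : ∀ v, b v = 0 → t v = 0) :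
    ∃ w, ∀ v, b v w = t v := by
  have ht : t ∈ LinearMap.range b.flip := by
    rw [← Subspace.dualCoannihilator_dualAnnihilator_eq (W := LinearMap.range b.flip), Submodule.mem_dualAnnihilator]
    intro v hv
    rw [Submodule.mem_dualCoannihilator] at hv
    refine h v (LinearMap.ext fun w => ?_)
    exact hv (b.flip w) ⟨w, rfl⟩
  obtain ⟨w, hw⟩ := ht
  exact ⟨w, fun v => by rw [← hw]; rfl⟩

/-- A functional that vanishes on the common kernel of finitely many functionals is a combination of
them. This is how the polynomials `Δ²v` and `Δv|_e` arise as Lagrange multipliers. -/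
theorem exists_eq_of_forall_ker (b : V →ₗ[ℝ] E →ₗ[ℝ] ℝ) (t : E →ₗ[ℝ] ℝ) (h : ∀ w, (∀ v, b v w = 0) → t w = 0) :
    ∃ v, b v = t := by
  change t ∈ LinearMap.range b
  rw [← Subspace.dualCoannihilator_dualAnnihilator_eq (W := LinearMap.range b), Submodule.mem_dualAnnihilator]
  intro w hw
  rw [Submodule.mem_dualCoannihilator] at hw
  exact h w fun v => hw (b v) ⟨v, rfl⟩

end linear

section polyEval
variable (p q : MvPolynomial (Fin 2) ℝ) (x : Plane)

theorem polyEval_add : polyEval (p + q) x = polyEval p x + polyEval q x := map_add _ _ _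
theorem polyEval_sub : polyEval (p - q) x = polyEval p x - polyEval q x := map_sub _ _ _
theorem polyEval_mul : polyEval (p * q) x = polyEval p x * polyEval q x := map_mul _ _ _
theorem polyEval_C (c : ℝ) : polyEval (MvPolynomial.C c) x = c := MvPolynomial.eval_C _
theorem polyEval_smul (c : ℝ) : polyEval (c • p) x = c * polyEval p x := MvPolynomial.smul_eval _ _ _
theorem polyEval_zero : polyEval 0 x = 0 := map_zero _
theorem polyEval_X (a : Fin 2) : polyEval (MvPolynomial.X a) x = x a := MvPolynomial.eval_X _

theorem contDiff_polyEval : ContDiff ℝ ∞ (polyEval p) := by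
  induction p using MvPolynomial.induction_on with
  | C a => simpa only [funext (polyEval_C · a)] using contDiff_const
  | add p q hp hq => simpa only [funext (polyEval_add p q)] using hp.add hq
  | mul_X p n hp =>
    have : ContDiff ℝ ∞ fun x : Plane => x n := by fun_prop
    simpa only [funext (polyEval_mul p (MvPolynomial.X n)), polyEval_X] using hp.mul this

theorem continuous_polyEval : Continuous (polyEval p) := (contDiff_polyEval p).continuous

end polyEval

/-- The polynomials of total degree at most `r`. -/
noncomputable abbrev PolyLE (r : ℕ) : Submodule ℝ (MvPolynomial (Fin 2) ℝ) := MvPolynomial.restrictTotalDegree (Fin 2) ℝ r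

theorem mem_polyLE {r : ℕ} {p : MvPolynomial (Fin 2) ℝ} : p ∈ PolyLE r ↔ p.totalDegree ≤ r :=
  MvPolynomial.mem_restrictTotalDegree _ _ _

variable {K : ConvexPolygon} {i : Fin (K.extra + 3)} {f f' g h p w χ : Plane → ℝ}

namespace ConvexPolygon

theorem ae_edgeMeasure_iff {P : Plane → Prop} : (∀ᵐ x ∂(K.edgeMeasure i), P x) ↔
    ∀ᵐ x ∂(Measure.map (K.edgePt i) (volume.restrict (Set.Icc 0 1))), P x :=
  Measure.ae_ennreal_smul_measure_iff (by simpa using K.edgeLength_pos i)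

theorem eqOn_edge_of_ae_eq (hf : ContinuousOn f (K.edge i)) (hg : ContinuousOn g (K.edge i))
    (h : f =ᵐ[K.edgeMeasure i] g) : Set.EqOn f g (K.edge i) := by
  have h1 := ae_of_ae_map (K.continuous_edgePt i).aemeasurable (ae_edgeMeasure_iff.1 h)
  have hm : Set.MapsTo (K.edgePt i) (Set.Icc 0 1) (K.edge i) := fun s hs => edgePt_mem_edge hs
  have h2 := Measure.eqOn_Icc_of_ae_eq (X := ℝ) volume (zero_ne_one) (f := fun s => f (K.edgePt i s)) (g := fun s => g (K.edgePt i s)) h1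
    (hf.comp (K.continuous_edgePt i).continuousOn hm) (hg.comp (K.continuous_edgePt i).continuousOn hm)
  intro x hx
  obtain ⟨s, hs, rfl⟩ := mem_edge_iff_exists.1 hx
  exact h2 hs

theorem eq_zero_of_integral_sq_eq_zero {ρ : Plane → ℝ} (hρ : Continuous ρ) (hf : Continuous f)
    (hρ0 : ∀ s ∈ Set.Ioo (0:ℝ) 1, 0 < ρ (K.edgePt i s)) (h : ∫ x, ρ x * f x ^ 2 ∂(K.edgeMeasure i) = 0) :
    ∀ x ∈ K.edge i, f x = 0 := by
  have hi : Integrable (fun x => ρ x * f x ^ 2) (K.edgeMeasure i) :=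
    (memLp_edge_of_continuous (K := K) (i := i) hρ).integrable_mul' (memLp_edge_of_continuous (hf.pow 2))
  have h0 : 0 ≤ᵐ[K.edgeMeasure i] fun x => ρ x * f x ^ 2 := by
    filter_upwards [ae_edgeMeasure_mem i] with x ⟨s, hs, hx⟩
    rw [hx]; exact mul_nonneg (hρ0 s hs).le (sq_nonneg _)
  have h1 := (integral_eq_zero_iff_of_nonneg_ae h0 hi).1 h
  refine eqOn_edge_of_ae_eq (g := 0) hf.continuousOn continuousOn_const ?_
  filter_upwards [h1, ae_edgeMeasure_mem i] with x hx ⟨s, hs, hxs⟩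
  have := hρ0 s hs
  rw [← hxs] at this
  simpa [this.ne'] using hx

/-- The affine parameter along the `i`-th edge, as a polynomial. -/
noncomputable def edgeParam (K : ConvexPolygon) (i : Fin (K.extra + 3)) : MvPolynomial (Fin 2) ℝ :=
  ∑ a, MvPolynomial.C (K.dvec i a / ‖K.dvec i‖ ^ 2) * (MvPolynomial.X a - MvPolynomial.C (K.vert i a))

theorem totalDegree_edgeParam (i : Fin (K.extra + 3)) : (edgeParam K i).totalDegree ≤ 1 := by
  refine MvPolynomial.totalDegree_finsetSum_le fun a _ => (MvPolynomial.totalDegree_mul _ _).trans ?_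
  rw [MvPolynomial.totalDegree_C, zero_add]
  refine (MvPolynomial.totalDegree_sub _ _).trans ?_
  simp

theorem polyEval_edgeParam (s : ℝ) : polyEval (edgeParam K i) (K.edgePt i s) = s := by
  have h0 : ‖K.dvec i‖ ^ 2 = K.dvec i 0 ^ 2 + K.dvec i 1 ^ 2 := by
    rw [EuclideanSpace.norm_sq_eq, Fin.sum_univ_two]; simp
  have h1 : ‖K.dvec i‖ ^ 2 ≠ 0 := by have := norm_pos_iff.2 (dvec_ne_zero (K := K) i); positivity
  rw [edgeParam, Fin.sum_univ_two, polyEval_add, polyEval_mul, polyEval_mul, polyEval_sub, polyEval_sub]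
  simp only [polyEval_C, polyEval_X, edgePt_eq, PiLp.add_apply, PiLp.smul_apply, smul_eq_mul]
  rw [h0] at h1 ⊢
  field_simp
  ring

/-- The restriction of a polynomial to the line through the `i`-th edge. -/
noncomputable def edgePoly (K : ConvexPolygon) (i : Fin (K.extra + 3)) (p : MvPolynomial (Fin 2) ℝ) : Polynomial ℝ :=
  MvPolynomial.aeval (fun a => Polynomial.C (K.vert i a) + Polynomial.C (K.dvec i a) * Polynomial.X) p

theorem eval_edgePoly (p : MvPolynomial (Fin 2) ℝ) (s : ℝ) : (edgePoly K i p).eval s = polyEval p (K.edgePt i s) := by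
  unfold edgePoly polyEval
  rw [← Polynomial.coe_evalRingHom, MvPolynomial.aeval_def, MvPolynomial.eval₂_comp_left]
  unfold MvPolynomial.eval
  have e1 : (Polynomial.evalRingHom s).comp (algebraMap ℝ (Polynomial ℝ)) = RingHom.id ℝ := by ext; simp
  rw [e1]
  congr 1
  ext a
  simp only [Function.comp, Polynomial.coe_evalRingHom, Polynomial.eval_add, Polynomial.eval_C, Polynomial.eval_mul, Polynomial.eval_X,
    edgePt_eq, PiLp.add_apply, PiLp.smul_apply, smul_eq_mul, mul_comm s]

theorem natDegree_edgePoly {p : MvPolynomial (Fin 2) ℝ} {k : ℕ} (hp : p.totalDegree ≤ k) : (edgePoly K i p).natDegree ≤ k := by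
  have := MvPolynomial.aeval_natDegree_le (n := 1) p hp (fun a => Polynomial.C (K.vert i a) + Polynomial.C (K.dvec i a) * Polynomial.X)
    (fun a => by
      refine (Polynomial.natDegree_add_le _ _).trans ?_
      rw [Polynomial.natDegree_C]
      exact max_le (by omega) ((Polynomial.natDegree_C_mul_le _ _).trans Polynomial.natDegree_X_le))
  rwa [mul_one] at this

theorem totalDegree_aeval_edgeParam (r : Polynomial ℝ) : (Polynomial.aeval (edgeParam K i) r).totalDegree ≤ r.natDegree := by
  rw [Polynomial.aeval_eq_sum_range]
  refine MvPolynomial.totalDegree_finsetSum_le fun n hn => (MvPolynomial.totalDegree_smul_le _ _).trans ?_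
  refine (MvPolynomial.totalDegree_pow _ _).trans ?_
  have h1 := totalDegree_edgeParam (K := K) i
  have h2 : n ≤ r.natDegree := by simpa [Nat.lt_succ_iff] using hn
  nlinarith

theorem polyEval_aeval_edgeParam (r : Polynomial ℝ) (s : ℝ) :
    polyEval (Polynomial.aeval (edgeParam K i) r) (K.edgePt i s) = r.eval s := by
  have := Polynomial.hom_eval₂ r (algebraMap ℝ (MvPolynomial (Fin 2) ℝ)) (MvPolynomial.eval (fun a => K.edgePt i s a)) (edgeParam K i)
  unfold polyEval
  rw [Polynomial.aeval_def, this]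
  have e : (MvPolynomial.eval fun a => K.edgePt i s a) (edgeParam K i) = s := polyEval_edgeParam s
  have e1 : (MvPolynomial.eval fun a => K.edgePt i s a).comp (algebraMap ℝ (MvPolynomial (Fin 2) ℝ)) = RingHom.id ℝ := by ext; simp
  rw [e, e1, Polynomial.eval₂_id]

/-- A polynomial of degree at most `k` on an edge is determined by its end point values and its moments up to `k - 2`. -/
theorem polyEval_eq_zero_on_edge {k : ℕ} {p : MvPolynomial (Fin 2) ℝ} (hp : p.totalDegree ≤ k)
    (h0 : polyEval p (K.vert i) = 0) (h1 : polyEval p (K.vert (i + 1)) = 0)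
    (hm : ∀ m : MvPolynomial (Fin 2) ℝ, m.totalDegree ≤ k - 2 → ∫ x, polyEval m x * polyEval p x ∂(K.edgeMeasure i) = 0) :
    ∀ x ∈ K.edge i, polyEval p x = 0 := by
  -- In the edge parameter `p` is divisible by `s (s - 1)`. The quotient has degree at most `k - 2`,
  -- so its lift `m` to two variables is an admissible test, and the moment against it is, up to
  -- sign, the integral of `m²` with the positive weight `s (1 - s)`.
  set q := edgePoly K i p with hq
  have q0 : q.IsRoot 0 := by rw [Polynomial.IsRoot, hq, eval_edgePoly, edgePt_zero, h0]
  have q1 : q.IsRoot 1 := by rw [Polynomial.IsRoot, hq, eval_edgePoly, edgePt_one, h1]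
  obtain ⟨q', hq'⟩ := Polynomial.dvd_iff_isRoot.2 q0
  have q1' : q'.IsRoot 1 := by
    rw [hq'] at q1
    simpa using q1
  obtain ⟨r, hr⟩ := Polynomial.dvd_iff_isRoot.2 q1'
  have hdeg : r.natDegree ≤ k - 2 := by
    by_cases hr0 : r = 0
    · simp [hr0]
    have hd := natDegree_edgePoly (K := K) (i := i) hp
    rw [← hq, hq', hr, Polynomial.natDegree_mul (Polynomial.X_sub_C_ne_zero 0) (mul_ne_zero (Polynomial.X_sub_C_ne_zero 1) hr0),
      Polynomial.natDegree_mul (Polynomial.X_sub_C_ne_zero 1) hr0, Polynomial.natDegree_X_sub_C, Polynomial.natDegree_X_sub_C] at hd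
    omega
  set m := Polynomial.aeval (edgeParam K i) r with hmd
  have hs : ∀ s, polyEval p (K.edgePt i s) = -(s * (1 - s) * polyEval m (K.edgePt i s)) := by
    intro s
    rw [← eval_edgePoly, ← hq, hq', hr, polyEval_aeval_edgeParam]
    simp
    ring
  set ρ : Plane → ℝ := fun x => polyEval (edgeParam K i) x * (1 - polyEval (edgeParam K i) x) with hρ
  have hρe : ∀ s, ρ (K.edgePt i s) = s * (1 - s) := fun s => by simp only [hρ, polyEval_edgeParam]
  have hz := hm m ((totalDegree_aeval_edgeParam r).trans hdeg)
  have hz2 : ∫ x, ρ x * polyEval m x ^ 2 ∂(K.edgeMeasure i) = 0 := by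
    rw [← neg_eq_zero, ← integral_neg, ← hz]
    refine integral_congr_ae ?_
    filter_upwards [ae_edgeMeasure_mem i] with x ⟨s, _, hx⟩
    rw [hx, hρe, hs]; ring
  have := eq_zero_of_integral_sq_eq_zero (ρ := ρ) ((continuous_polyEval _).mul (continuous_const.sub (continuous_polyEval _))) (continuous_polyEval m)
    (fun s hs => by rw [hρe]; exact mul_pos hs.1 (by linarith [hs.2])) hz2
  intro x hx
  have hxm := this x hx
  obtain ⟨s, _, rfl⟩ := mem_edge_iff_exists.1 hx
  rw [hs, hxm]; simp

/-! ### Lifting of boundary values -/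

theorem ell_succ_vert_eq (i : Fin (K.extra + 3)) : K.ell (i + 1) (K.vert i) = cross (K.dvec i) (K.dvec (i + 1)) := by
  simp only [ell, dvec, cross]
  simp
  ring

theorem ell_pred_vert_succ_eq (i : Fin (K.extra + 3)) : K.ell (i - 1) (K.vert (i + 1)) = cross (K.dvec (i - 1)) (K.dvec i) := by
  simp only [ell, dvec, cross, sub_add_cancel]
  simp
  ring

theorem vertProd_eq_zero_on_edge {j : Fin (K.extra + 3)} (h1 : j ≠ i) (h2 : j ≠ i + 1) {x : Plane} (hx : x ∈ K.edge i) :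
    vertProd K j x = 0 :=
  Finset.prod_eq_zero (i := i) (by
    simp only [Finset.mem_erase, Finset.mem_univ, and_true]
    exact ⟨fun h => h2 (by rw [h, sub_add_cancel]), h1.symm⟩) (ell_eq_zero_of_mem_edge hx)

theorem vertProd_self_eq (i : Fin (K.extra + 3)) (x : Plane) : vertProd K i x =
    K.ell (i + 1) x * ∏ k ∈ ((Finset.univ.erase i).erase (i - 1)).erase (i + 1), K.ell k x :=
  (Finset.mul_prod_erase _ (fun k => K.ell k x) (by
    simp only [Finset.mem_erase, Finset.mem_univ, and_true]
    exact ⟨(pred_ne_succ i).symm, succ_ne i⟩)).symm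

theorem vertProd_succ_eq (i : Fin (K.extra + 3)) (x : Plane) : vertProd K (i + 1) x =
    K.ell (i - 1) x * ∏ k ∈ ((Finset.univ.erase i).erase (i - 1)).erase (i + 1), K.ell k x := by
  have e : ((Finset.univ.erase i).erase (i - 1)).erase (i + 1) = (((Finset.univ.erase (i + 1)).erase (i + 1 - 1)).erase (i - 1)) := by
    rw [add_sub_cancel_right, Finset.erase_right_comm, Finset.erase_right_comm (a := i)]
  rw [e]
  exact (Finset.mul_prod_erase _ (fun k => K.ell k x) (by
    simp only [Finset.mem_erase, Finset.mem_univ, and_true, add_sub_cancel_right]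
    exact ⟨pred_ne i, pred_ne_succ i⟩)).symm

/-- Generalized barycentric coordinates that are affine on the edges. -/
theorem exists_barycentric (K : ConvexPolygon) : ∃ lam : Fin (K.extra + 3) → Plane → ℝ, (∀ i, ContDiff ℝ ∞ (lam i)) ∧
    ∀ i, ∀ s ∈ Set.Icc (0:ℝ) 1, lam i (K.edgePt i s) = 1 - s ∧ lam (i + 1) (K.edgePt i s) = s ∧
      ∀ j, j ≠ i → j ≠ i + 1 → lam j (K.edgePt i s) = 0 := by
  -- Wachspress coordinates. On the `i`-th edge only the terms of its two end points survive, and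
  -- with these weights they have a common factor, which is also the value of the denominator `Φ`;
  -- the quotients are therefore affine there.
  set κ := fun i => cross (K.dvec (i - 1)) (K.dvec i) with hκ
  obtain ⟨δ, δ0, hδ⟩ := exists_le_sum_vertProd K κ cross_dvec_pos
  set Φ : Plane → ℝ := fun x => ∑ i, κ i * vertProd K i x with hΦ
  have hΦs : ContDiff ℝ ∞ Φ := ContDiff.sum fun i _ => contDiff_const.mul (contDiff_vertProd i)
  -- Since `Φ ≥ δ` on the polygon, `r (Φ - δ)` is `1 / Φ` there and is smooth in the whole plane,
  -- where `Φ` may vanish.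
  obtain ⟨r, hr, hr1⟩ := exists_smooth_reciprocal δ0
  refine ⟨fun i x => κ i * vertProd K i x * r (Φ x - δ), fun i => (contDiff_const.mul (contDiff_vertProd i)).mul (hr.comp (hΦs.sub contDiff_const)),
    fun i s hs => ?_⟩
  have hx := edgePt_mem_edge (K := K) (i := i) hs
  have hxc := edge_subset_carrier hx
  set x := K.edgePt i s with hxd
  have hΦp : 0 < Φ x := δ0.trans_le (hδ x hxc)
  have hR : r (Φ x - δ) = (Φ x)⁻¹ := by rw [hr1 _ (sub_nonneg.2 (hδ x hxc)), sub_add_cancel]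
  have hz : ∀ j, j ≠ i → j ≠ i + 1 → vertProd K j x = 0 := fun j h1 h2 => vertProd_eq_zero_on_edge h1 h2 hx
  set Q := ∏ k ∈ ((Finset.univ.erase i).erase (i - 1)).erase (i + 1), K.ell k x with hQ
  have e1 : κ i * vertProd K i x = (1 - s) * (κ i * κ (i + 1) * Q) := by
    rw [vertProd_self_eq, hxd, ell_succ_edgePt, ell_succ_vert_eq, hκ]
    simp only [add_sub_cancel_right, hQ, hxd]; ring
  have e2 : κ (i + 1) * vertProd K (i + 1) x = s * (κ i * κ (i + 1) * Q) := by
    rw [vertProd_succ_eq, hxd, ell_pred_edgePt, ell_pred_vert_succ_eq, hκ]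
    simp only [hQ, hxd]; ring
  have e3 : Φ x = κ i * κ (i + 1) * Q := by
    have : Φ x = ∑ j ∈ {i, i + 1}, κ j * vertProd K j x := by
      refine (Finset.sum_subset (Finset.subset_univ _) fun j _ hj => ?_).symm
      simp only [Finset.mem_insert, Finset.mem_singleton, not_or] at hj
      rw [hz j hj.1 hj.2, mul_zero]
    rw [this, Finset.sum_pair (succ_ne i).symm, e1, e2]; ring
  refine ⟨?_, ?_, fun j h1 h2 => ?_⟩
  · simp only [hR, e1, ← e3]; field_simp
  · simp only [hR, e2, ← e3]; field_simp
  · simp only [hz j h1 h2, mul_zero, zero_mul]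

/-- A smooth function with polynomial edge values matching the vertex values and edge moments of `u`. -/
theorem exists_boundary_lift {k : ℕ} (hk : 2 ≤ k) {u : Plane → ℝ} (hu : ContinuousOn u K.carrier) :
    ∃ L : Plane → ℝ, ContDiff ℝ ∞ L ∧ (∀ i, L (K.vert i) = u (K.vert i)) ∧
      (∀ i, ∃ p : MvPolynomial (Fin 2) ℝ, p.totalDegree ≤ k ∧ ∀ x ∈ K.edge i, L x = polyEval p x) ∧
      ∀ i, ∀ m : MvPolynomial (Fin 2) ℝ, m.totalDegree ≤ k - 2 →
        ∫ x, polyEval m x * L x ∂(K.edgeMeasure i) = ∫ x, polyEval m x * u x ∂(K.edgeMeasure i) := by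
  obtain ⟨lam, hl, hle⟩ := exists_barycentric K
  have mu : ∀ i, MemLp u 2 (K.edgeMeasure i) := fun i => memLp_edge (hu.mono edge_subset_carrier)
  set lin : Fin (K.extra + 3) → MvPolynomial (Fin 2) ℝ := fun i =>
    MvPolynomial.C (u (K.vert i)) * (1 - edgeParam K i) + MvPolynomial.C (u (K.vert (i + 1))) * edgeParam K i with hlin
  have mp : ∀ (i : Fin (K.extra + 3)) (q : MvPolynomial (Fin 2) ℝ), MemLp (polyEval q) 2 (K.edgeMeasure i) := fun i q =>
    memLp_edge_of_continuous (continuous_polyEval q)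
  -- The bubble coefficient that matches the edge moments left over by linear interpolation. The
  -- bilinear form has the positive weight `s (1 - s)`, so its kernel consists of the polynomials
  -- that vanish on the edge; for these the right side is zero as well, and the system is solvable.
  have hr : ∀ i, ∃ r : MvPolynomial (Fin 2) ℝ, r.totalDegree ≤ k - 2 ∧ ∀ m : MvPolynomial (Fin 2) ℝ, m.totalDegree ≤ k - 2 →
      ∫ x, polyEval m x * polyEval (edgeParam K i * (1 - edgeParam K i) * r) x ∂(K.edgeMeasure i) =
        ∫ x, polyEval m x * (u x - polyEval (lin i) x) ∂(K.edgeMeasure i) := by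
    intro i
    set ρ := edgeParam K i * (1 - edgeParam K i) with hρ
    set b : PolyLE (k - 2) →ₗ[ℝ] PolyLE (k - 2) →ₗ[ℝ] ℝ := LinearMap.mk₂ ℝ
      (fun m r => ∫ x, polyEval (m : MvPolynomial (Fin 2) ℝ) x * polyEval (ρ * r) x ∂(K.edgeMeasure i))
      (fun m m' r => by
        rw [← integral_add ((mp i _).integrable_mul' (mp i _)) ((mp i _).integrable_mul' (mp i _))]
        simp only [Submodule.coe_add, polyEval_add, add_mul])
      (fun c m r => by
        rw [smul_eq_mul, ← integral_const_mul]
        simp only [Submodule.coe_smul, polyEval_smul, mul_assoc])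
      (fun m r r' => by
        rw [← integral_add ((mp i _).integrable_mul' (mp i _)) ((mp i _).integrable_mul' (mp i _))]
        simp only [Submodule.coe_add, polyEval_add, mul_add])
      (fun c m r => by
        rw [smul_eq_mul, ← integral_const_mul]
        simp only [Submodule.coe_smul, polyEval_smul, polyEval_mul]
        congr 1; ext x; ring) with hb
    have mul : MemLp (fun x => u x - polyEval (lin i) x) 2 (K.edgeMeasure i) := (mu i).sub (mp i _)
    set t : PolyLE (k - 2) →ₗ[ℝ] ℝ :=
      { toFun := fun m => ∫ x, polyEval (m : MvPolynomial (Fin 2) ℝ) x * (u x - polyEval (lin i) x) ∂(K.edgeMeasure i)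
        map_add' := fun m m' => by
          rw [← integral_add ((mp i _).integrable_mul' mul) ((mp i _).integrable_mul' mul)]
          simp only [Submodule.coe_add, polyEval_add, add_mul]
        map_smul' := fun c m => by
          rw [RingHom.id_apply, smul_eq_mul, ← integral_const_mul]
          simp only [Submodule.coe_smul, polyEval_smul, mul_assoc] } with ht
    obtain ⟨r, hr⟩ := exists_forall_eq_of_annihilator b t (fun m hm => by
      have h0 : ∫ x, polyEval ρ x * polyEval (m : MvPolynomial (Fin 2) ℝ) x ^ 2 ∂(K.edgeMeasure i) = 0 := by
        have := LinearMap.congr_fun hm m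
        rw [LinearMap.zero_apply, hb, LinearMap.mk₂_apply] at this
        rw [← this]
        congr 1; ext x; rw [polyEval_mul ρ]; ring
      have h1 := eq_zero_of_integral_sq_eq_zero (continuous_polyEval ρ) (continuous_polyEval _)
        (fun s hs => by
          rw [hρ, polyEval_mul, polyEval_sub, polyEval_edgeParam, show polyEval 1 (K.edgePt i s) = 1 from map_one _]
          exact mul_pos hs.1 (by linarith [hs.2])) h0
      change ∫ x, polyEval (m : MvPolynomial (Fin 2) ℝ) x * (u x - polyEval (lin i) x) ∂(K.edgeMeasure i) = 0
      refine integral_eq_zero_of_ae ?_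
      filter_upwards [ae_edgeMeasure_mem_edge i] with x hx
      rw [h1 x hx, zero_mul]; rfl)
    exact ⟨r, mem_polyLE.1 r.2, fun m hm => hr ⟨m, mem_polyLE.2 hm⟩⟩
  choose r hrd hrm using hr
  -- On the `i`-th edge the product `lam j * lam (j + 1)` vanishes for `j ≠ i` and is `s (1 - s)`
  -- for `j = i`, so the bubbles of different edges do not interact.
  set L : Plane → ℝ := fun x => (∑ j, u (K.vert j) * lam j x) + ∑ j, lam j x * lam (j + 1) x * polyEval (r j) x with hL
  set P : Fin (K.extra + 3) → MvPolynomial (Fin 2) ℝ := fun i => lin i + edgeParam K i * (1 - edgeParam K i) * r i with hP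
  have one_eval : ∀ x, polyEval 1 x = 1 := fun x => map_one _
  have hLe : ∀ i, ∀ x ∈ K.edge i, L x = polyEval (P i) x := by
    intro i x hx
    obtain ⟨s, hs, rfl⟩ := mem_edge_iff_exists.1 hx
    obtain ⟨l1, l2, l3⟩ := hle i s hs
    have s1 : ∑ j, u (K.vert j) * lam j (K.edgePt i s) = u (K.vert i) * (1 - s) + u (K.vert (i + 1)) * s := by
      have := Finset.sum_pair (f := fun j => u (K.vert j) * lam j (K.edgePt i s)) (succ_ne i).symm
      rw [l1, l2] at this
      rw [← this]
      refine (Finset.sum_subset (Finset.subset_univ _) fun j _ hj => ?_).symm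
      simp only [Finset.mem_insert, Finset.mem_singleton, not_or] at hj
      rw [l3 j hj.1 hj.2, mul_zero]
    have s2 : ∑ j, lam j (K.edgePt i s) * lam (j + 1) (K.edgePt i s) * polyEval (r j) (K.edgePt i s) =
        (1 - s) * s * polyEval (r i) (K.edgePt i s) := by
      rw [Finset.sum_eq_single i, l1, l2]
      · intro j _ hj
        by_cases h2 : j = i + 1
        · subst h2
          rw [l3 (i + 1 + 1) (succ_succ_ne i) (succ_ne _)]; ring
        · rw [l3 j hj h2]; ring
      · intro h; exact absurd (Finset.mem_univ _) h
    simp only [hL, s1, s2, hP, hlin, polyEval_add, polyEval_mul, polyEval_sub, polyEval_C, polyEval_edgeParam, one_eval]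
    ring
  have dE : ∀ i, (edgeParam K i).totalDegree ≤ 1 := totalDegree_edgeParam
  have d1E : ∀ i, (1 - edgeParam K i).totalDegree ≤ 1 := fun i =>
    (MvPolynomial.totalDegree_sub _ _).trans (max_le (by simp) (dE i))
  refine ⟨L, (ContDiff.sum fun j _ => contDiff_const.mul (hl j)).add (ContDiff.sum fun j _ => ((hl j).mul (hl (j + 1))).mul (contDiff_polyEval _)),
    fun i => ?_, fun i => ⟨P i, ?_, hLe i⟩, fun i m hm => ?_⟩
  · rw [hLe i _ vert_mem_edge, ← edgePt_zero]
    simp only [hP, hlin, polyEval_add, polyEval_mul, polyEval_sub, polyEval_C, polyEval_edgeParam, one_eval]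
    simp
  · refine (MvPolynomial.totalDegree_add _ _).trans (max_le ?_ ?_)
    · refine (MvPolynomial.totalDegree_add _ _).trans (max_le ?_ ?_)
      · refine (MvPolynomial.totalDegree_mul _ _).trans ?_
        have := d1E i; simp; omega
      · refine (MvPolynomial.totalDegree_mul _ _).trans ?_
        have := dE i; simp; omega
    · refine (MvPolynomial.totalDegree_mul _ _).trans ?_
      have h1 := MvPolynomial.totalDegree_mul (edgeParam K i) (1 - edgeParam K i)
      have := dE i; have := d1E i; have := hrd i; omega
  · have e : ∫ x, polyEval m x * L x ∂(K.edgeMeasure i) = ∫ x, polyEval m x * polyEval (P i) x ∂(K.edgeMeasure i) := by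
      refine integral_congr_ae ?_
      filter_upwards [ae_edgeMeasure_mem_edge i] with x hx
      rw [hLe i x hx]
    have e2 : ∫ x, polyEval m x * polyEval (P i) x ∂(K.edgeMeasure i) = (∫ x, polyEval m x * polyEval (lin i) x ∂(K.edgeMeasure i)) +
        ∫ x, polyEval m x * polyEval (edgeParam K i * (1 - edgeParam K i) * r i) x ∂(K.edgeMeasure i) := by
      rw [← integral_add ((mp i _).integrable_mul' (mp i _)) ((mp i _).integrable_mul' (mp i _))]
      simp only [hP, polyEval_add, mul_add]
    have mul : MemLp (fun x => u x - polyEval (lin i) x) 2 (K.edgeMeasure i) := (mu i).sub (mp i _)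
    rw [e, e2, hrm i m hm, ← integral_add ((mp i _).integrable_mul' (mp i _)) ((mp i _).integrable_mul' mul)]
    congr 1; ext x; ring

end ConvexPolygon
end StrainGradientVEM

namespace StrainGradientVEM
open ConvexPolygon

/-! ## Completeness of `H² ∩ H¹₀` for the Laplacian norm -/

variable {K : ConvexPolygon} {i : Fin (K.extra + 3)} {f f' g h p w w' u v e φ : Plane → ℝ}

theorem L2Lim.tendsto_l2n_self {μ : Measure Plane} {φ : ℕ → Plane → ℝ} (h : L2Lim μ φ f) (hφ : ∀ m, MemLp (φ m) 2 μ) (hf : MemLp f 2 μ) :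
    Tendsto (fun m => l2n μ (φ m)) atTop (𝓝 (l2n μ f)) := by
  have h0 := h.tendsto_l2n
  rw [tendsto_iff_dist_tendsto_zero]
  refine squeeze_zero (fun _ => dist_nonneg) (fun m => ?_) h0
  rw [Real.dist_eq, abs_le]
  have e1 : φ m = (φ m - f) + f := by abel
  have e2 : f = φ m - (φ m - f) := by abel
  have a1 := l2n_add_le ((hφ m).sub hf) hf
  have a2 := l2n_sub_le (hφ m) ((hφ m).sub hf)
  rw [← e1] at a1
  rw [← e2] at a2
  constructor <;> linarith

theorem trace_le (i : Fin (K.extra + 3)) : ∃ C, 0 ≤ C ∧ ∀ f : Plane → ℝ, MemH1 K.inner f →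
    l2n (K.edgeMeasure i) (trace K i f) ≤ C * (l2n (volume.restrict K.inner) f +
      ∑ a, l2n (volume.restrict K.inner) (weakPartial K.inner a f)) := by
  obtain ⟨C, C0, hC⟩ := trace_inequality (K := K) i
  refine ⟨C, C0, fun f hf => ?_⟩
  obtain ⟨φ, hφ⟩ := hf.exists_approx
  have m := fun {q : Plane → ℝ} (hq : Continuous q) => memLp_of_continuous (U := K.inner) K.isBounded_inner hq
  have l1 := (hφ.l2Lim_trace hf i).tendsto_l2n_self (fun n => memLp_edge_of_continuous (hφ.1 n).continuous) (hf.memLp_trace i)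
  have l2 := ((hφ.2.1.tendsto_l2n_self (fun n => m (hφ.1 n).continuous) hf.1).add (tendsto_finsetSum Finset.univ fun a _ =>
    (hφ.2.2 a).tendsto_l2n_self (fun n => m (pderiv_contDiff (hφ.1 n) a).continuous) (hf.memLp_weakPartial K.isOpen_inner a))).const_mul C
  exact le_of_tendsto_of_tendsto' l1 l2 fun n => hC _ (hφ.1 n)

theorem l2Lim_trace_of_l2Lim {ws : ℕ → Plane → ℝ} (hw : ∀ n, MemH1 K.inner (ws n)) (hf : MemH1 K.inner f)
    (h0 : L2Lim (volume.restrict K.inner) ws f)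
    (h1 : ∀ a, L2Lim (volume.restrict K.inner) (fun n => weakPartial K.inner a (ws n)) (weakPartial K.inner a f)) (i : Fin (K.extra + 3)) :
    L2Lim (K.edgeMeasure i) (fun n => trace K i (ws n)) (trace K i f) := by
  obtain ⟨C, C0, hC⟩ := trace_le (K := K) i
  refine l2Lim_of_tendsto (fun n => (hw n).memLp_trace i) (hf.memLp_trace i) ?_
  have lim := (h0.tendsto_l2n.add (tendsto_finsetSum Finset.univ fun a _ => (h1 a).tendsto_l2n)).const_mul C
  simp only [Finset.sum_const_zero, add_zero, mul_zero] at lim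
  refine squeeze_zero (fun _ => l2n_nonneg _ _) (fun n => ?_) lim
  have := hC _ ((hw n).sub K.isOpen_inner hf)
  rw [l2n_congr (trace_sub (hw n) hf i)] at this
  refine this.trans (le_of_eq ?_)
  simp only [l2n_congr (weakPartial_sub K.isOpen_inner (hw n) hf _)]

theorem MemH2H10.sub (hw : MemH2H10 K w) (hg : MemH2H10 K g) : MemH2H10 K (w - g) := by
  have : w - g = w + (-1 : ℝ) • g := by rw [neg_one_smul, sub_eq_add_neg]
  rw [this]; exact hw.add (hg.const_smul _)

theorem MemH2H10.l2n_grad_le (hw : MemH2H10 K w) (a : Fin 2) :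
    l2n (volume.restrict K.inner) (weakPartial K.inner a w) ≤ 2 * K.diam * l2n (volume.restrict K.inner) (weakLaplacian K.inner w) := by
  refine le_trans ?_ hw.grad_le
  rw [l2n_eq_sqrt (hw.1.1.memLp_weakPartial K.isOpen_inner a)]
  exact Real.sqrt_le_sqrt (Finset.single_le_sum (f := fun a => ∫ x in K.inner, weakPartial K.inner a w x ^ 2)
      (fun a _ => integral_nonneg fun x => sq_nonneg _) (Finset.mem_univ a))

theorem MemH2H10.l2n_le (hw : MemH2H10 K w) :
    l2n (volume.restrict K.inner) w ≤ (2 * K.diam) ^ 2 * l2n (volume.restrict K.inner) (weakLaplacian K.inner w) := by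
  have h1 := friedrichs hw.1.1 hw.trace_eq_zero 0
  have h2 := mul_le_mul_of_nonneg_left (hw.l2n_grad_le 0) (by have := diam_pos K; positivity : 0 ≤ 2 * K.diam)
  nlinarith

theorem MemH2H10.l2n_hessian_le (hw : MemH2H10 K w) (a b : Fin 2) :
    l2n (volume.restrict K.inner) (weakPartial K.inner b (weakPartial K.inner a w)) ≤ l2n (volume.restrict K.inner) (weakLaplacian K.inner w) := by
  refine (sq_le_sq₀ (l2n_nonneg _ _) (l2n_nonneg _ _)).1 ?_
  rw [← hw.sum_integral_hessian_sq, l2n_sq ((hw.1.2 a).memLp_weakPartial K.isOpen_inner b)]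
  have n := fun i j : Fin 2 => integral_nonneg (μ := volume.restrict K.inner) (f := fun x => weakPartial K.inner j (weakPartial K.inner i w) x ^ 2)
    (fun x => sq_nonneg _)
  exact (Finset.single_le_sum (f := fun j => ∫ x in K.inner, weakPartial K.inner j (weakPartial K.inner a w) x ^ 2) (fun j _ => n a j) (Finset.mem_univ b)).trans
    (Finset.single_le_sum (f := fun i => ∑ j, ∫ x in K.inner, weakPartial K.inner j (weakPartial K.inner i w) x ^ 2)
      (fun i _ => Finset.sum_nonneg fun j _ => n i j) (Finset.mem_univ a))

/-- `D` stands for the identity, a first or a second weak derivative. Each is bounded by the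
Laplacian on `H² ∩ H¹₀`, so Laplacians that converge make it a Cauchy sequence. -/
theorem exists_l2Lim_of_laplacian_bound {ws : ℕ → Plane → ℝ} (hw : ∀ n, MemH2H10 K (ws n)) {F : Plane → ℝ} (hF : MemLp F 2 (volume.restrict K.inner))
    (hl : L2Lim (volume.restrict K.inner) (fun n => weakLaplacian K.inner (ws n)) F) (D : (Plane → ℝ) → Plane → ℝ) {C : ℝ} (C0 : 0 ≤ C)
    (hD : ∀ w, MemH2H10 K w → MemLp (D w) 2 (volume.restrict K.inner) ∧ l2n (volume.restrict K.inner) (D w) ≤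
      C * l2n (volume.restrict K.inner) (weakLaplacian K.inner w))
    (hs : ∀ w w', MemH2H10 K w → MemH2H10 K w' → D (w - w') =ᵐ[volume.restrict K.inner] D w - D w') :
    ∃ T, MemLp T 2 (volume.restrict K.inner) ∧ L2Lim (volume.restrict K.inner) (fun n => D (ws n)) T := by
  refine exists_l2Lim_of_cauchy (fun n => (hD _ (hw n)).1) fun ε hε => ?_
  obtain ⟨N, hN⟩ := hl.eventually_l2n_sub_lt (fun n => (hw n).1.memLp_weakLaplacian K.isOpen_inner) hF (ε := ε / (C + 1)) (by positivity)
  refine ⟨N, fun m hm n hn => ?_⟩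
  rw [← l2n_congr (hs _ _ (hw m) (hw n))]
  refine ((hD _ ((hw m).sub (hw n))).2).trans_lt ?_
  rw [l2n_congr (weakLaplacian_sub K.isOpen_inner (hw m).1 (hw n).1)]
  have h1 := hN m hm n hn
  calc _ ≤ C * (ε / (C + 1)) := by gcongr
    _ < (C + 1) * (ε / (C + 1)) := by gcongr; linarith
    _ = ε := by field_simp

/-- The Laplacian controls the full `H²` norm by Friedrichs' inequality and the Miranda-Talenti
identity. The derivatives converge separately, weak differentiation is closed, and the traces
converge by the trace inequality, so the limit still vanishes on the boundary. The convergence of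
the gradient traces keeps track of the normal moments. -/
theorem exists_memH2H10_limit {ws : ℕ → Plane → ℝ} (hw : ∀ n, MemH2H10 K (ws n)) {F : Plane → ℝ} (hF : MemLp F 2 (volume.restrict K.inner))
    (hl : L2Lim (volume.restrict K.inner) (fun n => weakLaplacian K.inner (ws n)) F) :
    ∃ w, MemH2H10 K w ∧ weakLaplacian K.inner w =ᵐ[volume.restrict K.inner] F ∧ L2Lim (volume.restrict K.inner) ws w ∧
      ∀ i a, L2Lim (K.edgeMeasure i) (fun n => trace K i (weakPartial K.inner a (ws n))) (trace K i (weakPartial K.inner a w)) := by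
  have hU := K.isOpen_inner
  have hd := (diam_pos K).le
  obtain ⟨W, mW, lW⟩ := exists_l2Lim_of_laplacian_bound hw hF hl (fun w => w) (C := (2 * K.diam) ^ 2) (by positivity)
    (fun w hw => ⟨hw.1.1.1, hw.l2n_le⟩) (fun w w' _ _ => ae_eq_refl _)
  have h1 := fun a => exists_l2Lim_of_laplacian_bound hw hF hl (fun w => weakPartial K.inner a w) (C := 2 * K.diam) (by positivity)
    (fun w hw => ⟨hw.1.1.memLp_weakPartial hU a, hw.l2n_grad_le a⟩) (fun w w' hw hw' => weakPartial_sub hU hw.1.1 hw'.1.1 a)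
  choose W1 m1 l1 using h1
  have h2 := fun a b => exists_l2Lim_of_laplacian_bound hw hF hl (fun w => weakPartial K.inner b (weakPartial K.inner a w)) (C := 1) (by positivity)
    (fun w hw => ⟨(hw.1.2 a).memLp_weakPartial hU b, by rw [one_mul]; exact hw.l2n_hessian_le a b⟩)
    (fun w w' hw hw' => weakPartial2_sub hU hw.1 hw'.1 a b)
  choose W2 m2 l2 using h2
  have p1 : ∀ a, IsWeakPartial K.inner a W (W1 a) := fun a => isWeakPartial_of_L2Lim (fun n => (hw n).1.1.1)
    (fun n => (hw n).1.1.memLp_weakPartial hU a) (fun n => (hw n).1.1.isWeakPartial a) mW (m1 a) lW (l1 a)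
  have p2 : ∀ a b, IsWeakPartial K.inner b (W1 a) (W2 a b) := fun a b => isWeakPartial_of_L2Lim (fun n => (hw n).1.1.memLp_weakPartial hU a)
    (fun n => ((hw n).1.2 a).memLp_weakPartial hU b) (fun n => ((hw n).1.2 a).isWeakPartial b) (m1 a) (m2 a b) (l1 a) (l2 a b)
  have e1 := fun a => (p1 a).weakPartial_ae hU
  have H1 : MemH1 K.inner W := ⟨mW, fun a => ⟨_, m1 a, p1 a⟩⟩
  have H1' : ∀ a, MemH1 K.inner (W1 a) := fun a => ⟨m1 a, fun b => ⟨_, m2 a b, p2 a b⟩⟩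
  have H2 : MemH2 K.inner W := ⟨H1, fun a => (H1' a).congr hU (e1 a).symm⟩
  have e2 : ∀ a b, weakPartial K.inner b (weakPartial K.inner a W) =ᵐ[volume.restrict K.inner] W2 a b := fun a b => by
    rw [weakPartial_congr (e1 a)]; exact (p2 a b).weakPartial_ae hU
  have l1' : ∀ a, L2Lim (volume.restrict K.inner) (fun n => weakPartial K.inner a (ws n)) (weakPartial K.inner a W) := fun a =>
    (l1 a).congr (fun _ => ae_eq_refl _) (e1 a).symm
  have l2' : ∀ a b, L2Lim (volume.restrict K.inner) (fun n => weakPartial K.inner b (weakPartial K.inner a (ws n)))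
      (weakPartial K.inner b (weakPartial K.inner a W)) := fun a b => (l2 a b).congr (fun _ => ae_eq_refl _) (e2 a b).symm
  have tz : ∀ i, trace K i W =ᵐ[K.edgeMeasure i] 0 := fun i => by
    have lt := l2Lim_trace_of_l2Lim (fun n => (hw n).1.1) H1 lW l1' i
    refine lt.unique ((L2Lim.const _ 0).congr (fun n => ((hw n).trace_eq_zero i).symm) (ae_eq_refl _)) (fun n => ((hw n).1.1.memLp_trace i).1)
      (H1.memLp_trace i).1 aestronglyMeasurable_zero
  refine ⟨W, ⟨H2, fun x hx => ?_⟩, ?_, lW, fun i a => l2Lim_trace_of_l2Lim (fun n => (hw n).1.2 a) (H2.2 a) (l1' a) (l2' a) i⟩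
  · obtain ⟨i, hi⟩ := mem_frontier_iff_edge.1 hx
    exact eqOn_edge_of_ae_eq (g := 0) (H2.continuousOn_contRep.mono edge_subset_carrier) continuousOn_const
      ((trace_ae_eq_contRep H2 i).symm.trans (tz i)) hi
  · have l3 := (l2' 0 0).add (l2' 1 1) (fun n => (((hw n).1.2 0).memLp_weakPartial hU 0).1) (fun n => (((hw n).1.2 1).memLp_weakPartial hU 1).1)
      ((H2.2 0).memLp_weakPartial hU 0).1 ((H2.2 1).memLp_weakPartial hU 1).1
    have l4 : L2Lim (volume.restrict K.inner) (fun n => weakLaplacian K.inner (ws n)) (weakLaplacian K.inner W) :=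
      l3.congr (fun n => ae_of_all _ fun x => by simp [weakLaplacian, Fin.sum_univ_two]) (ae_of_all _ fun x => by simp [weakLaplacian, Fin.sum_univ_two])
    exact l4.unique hl (fun n => ((hw n).1.memLp_weakLaplacian hU).1) (H2.memLp_weakLaplacian hU).1 hF.1

/-! ## Moments -/

theorem normalDeriv_add (hf : MemH2 K.inner f) (hg : MemH2 K.inner g) (i : Fin (K.extra + 3)) :
    normalDeriv K i (f + g) =ᵐ[K.edgeMeasure i] normalDeriv K i f + normalDeriv K i g := by
  have h := fun a => trace_add (hf.2 a) (hg.2 a) i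
  have c := fun a => trace_congr (weakPartial_add K.isOpen_inner hf.1 hg.1 a) i
  filter_upwards [h 0, h 1] with x h0 h1
  simp only [normalDeriv, Fin.sum_univ_two, c, Pi.add_apply, h0, h1]; ring

theorem normalDeriv_const_smul (hf : MemH2 K.inner f) (c : ℝ) (i : Fin (K.extra + 3)) :
    normalDeriv K i (c • f) =ᵐ[K.edgeMeasure i] c • normalDeriv K i f := by
  have h := fun a => trace_const_smul (hf.2 a) c i
  have c := fun a => trace_congr (weakPartial_const_smul K.isOpen_inner hf.1 c a) i
  filter_upwards [h 0, h 1] with x h0 h1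
  simp only [normalDeriv, Fin.sum_univ_two, c, Pi.smul_apply, smul_eq_mul, h0, h1]; ring

theorem normalDeriv_congr (h : f =ᵐ[volume.restrict K.inner] f') (i : Fin (K.extra + 3)) : normalDeriv K i f = normalDeriv K i f' := by
  unfold normalDeriv; simp only [weakPartial_congr h]

theorem normalDeriv_of_contDiff (hp : ContDiff ℝ ∞ p) (i : Fin (K.extra + 3)) :
    normalDeriv K i p =ᵐ[K.edgeMeasure i] fun x => ∑ a, K.normal i a * pderiv a p x := by
  have c := fun a => trace_congr (weakPartial_of_contDiff K.isOpen_inner hp a) i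
  have h := fun a => trace_of_contDiff (K := K) (pderiv_contDiff hp a) i
  filter_upwards [h 0, h 1] with x h0 h1
  simp only [normalDeriv, Fin.sum_univ_two, c, h0, h1]

theorem memLp_polyEval (K : ConvexPolygon) (m : MvPolynomial (Fin 2) ℝ) : MemLp (polyEval m) 2 (volume.restrict K.inner) :=
  memLp_of_continuous K.isBounded_inner (continuous_polyEval m)

theorem memLp_polyEval_edge (i : Fin (K.extra + 3)) (m : MvPolynomial (Fin 2) ℝ) : MemLp (polyEval m) 2 (K.edgeMeasure i) :=
  memLp_edge_of_continuous (continuous_polyEval m)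

/-- The right-hand side of Green's formula in the definition of the boundary values of the Laplacian. -/
noncomputable def momentPairing (K : ConvexPolygon) (f : MvPolynomial (Fin 2) ℝ) (g : Fin (K.extra + 3) → MvPolynomial (Fin 2) ℝ) (w : Plane → ℝ) : ℝ :=
  (∫ x in K.inner, polyEval f x * w x) + ∑ i, ∫ x, polyEval (g i) x * normalDeriv K i w x ∂(K.edgeMeasure i)

section momentPairing
variable {m m' : MvPolynomial (Fin 2) ℝ} {q q' : Fin (K.extra + 3) → MvPolynomial (Fin 2) ℝ}

theorem momentPairing_congr (h : f =ᵐ[volume.restrict K.inner] f') : momentPairing K m q f = momentPairing K m q f' := by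
  unfold momentPairing
  simp only [normalDeriv_congr h]
  congr 1
  refine integral_congr_ae ?_
  filter_upwards [h] with x hx
  rw [hx]

theorem momentPairing_add_right (hf : MemH2 K.inner f) (hg : MemH2 K.inner g) :
    momentPairing K m q (f + g) = momentPairing K m q f + momentPairing K m q g := by
  have e1 : ∫ x in K.inner, polyEval m x * (f + g) x = (∫ x in K.inner, polyEval m x * f x) + ∫ x in K.inner, polyEval m x * g x := by
    rw [← integral_add ((memLp_polyEval K m).integrable_mul' hf.1.1) ((memLp_polyEval K m).integrable_mul' hg.1.1)]
    simp only [Pi.add_apply, mul_add]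
  have e2 : ∀ i, ∫ x, polyEval (q i) x * normalDeriv K i (f + g) x ∂(K.edgeMeasure i) =
      (∫ x, polyEval (q i) x * normalDeriv K i f x ∂(K.edgeMeasure i)) + ∫ x, polyEval (q i) x * normalDeriv K i g x ∂(K.edgeMeasure i) := fun i => by
    rw [← integral_add ((memLp_polyEval_edge i (q i)).integrable_mul' (memLp_normalDeriv hf i)) ((memLp_polyEval_edge i (q i)).integrable_mul' (memLp_normalDeriv hg i))]
    refine integral_congr_ae ?_
    filter_upwards [normalDeriv_add hf hg i] with x hx
    rw [hx, Pi.add_apply]; ring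
  simp only [momentPairing, e1, e2, Finset.sum_add_distrib]; ring

theorem momentPairing_smul_right (hf : MemH2 K.inner f) (c : ℝ) :
    momentPairing K m q (c • f) = c * momentPairing K m q f := by
  have e1 : ∫ x in K.inner, polyEval m x * (c • f) x = c * ∫ x in K.inner, polyEval m x * f x := by
    rw [← integral_const_mul]; congr 1; ext x; simp only [Pi.smul_apply, smul_eq_mul]; ring
  have e2 : ∀ i, ∫ x, polyEval (q i) x * normalDeriv K i (c • f) x ∂(K.edgeMeasure i) =
      c * ∫ x, polyEval (q i) x * normalDeriv K i f x ∂(K.edgeMeasure i) := fun i => by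
    rw [← integral_const_mul]
    refine integral_congr_ae ?_
    filter_upwards [normalDeriv_const_smul hf c i] with x hx
    simp only [hx, Pi.smul_apply, smul_eq_mul]; ring
  simp only [momentPairing, e1, e2, ← Finset.mul_sum]; ring

theorem momentPairing_sub_right (hf : MemH2 K.inner f) (hg : MemH2 K.inner g) :
    momentPairing K m q (f - g) = momentPairing K m q f - momentPairing K m q g := by
  have : f - g = f + (-1 : ℝ) • g := by rw [neg_one_smul, sub_eq_add_neg]
  rw [this, momentPairing_add_right hf (hg.const_smul K.isOpen_inner _), momentPairing_smul_right hg]; ring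

theorem momentPairing_add_left (hf : MemH2 K.inner f) :
    momentPairing K (m + m') (q + q') f = momentPairing K m q f + momentPairing K m' q' f := by
  have e1 : ∫ x in K.inner, polyEval (m + m') x * f x = (∫ x in K.inner, polyEval m x * f x) + ∫ x in K.inner, polyEval m' x * f x := by
    rw [← integral_add ((memLp_polyEval K m).integrable_mul' hf.1.1) ((memLp_polyEval K m').integrable_mul' hf.1.1)]
    simp only [polyEval_add, add_mul]
  have e2 : ∀ i, ∫ x, polyEval ((q + q') i) x * normalDeriv K i f x ∂(K.edgeMeasure i) =
      (∫ x, polyEval (q i) x * normalDeriv K i f x ∂(K.edgeMeasure i)) + ∫ x, polyEval (q' i) x * normalDeriv K i f x ∂(K.edgeMeasure i) := fun i => by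
    rw [← integral_add ((memLp_polyEval_edge i (q i)).integrable_mul' (memLp_normalDeriv hf i)) ((memLp_polyEval_edge i (q' i)).integrable_mul' (memLp_normalDeriv hf i))]
    simp only [Pi.add_apply, polyEval_add, add_mul]
  simp only [momentPairing, e1, e2, Finset.sum_add_distrib]; ring

theorem momentPairing_smul_left (c : ℝ) : momentPairing K (c • m) (c • q) f = c * momentPairing K m q f := by
  simp only [momentPairing, Pi.smul_apply, polyEval_smul, mul_assoc, integral_const_mul, ← Finset.mul_sum]; ring

theorem momentPairing_zero_right (m : MvPolynomial (Fin 2) ℝ) : momentPairing K m 0 f = ∫ x in K.inner, polyEval m x * f x := by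
  simp [momentPairing, polyEval_zero]

theorem momentPairing_single (i : Fin (K.extra + 3)) (m : MvPolynomial (Fin 2) ℝ) :
    momentPairing K 0 (Pi.single i m) f = dofNormal K i m f := by
  have h0 : ∀ j, j ≠ i → ∫ x, polyEval ((Pi.single i m : Fin (K.extra + 3) → MvPolynomial (Fin 2) ℝ) j) x * normalDeriv K j f x ∂(K.edgeMeasure j) = 0 := fun j hj => by
    simp [Pi.single_eq_of_ne hj, polyEval_zero]
  rw [momentPairing, Finset.sum_eq_single i (fun j _ hj => h0 j hj) (fun h => absurd (Finset.mem_univ _) h), Pi.single_eq_same]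
  simp [polyEval_zero, dofNormal]

end momentPairing

theorem memH2H10_of_contDiff (hp : ContDiff ℝ ∞ p) (h : ∀ i, ∀ x ∈ K.edge i, p x = 0) : MemH2H10 K p :=
  ⟨memH2_of_contDiff K.isOpen_inner K.isBounded_inner hp, fun x hx => by
    rw [contRep_of_continuousOn hp.continuous.continuousOn (K.isClosed_carrier.frontier_subset hx)]
    obtain ⟨i, hi⟩ := mem_frontier_iff_edge.1 hx
    exact h i x hi⟩

theorem MemH2H10.zero : MemH2H10 K 0 := memH2H10_of_contDiff contDiff_const fun _ _ _ => rfl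

/-- The space `H² ∩ H¹₀` as a submodule of the functions. -/
noncomputable def hingeSpace (K : ConvexPolygon) : Submodule ℝ (Plane → ℝ) where
  carrier := {w | MemH2H10 K w}
  add_mem' := fun ha hb => ha.add hb
  zero_mem' := MemH2H10.zero
  smul_mem' := fun c _ hx => hx.const_smul c

/-- Test polynomials for the interior and normal moments. -/
abbrev MomentSpace (K : ConvexPolygon) (r : ℕ) : Type := PolyLE r × (Fin (K.extra + 3) → PolyLE r)

/-- The moments as a pairing of test polynomials with functions in `H² ∩ H¹₀`. -/
noncomputable def momentMap (K : ConvexPolygon) (r : ℕ) : MomentSpace K r →ₗ[ℝ] hingeSpace K →ₗ[ℝ] ℝ :=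
  LinearMap.mk₂ ℝ (fun v w => momentPairing K v.1 (fun i => v.2 i) w)
    (fun _ _ w => momentPairing_add_left w.2.1) (fun c _ _ => momentPairing_smul_left c)
    (fun _ w w' => momentPairing_add_right w.2.1 w'.2.1) (fun c _ w => momentPairing_smul_right w.2.1 c)

/-- `w` has vanishing interior and normal moments of order at most `r`. -/
def MomentFree (K : ConvexPolygon) (r : ℕ) (w : Plane → ℝ) : Prop :=
  ∀ (m : MvPolynomial (Fin 2) ℝ) (q : Fin (K.extra + 3) → MvPolynomial (Fin 2) ℝ), m.totalDegree ≤ r → (∀ i, (q i).totalDegree ≤ r) →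
    momentPairing K m q w = 0

theorem momentFree_iff {r : ℕ} {w : hingeSpace K} : MomentFree K r w ↔ ∀ v, momentMap K r v w = 0 :=
  ⟨fun h v => h _ _ (mem_polyLE.1 v.1.2) fun i => mem_polyLE.1 (v.2 i).2,
    fun h m q hm hq => h (⟨m, mem_polyLE.2 hm⟩, fun i => ⟨q i, mem_polyLE.2 (hq i)⟩)⟩

/-! ### Solvability of moment conditions in `H² ∩ H¹₀` -/

/-- The product of all `ell k`. -/
noncomputable def ellProd (K : ConvexPolygon) (x : Plane) : ℝ := ∏ k, K.ell k x

theorem contDiff_ellProd (K : ConvexPolygon) : ContDiff ℝ ∞ (ellProd K) := contDiff_prod fun k _ => contDiff_ell k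

theorem ellProd_eq (i : Fin (K.extra + 3)) (x : Plane) : ellProd K x = K.ell i x * coProd K i x :=
  (Finset.mul_prod_erase _ (fun k => K.ell k x) (Finset.mem_univ i)).symm

theorem ellProd_eq_zero {x : Plane} (hx : x ∈ K.edge i) : ellProd K x = 0 := by
  rw [ellProd_eq i, ell_eq_zero_of_mem_edge hx, zero_mul]

theorem pderiv_ellProd_mul (hp : ContDiff ℝ ∞ p) {x : Plane} (hx : x ∈ K.edge i) (a : Fin 2) :
    pderiv a (ellProd K * p) x = -(K.edgeLength i * K.normal i a) * (coProd K i x * p x) := by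
  have e : ellProd K * p = K.ell i * (coProd K i * p) := by ext y; simp only [Pi.mul_apply, ellProd_eq i]; ring
  have h := pderiv_mul ((contDiff_ell (K := K) i).differentiable (by simp)) (((contDiff_coProd i).mul hp).differentiable (by simp)) a x
  rw [e]
  refine h.trans ?_
  rw [ell_eq_zero_of_mem_edge hx, pderiv_ell_eq]
  simp

theorem sum_normal_sq (i : Fin (K.extra + 3)) : ∑ a, K.normal i a * K.normal i a = 1 := by
  have h := K.edgeLength_pos i
  rw [sum_normal_mul]
  have e0 : K.normal i 0 = (K.edgeLength i)⁻¹ * K.dvec i 1 := by simp [ConvexPolygon.normal, ConvexPolygon.dvec]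
  have e1 : K.normal i 1 = -((K.edgeLength i)⁻¹ * K.dvec i 0) := by simp [ConvexPolygon.normal, ConvexPolygon.dvec]; ring
  have h2 : K.edgeLength i ^ 2 = K.dvec i 0 ^ 2 + K.dvec i 1 ^ 2 := by
    rw [edgeLength_eq, EuclideanSpace.norm_sq_eq, Fin.sum_univ_two]; simp
  rw [cross, e0, e1]
  field_simp
  rw [h2]; ring

theorem normalDeriv_ellProd_mul (hp : ContDiff ℝ ∞ p) (i : Fin (K.extra + 3)) :
    normalDeriv K i (ellProd K * p) =ᵐ[K.edgeMeasure i] fun x => -K.edgeLength i * (coProd K i x * p x) := by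
  filter_upwards [normalDeriv_of_contDiff ((contDiff_ellProd K).mul hp) i, ae_edgeMeasure_mem_edge i] with x hx hxe
  refine hx.trans ?_
  have := fun a => pderiv_ellProd_mul hp hxe a
  have e : ∀ a, pderiv a (fun x => ellProd K x * p x) x = _ := this
  simp only [e, Fin.sum_univ_two]
  have h1 := sum_normal_sq (K := K) i
  rw [Fin.sum_univ_two] at h1
  linear_combination (-(K.edgeLength i) * (coProd K i x * p x)) * h1

/-- Testing with `ellProd² m`, whose normal derivative vanishes on the boundary, gives `m = 0` on
`K`. Testing with `ellProd * coProd i * q i`, whose normal derivative lives on the `i`-th edge only,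
then gives `q i = 0` on that edge. The polynomial `q i` itself need not be zero, so the conclusion
is about the pairing with an arbitrary function and not about its coefficients. -/
theorem momentPairing_eq_zero_of_annihilates {m : MvPolynomial (Fin 2) ℝ} {q : Fin (K.extra + 3) → MvPolynomial (Fin 2) ℝ}
    (h : ∀ w, MemH2H10 K w → momentPairing K m q w = 0) (e : Plane → ℝ) : momentPairing K m q e = 0 := by
  have hE := contDiff_ellProd K
  have hX : ∀ {p : Plane → ℝ}, ContDiff ℝ ∞ p → MemH2H10 K (ellProd K * p) := fun hp =>
    memH2H10_of_contDiff (hE.mul hp) fun i x hx => by rw [Pi.mul_apply, ellProd_eq_zero hx, zero_mul]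
  have hm : polyEval m =ᵐ[volume.restrict K.inner] 0 := by
    have hs : ContDiff ℝ ∞ (ellProd K * polyEval m) := hE.mul (contDiff_polyEval m)
    have h1 := h _ (hX hs)
    rw [momentPairing, Finset.sum_eq_zero] at h1
    swap
    · intro i _
      rw [integral_eq_zero_of_ae]
      filter_upwards [normalDeriv_ellProd_mul hs i, ae_edgeMeasure_mem_edge i] with x hx hxe
      rw [hx, Pi.mul_apply, ellProd_eq_zero hxe]; simp
    rw [add_zero] at h1
    have hc : Continuous fun x => polyEval m x * (ellProd K * (ellProd K * polyEval m)) x :=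
      (continuous_polyEval m).mul (hE.continuous.mul (hE.continuous.mul (continuous_polyEval m)))
    have hi : Integrable (fun x => polyEval m x * (ellProd K * (ellProd K * polyEval m)) x) (volume.restrict K.inner) :=
      (hc.continuousOn.integrableOn_compact K.isCompact_carrier).mono_set inner_subset_carrier
    have h2 := (integral_eq_zero_iff_of_nonneg (fun x => by
      simp only [Pi.mul_apply, Pi.zero_apply]
      nlinarith [sq_nonneg (ellProd K x * polyEval m x)]) hi).1 h1
    filter_upwards [h2, ae_restrict_mem K.isOpen_inner.measurableSet] with x hx hxi
    have : 0 < ellProd K x := Finset.prod_pos fun k _ => mem_inner_iff.1 hxi k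
    simpa [this.ne'] using hx
  have hq : ∀ i, ∀ x ∈ K.edge i, polyEval (q i) x = 0 := by
    intro i
    have hs : ContDiff ℝ ∞ (coProd K i * polyEval (q i)) := (contDiff_coProd i).mul (contDiff_polyEval _)
    have h1 := h _ (hX hs)
    rw [momentPairing, integral_eq_zero_of_ae, zero_add, Finset.sum_eq_single i] at h1
    · refine eq_zero_of_integral_sq_eq_zero (ρ := fun x => coProd K i x ^ 2) ((contDiff_coProd i).continuous.pow 2) (continuous_polyEval _)
        (fun s hs => pow_pos (Finset.prod_pos fun k hk => ell_edgePt_pos (Finset.ne_of_mem_erase hk) hs) 2) ?_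
      have e : ∫ x, polyEval (q i) x * normalDeriv K i (ellProd K * (coProd K i * polyEval (q i))) x ∂(K.edgeMeasure i) =
          ∫ x, -K.edgeLength i * (coProd K i x ^ 2 * polyEval (q i) x ^ 2) ∂(K.edgeMeasure i) := by
        refine integral_congr_ae ?_
        filter_upwards [normalDeriv_ellProd_mul hs i] with x hx
        rw [hx, Pi.mul_apply]; ring
      rw [e, integral_const_mul, mul_eq_zero] at h1
      exact h1.resolve_left (neg_ne_zero.2 (K.edgeLength_pos i).ne')
    · intro j _ hj
      rw [integral_eq_zero_of_ae]
      filter_upwards [normalDeriv_ellProd_mul hs j, ae_edgeMeasure_mem_edge j] with x hx hxe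
      rw [hx, Pi.mul_apply, coProd_eq_zero hj hxe]; simp
    · intro h; exact absurd (Finset.mem_univ _) h
    · filter_upwards [hm] with x hx
      rw [hx]; simp
  rw [momentPairing, integral_eq_zero_of_ae, zero_add, Finset.sum_eq_zero]
  · intro i _
    rw [integral_eq_zero_of_ae]
    filter_upwards [ae_edgeMeasure_mem_edge i] with x hx
    rw [hq i x hx]; simp
  · filter_upwards [hm] with x hx
    rw [hx]; simp

/-- Finitely many conditions, which are solvable because any combination of moments that vanishes on
`H² ∩ H¹₀` vanishes altogether. -/
theorem exists_momentFree_sub (r : ℕ) (he : MemH2 K.inner e) : ∃ y, MemH2H10 K y ∧ MomentFree K r (e - y) := by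
  set t : MomentSpace K r →ₗ[ℝ] ℝ :=
    { toFun := fun v => momentPairing K v.1 (fun i => v.2 i) e
      map_add' := fun _ _ => momentPairing_add_left he
      map_smul' := fun c _ => momentPairing_smul_left c } with ht
  obtain ⟨y, hy⟩ := exists_forall_eq_of_annihilator (momentMap K r) t (fun v hv =>
    momentPairing_eq_zero_of_annihilates (fun w hw => LinearMap.congr_fun hv (⟨w, hw⟩ : hingeSpace K)) e)
  refine ⟨y, y.2, fun m q hm hq => ?_⟩
  rw [momentPairing_sub_right he y.2.1, sub_eq_zero]
  exact (hy (⟨m, mem_polyLE.2 hm⟩, fun i => ⟨q i, mem_polyLE.2 (hq i)⟩)).symm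

/-! ### Orthogonal projection under moment constraints -/

theorem MomentFree.add {r : ℕ} (hw : MemH2 K.inner w) (hg : MemH2 K.inner g) (h : MomentFree K r w) (h' : MomentFree K r g) : MomentFree K r (w + g) :=
  fun m q hm hq => by rw [momentPairing_add_right hw hg, h m q hm hq, h' m q hm hq, add_zero]

theorem MomentFree.const_smul {r : ℕ} (hw : MemH2 K.inner w) (h : MomentFree K r w) (c : ℝ) : MomentFree K r (c • w) :=
  fun m q hm hq => by rw [momentPairing_smul_right hw, h m q hm hq, mul_zero]

theorem MomentFree.sub {r : ℕ} (hw : MemH2 K.inner w) (hg : MemH2 K.inner g) (h : MomentFree K r w) (h' : MomentFree K r g) : MomentFree K r (w - g) :=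
  fun m q hm hq => by rw [momentPairing_sub_right hw hg, h m q hm hq, h' m q hm hq, sub_zero]

theorem momentFree_of_l2Lim {r : ℕ} {ws : ℕ → Plane → ℝ} (hw : ∀ n, MemH2 K.inner (ws n)) (hwm : ∀ n, MomentFree K r (ws n)) (hf : MemH2 K.inner f)
    (h0 : L2Lim (volume.restrict K.inner) ws f)
    (h1 : ∀ i a, L2Lim (K.edgeMeasure i) (fun n => trace K i (weakPartial K.inner a (ws n))) (trace K i (weakPartial K.inner a f))) :
    MomentFree K r f := by
  intro m q hm hq
  have ln : ∀ i, L2Lim (K.edgeMeasure i) (fun n => normalDeriv K i (ws n)) (normalDeriv K i f) := fun i => by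
    refine (((h1 i 0).const_smul (K.normal i 0)).add ((h1 i 1).const_smul (K.normal i 1)) (fun n => (((hw n).2 0).memLp_trace i).1.const_smul _)
      (fun n => (((hw n).2 1).memLp_trace i).1.const_smul _) ((hf.2 0).memLp_trace i |>.1.const_smul _) ((hf.2 1).memLp_trace i |>.1.const_smul _)).congr
      (fun n => ae_of_all _ fun x => ?_) (ae_of_all _ fun x => ?_)
    · simp [normalDeriv, Fin.sum_univ_two]
    · simp [normalDeriv, Fin.sum_univ_two]
  have l1 := (L2Lim.const (volume.restrict K.inner) (polyEval m)).integral_mul h0 (fun _ => memLp_polyEval K m) (fun n => (hw n).1.1) (memLp_polyEval K m) hf.1.1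
  have l2 := tendsto_finsetSum Finset.univ fun i _ => (L2Lim.const (K.edgeMeasure i) (polyEval (q i))).integral_mul (ln i)
    (fun _ => memLp_polyEval_edge i _) (fun n => memLp_normalDeriv (hw n) i) (memLp_polyEval_edge i _) (memLp_normalDeriv hf i)
  have l3 := l1.add l2
  have e : (fun n => (∫ x in K.inner, polyEval m x * ws n x) + ∑ i, ∫ x, polyEval (q i) x * normalDeriv K i (ws n) x ∂(K.edgeMeasure i)) = fun _ => 0 := by
    funext n; exact hwm n m q hm hq
  rw [e] at l3
  exact tendsto_nhds_unique l3 tendsto_const_nhds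

/-- Project `Δv` in `L²` onto the Laplacians of the moment-free functions of `H² ∩ H¹₀`. That
subspace is closed, because convergence of the Laplacians implies convergence of the functions and
of the moments. No regularity theory is involved. -/
theorem exists_orthogonal_correction (r : ℕ) (hv : MemH2 K.inner v) :
    ∃ w, MemH2H10 K w ∧ MomentFree K r w ∧ ∀ w', MemH2H10 K w' → MomentFree K r w' →
      ∫ x in K.inner, weakLaplacian K.inner (v - w) x * weakLaplacian K.inner w' x = 0 := by
  have hU := K.isOpen_inner
  set μ := volume.restrict K.inner with hμ
  have mΔ := fun {w : Plane → ℝ} (hw : MemH2 K.inner w) => hw.memLp_weakLaplacian hU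
  let M : Submodule ℝ (Lp ℝ 2 μ) :=
    { carrier := {F | ∃ w, MemH2H10 K w ∧ MomentFree K r w ∧ weakLaplacian K.inner w =ᵐ[μ] F}
      add_mem' := by
        rintro F G ⟨w, h1, h2, h3⟩ ⟨w', h1', h2', h3'⟩
        exact ⟨w + w', h1.add h1', h2.add h1.1 h1'.1 h2', (weakLaplacian_add hU h1.1 h1'.1).trans ((h3.add h3').trans (Lp.coeFn_add F G).symm)⟩
      zero_mem' := ⟨(0 : ℝ) • (0 : Plane → ℝ), MemH2H10.zero.const_smul 0, fun m q _ _ => by rw [momentPairing_smul_right MemH2H10.zero.1, zero_mul], by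
        refine (weakLaplacian_const_smul hU MemH2H10.zero.1 0).trans ?_
        rw [zero_smul]
        exact (Lp.coeFn_zero ℝ 2 μ).symm⟩
      smul_mem' := by
        rintro c F ⟨w, h1, h2, h3⟩
        exact ⟨c • w, h1.const_smul c, h2.const_smul h1.1 c, (weakLaplacian_const_smul hU h1.1 c).trans ((h3.const_smul c).trans (Lp.coeFn_smul c F).symm)⟩ }
  have hM : IsClosed (M : Set (Lp ℝ 2 μ)) := by
    refine IsSeqClosed.isClosed fun Fs F hFs hF => ?_
    choose ws h1 h2 h3 using hFs
    have hl : L2Lim μ (fun n => weakLaplacian K.inner (ws n)) F := by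
      have := (Lp.tendsto_Lp_iff_tendsto_eLpNorm' _ _).1 hF
      exact L2Lim.congr (φ := fun n => Fs n) (f := F) this (fun n => (h3 n).symm) (ae_eq_refl _)
    obtain ⟨w, hw, hwF, l0, l1⟩ := exists_memH2H10_limit h1 (Lp.memLp F) hl
    exact ⟨w, hw, momentFree_of_l2Lim (fun n => (h1 n).1) h2 hw.1 l0 l1, hwF⟩
  have : CompleteSpace M := hM.completeSpace_coe
  obtain ⟨F, ⟨w, h1, h2, h3⟩, G, hG, hsum⟩ := M.exists_add_mem_mem_orthogonal ((mΔ hv).toLp _)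
  refine ⟨w, h1, h2, fun w' h1' h2' => ?_⟩
  have hw' : (mΔ h1'.1).toLp _ ∈ M := ⟨w', h1', h2', (MemLp.coeFn_toLp _).symm⟩
  have hin := (Submodule.mem_orthogonal' M G).1 hG _ hw'
  rw [L2.inner_def] at hin
  rw [← hin]
  refine integral_congr_ae ?_
  have e1 : (((mΔ hv).toLp _ : Lp ℝ 2 μ) : Plane → ℝ) =ᵐ[μ] F + G := by rw [hsum]; exact Lp.coeFn_add F G
  filter_upwards [weakLaplacian_sub hU hv h1.1, e1, (mΔ hv).coeFn_toLp, h3, (mΔ h1'.1).coeFn_toLp] with x a1 a2 a3 a4 a5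
  rw [a1, Pi.sub_apply, ← a3, a2, Pi.add_apply, a4, a5]
  simp; ring

/-! ## Local interpolation -/

/-- Equality of the local degrees of freedom of order `k`. -/
def SameLocalDofs (k : ℕ) (K : ConvexPolygon) (v w : Plane → ℝ) : Prop :=
  (∀ i, dofVertex K i v = dofVertex K i w) ∧
    ∀ m : MvPolynomial (Fin 2) ℝ, m.totalDegree ≤ k - 2 →
      (∀ i, dofEdge K i m v = dofEdge K i m w) ∧
      (∀ i, dofNormal K i m v = dofNormal K i m w) ∧
      dofInner K m v = dofInner K m w

theorem area_pos (K : ConvexPolygon) : 0 < K.area := by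
  have h1 : 0 < volume K.inner := K.isOpen_inner.measure_pos _ K.inner_nonempty
  exact ENNReal.toReal_pos (h1.trans_le (measure_mono inner_subset_carrier)).ne' K.isCompact_carrier.measure_lt_top.ne

theorem MomentFree.dofNormal_eq {r : ℕ} (hv : MemH2 K.inner v) (hu : MemH2 K.inner u) (h : MomentFree K r (v - u)) {m : MvPolynomial (Fin 2) ℝ}
    (hm : m.totalDegree ≤ r) (i : Fin (K.extra + 3)) : dofNormal K i m v = dofNormal K i m u := by
  have := h 0 (Pi.single i m) (by simp) (fun j => by
    by_cases hj : j = i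
    · subst hj; rwa [Pi.single_eq_same]
    · rw [Pi.single_eq_of_ne hj]; simp)
  rwa [momentPairing_sub_right hv hu, momentPairing_single, momentPairing_single, sub_eq_zero] at this

theorem MomentFree.integral_eq {r : ℕ} (hv : MemH2 K.inner v) (hu : MemH2 K.inner u) (h : MomentFree K r (v - u)) {m : MvPolynomial (Fin 2) ℝ}
    (hm : m.totalDegree ≤ r) : ∫ x in K.inner, polyEval m x * v x = ∫ x in K.inner, polyEval m x * u x := by
  have := h m 0 hm (fun j => by simp)
  rwa [momentPairing_sub_right hv hu, momentPairing_zero_right, momentPairing_zero_right, sub_eq_zero] at this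

theorem SameLocalDofs.momentFree {k : ℕ} (hv : MemH2 K.inner v) (hu : MemH2 K.inner u) (h : SameLocalDofs k K v u) : MomentFree K (k - 2) (v - u) := by
  intro m q hm hq
  have h1 := (h.2 m hm).2.2
  have h2 := fun i => (h.2 (q i) (hq i)).2.1 i
  rw [dofInner, dofInner] at h1
  have h1' := mul_left_cancel₀ (inv_ne_zero (area_pos K).ne') h1
  rw [momentPairing_sub_right hv hu, sub_eq_zero, momentPairing, momentPairing, h1']
  congr 1
  exact Finset.sum_congr rfl fun i _ => h2 i

/-- Green's formula in the definition of the space expresses the pairing by moments of `w`, all of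
which vanish. The formula is tested with the continuous representative of `w`, since it asks for
pointwise zero boundary values. -/
theorem MemLocalSpace.integral_laplacian_eq_zero {k : ℕ} (hv : MemLocalSpace k K v) (hw : MemH2H10 K w) (hm : MomentFree K (k - 2) w) :
    ∫ x in K.inner, weakLaplacian K.inner v x * weakLaplacian K.inner w x = 0 := by
  obtain ⟨_, _, f, hf, _, g, hg, hL⟩ := hv
  have hc := hw.1.ae_eq_contRep
  have := hL (contRep K w) (hw.1.congr K.isOpen_inner hc) hw.1.continuousOn_contRep hw.2
  rw [← weakLaplacian_congr hc] at this
  rw [this]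
  change momentPairing K f g (contRep K w) = 0
  rw [← momentPairing_congr hc]
  exact hm f g hf hg

theorem normalDeriv_test {φ : Plane → ℝ} (hφ : IsTestFunction K.inner φ) (i : Fin (K.extra + 3)) : normalDeriv K i φ =ᵐ[K.edgeMeasure i] 0 := by
  filter_upwards [normalDeriv_of_contDiff hφ.1 i, ae_edgeMeasure_mem_edge i] with x hx hxe
  rw [hx]
  refine Finset.sum_eq_zero fun a _ => ?_
  rw [(hφ.pderiv a).eq_zero, mul_zero]
  exact fun h => (ell_eq_zero_of_mem_edge hxe).not_gt (mem_inner_iff.1 h i)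

theorem memH2H10_test {φ : Plane → ℝ} (hφ : IsTestFunction K.inner φ) : MemH2H10 K φ :=
  memH2H10_of_contDiff hφ.1 fun i _ hx => hφ.eq_zero fun h => (ell_eq_zero_of_mem_edge hx).not_gt (mem_inner_iff.1 h i)

/-- With a boundary lift `L`, a moment correction `y` and the orthogonal correction `w`, the
function `L + y - w` has the boundary values of `L`, since `y` and `w` vanish there, and the moments
of `u`, since `w` has none. The orthogonality then makes it a member of the local space. -/
theorem exists_localInterpolant {k : ℕ} (hk : 2 ≤ k) (hu : MemH2 K.inner u) : ∃ v, MemLocalSpace k K v ∧ SameLocalDofs k K v u := by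
  have hU := K.isOpen_inner
  obtain ⟨L, hL, hLv, hLp, hLm⟩ := exists_boundary_lift hk hu.continuousOn_contRep
  have hL2 : MemH2 K.inner L := memH2_of_contDiff hU K.isBounded_inner hL
  have he := hu.sub hU hL2
  obtain ⟨y, hy, hym⟩ := exists_momentFree_sub (k - 2) he
  have hv0 := hL2.add hU hy.1
  obtain ⟨w, hw, hwm, hort⟩ := exists_orthogonal_correction (k - 2) hv0
  have hv := hv0.sub hU hw.1
  set v := L + y - w with hvd
  have hce : ∀ i, ∀ x ∈ K.edge i, contRep K v x = L x := by
    intro i x hx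
    have hxc := edge_subset_carrier hx
    rw [contRep_sub hv0 hw.1 hxc, Pi.sub_apply, contRep_add hL2 hy.1 hxc, Pi.add_apply, hw.edge i x hx, hy.edge i x hx,
      contRep_of_continuousOn hL.continuous.continuousOn hxc]; ring
  let T : hingeSpace K →ₗ[ℝ] ℝ :=
    { toFun := fun w' => ∫ x in K.inner, weakLaplacian K.inner v x * weakLaplacian K.inner w' x
      map_add' := fun a b => by
        have ma := a.2.1.memLp_weakLaplacian hU
        have mb := b.2.1.memLp_weakLaplacian hU
        have mv := hv.memLp_weakLaplacian hU
        rw [← integral_add (mv.integrable_mul' ma) (mv.integrable_mul' mb)]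
        refine integral_congr_ae ?_
        filter_upwards [weakLaplacian_add hU a.2.1 b.2.1] with x hx
        rw [Submodule.coe_add, hx, Pi.add_apply]; ring
      map_smul' := fun c a => by
        rw [RingHom.id_apply, smul_eq_mul, ← integral_const_mul]
        refine integral_congr_ae ?_
        filter_upwards [weakLaplacian_const_smul hU a.2.1 c] with x hx
        rw [Submodule.coe_smul, hx, Pi.smul_apply, smul_eq_mul]; ring }
  -- The components of the multiplier `c` are the polynomials `Δ²v` and `Δv|_e`, and `hT` is Green's
  -- formula for them. Compactly supported tests see only the first component.
  obtain ⟨c, hc⟩ := exists_eq_of_forall_ker (momentMap K (k - 2)) T (fun w' hw' => hort w' w'.2 (momentFree_iff.2 hw'))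
  have hT : ∀ w', MemH2H10 K w' → ∫ x in K.inner, weakLaplacian K.inner v x * weakLaplacian K.inner w' x =
      momentPairing K c.1 (fun i => c.2 i) w' := fun w' hw' => (LinearMap.congr_fun hc (⟨w', hw'⟩ : hingeSpace K)).symm
  refine ⟨v, ⟨hv, fun i => ?_, c.1, mem_polyLE.1 c.1.2, fun φ hφ => ?_, fun i => c.2 i, fun i => mem_polyLE.1 (c.2 i).2, fun w' h1 h2 h3 => ?_⟩, fun i => ?_, fun m hm => ⟨fun i => ?_, ?_⟩⟩
  · obtain ⟨p, hp, hpe⟩ := hLp i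
    exact ⟨p, hp, fun x hx => by rw [hce i x hx, hpe x hx]⟩
  · rw [hT φ (memH2H10_test hφ), momentPairing, Finset.sum_eq_zero, add_zero]
    intro i _
    rw [integral_eq_zero_of_ae]
    filter_upwards [normalDeriv_test hφ i] with x hx
    rw [hx]; simp
  · exact hT w' ⟨h1, fun x hx => by rw [contRep_of_continuousOn h2 (K.isClosed_carrier.frontier_subset hx), h3 x hx]⟩
  · rw [dofVertex, hce i _ vert_mem_edge, hLv]; rfl
  · rw [dofEdge, dofEdge]
    congr 1
    rw [← hLm i m hm]
    refine integral_congr_ae ?_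
    filter_upwards [ae_edgeMeasure_mem_edge i] with x hx
    rw [hce i x hx]
  · have hmf : MomentFree K (k - 2) (v - u) := by
      have e : v - u = (-1 : ℝ) • ((u - L) - y) - w := by rw [hvd, neg_one_smul]; abel
      rw [e]
      exact (hym.const_smul (he.sub hU hy.1) _).sub ((he.sub hU hy.1).const_smul hU _) hw.1 hwm
    refine ⟨fun i => hmf.dofNormal_eq hv hu hm i, ?_⟩
    rw [dofInner, dofInner, hmf.integral_eq hv hu hm]

/-- The edge restriction is a polynomial of degree at most `k`, which the end point values and the
moments determine. -/
theorem MemLocalSpace.sub_memH2H10 {k : ℕ} (hv : MemLocalSpace k K v) (hw : MemLocalSpace k K w) (hd : ∀ i, dofVertex K i v = dofVertex K i w)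
    (he : ∀ m : MvPolynomial (Fin 2) ℝ, m.totalDegree ≤ k - 2 → ∀ i, dofEdge K i m v = dofEdge K i m w) : MemH2H10 K (v - w) := by
  refine ⟨hv.1.sub K.isOpen_inner hw.1, fun x hx => ?_⟩
  obtain ⟨i, hi⟩ := mem_frontier_iff_edge.1 hx
  obtain ⟨p, hp, hpe⟩ := hv.2.1 i
  obtain ⟨q, hq, hqe⟩ := hw.2.1 i
  rw [contRep_sub hv.1 hw.1 (edge_subset_carrier hi), Pi.sub_apply, hpe x hi, hqe x hi, ← polyEval_sub]
  refine polyEval_eq_zero_on_edge (k := k) ((MvPolynomial.totalDegree_sub _ _).trans (max_le hp hq)) ?_ ?_ (fun m hm => ?_) x hi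
  · rw [polyEval_sub, ← hpe _ vert_mem_edge, ← hqe _ vert_mem_edge, sub_eq_zero]; exact hd i
  · rw [polyEval_sub, ← hpe _ vert_succ_mem_edge, ← hqe _ vert_succ_mem_edge, sub_eq_zero]; exact hd (i + 1)
  · have h1 := mul_left_cancel₀ (inv_ne_zero (K.edgeLength_pos i).ne') (he m hm i)
    have e1 : ∫ x, polyEval m x * contRep K v x ∂(K.edgeMeasure i) = ∫ x, polyEval m x * polyEval p x ∂(K.edgeMeasure i) := by
      refine integral_congr_ae ?_
      filter_upwards [ae_edgeMeasure_mem_edge i] with x hx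
      rw [hpe x hx]
    have e2 : ∫ x, polyEval m x * contRep K w x ∂(K.edgeMeasure i) = ∫ x, polyEval m x * polyEval q x ∂(K.edgeMeasure i) := by
      refine integral_congr_ae ?_
      filter_upwards [ae_edgeMeasure_mem_edge i] with x hx
      rw [hqe x hx]
    rw [e1, e2, ← sub_eq_zero, ← integral_sub ((memLp_polyEval_edge i m).integrable_mul' (memLp_polyEval_edge i p)) ((memLp_polyEval_edge i m).integrable_mul' (memLp_polyEval_edge i q))] at h1
    rw [← h1]
    simp only [polyEval_sub, mul_sub]

theorem ae_eq_zero_of_laplacian (hw : MemH2H10 K w) (h : l2n (volume.restrict K.inner) (weakLaplacian K.inner w) = 0) :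
    w =ᵐ[volume.restrict K.inner] 0 := by
  have := hw.l2n_le
  rw [h, mul_zero] at this
  exact (l2n_eq_zero_iff hw.1.1.1).1 (le_antisymm this (l2n_nonneg _ _))

/-- The difference `z` vanishes on the boundary and has no moments, hence is an admissible test for
both functions; this gives `‖Δz‖² = 0`. -/
theorem MemLocalSpace.ae_eq {k : ℕ} (hv : MemLocalSpace k K v) (hw : MemLocalSpace k K w) (h : SameLocalDofs k K v w) :
    v =ᵐ[volume.restrict K.inner] w := by
  have hU := K.isOpen_inner
  have hz := hv.sub_memH2H10 hw h.1 fun m hm => (h.2 m hm).1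
  have hm := h.momentFree hv.1 hw.1
  have h1 := hv.integral_laplacian_eq_zero hz hm
  have h2 := hw.integral_laplacian_eq_zero hz hm
  have mz := hz.1.memLp_weakLaplacian hU
  have h3 : l2n (volume.restrict K.inner) (weakLaplacian K.inner (v - w)) = 0 := by
    rw [← sq_eq_zero_iff, l2n_sq mz]
    have := integral_sub ((hv.1.memLp_weakLaplacian hU).integrable_mul' mz) ((hw.1.memLp_weakLaplacian hU).integrable_mul' mz)
    rw [h1, h2, sub_zero] at this
    rw [← this]
    refine integral_congr_ae ?_
    filter_upwards [weakLaplacian_sub hU hv.1 hw.1] with x hx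
    simp only [hx, Pi.sub_apply]; ring
  filter_upwards [ae_eq_zero_of_laplacian hz h3] with x hx
  have : v x - w x = 0 := hx
  linarith

end StrainGradientVEM

namespace StrainGradientVEM
open ConvexPolygon

/-! ## The Poincaré inequality -/

variable {K : ConvexPolygon} {i : Fin (K.extra + 3)} {f f' g h p w w' u v e φ : Plane → ℝ}

theorem sq_integral_unit_le {f : ℝ → ℝ} (hf : Continuous f) :
    (∫ s in (0:ℝ)..1, f s) ^ 2 ≤ ∫ s in (0:ℝ)..1, f s ^ 2 := by
  set m := ∫ s in (0:ℝ)..1, f s with hm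
  have h0 : 0 ≤ ∫ s in (0:ℝ)..1, (f s - m) ^ 2 := intervalIntegral.integral_nonneg zero_le_one fun s _ => sq_nonneg _
  have h1 : ∫ s in (0:ℝ)..1, (f s - m) ^ 2 = (∫ s in (0:ℝ)..1, f s ^ 2) - 2 * m * m + m ^ 2 := by
    have : ∀ s, (f s - m) ^ 2 = f s ^ 2 - 2 * m * f s + m ^ 2 := fun s => by ring
    simp only [this]
    rw [intervalIntegral.integral_add, intervalIntegral.integral_sub, intervalIntegral.integral_const_mul, ← hm]
    · simp
    all_goals exact Continuous.intervalIntegrable (by fun_prop) _ _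
  nlinarith

theorem sq_sub_le_integral_line (hφ : ContDiff ℝ ∞ φ) (x y : Plane) :
    (φ y - φ x) ^ 2 ≤ dist x y ^ 2 * ∫ s in (0:ℝ)..1, ∑ a, pderiv a φ ((1 - s) • x + s • y) ^ 2 := by
  have hl : ∀ s : ℝ, (1 - s) • x + s • y = x + s • (y - x) := fun s => by module
  simp only [hl]
  set d := y - x with hd
  have hc : ∀ a, Continuous fun s : ℝ => pderiv a φ (x + s • d) := fun a =>
    (pderiv_contDiff hφ a).continuous.comp (by fun_prop)
  have hc1 : Continuous fun s : ℝ => ∑ a, d a * pderiv a φ (x + s • d) :=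
    continuous_finsetSum _ fun a _ => continuous_const.mul (hc a)
  have h1 := intervalIntegral.integral_eq_sub_of_hasDerivAt (a := 0) (b := 1)
    (fun s _ => hasDerivAt_comp_line hφ x d s) (hc1.intervalIntegrable _ _)
  have h2 : φ y - φ x = ∫ s in (0:ℝ)..1, ∑ a, d a * pderiv a φ (x + s • d) := by
    rw [h1]; simp [hd]
  rw [h2, ← intervalIntegral.integral_const_mul]
  refine (sq_integral_unit_le hc1).trans (intervalIntegral.integral_mono_on zero_le_one
    ((hc1.pow 2).intervalIntegrable _ _) (Continuous.intervalIntegrable (continuous_const.mul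
      (continuous_finsetSum _ fun a _ => (hc a).pow 2)) _ _) fun s _ => ?_)
  rw [dist_comm, dist_eq_norm, ← hd, EuclideanSpace.norm_sq_eq]
  simp only [Real.norm_eq_abs, sq_abs]
  exact Finset.sum_mul_sq_le_sq_mul_sq _ _ _

/-- For `s ≥ 1/2` and fixed `x`, the map `y ↦ (1 - s) x + s y` stays in the convex set and has
Jacobian `s²`, so it costs a factor at most `4`. For `s ≤ 1/2` exchange the roles of `x` and `y`. -/
theorem lintegral_line_le {G : Plane → ENNReal} (hG : Measurable G) {s : ℝ} (hs : s ∈ Set.Icc (0:ℝ) 1) :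
    ∫⁻ x in K.inner, ∫⁻ y in K.inner, G ((1 - s) • x + s • y) ≤ 4 * volume K.inner * ∫⁻ x in K.inner, G x := by
  have hm := K.isOpen_inner.measurableSet
  have key : ∀ s ∈ Set.Icc (1/2:ℝ) 1, ∫⁻ x in K.inner, ∫⁻ y in K.inner, G ((1 - s) • x + s • y) ≤
      4 * volume K.inner * ∫⁻ x in K.inner, G x := by
    intro s hs
    have h1 : ∀ x ∈ K.inner, ∫⁻ y in K.inner, G ((1 - s) • x + s • y) ≤ 4 * ∫⁻ x in K.inner, G x := by
      intro x hx
      have e0 : Measurable fun y : Plane => (1 - (1 - s)) • y + (1 - s) • x := by fun_prop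
      calc ∫⁻ y in K.inner, G ((1 - s) • x + s • y)
          = ∫⁻ y in K.inner, K.inner.indicator G ((1 - (1 - s)) • y + (1 - s) • x) := by
            refine setLIntegral_congr_fun hm fun y hy => ?_
            have e : (1 - (1 - s)) • y + (1 - s) • x = (1 - s) • x + s • y := by module
            have : (1 - s) • x + s • y ∈ K.inner := K.convex_inner hx hy (by linarith [hs.2]) (by linarith [hs.1]) (by ring)
            rw [e, Set.indicator_of_mem this]
        _ ≤ ∫⁻ y, K.inner.indicator G ((1 - (1 - s)) • y + (1 - s) • x) := setLIntegral_le_lintegral _ _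
        _ = ∫⁻ y, K.inner.indicator G y ∂(Measure.map (fun y : Plane => (1 - (1 - s)) • y + (1 - s) • x) volume) :=
            (lintegral_map (hG.indicator hm) e0).symm
        _ ≤ ∫⁻ y, K.inner.indicator G y ∂((4 : ENNReal) • volume) :=
            lintegral_mono' (map_contraction_le (by linarith [hs.1]) x) le_rfl
        _ = 4 * ∫⁻ x in K.inner, G x := by rw [lintegral_smul_measure, lintegral_indicator hm, smul_eq_mul]
    calc _ ≤ ∫⁻ x in K.inner, 4 * ∫⁻ x in K.inner, G x := setLIntegral_mono measurable_const h1
      _ = _ := by rw [setLIntegral_const]; ring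
  rcases le_total (1/2) s with h | h
  · exact key s ⟨h, hs.2⟩
  · have := key (1 - s) ⟨by linarith, by linarith [hs.1]⟩
    rw [lintegral_lintegral_swap] at this
    · refine le_trans (le_of_eq ?_) this
      refine lintegral_congr fun x => lintegral_congr fun y => ?_
      rw [sub_sub_cancel, add_comm]
    · exact (hG.comp (by fun_prop)).aemeasurable

/-- The left side is the double integral of `(φ y - φ x)²`. Each difference is an integral along the
segment, and averaging over all segments is controlled by `lintegral_line_le`. The constant depends
on the diameter only. -/
theorem poincare_smooth (hφ : ContDiff ℝ ∞ φ) :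
    2 * (volume.real K.inner * ∫ x in K.inner, φ x ^ 2) - 2 * (∫ x in K.inner, φ x) ^ 2 ≤
      4 * K.diam ^ 2 * (volume.real K.inner * ∑ a, ∫ x in K.inner, pderiv a φ x ^ 2) := by
  have hm := K.isOpen_inner.measurableSet
  have hfin : volume K.inner ≠ ⊤ := K.isBounded_inner.measure_lt_top.ne
  have hI : ∀ {F : Plane → ℝ}, Continuous F → Integrable F (volume.restrict K.inner) := fun hF =>
    (hF.continuousOn.integrableOn_compact K.isCompact_carrier).mono_set inner_subset_carrier
  have hφc := hφ.continuous
  set G : Plane → ℝ := fun x => ∑ a, pderiv a φ x ^ 2 with hG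
  have hGc : Continuous G := continuous_finsetSum _ fun a _ => (pderiv_contDiff hφ a).continuous.pow 2
  have hG0 : ∀ x, 0 ≤ G x := fun x => Finset.sum_nonneg fun a _ => sq_nonneg _
  have hx : ∀ x, ∫ y in K.inner, (φ y - φ x) ^ 2 =
      (∫ y in K.inner, φ y ^ 2) - 2 * φ x * (∫ y in K.inner, φ y) + volume.real K.inner * φ x ^ 2 := by
    intro x
    have : ∀ y, (φ y - φ x) ^ 2 = φ y ^ 2 - 2 * φ x * φ y + φ x ^ 2 := fun y => by ring
    simp only [this]
    rw [integral_add, integral_sub, integral_const_mul, setIntegral_const, smul_eq_mul]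
    all_goals exact hI (by fun_prop)
  have hxc : Continuous fun x => (∫ y in K.inner, φ y ^ 2) - 2 * φ x * (∫ y in K.inner, φ y) + volume.real K.inner * φ x ^ 2 := by
    fun_prop
  have e1 : ∫⁻ x in K.inner, ∫⁻ y in K.inner, ENNReal.ofReal ((φ y - φ x) ^ 2) =
      ENNReal.ofReal (2 * (volume.real K.inner * ∫ x in K.inner, φ x ^ 2) - 2 * (∫ x in K.inner, φ x) ^ 2) := by
    have : ∀ x, ∫⁻ y in K.inner, ENNReal.ofReal ((φ y - φ x) ^ 2) = ENNReal.ofReal (∫ y in K.inner, (φ y - φ x) ^ 2) := fun x =>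
      (ofReal_integral_eq_lintegral_ofReal (hI (by fun_prop)) (Eventually.of_forall fun y => sq_nonneg _)).symm
    simp only [this]
    rw [← ofReal_integral_eq_lintegral_ofReal]
    · congr 1
      simp only [hx]
      rw [integral_add, integral_sub, integral_mul_const, integral_const_mul, integral_const_mul, setIntegral_const, smul_eq_mul]
      · ring
      all_goals exact hI (by fun_prop)
    · simp only [hx]; exact hI hxc
    · exact Eventually.of_forall fun x => integral_nonneg fun y => sq_nonneg _
  have e2 : ∫⁻ x in K.inner, ∫⁻ y in K.inner, ENNReal.ofReal ((φ y - φ x) ^ 2) ≤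
      ENNReal.ofReal (K.diam ^ 2) * (4 * volume K.inner * ∫⁻ x in K.inner, ENNReal.ofReal (G x)) := by
    have hmeas : Measurable fun q : (Plane × Plane) × ℝ => ENNReal.ofReal (G ((1 - q.2) • q.1.1 + q.2 • q.1.2)) :=
      (ENNReal.continuous_ofReal.comp (hGc.comp (by fun_prop))).measurable
    have hle : ∀ x ∈ K.inner, ∫⁻ y in K.inner, ENNReal.ofReal ((φ y - φ x) ^ 2) ≤
        ∫⁻ y in K.inner, ∫⁻ s in Set.Ioc (0:ℝ) 1, ENNReal.ofReal (K.diam ^ 2) * ENNReal.ofReal (G ((1 - s) • x + s • y)) := by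
      intro x hx
      refine setLIntegral_mono ?_ fun y hy => ?_
      · exact Measurable.lintegral_prod_right' (f := fun q : Plane × ℝ => ENNReal.ofReal (K.diam ^ 2) * ENNReal.ofReal (G ((1 - q.2) • x + q.2 • q.1)))
          (measurable_const.mul (hmeas.comp (by fun_prop : Measurable fun q : Plane × ℝ => ((x, q.1), q.2))))
      have hs : Continuous fun s : ℝ => G ((1 - s) • x + s • y) := hGc.comp (by fun_prop)
      rw [lintegral_const_mul _ (f := fun s => ENNReal.ofReal (G ((1 - s) • x + s • y))) (ENNReal.continuous_ofReal.comp hs).measurable,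
        ← ofReal_integral_eq_lintegral_ofReal (hs.integrableOn_Ioc) (Eventually.of_forall fun s => hG0 _),
        ← ENNReal.ofReal_mul (sq_nonneg _)]
      refine ENNReal.ofReal_le_ofReal ((sq_sub_le_integral_line hφ x y).trans ?_)
      rw [intervalIntegral.integral_of_le zero_le_one]
      exact mul_le_mul_of_nonneg_right (pow_le_pow_left₀ dist_nonneg
        (dist_le_diam (inner_subset_carrier hx) (inner_subset_carrier hy)) 2) (integral_nonneg fun s => hG0 _)
    refine (setLIntegral_mono' hm hle).trans ?_
    have hc : ∀ x, ∫⁻ y in K.inner, ∫⁻ s in Set.Ioc (0:ℝ) 1, ENNReal.ofReal (K.diam ^ 2) * ENNReal.ofReal (G ((1 - s) • x + s • y)) =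
        ∫⁻ s in Set.Ioc (0:ℝ) 1, ∫⁻ y in K.inner, ENNReal.ofReal (K.diam ^ 2) * ENNReal.ofReal (G ((1 - s) • x + s • y)) := fun x =>
      lintegral_lintegral_swap (measurable_const.mul (hmeas.comp (by fun_prop : Measurable fun q : Plane × ℝ => ((x, q.1), q.2)))).aemeasurable
    simp only [hc]
    rw [lintegral_lintegral_swap]
    swap
    · refine Measurable.aemeasurable (Measurable.lintegral_prod_right' (f := fun q : (Plane × ℝ) × Plane =>
        ENNReal.ofReal (K.diam ^ 2) * ENNReal.ofReal (G ((1 - q.1.2) • q.1.1 + q.1.2 • q.2))) ?_)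
      exact measurable_const.mul (hmeas.comp (by fun_prop : Measurable fun q : (Plane × ℝ) × Plane => ((q.1.1, q.2), q.1.2)))
    calc _ ≤ ∫⁻ s in Set.Ioc (0:ℝ) 1, ENNReal.ofReal (K.diam ^ 2) * (4 * volume K.inner * ∫⁻ x in K.inner, ENNReal.ofReal (G x)) := by
          refine setLIntegral_mono measurable_const fun s hs => ?_
          refine le_trans (le_of_eq ?_) (mul_le_mul_right (lintegral_line_le (K := K) (G := fun x => ENNReal.ofReal (G x))
            (ENNReal.continuous_ofReal.comp hGc).measurable ⟨hs.1.le, hs.2⟩) _)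
          rw [← lintegral_const_mul]
          · refine lintegral_congr fun x => ?_
            rw [lintegral_const_mul]
            exact (ENNReal.continuous_ofReal.comp (hGc.comp (by fun_prop))).measurable
          · exact Measurable.lintegral_prod_right' (f := fun q : Plane × Plane => ENNReal.ofReal (G ((1 - s) • q.1 + s • q.2)))
              (ENNReal.continuous_ofReal.comp (hGc.comp (by fun_prop))).measurable
      _ = _ := by rw [setLIntegral_const]; simp
  rw [e1, ← ofReal_integral_eq_lintegral_ofReal (hI hGc) (Eventually.of_forall hG0), ← ENNReal.ofReal_toReal hfin,
    show (4 : ENNReal) = ENNReal.ofReal 4 by simp, ← ENNReal.ofReal_mul (by norm_num), ← ENNReal.ofReal_mul (by positivity),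
    ← ENNReal.ofReal_mul (by positivity), ENNReal.ofReal_le_ofReal_iff] at e2
  · have e3 : ∫ x in K.inner, G x = ∑ a, ∫ x in K.inner, pderiv a φ x ^ 2 :=
      integral_finsetSum (f := fun a x => pderiv a φ x ^ 2) _ fun a _ => hI ((pderiv_contDiff hφ a).continuous.pow 2)
    rw [e3] at e2
    refine e2.trans (le_of_eq ?_)
    rw [Measure.real]; ring
  · have : 0 ≤ ∫ x in K.inner, G x := integral_nonneg hG0
    positivity

/-- The Poincaré inequality for functions with mean value zero. -/
theorem poincare (hg : MemH1 K.inner g) (h0 : ∫ x in K.inner, g x = 0) :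
    l2n (volume.restrict K.inner) g ^ 2 ≤ 2 * K.diam ^ 2 * ∑ a, l2n (volume.restrict K.inner) (weakPartial K.inner a g) ^ 2 := by
  obtain ⟨φ, hφ⟩ := hg.exists_approx
  have hL : ∀ {F : Plane → ℝ}, Continuous F → MemLp F 2 (volume.restrict K.inner) := fun hF => memLp_of_continuous K.isBounded_inner hF
  have hw := fun a => hg.memLp_weakPartial K.isOpen_inner a
  have hA : 0 < volume.real K.inner := ENNReal.toReal_pos (K.isOpen_inner.measure_pos _ K.inner_nonempty).ne' K.isBounded_inner.measure_lt_top.ne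
  have t1 : Tendsto (fun m => ∫ x in K.inner, φ m x ^ 2) atTop (𝓝 (∫ x in K.inner, g x ^ 2)) := by
    simpa only [sq] using hφ.2.1.integral_mul hφ.2.1 (fun m => hL (hφ.1 m).continuous) (fun m => hL (hφ.1 m).continuous) hg.1 hg.1
  have t2 : Tendsto (fun m => ∫ x in K.inner, φ m x) atTop (𝓝 0) := by
    have := hφ.2.1.integral_mul_const (g := fun _ => 1) (fun m => hL (hφ.1 m).continuous) hg.1 (hL continuous_const)
    simpa only [mul_one, h0] using this
  have t3 : ∀ a, Tendsto (fun m => ∫ x in K.inner, pderiv a (φ m) x ^ 2) atTop (𝓝 (∫ x in K.inner, weakPartial K.inner a g x ^ 2)) := by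
    intro a
    have hc := fun m => hL (pderiv_contDiff (hφ.1 m) a).continuous
    simpa only [sq] using (hφ.2.2 a).integral_mul (hφ.2.2 a) hc hc (hw a) (hw a)
  have := le_of_tendsto_of_tendsto' (((t1.const_mul (volume.real K.inner)).const_mul 2).sub ((t2.pow 2).const_mul 2))
    (((tendsto_finsetSum _ fun a _ => t3 a).const_mul (volume.real K.inner)).const_mul (4 * K.diam ^ 2))
    fun m => poincare_smooth (hφ.1 m)
  rw [l2n_sq hg.1]
  simp only [l2n_sq (hw _)]
  refine le_of_mul_le_mul_left ?_ hA
  linarith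

end StrainGradientVEM

namespace StrainGradientVEM
open ConvexPolygon

/-! ## Vector fields with prescribed moments against gradients of polynomials -/

section Polynomials

variable (p : MvPolynomial (Fin 2) ℝ)

theorem pderiv_polyEval (a : Fin 2) : pderiv a (polyEval p) = polyEval (MvPolynomial.pderiv a p) := by
  have hd : ∀ p, Differentiable ℝ (polyEval p) := fun p => (contDiff_polyEval p).differentiable (by simp)
  induction p using MvPolynomial.induction_on with
  | C c =>
    have : polyEval (MvPolynomial.C c) = fun _ => c := funext fun x => polyEval_C x c
    funext x
    rw [this, MvPolynomial.pderiv_C, polyEval_zero, pderiv]; simp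
  | add p q hp hq =>
    have : polyEval (p + q) = polyEval p + polyEval q := funext fun x => polyEval_add p q x
    funext x
    rw [this, pderiv_add (hd p) (hd q), hp, hq, map_add, polyEval_add]
  | mul_X p b hp =>
    have : polyEval (p * MvPolynomial.X b) = polyEval p * polyEval (MvPolynomial.X b) := funext fun x => polyEval_mul p _ x
    have hX : polyEval (MvPolynomial.X b) = fun x => x b - 0 := funext fun x => by rw [polyEval_X, sub_zero]
    funext x
    rw [this, pderiv_mul (hd p) (hd _), hp, hX, pderiv_coord_sub, MvPolynomial.pderiv_mul, MvPolynomial.pderiv_X, polyEval_add,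
      polyEval_mul, polyEval_mul, polyEval_X]
    by_cases h : b = a
    · subst h
      simp only [Pi.single_eq_same, ↓reduceIte, sub_zero, polyEval, map_one]; ring
    · rw [if_neg h, Pi.single_eq_of_ne h, polyEval_zero]; ring

theorem totalDegree_pderiv_le (a : Fin 2) : (MvPolynomial.pderiv a p).totalDegree ≤ p.totalDegree - 1 := by
  classical
  conv_lhs => rw [p.as_sum, map_sum]
  refine MvPolynomial.totalDegree_finsetSum_le fun s hs => ?_
  rw [MvPolynomial.pderiv_monomial]
  by_cases h : s a = 0
  · simp [h]
  refine (MvPolynomial.totalDegree_monomial_le _ _).trans ?_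
  have h1 : s.degree ≤ p.totalDegree := MvPolynomial.le_totalDegree hs
  change (s - Finsupp.single a 1).degree ≤ _
  have h2 : (s - Finsupp.single a 1 + Finsupp.single a 1) = s :=
    tsub_add_cancel_of_le (Finsupp.single_le_iff.2 (Nat.one_le_iff_ne_zero.2 h))
  have h3 : (s - Finsupp.single a 1).degree + 1 = s.degree := by
    conv_rhs => rw [← h2, map_add]
    simp
  omega

/-- The polynomial `x ↦ p (t x + c)`. -/
noncomputable def affineSubst (t : ℝ) (c : Plane) : MvPolynomial (Fin 2) ℝ :=
  MvPolynomial.aeval (fun a => MvPolynomial.C t * MvPolynomial.X a + MvPolynomial.C (c a)) p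

theorem polyEval_affineSubst (t : ℝ) (c x : Plane) : polyEval (affineSubst p t c) x = polyEval p (t • x + c) := by
  have := MvPolynomial.map_aeval (fun a => MvPolynomial.C t * MvPolynomial.X a + MvPolynomial.C (c a)) (MvPolynomial.eval fun a => x a) p
  rw [polyEval, affineSubst, this, polyEval]
  have e : (MvPolynomial.eval fun a => x a).comp (algebraMap ℝ (MvPolynomial (Fin 2) ℝ)) = RingHom.id ℝ := by
    ext y; simp
  rw [e]
  change MvPolynomial.eval _ p = MvPolynomial.eval _ p
  congr 2
  funext a; simp

theorem totalDegree_affineSubst_le (t : ℝ) (c : Plane) : (affineSubst p t c).totalDegree ≤ p.totalDegree := by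
  rw [affineSubst, MvPolynomial.aeval_def, MvPolynomial.eval₂_eq']
  refine MvPolynomial.totalDegree_finsetSum_le fun s hs => (MvPolynomial.totalDegree_mul _ _).trans ?_
  have h0 : (algebraMap ℝ (MvPolynomial (Fin 2) ℝ) (p.coeff s)).totalDegree = 0 := MvPolynomial.totalDegree_C _
  have h1 : ∀ a, (MvPolynomial.C t * MvPolynomial.X a + MvPolynomial.C (c a) : MvPolynomial (Fin 2) ℝ).totalDegree ≤ 1 := fun a => by
    refine (MvPolynomial.totalDegree_add _ _).trans (max_le ((MvPolynomial.totalDegree_mul _ _).trans ?_) ?_)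
    · rw [MvPolynomial.totalDegree_C, MvPolynomial.totalDegree_X]
    · rw [MvPolynomial.totalDegree_C]; exact zero_le_one
  have h2 := MvPolynomial.le_totalDegree hs
  rw [Finsupp.sum_fintype _ _ fun _ => rfl] at h2
  rw [h0, zero_add]
  refine (MvPolynomial.totalDegree_finsetProd _ _).trans ((Finset.sum_le_sum fun a _ => ?_).trans h2)
  exact (MvPolynomial.totalDegree_pow _ _).trans (by nlinarith [h1 a])

variable {p}

theorem eq_zero_of_polyEval_eventually (h : polyEval p =ᶠ[𝓝 0] 0) : p = 0 := by
  have ha : AnalyticOnNhd ℝ (polyEval p) Set.univ :=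
    AnalyticOnNhd.eval_continuousLinearMap' (fun a => (EuclideanSpace.proj a : Plane →L[ℝ] ℝ)) p
  have := ha.eq_of_eventuallyEq (analyticOnNhd_const (v := (0:ℝ))) h
  refine MvPolynomial.funext fun x => ?_
  have h1 := congrFun this (WithLp.toLp 2 x)
  simpa [polyEval] using h1

theorem eq_C_of_pderiv_eventually (h : ∀ a, ∀ᶠ x in 𝓝 0, pderiv a (polyEval p) x = 0) : p = MvPolynomial.C (polyEval p 0) := by
  have h1 : ∀ᶠ x in 𝓝 (0:Plane), ∀ a, pderiv a (polyEval p) x = 0 := eventually_all.2 h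
  obtain ⟨δ, hδ, hb⟩ := Metric.eventually_nhds_iff_ball.1 h1
  have hd : Differentiable ℝ (polyEval p) := (contDiff_polyEval p).differentiable (by simp)
  rw [← sub_eq_zero]
  refine eq_zero_of_polyEval_eventually (Filter.mem_of_superset (Metric.ball_mem_nhds 0 hδ) fun x hx => ?_)
  have := (convex_ball (0:Plane) δ).is_const_of_fderivWithin_eq_zero (𝕜 := ℝ) (f := polyEval p) hd.differentiableOn (fun y hy => by
    rw [fderivWithin_of_isOpen Metric.isOpen_ball hy]
    ext v
    rw [fderiv_eq_sum_pderiv, Finset.sum_eq_zero fun a _ => by rw [hb y hy a, mul_zero]]; rfl) hx (Metric.mem_ball_self hδ)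
  simp only [Set.mem_ofPred_eq, polyEval_sub, polyEval_C, this, sub_self, Pi.zero_apply]

end Polynomials

/-- On polynomials of degree at most `r` the form `∫ κ ∇v · ∇w`, with `κ` a bump function, has the
constants as kernel, which is also the kernel of `D v = v - v(0)`. Hence each coordinate of `D v` in
a basis `b` is of the form `∫ κ ∇ρ_j · ∇v`, and `Φ j c` is `κ ∂_c ρ_j`. -/
theorem exists_gradient_moments (r : ℕ) : ∃ (N : ℕ) (b : Fin N → MvPolynomial (Fin 2) ℝ) (Φ : Fin N → Fin 2 → Plane → ℝ),
    (∀ j, (b j).totalDegree ≤ r) ∧ (∀ j c, IsTestFunction (Metric.ball 0 1) (Φ j c)) ∧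
    ∀ q : MvPolynomial (Fin 2) ℝ, q.totalDegree ≤ r →
      q = MvPolynomial.C (polyEval q 0) + ∑ j, (∑ c, ∫ x, Φ j c x * pderiv c (polyEval q) x) • b j := by
  let κ : ContDiffBump (0:Plane) := ⟨1/4, 1/2, by norm_num, by norm_num⟩
  have hκ : ContDiff ℝ ∞ κ := κ.contDiff
  have hκt : IsTestFunction (Metric.ball 0 1) κ := ⟨hκ, κ.hasCompactSupport, by
    rw [κ.tsupport_eq]; exact Metric.closedBall_subset_ball (by norm_num [κ])⟩
  have hint : ∀ {F : Plane → ℝ}, Continuous F → Integrable fun x => κ x * F x := fun hF =>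
    (hκ.continuous.mul hF).integrable_of_hasCompactSupport κ.hasCompactSupport.mul_right
  have hint' : ∀ (c : Fin 2) (v w : MvPolynomial (Fin 2) ℝ), Integrable fun x => κ x * (pderiv c (polyEval v) x * pderiv c (polyEval w) x) :=
    fun c v w => hint ((pderiv_contDiff (contDiff_polyEval v) c).continuous.mul (pderiv_contDiff (contDiff_polyEval w) c).continuous)
  have hadd : ∀ c (v w : MvPolynomial (Fin 2) ℝ) x, pderiv c (polyEval (v + w)) x = pderiv c (polyEval v) x + pderiv c (polyEval w) x :=
    fun c v w x => by simp only [pderiv_polyEval, map_add, polyEval_add]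
  have hsmul : ∀ c (t : ℝ) (v : MvPolynomial (Fin 2) ℝ) x, pderiv c (polyEval (t • v)) x = t * pderiv c (polyEval v) x :=
    fun c t v x => by simp only [pderiv_polyEval, Derivation.map_smul, polyEval_smul]
  let B : PolyLE r →ₗ[ℝ] PolyLE r →ₗ[ℝ] ℝ := LinearMap.mk₂ ℝ
    (fun v w => ∑ c, ∫ x, κ x * (pderiv c (polyEval v) x * pderiv c (polyEval w) x))
    (fun v v' w => by
      rw [← Finset.sum_add_distrib]
      refine Finset.sum_congr rfl fun c _ => ?_
      rw [← integral_add (hint' _ _ _) (hint' _ _ _)]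
      congr 1; funext x
      rw [Submodule.coe_add, hadd]; ring)
    (fun t v w => by
      rw [smul_eq_mul, Finset.mul_sum]
      refine Finset.sum_congr rfl fun c _ => ?_
      rw [← integral_const_mul]
      congr 1; funext x
      rw [Submodule.coe_smul, hsmul]; ring)
    (fun v w w' => by
      rw [← Finset.sum_add_distrib]
      refine Finset.sum_congr rfl fun c _ => ?_
      rw [← integral_add (hint' _ _ _) (hint' _ _ _)]
      congr 1; funext x
      rw [Submodule.coe_add, hadd]; ring)
    (fun t v w => by
      rw [smul_eq_mul, Finset.mul_sum]
      refine Finset.sum_congr rfl fun c _ => ?_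
      rw [← integral_const_mul]
      congr 1; funext x
      rw [Submodule.coe_smul, hsmul]; ring)
  have hBapply : ∀ v w : PolyLE r, B v w = ∑ c, ∫ x, κ x * (pderiv c (polyEval v) x * pderiv c (polyEval w) x) := fun _ _ => rfl
  let E : PolyLE r →ₗ[ℝ] PolyLE r :=
    { toFun := fun q => ⟨MvPolynomial.C (polyEval q 0), mem_polyLE.2 (by rw [MvPolynomial.totalDegree_C]; exact Nat.zero_le _)⟩
      map_add' := fun q q' => Subtype.ext (by simp [polyEval_add])
      map_smul' := fun t q => Subtype.ext (by
        change MvPolynomial.C (polyEval (t • (q : MvPolynomial (Fin 2) ℝ)) 0) = t • MvPolynomial.C (polyEval q 0)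
        rw [polyEval_smul, map_mul, MvPolynomial.smul_eq_C_mul]) }
  let D : PolyLE r →ₗ[ℝ] PolyLE r := LinearMap.id - E
  let bs := Module.finBasis ℝ (PolyLE r)
  have hker : ∀ v : PolyLE r, B v = 0 → D v = 0 := by
    intro v hv
    have h1 : B v v = 0 := by rw [hv]; rfl
    rw [hBapply] at h1
    have h2 : ∀ c x, 0 ≤ κ x * (pderiv c (polyEval v) x * pderiv c (polyEval v) x) := fun c x =>
      mul_nonneg κ.nonneg (mul_self_nonneg _)
    have h3 := (Finset.sum_eq_zero_iff_of_nonneg fun c _ => integral_nonneg (h2 c)).1 h1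
    refine Subtype.ext ?_
    change (v : MvPolynomial (Fin 2) ℝ) - MvPolynomial.C (polyEval v 0) = 0
    rw [sub_eq_zero]
    refine eq_C_of_pderiv_eventually fun c => ?_
    have hc : Continuous fun x => κ x * (pderiv c (polyEval v) x * pderiv c (polyEval v) x) := by
      have := (pderiv_contDiff (contDiff_polyEval (v : MvPolynomial (Fin 2) ℝ)) c).continuous
      exact hκ.continuous.mul (this.mul this)
    have h4 := (hc.ae_eq_iff_eq volume continuous_const).1
      ((integral_eq_zero_iff_of_nonneg (h2 c) (hint' c v v)).1 (h3 c (Finset.mem_univ c)))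
    filter_upwards [Metric.ball_mem_nhds (0:Plane) (show (0:ℝ) < 1/2 by norm_num)] with x hx
    have h5 : κ x * (pderiv c (polyEval v) x * pderiv c (polyEval v) x) = 0 := congrFun h4 x
    have h6 : 0 < κ x := κ.pos_of_mem_ball hx
    exact mul_self_eq_zero.1 ((mul_eq_zero.1 h5).resolve_left h6.ne')
  have hex : ∀ j, ∃ w, ∀ v, B v w = (bs.coord j) (D v) := fun j =>
    exists_forall_eq_of_annihilator B ((bs.coord j).comp D) fun v hv => by
      rw [LinearMap.comp_apply, hker v hv, map_zero]
  choose ρ hρ using hex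
  refine ⟨_, fun j => bs j, fun j c x => pderiv c (polyEval (ρ j)) x * κ x, fun j => mem_polyLE.1 (bs j).2,
    fun j c => hκt.mul (pderiv_contDiff (contDiff_polyEval _) c), fun q hq => ?_⟩
  set v : PolyLE r := ⟨q, mem_polyLE.2 hq⟩
  have h1 := bs.sum_repr (D v)
  have h2 := congrArg (Subtype.val) h1
  have h3 : ((D v : PolyLE r) : MvPolynomial (Fin 2) ℝ) = q - MvPolynomial.C (polyEval q 0) := rfl
  rw [h3, Submodule.coe_sum] at h2
  rw [← sub_eq_iff_eq_add', ← h2]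
  refine Finset.sum_congr rfl fun j _ => ?_
  rw [Submodule.coe_smul, ← Module.Basis.coord_apply, ← hρ j v, hBapply]
  congr 1
  refine Finset.sum_congr rfl fun c _ => ?_
  congr 1; funext x; ring

end StrainGradientVEM

/-! ### Scaling of the moment fields to an element -/

namespace StrainGradientVEM
open ConvexPolygon

variable {K : ConvexPolygon} {i : Fin (K.extra + 3)} {U : Set Plane} {f f' g h p w w' u v e φ : Plane → ℝ}

theorem pderiv_comp_affine (hφ : Differentiable ℝ φ) (t : ℝ) (d : Plane) (a : Fin 2) :
    pderiv a (fun x => φ (t • x + d)) = fun x => t * pderiv a φ (t • x + d) := by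
  funext x
  have h1 : HasFDerivAt (fun x : Plane => t • x + d) (t • ContinuousLinearMap.id ℝ Plane) x :=
    ((hasFDerivAt_id x).const_smul t).add_const d
  have h2 := (hφ (t • x + d)).hasFDerivAt.comp x h1
  rw [pderiv, show (fun x => φ (t • x + d)) = φ ∘ fun x => t • x + d from rfl, h2.fderiv, pderiv]
  simp

theorem pderiv_sum {N : ℕ} {F : Fin N → Plane → ℝ} (hF : ∀ j, Differentiable ℝ (F j)) (t : Fin N → ℝ) (a : Fin 2) :
    pderiv a (fun x => ∑ j, t j * F j x) = fun x => ∑ j, t j * pderiv a (F j) x := by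
  funext x
  rw [pderiv, fderiv_fun_sum fun j _ => ((hF j).const_mul (t j)) x, sum_apply]
  refine Finset.sum_congr rfl fun j _ => ?_
  rw [fderiv_const_mul (hF j x)]; rfl

theorem IsTestFunction.sum {N : ℕ} {F : Fin N → Plane → ℝ} (hF : ∀ j, IsTestFunction U (F j)) (t : Fin N → ℝ) :
    IsTestFunction U (fun x => ∑ j, t j * F j x) := by
  have key : ∀ s : Finset (Fin N), IsTestFunction U (fun x => ∑ j ∈ s, t j * F j x) := by
    classical
    intro s
    induction s using Finset.induction_on with
    | empty =>
      have : tsupport (fun _ : Plane => (0:ℝ)) = ∅ := by rw [tsupport, Function.support_fun_zero, closure_empty]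
      simp only [Finset.sum_empty]
      exact ⟨contDiff_const, HasCompactSupport.zero, this ▸ Set.empty_subset _⟩
    | insert j s hj ih =>
      have h1 := (hF j).mul (contDiff_const (c := t j))
      simp only [Finset.sum_insert hj]
      exact ⟨h1.1.add ih.1, h1.2.1.add ih.2.1, (tsupport_add _ _).trans (Set.union_subset h1.2.2 ih.2.2)⟩
  exact key Finset.univ

theorem IsTestFunction.comp_affine {c : Plane} {R : ℝ} (hR : 0 < R) (h : IsTestFunction (Metric.ball 0 1) φ) :
    IsTestFunction (Metric.ball c R) (fun x => φ (R⁻¹ • x + -(R⁻¹ • c))) := by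
  have hs : tsupport (fun x => φ (R⁻¹ • x + -(R⁻¹ • c))) ⊆ Metric.ball c R := by
    refine (tsupport_comp_subset_preimage φ (f := fun x : Plane => R⁻¹ • x + -(R⁻¹ • c)) (by fun_prop)).trans fun x hx => ?_
    have h1 : R⁻¹ • x + -(R⁻¹ • c) ∈ Metric.ball (0:Plane) 1 := h.2.2 hx
    rw [mem_ball_zero_iff, ← smul_neg, ← smul_add, norm_smul, Real.norm_of_nonneg (by positivity), inv_mul_lt_iff₀ hR, mul_one] at h1
    rwa [mem_ball_iff_norm, sub_eq_add_neg]
  refine ⟨h.1.comp (by fun_prop), ?_, hs⟩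
  exact HasCompactSupport.of_support_subset_isCompact (isCompact_closedBall c R)
    ((subset_tsupport _).trans (hs.trans Metric.ball_subset_closedBall))

theorem integral_comp_affine {R : ℝ} (hR : 0 < R) (c : Plane) (G : Plane → ℝ) : ∫ y, G (R • y + c) = (R ^ 2)⁻¹ * ∫ x, G x := by
  have h1 := Measure.integral_comp_smul_of_nonneg (volume : Measure Plane) (fun x => G (x + c)) R (hR := hR.le)
  rw [h1, integral_add_right_eq_self, finrank_euclideanSpace, Fintype.card_fin, smul_eq_mul]

/-- A mean-free function acts on polynomials like the negative divergence of a smooth field with compact support, with a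
scale-invariant bound. -/
theorem exists_moment_field (r : ℕ) {Λ : ℝ} (hΛ : 0 < Λ) : ∃ M, 0 ≤ M ∧ ∀ (K : ConvexPolygon) (c : Plane) (R : ℝ), 0 < R →
    Metric.closedBall c R ⊆ K.carrier → K.carrier ⊆ Metric.closedBall c (Λ * R) →
    ∀ g, MemLp g 2 (volume.restrict K.inner) → ∫ x in K.inner, g x = 0 →
    ∃ W : Fin 2 → Plane → ℝ, (∀ b, IsTestFunction K.inner (W b)) ∧
      (∀ q : MvPolynomial (Fin 2) ℝ, q.totalDegree ≤ r →
        ∑ b, ∫ x in K.inner, W b x * pderiv b (polyEval q) x = -∫ x in K.inner, g x * polyEval q x) ∧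
      ∀ b, l2n (volume.restrict K.inner) (weakLaplacian K.inner (W b)) ≤ M * R⁻¹ * l2n (volume.restrict K.inner) g := by
  obtain ⟨N, b, Φ, hb, hΦ, hid⟩ := exists_gradient_moments r
  have hβ : ∀ j, ∃ β, ∀ x ∈ Metric.closedBall (0:Plane) Λ, ‖polyEval (b j) x‖ ≤ β := fun j =>
    (isCompact_closedBall _ _).exists_bound_of_continuousOn (continuous_polyEval (b j)).continuousOn
  choose β hβ using hβ
  have hβ0 : ∀ j, 0 ≤ β j := fun j => (norm_nonneg _).trans (hβ j 0 (Metric.mem_closedBall_self hΛ.le))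
  have hΦ2 := fun j d a => ((hΦ j d).pderiv a).pderiv a
  have hγ : ∀ j d a, ∃ γ, ∀ x, ‖pderiv a (pderiv a (Φ j d)) x‖ ≤ γ := fun j d a =>
    (hΦ2 j d a).2.1.exists_bound_of_continuous (hΦ2 j d a).1.continuous
  choose γ hγ using hγ
  have hγ0 : ∀ j d a, 0 ≤ γ j d a := fun j d a => (norm_nonneg _).trans (hγ j d a 0)
  set V := volume.real (Metric.ball (0:Plane) 1) with hV
  have hV0 : 0 ≤ V := measureReal_nonneg
  -- `β j` bounds the basis polynomial on the rescaled element, which lies in the ball of radius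
  -- `Λ`; `γ` bounds the second derivatives of the reference fields; `Λ² V R²` bounds the area of
  -- the element. All of them are independent of `K`.
  refine ⟨∑ j, β j * (∑ d, ∑ a, γ j d a) * (Λ ^ 2 * V), Finset.sum_nonneg fun j _ => mul_nonneg (mul_nonneg (hβ0 j)
    (Finset.sum_nonneg fun d _ => Finset.sum_nonneg fun a _ => hγ0 j d a)) (by positivity), ?_⟩
  intro K c R hR hin hout g hg hg0
  have hUm := K.isOpen_inner.measurableSet
  set d0 := -(R⁻¹ • c) with hd0
  have hy : ∀ x : Plane, R • (R⁻¹ • x + d0) + c = x := fun x => by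
    rw [hd0, smul_add, smul_neg, smul_smul, smul_smul, mul_inv_cancel₀ hR.ne', one_smul, one_smul, neg_add_cancel_right]
  have hy' : ∀ y : Plane, R⁻¹ • (R • y + c) + d0 = y := fun y => by
    rw [hd0, smul_add, smul_smul, inv_mul_cancel₀ hR.ne', one_smul, add_neg_cancel_right]
  have hKy : ∀ x ∈ K.inner, R⁻¹ • x + d0 ∈ Metric.closedBall (0:Plane) Λ := fun x hx => by
    have h1 := hout (inner_subset_carrier hx)
    rw [mem_closedBall_iff_norm] at h1
    rw [mem_closedBall_zero_iff, hd0, ← smul_neg, ← smul_add, ← sub_eq_add_neg, norm_smul, Real.norm_of_nonneg (by positivity),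
      inv_mul_le_iff₀ hR]
    linarith
  have hball : Metric.ball c R ⊆ K.inner := interior_maximal (Metric.ball_subset_closedBall.trans hin) Metric.isOpen_ball
  set F : Fin N → Fin 2 → Plane → ℝ := fun j d x => Φ j d (R⁻¹ • x + d0) with hF
  have hFt : ∀ j d, IsTestFunction K.inner (F j d) := fun j d => ((hΦ j d).comp_affine hR).mono hball
  set B : Fin N → Plane → ℝ := fun j x => polyEval (b j) (R⁻¹ • x + d0) with hB
  have hBc : ∀ j, MemLp (B j) 2 (volume.restrict K.inner) := fun j => memLp_of_continuous K.isBounded_inner ((continuous_polyEval _).comp (by fun_prop))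
  have hone : MemLp (fun _ : Plane => (1:ℝ)) 2 (volume.restrict K.inner) := memLp_of_continuous K.isBounded_inner continuous_const
  have hvol : l2n (volume.restrict K.inner) (fun _ => 1) ^ 2 ≤ Λ ^ 2 * R ^ 2 * V := by
    rw [l2n_sq hone]
    simp only [one_pow, integral_const, smul_eq_mul, mul_one, measureReal_restrict_apply_univ]
    refine (measureReal_mono (inner_subset_carrier.trans hout) measure_closedBall_lt_top.ne).trans (le_of_eq ?_)
    rw [Measure.addHaar_real_closedBall _ _ (by positivity), finrank_euclideanSpace, Fintype.card_fin]; ring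
  -- Chosen by comparing coefficients: `∫ W · ∇q = ∑ t j * T j`, while `∫ g q = ∑ R⁻¹ T j ∫ g B j`
  -- by the expansion `hqx`, whose constant term is annihilated because `g` has mean zero.
  set t : Fin N → ℝ := fun j => -(R⁻¹ * ∫ x in K.inner, g x * B j x) with ht
  have htb : ∀ j, |t j| ≤ R⁻¹ * (l2n (volume.restrict K.inner) g * (β j * l2n (volume.restrict K.inner) (fun _ => 1))) := fun j => by
    rw [ht, abs_neg, abs_mul, abs_of_pos (inv_pos.2 hR)]
    refine mul_le_mul_of_nonneg_left ((abs_integral_mul_le hg (hBc j)).trans (mul_le_mul_of_nonneg_left ?_ (l2n_nonneg _ _))) (by positivity)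
    have := l2n_mul_le hUm (hβ0 j) (q := B j) (fun x hx => hβ j _ (hKy x hx)) hone
    rwa [show B j * (fun _ => (1:ℝ)) = B j from funext fun x => mul_one _] at this
  have hWt : ∀ d, IsTestFunction K.inner (fun x => ∑ j, t j * F j d x) := fun d => IsTestFunction.sum (fun j => hFt j d) t
  refine ⟨fun d x => ∑ j, t j * F j d x, hWt, fun q hq => ?_, fun d => ?_⟩
  · have hqd : ∀ a, pderiv a (polyEval (affineSubst q R c)) = fun y => R * pderiv a (polyEval q) (R • y + c) := fun a => by
      rw [← pderiv_comp_affine ((contDiff_polyEval q).differentiable (by simp))]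
      congr 1; funext y; exact polyEval_affineSubst _ _ _ _
    have hc := fun a => (pderiv_contDiff (contDiff_polyEval q) a).continuous
    set T : Fin N → ℝ := fun j => ∑ a, ∫ x in K.inner, F j a x * pderiv a (polyEval q) x with hT
    have hTj : ∀ j, ∑ a, ∫ y, Φ j a y * pderiv a (polyEval (affineSubst q R c)) y = R⁻¹ * T j := by
      intro j
      rw [hT, Finset.mul_sum]
      refine Finset.sum_congr rfl fun a _ => ?_
      rw [hqd a]
      have := integral_comp_affine hR c fun x => F j a x * pderiv a (polyEval q) x
      simp only [hF, hy'] at this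
      have e1 : ∀ y, Φ j a y * (R * pderiv a (polyEval q) (R • y + c)) = R * (Φ j a y * pderiv a (polyEval q) (R • y + c)) := fun y => by ring
      simp only [e1]
      rw [integral_const_mul, this, setIntegral_eq_integral_of_forall_compl_eq_zero fun x hx => by
        rw [(hFt j a).eq_zero hx, zero_mul]]
      have e : ∀ I : ℝ, R * ((R ^ 2)⁻¹ * I) = R⁻¹ * I := fun I => by field_simp
      exact e _
    -- The reference identity for the rescaled polynomial `y ↦ q (R y + c)`. A gradient contributes
    -- `R` and the area element `R⁻²`, which leaves `R⁻¹`.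
    have hqx : ∀ x, polyEval q x = polyEval (affineSubst q R c) 0 + ∑ j, R⁻¹ * T j * B j x := by
      intro x
      have h1 := congrArg (fun p => polyEval p (R⁻¹ • x + d0)) (hid (affineSubst q R c) ((totalDegree_affineSubst_le _ _ _).trans hq))
      simp only [polyEval_affineSubst, hy, polyEval_add, polyEval_C, hTj] at h1
      rw [h1, polyEval_affineSubst]
      congr 1
      simp only [polyEval, map_sum, MvPolynomial.smul_eval, hB]
    have i1 : ∀ j a, Integrable (fun x => F j a x * pderiv a (polyEval q) x) (volume.restrict K.inner) := fun j a =>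
      (memLp_of_continuous K.isBounded_inner (hFt j a).1.continuous).integrable_mul' (memLp_of_continuous K.isBounded_inner (hc a))
    have e2 : ∀ a, ∫ x in K.inner, (∑ j, t j * F j a x) * pderiv a (polyEval q) x =
        ∑ j, t j * ∫ x in K.inner, F j a x * pderiv a (polyEval q) x := fun a => by
      simp only [Finset.sum_mul, mul_assoc]
      rw [integral_finsetSum _ fun j _ => (i1 j a).const_mul _]
      simp only [integral_const_mul]
    simp only [e2]
    rw [Finset.sum_comm]
    simp only [← Finset.mul_sum]
    have i2 : ∀ j, Integrable (fun x => R⁻¹ * T j * (g x * B j x)) (volume.restrict K.inner) := fun j => (hg.integrable_mul' (hBc j)).const_mul _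
    have e3 : ∀ x, g x * polyEval q x = g x * polyEval (affineSubst q R c) 0 + ∑ j, R⁻¹ * T j * (g x * B j x) := fun x => by
      rw [hqx x, mul_add, Finset.mul_sum]
      congr 1
      exact Finset.sum_congr rfl fun j _ => by ring
    simp only [e3]
    rw [integral_add _ (integrable_finsetSum _ fun j _ => i2 j), integral_mul_const, hg0, zero_mul, zero_add, integral_finsetSum _ fun j _ => i2 j,
      ← Finset.sum_neg_distrib]
    · refine Finset.sum_congr rfl fun j _ => ?_
      rw [integral_const_mul, ht]; ring
    · simpa using hg.integrable_mul' (memLp_of_continuous K.isBounded_inner (continuous_const (y := polyEval (affineSubst q R c) 0)))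
  · have hFd : ∀ j a, pderiv a (pderiv a (F j d)) = fun x => R⁻¹ * (R⁻¹ * pderiv a (pderiv a (Φ j d)) (R⁻¹ • x + d0)) := fun j a => by
      have h1 : pderiv a (F j d) = _ := pderiv_comp_affine ((hΦ j d).1.differentiable (by simp)) R⁻¹ d0 a
      have h2 := pderiv_comp_affine (((hΦ j d).pderiv a).1.differentiable (by simp)) R⁻¹ d0 a
      rw [h1]
      funext x
      have h3 := pderiv_const_smul (φ := fun x => pderiv a (Φ j d) (R⁻¹ • x + d0))
        ((((hΦ j d).pderiv a).1.comp (g := pderiv a (Φ j d)) (f := fun x : Plane => R⁻¹ • x + d0) (by fun_prop)).differentiable (by simp)) R⁻¹ a x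
      rw [h2] at h3
      exact h3
    have hlap : weakLaplacian K.inner (fun x => ∑ j, t j * F j d x) =ᵐ[volume.restrict K.inner]
        fun x => ∑ a, ∑ j, t j * (R⁻¹ * (R⁻¹ * pderiv a (pderiv a (Φ j d)) (R⁻¹ • x + d0))) := by
      have h1 := fun a => weakPartial2_of_contDiff K.isOpen_inner (hWt d).1 a a
      filter_upwards [h1 0, h1 1] with x h0 h1
      rw [weakLaplacian, Fin.sum_univ_two, Fin.sum_univ_two, h0, h1]
      simp only [pderiv_sum (fun j => (hFt j d).1.differentiable (by simp)) t,
        pderiv_sum (fun j => ((hFt j d).pderiv _).1.differentiable (by simp)) t, hFd]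
    rw [l2n_congr hlap]
    set Q : ℝ := ∑ j, |t j| * (R⁻¹ * R⁻¹ * ∑ d, ∑ a, γ j d a) with hQ
    have hQ0 : 0 ≤ Q := Finset.sum_nonneg fun j _ => mul_nonneg (abs_nonneg _) (mul_nonneg (by positivity)
      (Finset.sum_nonneg fun d _ => Finset.sum_nonneg fun a _ => hγ0 j d a))
    have hpt : ∀ x, |∑ a, ∑ j, t j * (R⁻¹ * (R⁻¹ * pderiv a (pderiv a (Φ j d)) (R⁻¹ • x + d0)))| ≤ Q := fun x => by
      rw [Finset.sum_comm]
      refine (Finset.abs_sum_le_sum_abs _ _).trans (Finset.sum_le_sum fun j _ => ?_)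
      rw [← Finset.mul_sum, abs_mul]
      refine mul_le_mul_of_nonneg_left ?_ (abs_nonneg _)
      simp only [← Finset.mul_sum]
      rw [← mul_assoc, abs_mul, abs_of_pos (a := R⁻¹ * R⁻¹) (by positivity)]
      refine mul_le_mul_of_nonneg_left ((Finset.abs_sum_le_sum_abs _ _).trans ((Finset.sum_le_sum fun a _ => hγ j d a _).trans ?_)) (by positivity)
      exact Finset.single_le_sum (f := fun d => ∑ a, γ j d a) (fun d _ => Finset.sum_nonneg fun a _ => hγ0 j d a) (Finset.mem_univ d)
    have h1 := l2n_mul_le hUm hQ0 (fun x _ => hpt x) hone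
    rw [show (fun x => ∑ a, ∑ j, t j * (R⁻¹ * (R⁻¹ * pderiv a (pderiv a (Φ j d)) (R⁻¹ • x + d0)))) * (fun _ => (1:ℝ)) =
      (fun x => ∑ a, ∑ j, t j * (R⁻¹ * (R⁻¹ * pderiv a (pderiv a (Φ j d)) (R⁻¹ • x + d0)))) from funext fun x => mul_one _] at h1
    refine h1.trans ?_
    rw [hQ, Finset.sum_mul, Finset.sum_mul, Finset.sum_mul]
    refine Finset.sum_le_sum fun j _ => ?_
    set Γ := ∑ d, ∑ a, γ j d a
    have hΓ : 0 ≤ Γ := Finset.sum_nonneg fun d _ => Finset.sum_nonneg fun a _ => hγ0 j d a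
    set o := l2n (volume.restrict K.inner) (fun _ => 1)
    have ho : 0 ≤ o := l2n_nonneg _ _
    -- The powers of `R`: two inverse ones from second derivatives, one from `t j`, and `o² ≤ Λ² R²
    -- V` returns two, which leaves `R⁻¹`.
    calc |t j| * (R⁻¹ * R⁻¹ * Γ) * o ≤ R⁻¹ * (l2n (volume.restrict K.inner) g * (β j * o)) * (R⁻¹ * R⁻¹ * Γ) * o := by gcongr; exact htb j
      _ = (R⁻¹ * l2n (volume.restrict K.inner) g * β j * R⁻¹ * R⁻¹ * Γ) * o ^ 2 := by ring
      _ ≤ (R⁻¹ * l2n (volume.restrict K.inner) g * β j * R⁻¹ * R⁻¹ * Γ) * (Λ ^ 2 * R ^ 2 * V) := by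
          refine mul_le_mul_of_nonneg_left hvol ?_
          have := l2n_nonneg (volume.restrict K.inner) g
          have := hβ0 j
          positivity
      _ = β j * Γ * (Λ ^ 2 * V) * R⁻¹ * l2n (volume.restrict K.inner) g := by field_simp

end StrainGradientVEM

namespace StrainGradientVEM
open ConvexPolygon

/-! ## Functions with vanishing boundary degrees of freedom -/

variable {K : ConvexPolygon} {i : Fin (K.extra + 3)} {U : Set Plane} {f f' g h p w w' u v e φ : Plane → ℝ} {r : ℕ}

/-- The vertex values and the edge moments of order at most `r` vanish. -/
def BoundaryFree (K : ConvexPolygon) (r : ℕ) (w : Plane → ℝ) : Prop :=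
  (∀ i, dofVertex K i w = 0) ∧ ∀ m : MvPolynomial (Fin 2) ℝ, m.totalDegree ≤ r → ∀ i, dofEdge K i m w = 0 ∧ dofNormal K i m w = 0

theorem dofVertex_sub (hv : MemH2 K.inner v) (hu : MemH2 K.inner u) (i : Fin (K.extra + 3)) :
    dofVertex K i (v - u) = dofVertex K i v - dofVertex K i u := contRep_sub hv hu (vert_mem_carrier i)

theorem dofEdge_sub (hv : MemH2 K.inner v) (hu : MemH2 K.inner u) (i : Fin (K.extra + 3)) (m : MvPolynomial (Fin 2) ℝ) :
    dofEdge K i m (v - u) = dofEdge K i m v - dofEdge K i m u := by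
  have hc : ∀ {w : Plane → ℝ}, MemH2 K.inner w → MemLp (contRep K w) 2 (K.edgeMeasure i) := fun hw =>
    memLp_edge (hw.continuousOn_contRep.mono edge_subset_carrier)
  have hp := memLp_polyEval_edge i m
  simp only [dofEdge]
  rw [← mul_sub, ← integral_sub (hp.integrable_mul' (hc hv)) (hp.integrable_mul' (hc hu))]
  congr 1
  refine integral_congr_ae ?_
  filter_upwards [ae_edgeMeasure_mem_edge i] with x hx
  rw [contRep_sub hv hu (edge_subset_carrier hx), Pi.sub_apply, mul_sub]

theorem dofNormal_sub (hv : MemH2 K.inner v) (hu : MemH2 K.inner u) (i : Fin (K.extra + 3)) (m : MvPolynomial (Fin 2) ℝ) :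
    dofNormal K i m (v - u) = dofNormal K i m v - dofNormal K i m u := by
  rw [← momentPairing_single, momentPairing_sub_right hv hu, momentPairing_single, momentPairing_single]

theorem boundaryFree_sub_iff (hv : MemH2 K.inner v) (hu : MemH2 K.inner u) : BoundaryFree K r (v - u) ↔
    (∀ i, dofVertex K i v = dofVertex K i u) ∧ ∀ m : MvPolynomial (Fin 2) ℝ, m.totalDegree ≤ r → ∀ i,
      dofEdge K i m v = dofEdge K i m u ∧ dofNormal K i m v = dofNormal K i m u := by
  simp only [BoundaryFree, dofVertex_sub hv hu, dofEdge_sub hv hu, dofNormal_sub hv hu, sub_eq_zero]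

theorem SameLocalDofs.boundaryFree {k : ℕ} (hv : MemH2 K.inner v) (hu : MemH2 K.inner u) (h : SameLocalDofs k K v u) :
    BoundaryFree K (k - 2) (v - u) :=
  (boundaryFree_sub_iff hv hu).2 ⟨h.1, fun m hm i => ⟨(h.2 m hm).1 i, (h.2 m hm).2.1 i⟩⟩

theorem BoundaryFree.sub (hv : MemH2 K.inner v) (hu : MemH2 K.inner u) (h : BoundaryFree K r v) (h' : BoundaryFree K r u) :
    BoundaryFree K r (v - u) :=
  (boundaryFree_sub_iff hv hu).2 ⟨fun i => by rw [h.1, h'.1], fun m hm i => by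
    rw [(h.2 m hm i).1, (h.2 m hm i).2, (h'.2 m hm i).1, (h'.2 m hm i).2]; exact ⟨rfl, rfl⟩⟩

theorem boundaryFree_test (hφ : IsTestFunction K.inner φ) (r : ℕ) : BoundaryFree K r φ := by
  have h0 : ∀ i, ∀ x ∈ K.edge i, contRep K φ x = 0 := (memH2H10_test hφ).edge
  refine ⟨fun i => h0 i _ vert_mem_edge, fun m _ i => ⟨?_, ?_⟩⟩
  · rw [dofEdge, integral_eq_zero_of_ae, mul_zero]
    filter_upwards [ae_edgeMeasure_mem_edge i] with x hx
    rw [h0 i x hx, mul_zero]; rfl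
  · rw [dofNormal, integral_eq_zero_of_ae]
    filter_upwards [normalDeriv_test hφ i] with x hx
    rw [hx, Pi.zero_apply, mul_zero]

theorem BoundaryFree.integral_edge_eq_zero (hb : BoundaryFree K r w) {m : MvPolynomial (Fin 2) ℝ} (hm : m.totalDegree ≤ r)
    (i : Fin (K.extra + 3)) : ∫ x, polyEval m x * contRep K w x ∂(K.edgeMeasure i) = 0 :=
  (mul_eq_zero.1 (hb.2 m hm i).1).resolve_left (inv_ne_zero (edgeLength_pos i).ne')

/-- The gradient split into normal and tangential part. The factor `|e|⁻²` appears because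
`tangentialDeriv` is taken along the edge vector and not along its unit vector. -/
theorem trace_weakPartial_eq (i : Fin (K.extra + 3)) (a : Fin 2) (w : Plane → ℝ) (y : Plane) : trace K i (weakPartial K.inner a w) y =
    K.normal i a * normalDeriv K i w y + (K.edgeLength i ^ 2)⁻¹ * K.dvec i a * tangentialDeriv K i w y := by
  have hl := (edgeLength_pos (K := K) i).ne'
  have h2 : K.edgeLength i ^ 2 = K.dvec i 0 ^ 2 + K.dvec i 1 ^ 2 := by
    rw [edgeLength_eq, EuclideanSpace.norm_sq_eq, Fin.sum_univ_two]; simp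
  have e0 : K.normal i 0 = (K.edgeLength i)⁻¹ * K.dvec i 1 := by simp [ConvexPolygon.normal, ConvexPolygon.dvec]
  have e1 : K.normal i 1 = -((K.edgeLength i)⁻¹ * K.dvec i 0) := by simp [ConvexPolygon.normal, ConvexPolygon.dvec]; ring
  simp only [normalDeriv, tangentialDeriv, Fin.sum_univ_two]
  fin_cases a
  all_goals
    simp only [Fin.zero_eta, Fin.mk_one, e0, e1]
    field_simp
    rw [h2]; ring

/-- The edge degrees of freedom control moments of the whole gradient. The normal part is one of
them; the tangential part, integrated by parts along the edge, leaves vertex values and moments of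
lower degree. -/
theorem BoundaryFree.integral_trace_weakPartial (hb : BoundaryFree K r w) (hw : MemH2 K.inner w) {m : MvPolynomial (Fin 2) ℝ}
    (hm : m.totalDegree ≤ r) (i : Fin (K.extra + 3)) (a : Fin 2) :
    ∫ x, trace K i (weakPartial K.inner a w) x * polyEval m x ∂(K.edgeMeasure i) = 0 := by
  have hp := memLp_polyEval_edge i m
  have e : ∀ x, trace K i (weakPartial K.inner a w) x * polyEval m x = K.normal i a * (polyEval m x * normalDeriv K i w x) +
      (K.edgeLength i ^ 2)⁻¹ * K.dvec i a * (polyEval m x * tangentialDeriv K i w x) := fun x => by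
    rw [trace_weakPartial_eq i a w]; ring
  have h1 : ∫ x, polyEval m x * normalDeriv K i w x ∂(K.edgeMeasure i) = 0 := (hb.2 m hm i).2
  have h2 : ∫ x, polyEval m x * tangentialDeriv K i w x ∂(K.edgeMeasure i) = 0 := by
    rw [integral_tangentialDeriv hw (contDiff_polyEval m) i]
    have c1 : contRep K w (K.vert i) = 0 := hb.1 i
    have c2 : contRep K w (K.vert (i + 1)) = 0 := hb.1 (i + 1)
    have e3 : ∀ x, ∑ a, K.dvec i a * pderiv a (polyEval m) x = polyEval (∑ a, K.dvec i a • MvPolynomial.pderiv a m) x := fun x => by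
      simp only [pderiv_polyEval, Fin.sum_univ_two, polyEval_add, polyEval_smul]
    simp only [e3, c1, c2]
    rw [hb.integral_edge_eq_zero (MvPolynomial.totalDegree_finsetSum_le fun a _ => (MvPolynomial.totalDegree_smul_le _ _).trans
      ((totalDegree_pderiv_le m a).trans (by omega))) i]
    ring
  simp only [e]
  rw [integral_add ((hp.integrable_mul' (memLp_normalDeriv hw i)).const_mul _) ((hp.integrable_mul' (memLp_tangentialDeriv hw i)).const_mul _),
    integral_const_mul, integral_const_mul, h1, h2]
  ring

theorem memH1_polyEval (m : MvPolynomial (Fin 2) ℝ) : MemH1 K.inner (polyEval m) := memH1_of_contDiff K.isBounded_inner (contDiff_polyEval m)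

theorem integral_weakPartial_mul_polyEval (hf : MemH1 K.inner f) (m : MvPolynomial (Fin 2) ℝ) (a : Fin 2) :
    ∫ x in K.inner, weakPartial K.inner a f x * polyEval m x = (∑ i, K.normal i a * ∫ x, trace K i f x * polyEval m x ∂(K.edgeMeasure i)) -
      ∫ x in K.inner, f x * polyEval (MvPolynomial.pderiv a m) x := by
  have h1 := integral_mul_weakPartial hf (memH1_polyEval m) a
  have h2 : ∫ x in K.inner, f x * weakPartial K.inner a (polyEval m) x = ∫ x in K.inner, f x * polyEval (MvPolynomial.pderiv a m) x := by
    refine integral_congr_ae ?_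
    filter_upwards [weakPartial_of_contDiff K.isOpen_inner (contDiff_polyEval m) a] with x hx
    rw [hx, pderiv_polyEval]
  have h3 : ∀ i, ∫ x, trace K i f x * trace K i (polyEval m) x ∂(K.edgeMeasure i) = ∫ x, trace K i f x * polyEval m x ∂(K.edgeMeasure i) := fun i => by
    refine integral_congr_ae ?_
    filter_upwards [trace_of_contDiff (contDiff_polyEval m) i] with x hx
    rw [hx]
  simp only [h2, h3] at h1
  linarith

/-- By Green's formula with the test function one, the integral is a combination of edge means, and
these are degrees of freedom. It makes `div e` mean-free and the Poincaré inequality available for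
first derivatives of `e`. -/
theorem BoundaryFree.integral_weakPartial (hb : BoundaryFree K r w) (hw : MemH2 K.inner w) (a : Fin 2) :
    ∫ x in K.inner, weakPartial K.inner a w x = 0 := by
  have h1 := integral_weakPartial_mul_polyEval hw.1 (MvPolynomial.C 1) a
  have h3 : ∀ i, ∫ x, trace K i w x ∂(K.edgeMeasure i) = 0 := fun i => by
    have h := hb.integral_edge_eq_zero (m := MvPolynomial.C 1) (by rw [MvPolynomial.totalDegree_C]; exact Nat.zero_le _) i
    simp only [polyEval_C, one_mul] at h
    rw [← h]
    exact integral_congr_ae (trace_ae_eq_contRep hw i)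
  simp only [polyEval_C, mul_one, MvPolynomial.pderiv_C, polyEval_zero, mul_zero, integral_zero, h3, Finset.sum_const_zero, sub_zero] at h1
  exact h1

/-! ### Moments of the divergence and of its gradient; comparison of seminorms -/

section Divergence

variable {d d' : Fin 2 → Plane → ℝ}

theorem weakDiv_eq (U : Set Plane) (d : Fin 2 → Plane → ℝ) : weakDiv U d = weakPartial U 0 (d 0) + weakPartial U 1 (d 1) := by
  funext x; rw [weakDiv, Fin.sum_univ_two]; rfl

theorem memH1_weakDiv (hU : IsOpen U) (hd : ∀ c, MemH2 U (d c)) : MemH1 U (weakDiv U d) := by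
  rw [weakDiv_eq]; exact ((hd 0).2 0).add hU ((hd 1).2 1)

theorem weakDiv_sub (hU : IsOpen U) (hd : ∀ c, MemH2 U (d c)) (hd' : ∀ c, MemH2 U (d' c)) :
    weakDiv U (fun c => d c - d' c) =ᵐ[volume.restrict U] weakDiv U d - weakDiv U d' := by
  simp only [weakDiv_eq]
  filter_upwards [weakPartial_sub hU (hd 0).1 (hd' 0).1 0, weakPartial_sub hU (hd 1).1 (hd' 1).1 1] with x h0 h1
  simp only [Pi.add_apply, Pi.sub_apply, h0, h1]; ring

/-- One more integration by parts: the edge terms are gradient moments, which vanish, and the volume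
term is a moment of the divergence against a derivative of `m`. Hence the second projection identity
follows from the first. -/
theorem integral_weakPartial_weakDiv_eq_zero (hd : ∀ c, MemH2 K.inner (d c)) (hb : ∀ c, BoundaryFree K r (d c))
    (h0 : ∀ m : MvPolynomial (Fin 2) ℝ, m.totalDegree ≤ r → ∫ x in K.inner, weakDiv K.inner d x * polyEval m x = 0)
    {m : MvPolynomial (Fin 2) ℝ} (hm : m.totalDegree ≤ r) (a : Fin 2) :
    ∫ x in K.inner, weakPartial K.inner a (weakDiv K.inner d) x * polyEval m x = 0 := by
  rw [integral_weakPartial_mul_polyEval (memH1_weakDiv K.isOpen_inner hd), h0 _ ((totalDegree_pderiv_le m a).trans (by omega)), sub_zero]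
  refine Finset.sum_eq_zero fun i _ => ?_
  have hp := memLp_polyEval_edge i m
  have h1 : ∫ x, trace K i (weakDiv K.inner d) x * polyEval m x ∂(K.edgeMeasure i) =
      ∫ x, (trace K i (weakPartial K.inner 0 (d 0)) x * polyEval m x + trace K i (weakPartial K.inner 1 (d 1)) x * polyEval m x) ∂(K.edgeMeasure i) := by
    refine integral_congr_ae ?_
    rw [weakDiv_eq]
    filter_upwards [trace_add ((hd 0).2 0) ((hd 1).2 1) i] with x hx
    rw [hx, Pi.add_apply, add_mul]
  rw [h1, integral_add ((((hd 0).2 0).memLp_trace i).integrable_mul' hp) ((((hd 1).2 1).memLp_trace i).integrable_mul' hp),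
    (hb 0).integral_trace_weakPartial (hd 0) hm, (hb 1).integral_trace_weakPartial (hd 1) hm]
  ring

/-- The projection depends on the function only through its moments. -/
theorem l2Proj_congr {U : Set Plane} (h : ∀ m : MvPolynomial (Fin 2) ℝ, m.totalDegree ≤ r → ∫ x in U, f x * polyEval m x = ∫ x in U, g x * polyEval m x) :
    l2Proj U r f = l2Proj U r g := by
  refine dite_choose_congr (funext fun q => propext (and_congr_right fun _ => forall_congr' fun m => forall_congr' fun hm => ?_))
  rw [h m hm]

theorem le_seminormH1 (hU : IsOpen U) (hd : ∀ c, MemH1 U (d c)) (c i : Fin 2) : l2n (volume.restrict U) (weakPartial U i (d c)) ≤ seminormH1 U d := by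
  have h0 : ∀ c i, 0 ≤ ∫ x in U, weakPartial U i (d c) x ^ 2 := fun c i => integral_nonneg fun x => sq_nonneg _
  refine Real.le_sqrt_of_sq_le ?_
  rw [l2n_sq ((hd c).memLp_weakPartial hU i)]
  exact (Finset.single_le_sum (f := fun i => ∫ x in U, weakPartial U i (d c) x ^ 2) (fun i _ => h0 c i) (Finset.mem_univ i)).trans
    (Finset.single_le_sum (f := fun c => ∑ i, ∫ x in U, weakPartial U i (d c) x ^ 2) (fun c _ => Finset.sum_nonneg fun i _ => h0 c i) (Finset.mem_univ c))

theorem seminormH1_le (hU : IsOpen U) (hd : ∀ c, MemH1 U (d c)) {B : ℝ} (hB : 0 ≤ B)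
    (h : ∀ c i, l2n (volume.restrict U) (weakPartial U i (d c)) ≤ B) : seminormH1 U d ≤ 2 * B := by
  refine Real.sqrt_le_iff.2 ⟨by positivity, ?_⟩
  have h1 : ∀ c i, ∫ x in U, weakPartial U i (d c) x ^ 2 ≤ B ^ 2 := fun c i => by
    rw [← l2n_sq ((hd c).memLp_weakPartial hU i)]; exact pow_le_pow_left₀ (l2n_nonneg _ _) (h c i) 2
  refine (Finset.sum_le_sum fun c _ => Finset.sum_le_sum fun i _ => h1 c i).trans (le_of_eq ?_)
  simp only [Finset.sum_const, Finset.card_univ, Fintype.card_fin, nsmul_eq_mul]; push_cast; ring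

theorem sum_le_seminormH2_sq (hU : IsOpen U) (hd : ∀ c, MemH2 U (d c)) (c i : Fin 2) :
    ∑ j, l2n (volume.restrict U) (weakPartial U j (weakPartial U i (d c))) ^ 2 ≤ seminormH2 U d ^ 2 := by
  have h0 : ∀ c i j, 0 ≤ ∫ x in U, weakPartial U j (weakPartial U i (d c)) x ^ 2 := fun c i j => integral_nonneg fun x => sq_nonneg _
  rw [seminormH2, Real.sq_sqrt (Finset.sum_nonneg fun c _ => Finset.sum_nonneg fun i _ => Finset.sum_nonneg fun j _ => h0 c i j)]
  simp only [l2n_sq (((hd c).2 i).memLp_weakPartial hU _)]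
  exact (Finset.single_le_sum (f := fun i => ∑ j, ∫ x in U, weakPartial U j (weakPartial U i (d c)) x ^ 2)
    (fun i _ => Finset.sum_nonneg fun j _ => h0 c i j) (Finset.mem_univ i)).trans
    (Finset.single_le_sum (f := fun c => ∑ i, ∑ j, ∫ x in U, weakPartial U j (weakPartial U i (d c)) x ^ 2)
      (fun c _ => Finset.sum_nonneg fun i _ => Finset.sum_nonneg fun j _ => h0 c i j) (Finset.mem_univ c))

theorem le_seminormH2 (hU : IsOpen U) (hd : ∀ c, MemH2 U (d c)) (c i j : Fin 2) :
    l2n (volume.restrict U) (weakPartial U j (weakPartial U i (d c))) ≤ seminormH2 U d :=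
  le_of_sq_le_sq ((Finset.single_le_sum (f := fun j => l2n (volume.restrict U) (weakPartial U j (weakPartial U i (d c))) ^ 2)
    (fun _ _ => sq_nonneg _) (Finset.mem_univ j)).trans (sum_le_seminormH2_sq hU hd c i)) (Real.sqrt_nonneg _)

/-- There are eight second derivatives, and `√8 ≤ 3`. -/
theorem seminormH2_le (hU : IsOpen U) (hd : ∀ c, MemH2 U (d c)) {B : ℝ} (hB : 0 ≤ B)
    (h : ∀ c i j, l2n (volume.restrict U) (weakPartial U j (weakPartial U i (d c))) ≤ B) : seminormH2 U d ≤ 3 * B := by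
  refine Real.sqrt_le_iff.2 ⟨by positivity, ?_⟩
  have h1 : ∀ c i j, ∫ x in U, weakPartial U j (weakPartial U i (d c)) x ^ 2 ≤ B ^ 2 := fun c i j => by
    rw [← l2n_sq (((hd c).2 i).memLp_weakPartial hU j)]; exact pow_le_pow_left₀ (l2n_nonneg _ _) (h c i j) 2
  refine (Finset.sum_le_sum fun c _ => Finset.sum_le_sum fun i _ => Finset.sum_le_sum fun j _ => h1 c i j).trans ?_
  simp only [Finset.sum_const, Finset.card_univ, Fintype.card_fin, nsmul_eq_mul]; push_cast; nlinarith [sq_nonneg B]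

end Divergence

end StrainGradientVEM

namespace StrainGradientVEM
open ConvexPolygon

/-! ## The correction of the interpolant on one element -/

variable {K : ConvexPolygon} {i : Fin (K.extra + 3)} {U : Set Plane} {f f' g h p w w' v e φ : Plane → ℝ} {r k : ℕ}

/-- Any one triangle of the triangulation contains a disc of radius `ρ diam τ ≥ ρ² diam K`. In this
form shape regularity enters the estimates. -/
theorem HasVirtualTriangulation.exists_closedBall {ρ : ℝ} (hρ : 0 < ρ) (h : HasVirtualTriangulation ρ K) :
    ∃ c, Metric.closedBall c (ρ ^ 2 * K.diam) ⊆ K.carrier := by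
  obtain ⟨TK, _, ⟨hU, _⟩, hball, hdiam, _⟩ := h
  obtain ⟨τ, hτ, _⟩ : ∃ τ ∈ TK, K.vert 0 ∈ τ.carrier := by
    have := hU ▸ K.vert_mem_carrier 0
    simpa using this
  obtain ⟨c, hc⟩ := hball τ hτ
  refine ⟨c, (Metric.closedBall_subset_closedBall ?_).trans (hc.trans ?_)⟩
  · rw [sq, mul_assoc]; exact mul_le_mul_of_nonneg_left (hdiam τ hτ) hρ.le
  · rw [← hU]; exact Set.subset_biUnion_of_mem (u := fun τ : ConvexPolygon => τ.carrier) hτ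

theorem weakDiv_add {d d' : Fin 2 → Plane → ℝ} (hU : IsOpen U) (hd : ∀ c, MemH2 U (d c)) (hd' : ∀ c, MemH2 U (d' c)) :
    weakDiv U (fun c => d c + d' c) =ᵐ[volume.restrict U] weakDiv U d + weakDiv U d' := by
  simp only [weakDiv_eq]
  filter_upwards [weakPartial_add hU (hd 0).1 (hd' 0).1 0, weakPartial_add hU (hd 1).1 (hd' 1).1 1] with x h0 h1
  simp only [Pi.add_apply, h0, h1]; ring

/-- The function `v - w + φ` is an admissible test for both `v` and `w`, so `‖Δ(v - w)‖² = -(Δ(v -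
w), Δφ)`. In other words `v - w` has the least Laplacian among all functions with its moments, and
`-φ` is a competitor. -/
theorem MemLocalSpace.l2n_laplacian_le (hv : MemLocalSpace k K v) (hw : MemLocalSpace k K w) (hz : MemH2H10 K (v - w))
    (hφ : IsTestFunction K.inner φ) (hm : MomentFree K (k - 2) (v - w + φ)) :
    l2n (volume.restrict K.inner) (weakLaplacian K.inner (v - w)) ≤ l2n (volume.restrict K.inner) (weakLaplacian K.inner φ) := by
  have hU := K.isOpen_inner
  have hφX := memH2H10_test hφ
  have hX := hz.add hφX
  have h1 := hv.integral_laplacian_eq_zero hX hm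
  have h2 := hw.integral_laplacian_eq_zero hX hm
  have lz := hz.1.memLp_weakLaplacian hU
  have lφ := hφX.1.memLp_weakLaplacian hU
  have lX := hX.1.memLp_weakLaplacian hU
  have h3 : ∫ x in K.inner, weakLaplacian K.inner (v - w) x * weakLaplacian K.inner (v - w + φ) x = 0 := by
    rw [← sub_self (0:ℝ)]
    nth_rw 1 [← h1]
    rw [← h2, ← integral_sub ((hv.1.memLp_weakLaplacian hU).integrable_mul' lX) ((hw.1.memLp_weakLaplacian hU).integrable_mul' lX)]
    refine integral_congr_ae ?_
    filter_upwards [weakLaplacian_sub hU hv.1 hw.1] with x hx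
    rw [hx, Pi.sub_apply, sub_mul]
  have h4 : l2n (volume.restrict K.inner) (weakLaplacian K.inner (v - w)) ^ 2 =
      -∫ x in K.inner, weakLaplacian K.inner (v - w) x * weakLaplacian K.inner φ x := by
    rw [l2n_sq lz, eq_neg_iff_add_eq_zero, ← h3, ← integral_add (lz.integrable_sq) (lz.integrable_mul' lφ)]
    refine integral_congr_ae ?_
    filter_upwards [weakLaplacian_add hU hz.1 hφX.1] with x hx
    rw [hx, Pi.add_apply]; ring
  have h5 := (neg_le_abs _).trans (abs_integral_mul_le lz lφ)
  rw [← h4] at h5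
  by_contra hlt
  push Not at hlt
  have := l2n_nonneg (volume.restrict K.inner) (weakLaplacian K.inner φ)
  nlinarith

/-- On one element the interpolant can be corrected, without changing its boundary degrees of freedom, such that the moments of the divergence and of
its gradient are those of the interpolated field. -/
theorem exists_local_correction (k : ℕ) (hk : 2 ≤ k) {ρ : ℝ} (hρ : 0 < ρ) : ∃ C : ℝ, 0 < C ∧ ∀ K : ConvexPolygon, HasVirtualTriangulation ρ K →
    ∀ u Iu : Fin 2 → Plane → ℝ, (∀ c, MemH2 K.inner (u c)) → (∀ c, MemLocalSpace k K (Iu c)) → (∀ c, SameLocalDofs k K (Iu c) (u c)) →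
    ∃ uI : Fin 2 → Plane → ℝ, (∀ c, MemLocalSpace k K (uI c)) ∧ (∀ c, BoundaryFree K (k - 2) (u c - uI c)) ∧
      (l2Proj K.inner (k - 1) (weakDiv K.inner uI) = l2Proj K.inner (k - 1) (weakDiv K.inner u) ∧
        ∀ i, l2Proj K.inner (k - 2) (weakPartial K.inner i (weakDiv K.inner uI)) = l2Proj K.inner (k - 2) (weakPartial K.inner i (weakDiv K.inner u))) ∧
      seminormH1 K.inner (u - uI) ≤ C * seminormH1 K.inner (u - Iu) ∧ seminormH2 K.inner (u - uI) ≤ C * seminormH2 K.inner (u - Iu) := by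
  obtain ⟨M, hM, hfield⟩ := exists_moment_field (k - 1) (Λ := (ρ ^ 2)⁻¹) (by positivity)
  -- Each derivative of `u - uI` is at most `(1 + 4 M ρ⁻²)` times the seminorm of `e`: one for `e`
  -- itself, the rest for `z = Iu - uI`. The factor `3` passes from the entries to the seminorms.
  refine ⟨3 * (1 + 4 * M * (ρ ^ 2)⁻¹), by positivity, fun K hK u Iu hu hIu hdof => ?_⟩
  obtain ⟨c, hc⟩ := hK.exists_closedBall hρ
  have hU := K.isOpen_inner
  have hh := diam_pos K
  set R := ρ ^ 2 * K.diam with hR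
  have hR0 : 0 < R := by positivity
  have hcK : c ∈ K.carrier := hc (Metric.mem_closedBall_self hR0.le)
  have hout : K.carrier ⊆ Metric.closedBall c ((ρ ^ 2)⁻¹ * R) := fun x hx => by
    rw [hR, ← mul_assoc, inv_mul_cancel₀ (by positivity), one_mul]; exact dist_le_diam hx hcK
  have he : ∀ c, MemH2 K.inner (u c - Iu c) := fun c => (hu c).sub hU (hIu c).1
  have heb : ∀ c, BoundaryFree K (k - 2) (u c - Iu c) := fun c => by
    have := (boundaryFree_sub_iff (hIu c).1 (hu c)).1 ((hdof c).boundaryFree (hIu c).1 (hu c))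
    exact (boundaryFree_sub_iff (hu c) (hIu c).1).2 ⟨fun i => (this.1 i).symm, fun m hm i => ⟨(this.2 m hm i).1.symm, (this.2 m hm i).2.symm⟩⟩
  set e : Fin 2 → Plane → ℝ := fun c => u c - Iu c with hedef
  have hg := (memH1_weakDiv hU he).1
  have hep := fun c a => (he c).1.memLp_weakPartial hU a
  -- The compatibility condition for prescribing `div e` through gradients of polynomials, among
  -- which constants are invisible.
  have hg0 : ∫ x in K.inner, weakDiv K.inner e x = 0 := by
    rw [weakDiv_eq]
    have h1 := integral_add ((hep 0 0).integrable_mul' (memLp_polyEval K (MvPolynomial.C 1))) ((hep 1 1).integrable_mul' (memLp_polyEval K (MvPolynomial.C 1)))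
    simp only [polyEval_C, mul_one] at h1
    simp only [Pi.add_apply]
    rw [h1, (heb 0).integral_weakPartial (he 0), (heb 1).integral_weakPartial (he 1), add_zero]
  obtain ⟨W, hW, hWm, hWb⟩ := hfield K c R hR0 hc hout _ hg hg0
  have hWX := fun c => memH2H10_test (hW c)
  have huW : ∀ c, MemH2 K.inner (u c + W c) := fun c => (hu c).add hU (hWX c).1
  -- `W` is compactly supported in the element, so the interpolant of `u + W` keeps the boundary
  -- degrees of freedom of `u`.
  choose uI huI hdI using fun c => exists_localInterpolant hk (huW c)
  have hd : ∀ c, MemH2 K.inner (u c - uI c) := fun c => (hu c).sub hU (huI c).1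
  have hdb : ∀ c, BoundaryFree K (k - 2) (u c - uI c) := fun c => by
    have h1 := ((hdI c).boundaryFree (huI c).1 (huW c))
    rw [boundaryFree_sub_iff (huI c).1 (huW c)] at h1
    have h2 : BoundaryFree K (k - 2) (u c + W c - uI c) := (boundaryFree_sub_iff (huW c) (huI c).1).2
      ⟨fun i => (h1.1 i).symm, fun m hm i => ⟨(h1.2 m hm i).1.symm, (h1.2 m hm i).2.symm⟩⟩
    have h3 := h2.sub ((huW c).sub hU (huI c).1) (hWX c).1 (boundaryFree_test (hW c) _)
    rwa [show u c + W c - uI c - W c = u c - uI c by abel] at h3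
  have hzX : ∀ c, MemH2H10 K (Iu c - uI c) := fun c => by
    have h1 := (boundaryFree_sub_iff (hu c) (huI c).1).1 (hdb c)
    refine (hIu c).sub_memH2H10 (huI c) (fun i => ((hdof c).1 i).trans (h1.1 i)) fun m hm i => (((hdof c).2 m hm).1 i).trans (h1.2 m hm i).1
  -- `Iu` has the moments of `u`, `uI` those of `u + W`; so `Iu - uI` has those of `-W`.
  have hzm : ∀ c, MomentFree K (k - 2) (Iu c - uI c + W c) := fun c => by
    have h1 := ((hdof c).momentFree (hIu c).1 (hu c)).sub ((hIu c).1.sub hU (hu c)) ((huI c).1.sub hU (huW c)) ((hdI c).momentFree (huI c).1 (huW c))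
    rwa [show Iu c - u c - (uI c - (u c + W c)) = Iu c - uI c + W c by abel] at h1
  have hzl : ∀ c, l2n (volume.restrict K.inner) (weakLaplacian K.inner (Iu c - uI c)) ≤ M * R⁻¹ * l2n (volume.restrict K.inner) (weakDiv K.inner e) :=
    fun c => ((hIu c).l2n_laplacian_le (huI c) (hzX c) (hW c) (hzm c)).trans (hWb c)
  have hcong : ∀ {F G : Plane → ℝ} (m : MvPolynomial (Fin 2) ℝ), F =ᵐ[volume.restrict K.inner] G →
      ∫ x in K.inner, F x * polyEval m x = ∫ x in K.inner, G x * polyEval m x := fun m h => integral_congr_ae (by filter_upwards [h] with x hx; rw [hx])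
  have hdec : ∀ c, u c - uI c = e c + (Iu c - uI c) := fun c => (sub_add_sub_cancel _ _ _).symm
  have hdiv : ∀ m : MvPolynomial (Fin 2) ℝ, m.totalDegree ≤ k - 1 → ∫ x in K.inner, weakDiv K.inner (fun c => u c - uI c) x * polyEval m x = 0 := by
    intro m hm
    have hp := memLp_polyEval K m
    have hzp := fun c a => (hzX c).1.1.memLp_weakPartial hU a
    -- No edge terms, since `z` vanishes on the boundary. For `m` of degree `k - 1` the derivative
    -- has degree `k - 2`, so `z` may be replaced by `-W` under the integral.
    have hz : ∀ c, ∫ x in K.inner, weakPartial K.inner c (Iu c - uI c) x * polyEval m x = ∫ x in K.inner, W c x * pderiv c (polyEval m) x := fun c => by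
      rw [integral_weakPartial_mul_polyEval (hzX c).1.1, Finset.sum_eq_zero, zero_sub, pderiv_polyEval]
      · have h1 := hzm c (MvPolynomial.pderiv c m) 0 ((totalDegree_pderiv_le m c).trans (by omega)) (fun j => by simp)
        rw [momentPairing_zero_right] at h1
        have hp' := memLp_polyEval K (MvPolynomial.pderiv c m)
        simp only [Pi.add_apply, mul_add] at h1
        rw [integral_add (hp'.integrable_mul' (hzX c).1.1.1) (hp'.integrable_mul' (hWX c).1.1.1)] at h1
        simp only [mul_comm] at h1 ⊢
        linarith
      · intro i _
        rw [integral_eq_zero_of_ae, mul_zero]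
        filter_upwards [(hzX c).trace_eq_zero i] with x hx
        rw [hx, Pi.zero_apply, zero_mul]
    have h1 := hWm m hm
    rw [Fin.sum_univ_two, ← hz 0, ← hz 1] at h1
    have h2 : ∫ x in K.inner, weakDiv K.inner (fun c => u c - uI c) x * polyEval m x = ∫ x in K.inner, (weakDiv K.inner e x * polyEval m x +
        (weakPartial K.inner 0 (Iu 0 - uI 0) x * polyEval m x + weakPartial K.inner 1 (Iu 1 - uI 1) x * polyEval m x)) := by
      refine integral_congr_ae ?_
      rw [show (fun c => u c - uI c) = fun c => e c + (Iu c - uI c) from funext hdec]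
      filter_upwards [weakDiv_add hU he fun c => (hzX c).1] with x h0
      rw [h0, Pi.add_apply, add_mul, weakDiv_eq K.inner fun c => Iu c - uI c, Pi.add_apply, add_mul]
    have i0 := (hzp 0 0).integrable_mul' hp
    have i1 := (hzp 1 1).integrable_mul' hp
    rw [h2, integral_add (hg.integrable_mul' hp) (show Integrable (fun x => _ + _) _ from i0.add i1), integral_add i0 i1, h1]
    ring
  refine ⟨uI, huI, hdb, ⟨l2Proj_congr fun m hm => ?_, fun a => l2Proj_congr fun m hm => ?_⟩, ?_⟩
  · have h1 := hdiv m hm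
    have hp := memLp_polyEval K m
    rw [hcong m (weakDiv_sub hU hu fun c => (huI c).1)] at h1
    simp only [Pi.sub_apply, sub_mul] at h1
    rw [integral_sub ((memH1_weakDiv hU hu).1.integrable_mul' hp) ((memH1_weakDiv hU fun c => (huI c).1).1.integrable_mul' hp)] at h1
    linarith
  · have h1 := integral_weakPartial_weakDiv_eq_zero hd hdb (fun m hm => hdiv m (by omega)) hm a
    have hp := memLp_polyEval K m
    have m1 := memH1_weakDiv hU hu
    have m2 := memH1_weakDiv hU fun c => (huI c).1
    rw [weakPartial_congr (weakDiv_sub hU hu fun c => (huI c).1), hcong m (weakPartial_sub hU m1 m2 a)] at h1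
    simp only [Pi.sub_apply, sub_mul] at h1
    rw [integral_sub ((m1.memLp_weakPartial hU a).integrable_mul' hp) ((m2.memLp_weakPartial hU a).integrable_mul' hp)] at h1
    linarith
  have hue : u - Iu = e := rfl
  have hud : u - uI = fun c => u c - uI c := rfl
  have hgl : l2n (volume.restrict K.inner) (weakDiv K.inner e) ≤
      l2n (volume.restrict K.inner) (weakPartial K.inner 0 (e 0)) + l2n (volume.restrict K.inner) (weakPartial K.inner 1 (e 1)) := by
    rw [weakDiv_eq]; exact l2n_add_le (hep 0 0) (hep 1 1)
  -- All dependence on the size of the element cancels in this ratio.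
  have hRi : K.diam * R⁻¹ = (ρ ^ 2)⁻¹ := by rw [hR]; field_simp
  rw [hue, hud]
  constructor
  · set S := seminormH1 K.inner e
    have hS : 0 ≤ S := Real.sqrt_nonneg _
    have hel := le_seminormH1 hU (fun c => (he c).1)
    have h1 : ∀ c a, l2n (volume.restrict K.inner) (weakPartial K.inner a (u c - uI c)) ≤ (1 + 4 * M * (ρ ^ 2)⁻¹) * S := fun c a => by
      rw [hdec c, l2n_congr (weakPartial_add hU (he c).1 (hzX c).1.1 a)]
      refine (l2n_add_le (hep c a) ((hzX c).1.1.memLp_weakPartial hU a)).trans ?_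
      have h2 := (hzX c).l2n_grad_le a
      have h3 : 2 * K.diam * l2n (volume.restrict K.inner) (weakLaplacian K.inner (Iu c - uI c)) ≤ 2 * K.diam * (M * R⁻¹ * (2 * S)) := by
        refine mul_le_mul_of_nonneg_left ((hzl c).trans (mul_le_mul_of_nonneg_left ?_ (by positivity))) (by positivity)
        exact hgl.trans (by linarith [hel 0 0, hel 1 1])
      have h4 : 2 * K.diam * (M * R⁻¹ * (2 * S)) = 4 * M * (K.diam * R⁻¹) * S := by ring
      rw [h4, hRi] at h3
      linarith [hel c a]
    refine (seminormH1_le hU (fun c => (hd c).1) (by positivity) h1).trans ?_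
    have : 0 ≤ (1 + 4 * M * (ρ ^ 2)⁻¹) * S := by positivity
    linarith
  · set S := seminormH2 K.inner e
    have hS : 0 ≤ S := Real.sqrt_nonneg _
    have hel := le_seminormH2 hU he
    -- For the second seminorm `‖Δz‖ ≤ M R⁻¹ ‖div e‖` has one inverse length too many. Poincaré's
    -- inequality for the mean-free `∂_c e_c` returns it.
    have hpo : ∀ c, l2n (volume.restrict K.inner) (weakPartial K.inner c (e c)) ≤ 2 * K.diam * S := fun c => by
      have h2 := poincare ((he c).2 c) ((heb c).integral_weakPartial (he c) c)
      have h3 := sum_le_seminormH2_sq hU he c c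
      refine le_of_sq_le_sq (h2.trans ?_) (by positivity)
      nlinarith [mul_le_mul_of_nonneg_left h3 (sq_nonneg K.diam), mul_nonneg (sq_nonneg K.diam) (sq_nonneg S)]
    have h1 : ∀ c a b, l2n (volume.restrict K.inner) (weakPartial K.inner b (weakPartial K.inner a (u c - uI c))) ≤ (1 + 4 * M * (ρ ^ 2)⁻¹) * S := fun c a b => by
      rw [hdec c, l2n_congr (weakPartial2_add hU (he c) (hzX c).1 a b)]
      refine (l2n_add_le (((he c).2 a).memLp_weakPartial hU b) (((hzX c).1.2 a).memLp_weakPartial hU b)).trans ?_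
      have h2 := (hzX c).l2n_hessian_le a b
      have h3 := (hzl c).trans (mul_le_mul_of_nonneg_left (hgl.trans (add_le_add (hpo 0) (hpo 1))) (by positivity : 0 ≤ M * R⁻¹))
      have h4 : M * R⁻¹ * (2 * K.diam * S + 2 * K.diam * S) = 4 * M * (K.diam * R⁻¹) * S := by ring
      rw [h4, hRi] at h3
      linarith [hel c a b]
    refine (seminormH2_le hU hd (by positivity) h1).trans (le_of_eq (by ring))

end StrainGradientVEM

namespace StrainGradientVEM
open ConvexPolygon

/-! ## Edges shared by two elements -/

variable {K L : ConvexPolygon} {i : Fin (K.extra + 3)} {j : Fin (L.extra + 3)} {Ω U : Set Plane} {f u φ : Plane → ℝ}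

namespace ConvexPolygon

/-- Let `s` and `t` be the parameters on the edge of `K` of the end points of the edge of `L`. If `s
< t`, both polygons lie to the left of the same oriented line, and points slightly inside near the
midpoint of the edge of `L` belong to both interiors. Hence `t < s`, and since each edge contains
the other, `s = 1` and `t = 0`. -/
theorem shared_edge (hd : Disjoint K.inner L.inner) (h : K.edge i = L.edge j) : L.vert j = K.vert (i + 1) ∧ L.vert (j + 1) = K.vert i := by
  obtain ⟨s, hs, es⟩ := mem_edge_iff_exists.1 (h ▸ vert_mem_edge : L.vert j ∈ K.edge i)
  obtain ⟨t, ht, et⟩ := mem_edge_iff_exists.1 (h ▸ vert_succ_mem_edge : L.vert (j + 1) ∈ K.edge i)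
  rw [edgePt_eq] at es et
  have hdv : L.dvec j = (t - s) • K.dvec i := by rw [dvec, ← es, ← et]; module
  have hpt : ∀ τ, L.edgePt j τ = K.edgePt i ((1 - τ) * s + τ * t) := fun τ => by rw [edgePt_eq, edgePt_eq, hdv, ← es]; module
  have hell : ∀ x, L.ell j x = (t - s) * K.ell i x := fun x => by
    rw [ell, hdv, cross_smul_left, ← es, ← sub_sub, cross_sub_right, cross_smul_right, cross_self, mul_zero, sub_zero]; rfl
  -- Move from the midpoint `x` towards an interior point `y` of `K`. This stays in the interior of
  -- `K`; the functions `ell k` of `L` with `k ≠ j` remain positive by continuity, and `ell j` is a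
  -- positive multiple of that of `K`.
  have hst : t < s := by
    by_contra hlt
    have hne : t ≠ s := fun e => dvec_ne_zero j (by rw [hdv, e, sub_self, zero_smul])
    have hlt' : s < t := lt_of_le_of_ne (not_lt.1 hlt) hne.symm
    set x := L.edgePt j (1/2) with hx
    have hx' : x = K.edgePt i ((1 - 1/2) * s + 1/2 * t) := hpt _
    obtain ⟨y, hy⟩ := K.inner_nonempty
    have hseg : Tendsto (fun ε : ℝ => (1 - ε) • x + ε • y) (𝓝[>] 0) (𝓝 x) := by
      have : Continuous fun ε : ℝ => (1 - ε) • x + ε • y := by fun_prop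
      have h1 := this.tendsto 0
      simp only [sub_zero, one_smul, zero_smul, add_zero] at h1
      exact h1.mono_left nhdsWithin_le_nhds
    have hL : ∀ᶠ ε : ℝ in 𝓝[>] 0, ∀ k, k ≠ j → 0 < L.ell k ((1 - ε) • x + ε • y) := eventually_all.2 fun k => by
      by_cases hk : k = j
      · exact Eventually.of_forall fun _ h => absurd hk h
      · have := ((continuous_ell k).tendsto x).comp hseg
        filter_upwards [this.eventually (lt_mem_nhds (ell_edgePt_pos hk ⟨by norm_num, by norm_num⟩))] with ε hε _ using hε
    have h1 : ∀ᶠ ε : ℝ in 𝓝[>] 0, 0 < ε ∧ ε < 1 := by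
      filter_upwards [self_mem_nhdsWithin, mem_nhdsWithin_of_mem_nhds (Iio_mem_nhds one_pos)] with ε h0 h1 using ⟨h0, h1⟩
    obtain ⟨ε, hε, h0, h1⟩ := (hL.and h1).exists
    have hK : ∀ k, 0 < K.ell k ((1 - ε) • x + ε • y) := fun k => by
      rw [ell_combo (by ring)]
      have : 0 ≤ K.ell k x := mem_carrier_iff.1 (edge_subset_carrier (hx' ▸ edgePt_mem_edge ⟨by linarith [hs.1, ht.1], by linarith [hs.2, ht.2]⟩)) k
      have h3 := mem_inner_iff.1 hy k
      have := mul_nonneg (sub_nonneg.2 h1.le) this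
      have := mul_pos h0 h3
      linarith
    refine Set.disjoint_left.1 hd (mem_inner_iff.2 hK) (mem_inner_iff.2 fun k => ?_)
    by_cases hk : k = j
    · rw [hk, hell]; exact mul_pos (sub_pos.2 hlt') (hK i)
    · exact hε k hk
  have hinj : ∀ a b : ℝ, K.edgePt i a = K.edgePt i b → a = b := fun a b hab => by
    rw [edgePt_eq, edgePt_eq, add_right_inj] at hab
    exact smul_left_injective ℝ (dvec_ne_zero i) hab
  obtain ⟨τ, hτ, eτ⟩ := mem_edge_iff_exists.1 (h ▸ vert_mem_edge : K.vert i ∈ L.edge j)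
  obtain ⟨σ, hσ, eσ⟩ := mem_edge_iff_exists.1 (h ▸ vert_succ_mem_edge : K.vert (i + 1) ∈ L.edge j)
  have e0 : K.vert i = K.edgePt i 0 := by rw [edgePt_eq]; simp
  have e1 : K.vert (i + 1) = K.edgePt i 1 := by rw [edgePt_eq, dvec]; simp
  have a0 := hinj _ _ ((hpt τ).symm.trans (eτ.trans e0))
  have a1 := hinj _ _ ((hpt σ).symm.trans (eσ.trans e1))
  have t0 : t = 0 := le_antisymm (by nlinarith [mul_nonneg (sub_nonneg.2 hτ.2) (sub_nonneg.2 hst.le)]) ht.1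
  have s1 : s = 1 := le_antisymm hs.2 (by nlinarith [mul_nonneg hσ.1 (sub_nonneg.2 hst.le)])
  subst t0 s1
  constructor
  · rw [← es, dvec]; module
  · rw [← et]; module

theorem ell_of_shared (h : L.vert j = K.vert (i + 1) ∧ L.vert (j + 1) = K.vert i) (x : Plane) : L.ell j x = -K.ell i x := by
  rw [ell, ell, dvec, dvec, h.1, h.2]; simp [cross]; ring

theorem edgeLength_of_shared (h : L.vert j = K.vert (i + 1) ∧ L.vert (j + 1) = K.vert i) : L.edgeLength j = K.edgeLength i := by
  rw [edgeLength, edgeLength, h.1, h.2, dist_comm]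

theorem normal_of_shared (h : L.vert j = K.vert (i + 1) ∧ L.vert (j + 1) = K.vert i) (a : Fin 2) : L.normal j a = -K.normal i a := by
  rw [normal, normal, edgeLength_of_shared h, h.1, h.2]
  fin_cases a <;> simp <;> ring

theorem edgePt_of_shared (h : L.vert j = K.vert (i + 1) ∧ L.vert (j + 1) = K.vert i) (s : ℝ) : L.edgePt j s = K.edgePt i (1 - s) := by
  rw [edgePt, edgePt, h.1, h.2, AffineMap.lineMap_apply_one_sub]

theorem edgeMeasure_of_shared (h : L.vert j = K.vert (i + 1) ∧ L.vert (j + 1) = K.vert i) : L.edgeMeasure j = K.edgeMeasure i := by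
  have e1 : (fun t : ℝ => AffineMap.lineMap (L.vert j) (L.vert (j + 1)) t) =
      K.edgePt i ∘ fun t => 1 - t := by
    funext t; exact edgePt_of_shared h t
  have e2 := ((Measure.measurePreserving_sub_left volume (1:ℝ)).restrict_preimage (measurableSet_Icc (a := (0:ℝ)) (b := 1))).map_eq
  have e3 : (fun t : ℝ => 1 - t) ⁻¹' Set.Icc 0 1 = Set.Icc 0 1 := by simp
  rw [e3] at e2
  rw [edgeMeasure, edgeMeasure, edgeLength_of_shared h, e1, ← Measure.map_map (K.continuous_edgePt i).measurable (by fun_prop), e2]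
  rfl

/-- Two elements on opposite sides of an edge cover a neighbourhood of its relative interior. -/
theorem union_mem_nhds_of_shared (h : L.vert j = K.vert (i + 1) ∧ L.vert (j + 1) = K.vert i) {s : ℝ} (hs : s ∈ Set.Ioo (0:ℝ) 1) : K.carrier ∪ L.carrier ∈ 𝓝 (K.edgePt i s) := by
  have hx : K.edgePt i s = L.edgePt j (1 - s) := by rw [edgePt_of_shared h, sub_sub_cancel]
  have h1 : ∀ᶠ y in 𝓝 (K.edgePt i s), ∀ k, k ≠ i → 0 < K.ell k y := eventually_all.2 fun k => by
    by_cases hk : k = i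
    · exact Eventually.of_forall fun _ h => absurd hk h
    · filter_upwards [((continuous_ell k).tendsto _).eventually (lt_mem_nhds (ell_edgePt_pos hk hs))] with y hy _ using hy
  have h2 : ∀ᶠ y in 𝓝 (K.edgePt i s), ∀ k, k ≠ j → 0 < L.ell k y := eventually_all.2 fun k => by
    by_cases hk : k = j
    · exact Eventually.of_forall fun _ h => absurd hk h
    · rw [hx]
      filter_upwards [((continuous_ell k).tendsto _).eventually (lt_mem_nhds (ell_edgePt_pos hk ⟨by linarith [hs.2], by linarith [hs.1]⟩))] with y hy _ using hy
  filter_upwards [h1, h2] with y hK hL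
  rcases le_total 0 (K.ell i y) with h0 | h0
  · refine Or.inl (mem_carrier_iff.2 fun k => ?_)
    by_cases hk : k = i
    · rwa [hk]
    · exact (hK k hk).le
  · refine Or.inr (mem_carrier_iff.2 fun k => ?_)
    by_cases hk : k = j
    · rw [hk, ell_of_shared h]; linarith
    · exact (hL k hk).le

end ConvexPolygon

/-! ## Values and traces of a global function on two elements -/

/-- On a ball inside `Ω` the function has one continuous representative. It agrees with that of each
element on the intersection, whose closure contains `x`. -/
theorem exists_continuous_near (hΩ : IsOpen Ω) (hu : MemH2 Ω u) {x : Plane} (hx : x ∈ Ω) :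
    ∃ g : Plane → ℝ, ∀ K : ConvexPolygon, K.inner ⊆ Ω → x ∈ K.carrier → contRep K u x = g x := by
  obtain ⟨δ, hδ, hb⟩ := Metric.isOpen_iff.1 hΩ x hx
  set B := Metric.ball x δ
  have hB : IsOpen B := Metric.isOpen_ball
  have hne : B.Nonempty := ⟨x, Metric.mem_ball_self hδ⟩
  have huB := hu.mono hΩ hB hb
  obtain ⟨ψ, hψ⟩ := (exists_approx hB (convex_ball x δ) Metric.isBounded_ball hne).2 huB
  obtain ⟨g, hg, hug, _⟩ := hψ.exists_continuous hB (convex_ball x δ) Metric.isBounded_ball hne huB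
  refine ⟨g, fun K hK hxK => ?_⟩
  have huK := hu.mono hΩ K.isOpen_inner hK
  have hcl : x ∈ closure (B ∩ K.inner) := hB.inter_closure ⟨Metric.mem_ball_self hδ, closure_inner (K := K) ▸ hxK⟩
  refine eqOn_closure_of_ae_eq (U := B ∩ K.inner) (V := insert x (B ∩ K.inner)) (hB.inter K.isOpen_inner)
    (Set.insert_subset hcl subset_closure) (huK.continuousOn_contRep.mono (Set.insert_subset hxK (Set.inter_subset_right.trans inner_subset_carrier)))
    (hg.mono ((Set.insert_subset (Metric.mem_ball_self hδ) Set.inter_subset_left).trans subset_closure)) (Set.subset_insert _ _) ?_ (Set.mem_insert _ _)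
  filter_upwards [ae_restrict_of_ae_restrict_of_subset Set.inter_subset_right huK.ae_eq_contRep,
    ae_restrict_of_ae_restrict_of_subset Set.inter_subset_left hug] with y h1 h2
  rw [← h1, h2]

theorem L2Lim.cutoff {B A : Set Plane} {χ : Plane → ℝ} {ψ : ℕ → Plane → ℝ} (hB : MeasurableSet B) (hχ : Continuous χ)
    (hc : HasCompactSupport χ) (h0 : ∀ x ∉ B, χ x = 0) (h : L2Lim (volume.restrict B) ψ f) : L2Lim (volume.restrict A) (fun m => χ * ψ m) (χ * f) := by
  obtain ⟨C, hC⟩ := hc.exists_bound_of_continuous hχ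
  have h1 : L2Lim (volume.restrict B) (fun m => χ * ψ m) (χ * f) := h.bdd_mul (Eventually.of_forall hC)
  refine L2Lim.mono (μ := volume) ?_ Measure.restrict_le_self
  have e : ∀ m, eLpNorm (χ * ψ m - χ * f) 2 volume = eLpNorm (χ * ψ m - χ * f) 2 (volume.restrict B) := fun m => by
    rw [← eLpNorm_indicator_eq_eLpNorm_restrict hB]
    congr 1
    refine (Set.indicator_eq_self.2 fun x hx => ?_).symm
    by_contra hxB
    exact hx (by simp [h0 x hxB])
  unfold L2Lim at h1 ⊢
  simpa only [e] using h1

/-- One smooth sequence on a ball, multiplied by a cutoff, approximates `κ f` on both elements at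
once, so both traces of `κ f` are the limit of the same functions on the edge. Dividing by the
cutoff gives equality near `x`. -/
theorem trace_eq_near (hΩ : IsOpen Ω) (hf : MemH1 Ω f) (hK : K.inner ⊆ Ω) (hL : L.inner ⊆ Ω) (hm : L.edgeMeasure j = K.edgeMeasure i)
    {x : Plane} (hx : x ∈ Ω) : ∃ V ∈ 𝓝 x, ∀ᵐ y ∂(K.edgeMeasure i), y ∈ V → trace K i f y = trace L j f y := by
  obtain ⟨δ, hδ, hb⟩ := Metric.isOpen_iff.1 hΩ x hx
  set B := Metric.ball x δ
  have hB : IsOpen B := Metric.isOpen_ball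
  have hfB := hf.mono hΩ hb
  obtain ⟨ψ, hψ⟩ := (exists_approx hB (convex_ball x δ) Metric.isBounded_ball ⟨x, Metric.mem_ball_self hδ⟩).1 hfB
  let κ : ContDiffBump x := ⟨δ/4, δ/2, by positivity, by linarith⟩
  have hκ : ContDiff ℝ ∞ κ := κ.contDiff
  have hκs : tsupport κ ⊆ B := by rw [κ.tsupport_eq]; exact Metric.closedBall_subset_ball (by simp only [κ]; linarith)
  have hκ0 : ∀ y ∉ B, κ y = 0 := fun y hy => image_eq_zero_of_notMem_tsupport fun h => hy (hκs h)
  have hκd0 : ∀ a, ∀ y ∉ B, pderiv a κ y = 0 := fun a y hy => image_eq_zero_of_notMem_tsupport fun h => hy (hκs (tsupport_pderiv_subset _ a h))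
  have hκdc : ∀ a, HasCompactSupport (pderiv a κ) := fun a => κ.hasCompactSupport.mono' ((subset_tsupport _).trans (tsupport_pderiv_subset _ a))
  have key : ∀ M : ConvexPolygon, M.inner ⊆ Ω → Approx1 M.inner (κ * f) (fun m => κ * ψ m) := by
    intro M hM
    have hfM := hf.mono hΩ hM
    refine ⟨fun m => hκ.mul (hψ.1 m), hψ.2.1.cutoff hB.measurableSet hκ.continuous κ.hasCompactSupport hκ0, fun a => ?_⟩
    have h1 := (hψ.2.2 a).cutoff (A := M.inner) hB.measurableSet hκ.continuous κ.hasCompactSupport hκ0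
    have h2 := hψ.2.1.cutoff (A := M.inner) hB.measurableSet (pderiv_contDiff hκ a).continuous (hκdc a) (hκd0 a)
    have hBM : (κ : Plane → ℝ) * weakPartial B a f =ᵐ[volume.restrict M.inner] κ * weakPartial M.inner a f := by
      have e1 := (ae_restrict_iff' hB.measurableSet).1 (weakPartial_restrict hB hb (hf.isWeakPartial a))
      filter_upwards [weakPartial_restrict M.isOpen_inner hM (hf.isWeakPartial a), ae_restrict_of_ae e1] with y hy1 hy2
      by_cases hyB : y ∈ B
      · rw [Pi.mul_apply, Pi.mul_apply, hy1, hy2 hyB]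
      · rw [Pi.mul_apply, Pi.mul_apply, hκ0 y hyB, zero_mul, zero_mul]
    have hLp : ∀ {F : Plane → ℝ}, Continuous F → AEStronglyMeasurable F (volume.restrict M.inner) := fun hF => hF.aestronglyMeasurable
    have h1' := h1.congr (fun m => EventuallyEq.rfl) hBM
    refine (h1'.add h2 (fun m => hLp (hκ.continuous.mul (pderiv_contDiff (hψ.1 m) a).continuous))
      (fun m => hLp ((pderiv_contDiff hκ a).continuous.mul (hψ.1 m).continuous))
      ((hLp hκ.continuous).mul (hfM.memLp_weakPartial M.isOpen_inner a).1) ((hLp (pderiv_contDiff hκ a).continuous).mul hfM.1.1)).congr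
      (fun m => Eventually.of_forall fun y => ?_) (weakPartial_smooth_mul M.isOpen_inner hκ hfM a).symm
    rw [pderiv_mul (hκ.differentiable (by simp)) ((hψ.1 m).differentiable (by simp))]; rfl
  have hsm : ∀ M : ConvexPolygon, M.inner ⊆ Ω → MemH1 M.inner (κ * f) := fun M hM => (hf.mono hΩ hM).smooth_mul M.isOpen_inner M.isBounded_inner hκ
  have t1 := (key K hK).l2Lim_trace (hsm K hK) i
  have t2 := (key L hL).l2Lim_trace (hsm L hL) j
  rw [hm] at t2
  have e1 := t1.unique t2 (fun m => (hκ.mul (hψ.1 m)).continuous.aestronglyMeasurable) ((hsm K hK).memLp_trace i).1 (hm ▸ ((hsm L hL).memLp_trace j).1)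
  have e2 := trace_smooth_mul hκ (hf.mono hΩ hK) i
  have e3 := trace_smooth_mul hκ (hf.mono hΩ hL) j
  rw [hm] at e3
  refine ⟨Metric.ball x (δ/2), Metric.ball_mem_nhds x (by positivity), ?_⟩
  filter_upwards [e1, e2, e3] with y h1 h2 h3 hy
  rw [h2, h3, Pi.mul_apply, Pi.mul_apply] at h1
  exact mul_left_cancel₀ (κ.pos_of_mem_ball hy).ne' h1

/-- The set of points of the open edge where the traces differ is locally null, hence null; the end
points do not count. -/
theorem trace_eq_of_shared (hΩ : IsOpen Ω) (hf : MemH1 Ω f) (hK : K.inner ⊆ Ω) (hL : L.inner ⊆ Ω)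
    (h : L.vert j = K.vert (i + 1) ∧ L.vert (j + 1) = K.vert i) (he : ∀ s ∈ Set.Ioo (0:ℝ) 1, K.edgePt i s ∈ Ω) :
    trace K i f =ᵐ[K.edgeMeasure i] trace L j f := by
  have h1 : K.edgeMeasure i ({y | ∃ s ∈ Set.Ioo (0:ℝ) 1, y = K.edgePt i s} ∩ {y | trace K i f y ≠ trace L j f y}) = 0 := by
    refine measure_null_of_locally_null _ fun y hy => ?_
    obtain ⟨⟨s, hs, rfl⟩, _⟩ := hy
    obtain ⟨V, hV, hVe⟩ := trace_eq_near hΩ hf hK hL (edgeMeasure_of_shared h) (he s hs)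
    refine ⟨V ∩ {y | trace K i f y ≠ trace L j f y}, ?_, ?_⟩
    · exact Filter.inter_mem (mem_nhdsWithin_of_mem_nhds hV) (mem_of_superset self_mem_nhdsWithin Set.inter_subset_right)
    · rw [ae_iff] at hVe
      convert hVe using 2
      ext y; simp
  have h2 := measure_eq_zero_iff_ae_notMem.1 h1
  filter_upwards [h2, ae_edgeMeasure_mem i] with y hy hm
  by_contra hne
  exact hy ⟨hm, hne⟩

end StrainGradientVEM

namespace StrainGradientVEM
open ConvexPolygon

/-! ## Global spaces on a mesh -/

variable {K L : ConvexPolygon} {i : Fin (K.extra + 3)} {j : Fin (L.extra + 3)} {Ω : Set Plane} {T : Finset ConvexPolygon}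
  {u v w φ : Plane → ℝ} {k r : ℕ}

theorem IsMesh.carrier_subset (h : IsMesh Ω T) (hK : K ∈ T) : K.carrier ⊆ closure Ω := by
  rw [← h.2.2.1]; exact Set.subset_biUnion_of_mem (u := fun K : ConvexPolygon => K.carrier) hK

theorem IsMesh.inner_subset (h : IsMesh Ω T) (hK : K ∈ T) : K.inner ⊆ Ω := by
  rw [← h.2.1]; exact interior_mono (h.carrier_subset hK)

theorem IsMesh.disjoint_inner (h : IsMesh Ω T) (hK : K ∈ T) (hL : L ∈ T) (hne : K ≠ L) : Disjoint K.inner L.inner := by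
  have key : K.carrier ∩ L.carrier ⊆ frontier K.carrier := by
    rcases h.2.2.2 K hK L hL hne with h1 | ⟨i, _, _, h1⟩ | ⟨i, _, _, h1⟩
    · rw [h1]; exact Set.empty_subset _
    · rw [h1, Set.singleton_subset_iff]; exact edge_subset_frontier vert_mem_edge
    · rw [h1]; exact edge_subset_frontier
  refine Set.disjoint_left.2 fun x hx hx' => ?_
  exact (key ⟨inner_subset_carrier hx, inner_subset_carrier hx'⟩).2 hx

/-- Two elements cover a neighbourhood of the open edge, so the edge lies in the interior of the
closure of `Ω`, which is `Ω`; a slit along the edge is excluded. -/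
theorem IsMesh.edgePt_mem (h : IsMesh Ω T) (hK : K ∈ T) (hL : L ∈ T) (hs : L.vert j = K.vert (i + 1) ∧ L.vert (j + 1) = K.vert i)
    {s : ℝ} (hs' : s ∈ Set.Ioo (0:ℝ) 1) : K.edgePt i s ∈ Ω := by
  rw [← h.2.1, mem_interior_iff_mem_nhds]
  exact mem_of_superset (union_mem_nhds_of_shared hs hs') (Set.union_subset (h.carrier_subset hK) (h.carrier_subset hL))

theorem IsMesh.ae_iff (h : IsMesh Ω T) (hf : ∀ K ∈ T, v =ᵐ[volume.restrict K.inner] w) : v =ᵐ[volume.restrict Ω] w := by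
  refine ae_restrict_of_ae_restrict_of_subset (subset_closure (s := Ω)) ?_
  rw [← h.2.2.1]
  refine (ae_restrict_biUnion_finset_iff _ T _).2 fun K hK => ?_
  rw [← restrict_inner_eq]
  exact hf K hK

theorem IsMesh.contRep_eq_on_edge (h : IsMesh Ω T) (hu : MemH2 Ω u) (hK : K ∈ T) (hL : L ∈ T)
    (hs : L.vert j = K.vert (i + 1) ∧ L.vert (j + 1) = K.vert i) : Set.EqOn (contRep K u) (contRep L u) (K.edge i) := by
  have hKL : K.edge i = L.edge j := by rw [edge, edge, hs.1, hs.2, segment_symm]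
  have huK := (hu.mono h.1 K.isOpen_inner (h.inner_subset hK)).continuousOn_contRep.mono (edge_subset_carrier (i := i))
  have huL := (hu.mono h.1 L.isOpen_inner (h.inner_subset hL)).continuousOn_contRep.mono (edge_subset_carrier (i := j))
  refine eqOn_edge_of_ae_eq huK (hKL ▸ huL) ?_
  filter_upwards [ae_edgeMeasure_mem i, ae_edgeMeasure_mem_edge i] with x hx hxe
  obtain ⟨s, hs', rfl⟩ := hx
  obtain ⟨g, hg⟩ := exists_continuous_near h.1 hu (h.edgePt_mem hK hL hs hs')
  rw [hg K (h.inner_subset hK) (edge_subset_carrier hxe), hg L (h.inner_subset hL) (edge_subset_carrier (hKL ▸ hxe))]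

/-- A common vertex on `∂Ω` is reached along a common edge, on which the two continuous
representatives agree up to its end points. -/
theorem IsMesh.dofVertex_eq (h : IsMesh Ω T) (hu : MemH2 Ω u) (hK : K ∈ T) (hL : L ∈ T) {p : Fin (K.extra + 3)} {q : Fin (L.extra + 3)}
    (hpq : K.vert p = L.vert q) (hc : K.vert p ∈ Ω ∨ ∃ i j, K.edge i = L.edge j ∧ K.vert p ∈ K.edge i) : dofVertex K p u = dofVertex L q u := by
  rcases hc with hc | ⟨i, j, hij, hp⟩
  · obtain ⟨g, hg⟩ := exists_continuous_near h.1 hu hc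
    rw [dofVertex, dofVertex, ← hpq, hg K (h.inner_subset hK) (vert_mem_carrier p), hg L (h.inner_subset hL) (hpq ▸ vert_mem_carrier q)]
  · by_cases hne : K = L
    · subst hne
      rw [vert_injective hpq]
    · rw [dofVertex, dofVertex, ← hpq]
      exact h.contRep_eq_on_edge hu hK hL (shared_edge (h.disjoint_inner hK hL hne) hij) hp

theorem IsMesh.dofEdge_eq (h : IsMesh Ω T) (hu : MemH2 Ω u) (hK : K ∈ T) (hL : L ∈ T)
    (hs : L.vert j = K.vert (i + 1) ∧ L.vert (j + 1) = K.vert i) (m : MvPolynomial (Fin 2) ℝ) : dofEdge K i m u = dofEdge L j m u := by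
  rw [dofEdge, dofEdge, edgeLength_of_shared hs, edgeMeasure_of_shared hs]
  congr 1
  refine integral_congr_ae ?_
  filter_upwards [ae_edgeMeasure_mem_edge i] with x hx
  rw [h.contRep_eq_on_edge hu hK hL hs hx]

theorem IsMesh.dofNormal_eq (h : IsMesh Ω T) (hu : MemH2 Ω u) (hK : K ∈ T) (hL : L ∈ T)
    (hs : L.vert j = K.vert (i + 1) ∧ L.vert (j + 1) = K.vert i) (m : MvPolynomial (Fin 2) ℝ) : dofNormal K i m u = -dofNormal L j m u := by
  rw [dofNormal, dofNormal, edgeMeasure_of_shared hs, ← integral_neg]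
  have ht := fun a => trace_eq_of_shared h.1 (hu.2 a) (h.inner_subset hK) (h.inner_subset hL) hs fun s hs' => h.edgePt_mem hK hL hs hs'
  refine integral_congr_ae ?_
  filter_upwards [ht 0, ht 1] with x h0 h1
  have e := fun (M : ConvexPolygon) (hM : M ∈ T) a => weakPartial_restrict M.isOpen_inner (h.inner_subset hM) (hu.1.isWeakPartial a)
  simp only [normalDeriv, Fin.sum_univ_two, normal_of_shared hs, trace_congr (e K hK _), trace_congr (e L hL _), h0, h1]
  ring

/-- The boundary degrees of freedom are those of `u`, which are single-valued because `u` belongs to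
`H²` across the edges. -/
theorem memGlobalSpace_of_boundaryFree (h : IsMesh Ω T) (hu : MemH2 Ω u) (hv : ∀ K ∈ T, MemLocalSpace k K v)
    (hb : ∀ K ∈ T, BoundaryFree K (k - 2) (u - v)) : MemGlobalSpace k Ω T v := by
  have hd := fun K (hK : K ∈ T) => (boundaryFree_sub_iff (hu.mono h.1 K.isOpen_inner (h.inner_subset hK)) (hv K hK).1).1 (hb K hK)
  refine ⟨hv, fun K hK L hL p q hpq hc => ?_, fun K hK L hL hne i j hij m hm => ?_⟩
  · rw [← (hd K hK).1, ← (hd L hL).1]; exact h.dofVertex_eq hu hK hL hpq hc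
  · have hs := shared_edge (h.disjoint_inner hK hL hne) hij
    rw [← ((hd K hK).2 m hm i).1, ← ((hd K hK).2 m hm i).2, ← ((hd L hL).2 m hm j).1, ← ((hd L hL).2 m hm j).2]
    exact ⟨h.dofEdge_eq hu hK hL hs m, h.dofNormal_eq hu hK hL hs m⟩

/-! ### Boundary values of functions in `H²₀` -/

theorem MemH20.approx2 (hK : K.inner ⊆ Ω) (hu : MemH20 Ω u) : ∃ φ : ℕ → Plane → ℝ, (∀ m, IsTestFunction Ω (φ m)) ∧ Approx2 K.inner u φ := by
  obtain ⟨hu2, φ, hφ, h0, h1, h2⟩ := hu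
  have hle : volume.restrict K.inner ≤ volume.restrict Ω := Measure.restrict_mono hK le_rfl
  have e1 := fun a => weakPartial_restrict K.isOpen_inner hK (hu2.1.isWeakPartial a)
  have l1 : ∀ a, L2Lim (volume.restrict K.inner) (fun m => pderiv a (φ m)) (weakPartial K.inner a u) := fun a =>
    (L2Lim.mono (h1 a) hle).congr (fun _ => EventuallyEq.rfl) (e1 a).symm
  exact ⟨φ, hφ, ⟨fun m => (hφ m).1, L2Lim.mono h0 hle, l1⟩, fun a => ⟨fun m => pderiv_contDiff (hφ m).1 a, l1 a, fun b =>
    (L2Lim.mono (h2 a b) hle).congr (fun _ => EventuallyEq.rfl) (weakPartial2_restrict K.isOpen_inner hK hu2 a b).symm⟩⟩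

/-- The approximating test functions vanish off `Ω` and converge uniformly on the closed element. -/
theorem MemH20.contRep_eq_zero (hΩ : IsOpen Ω) (hK : K.inner ⊆ Ω) (hu : MemH20 Ω u) {x : Plane} (hx : x ∈ K.carrier) (hxΩ : x ∉ Ω) : contRep K u x = 0 := by
  obtain ⟨φ, hφ, ha⟩ := hu.approx2 hK
  have h1 := (ha.tendstoUniformlyOn_contRep (hu.1.mono hΩ K.isOpen_inner hK)).tendsto_at hx
  simp only [fun m => (hφ m).eq_zero hxΩ] at h1
  exact tendsto_nhds_unique h1 tendsto_const_nhds

/-- The test functions that define membership in `H²₀` also compute the traces of the gradient, and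
their derivatives vanish on an edge outside `Ω`. -/
theorem MemH20.normalDeriv_eq_zero (hΩ : IsOpen Ω) (hK : K.inner ⊆ Ω) (hu : MemH20 Ω u) (he : ∀ x ∈ K.edge i, x ∉ Ω) :
    normalDeriv K i u =ᵐ[K.edgeMeasure i] 0 := by
  obtain ⟨φ, hφ, ha⟩ := hu.approx2 hK
  have huK := hu.1.mono hΩ K.isOpen_inner hK
  have ht : ∀ a, trace K i (weakPartial K.inner a u) =ᵐ[K.edgeMeasure i] 0 := fun a => by
    refine (ha.2 a).trace_ae_eq (huK.2 a) aestronglyMeasurable_zero ((L2Lim.const (K.edgeMeasure i) 0).congr (fun m => ?_) EventuallyEq.rfl)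
    filter_upwards [ae_edgeMeasure_mem_edge i] with x hx
    rw [((hφ m).pderiv a).eq_zero (he x hx)]; rfl
  filter_upwards [ht 0, ht 1] with x h0 h1
  rw [normalDeriv, Fin.sum_univ_two, h0, h1]; simp

theorem memGlobalSpaceZero_of_boundaryFree (h : IsMesh Ω T) (hu : MemH20 Ω u) (hv : ∀ K ∈ T, MemLocalSpace k K v)
    (hb : ∀ K ∈ T, BoundaryFree K (k - 2) (u - v)) : MemGlobalSpaceZero k Ω T v := by
  have hd := fun K (hK : K ∈ T) => (boundaryFree_sub_iff (hu.1.mono h.1 K.isOpen_inner (h.inner_subset hK)) (hv K hK).1).1 (hb K hK)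
  have hf : ∀ x ∈ frontier Ω, x ∉ Ω := fun x hx => by rw [h.1.frontier_eq] at hx; exact hx.2
  refine ⟨memGlobalSpace_of_boundaryFree h hu.1 hv hb, fun K hK p hp => ?_, fun K hK i hi m hm => ?_⟩
  · rw [← (hd K hK).1]; exact hu.contRep_eq_zero h.1 (h.inner_subset hK) (vert_mem_carrier p) (hf _ hp)
  · rw [← ((hd K hK).2 m hm i).1, ← ((hd K hK).2 m hm i).2, dofEdge, dofNormal]
    constructor
    · rw [integral_eq_zero_of_ae, mul_zero]
      filter_upwards [ae_edgeMeasure_mem_edge i] with x hx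
      rw [hu.contRep_eq_zero h.1 (h.inner_subset hK) (edge_subset_carrier hx) (hf x (hi hx)), mul_zero]; rfl
    · rw [integral_eq_zero_of_ae]
      filter_upwards [hu.normalDeriv_eq_zero h.1 (h.inner_subset hK) fun x hx => hf x (hi hx)] with x hx
      rw [hx, Pi.zero_apply, mul_zero]

/-! ### Invariance under changes on null sets, and gluing -/

theorem MemLocalSpace.congr (hv : MemLocalSpace k K v) (h : v =ᵐ[volume.restrict K.inner] w) : MemLocalSpace k K w := by
  obtain ⟨h1, h2, f, hf, hb, g, hg, hl⟩ := hv
  refine ⟨h1.congr K.isOpen_inner h, by rwa [← contRep_congr h], f, hf, ?_, g, hg, ?_⟩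
  · unfold IsBilaplacian; rwa [← weakLaplacian_congr h]
  · unfold HasLaplacianTrace; rwa [← weakLaplacian_congr h]

theorem BoundaryFree.congr (hv : BoundaryFree K r v) (h : v =ᵐ[volume.restrict K.inner] w) : BoundaryFree K r w := by
  simpa only [BoundaryFree, dofVertex, dofEdge, dofNormal, contRep_congr h, normalDeriv_congr h] using hv

theorem SameLocalDofs.congr (hv : SameLocalDofs k K v u) (h : v =ᵐ[volume.restrict K.inner] w) : SameLocalDofs k K w u := by
  have hi : ∀ m : MvPolynomial (Fin 2) ℝ, dofInner K m v = dofInner K m w := fun m => by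
    rw [dofInner, dofInner]
    congr 1
    exact integral_congr_ae (by filter_upwards [h] with x hx; rw [hx])
  simpa only [SameLocalDofs, dofVertex, dofEdge, dofNormal, contRep_congr h, normalDeriv_congr h, hi] using hv

/-- The function that agrees with `v K` in the interior of each element `K`. -/
noncomputable def glue (T : Finset ConvexPolygon) (v : ConvexPolygon → Plane → ℝ) (x : Plane) : ℝ := ∑ K ∈ T, K.inner.indicator (v K) x

theorem IsMesh.glue_ae_eq (h : IsMesh Ω T) (v : ConvexPolygon → Plane → ℝ) (hK : K ∈ T) : v K =ᵐ[volume.restrict K.inner] glue T v := by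
  filter_upwards [ae_restrict_mem K.isOpen_inner.measurableSet] with x hx
  rw [glue, Finset.sum_eq_single_of_mem K hK fun L hL hne => Set.indicator_of_notMem
    (fun hx' => Set.disjoint_left.1 (h.disjoint_inner hK hL hne.symm) hx hx') _, Set.indicator_of_mem hx]

end StrainGradientVEM

/-! ### Assembly of the local fields over the mesh -/

theorem mainTheorem7 (k : ℕ) (hk : 2 ≤ k) (ρ : ℝ) (hρ : 0 < ρ) :
    ∃ C : ℝ, 0 < C ∧ ∀ (Ω : Set Plane) (T : Finset ConvexPolygon),
      IsMesh Ω T → (∀ K ∈ T, HasVirtualTriangulation ρ K) →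
      ∀ u : Fin 2 → Plane → ℝ, (∀ c, MemH2 Ω (u c)) →
        ∃ Iu : Fin 2 → Plane → ℝ,
          IsInterpolation k Ω T u Iu ∧
          (∀ Iu' : Fin 2 → Plane → ℝ, IsInterpolation k Ω T u Iu' →
            ∀ c, Iu' c =ᵐ[MeasureTheory.volume.restrict Ω] Iu c) ∧
          ∃ uI : Fin 2 → Plane → ℝ,
            (∀ c, MemGlobalSpace k Ω T (uI c)) ∧
            (∀ K ∈ T,
              l2Proj K.inner (k - 1) (weakDiv K.inner uI) =
                l2Proj K.inner (k - 1) (weakDiv K.inner u) ∧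
              ∀ i, l2Proj K.inner (k - 2) (weakPartial K.inner i (weakDiv K.inner uI)) =
                l2Proj K.inner (k - 2) (weakPartial K.inner i (weakDiv K.inner u))) ∧
            (∀ K ∈ T,
              seminormH1 K.inner (u - uI) ≤ C * seminormH1 K.inner (u - Iu) ∧
              seminormH2 K.inner (u - uI) ≤ C * seminormH2 K.inner (u - Iu)) ∧
            ((∀ c, MemH20 Ω (u c)) →
              ∀ c, MemGlobalSpaceZero k Ω T (Iu c) ∧ MemGlobalSpaceZero k Ω T (uI c)) := by
  classical
  obtain ⟨C, hC, hloc⟩ := exists_local_correction k hk hρ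
  refine ⟨C, hC, fun Ω T hT hV u hu => ?_⟩
  have hKu : ∀ K ∈ T, ∀ c, MemH2 K.inner (u c) := fun K hK c => (hu c).mono hT.1 K.isOpen_inner (hT.inner_subset hK)
  have h1 : ∀ K ∈ T, ∃ Iu : Fin 2 → Plane → ℝ, ∀ c, MemLocalSpace k K (Iu c) ∧ SameLocalDofs k K (Iu c) (u c) := fun K hK => by
    choose Iu h using fun c => exists_localInterpolant hk (hKu K hK c)
    exact ⟨Iu, h⟩
  choose! Iu hIu using h1
  have h2 := fun K hK => hloc K (hV K hK) u (Iu K) (hKu K hK) (fun c => (hIu K hK c).1) fun c => (hIu K hK c).2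
  choose! uI huI hb hp hs using h2
  -- The glued functions are zero on the element boundaries, which is immaterial: on each element
  -- they agree almost everywhere with the local ones, and all notions used see nothing else.
  have gI := fun K (hK : K ∈ T) c => hT.glue_ae_eq (fun K => Iu K c) hK
  have gu := fun K (hK : K ∈ T) c => hT.glue_ae_eq (fun K => uI K c) hK
  have lI : ∀ c, ∀ K ∈ T, MemLocalSpace k K (glue T fun K => Iu K c) := fun c K hK => (hIu K hK c).1.congr (gI K hK c)
  have lu : ∀ c, ∀ K ∈ T, MemLocalSpace k K (glue T fun K => uI K c) := fun c K hK => (huI K hK c).congr (gu K hK c)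
  have dI : ∀ c, ∀ K ∈ T, SameLocalDofs k K (glue T fun K => Iu K c) (u c) := fun c K hK => (hIu K hK c).2.congr (gI K hK c)
  have bI : ∀ c, ∀ K ∈ T, BoundaryFree K (k - 2) (u c - glue T fun K => Iu K c) := fun c K hK => by
    have h := dI c K hK
    exact (boundaryFree_sub_iff (hKu K hK c) (lI c K hK).1).2
      ⟨fun i => (h.1 i).symm, fun m hm i => ⟨((h.2 m hm).1 i).symm, ((h.2 m hm).2.1 i).symm⟩⟩
  have bu : ∀ c, ∀ K ∈ T, BoundaryFree K (k - 2) (u c - glue T fun K => uI K c) := fun c K hK =>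
    (hb K hK c).congr (EventuallyEq.rfl.sub (gu K hK c))
  refine ⟨fun c => glue T fun K => Iu K c, fun c => ⟨memGlobalSpace_of_boundaryFree hT (hu c) (lI c) (bI c), dI c⟩, fun Iu' h' c => ?_,
    fun c => glue T fun K => uI K c, fun c => memGlobalSpace_of_boundaryFree hT (hu c) (lu c) (bu c), fun K hK => ?_, fun K hK => ?_, fun h0 c =>
    ⟨memGlobalSpaceZero_of_boundaryFree hT (h0 c) (lI c) (bI c), memGlobalSpaceZero_of_boundaryFree hT (h0 c) (lu c) (bu c)⟩⟩
  -- Unisolvence on each element suffices, because the edges of the mesh form a null set.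
  · refine hT.ae_iff fun K hK => ((h' c).1.1 K hK).ae_eq (lI c K hK) ?_
    have hd := (h' c).2 K hK
    have hd' := dI c K hK
    exact ⟨fun i => (hd.1 i).trans (hd'.1 i).symm, fun m hm => ⟨fun i => ((hd.2 m hm).1 i).trans ((hd'.2 m hm).1 i).symm,
      fun i => ((hd.2 m hm).2.1 i).trans ((hd'.2 m hm).2.1 i).symm, (hd.2 m hm).2.2.trans (hd'.2 m hm).2.2.symm⟩⟩
  · have e : weakDiv K.inner (fun c => glue T fun K => uI K c) = weakDiv K.inner (uI K) := by
      rw [weakDiv_eq, weakDiv_eq, weakPartial_congr (gu K hK 0), weakPartial_congr (gu K hK 1)]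
    rw [e]
    exact hp K hK
  · have e : ∀ v : Fin 2 → ConvexPolygon → Plane → ℝ, ∀ c, (u - fun c => glue T (v c)) c =ᵐ[volume.restrict K.inner] (u - fun c => v c K) c := fun v c =>
      EventuallyEq.rfl.sub (hT.glue_ae_eq (v c) hK).symm
    have e1 : ∀ v : Fin 2 → ConvexPolygon → Plane → ℝ, seminormH1 K.inner (u - fun c => glue T (v c)) = seminormH1 K.inner (u - fun c => v c K) := fun v => by
      simp only [seminormH1, weakPartial_congr (e v _)]
    have e2 : ∀ v : Fin 2 → ConvexPolygon → Plane → ℝ, seminormH2 K.inner (u - fun c => glue T (v c)) = seminormH2 K.inner (u - fun c => v c K) := fun v => by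
      simp only [seminormH2, weakPartial_congr (e v _)]
    rw [e1 fun c K => uI K c, e1 fun c K => Iu K c, e2 fun c K => uI K c, e2 fun c K => Iu K c]
    exact hs K hK
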